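/- Let $S=X/\Gamma$ be a closed oriented surface of genus at least $2$ ($X$ its universal cover, $\Gamma=\pi_1 S$), equipped with a complex projective structure with developing map $\mathrm{dev}:X\to\mathbb{CP}^1=\partial_\infty\mathbb H^3$ and holonomy $\rho:\Gamma\to PSL(2,\mathbb C)=SO_0(3,1)$. Let $\mathbb E$ be the associated hyperbolic end and $\bar{\mathbb E}=\mathbb E\cup\partial_\infty\mathbb E\cup\mathbb E^*$ its projective extension, where $\mathbb E^*$ is the maximal globally hyperbolic de Sitter spacetime with the same boundary at infinity. (The universal cover of $\bar{\mathbb E}$ minus the pleated boundary $\partial_0\mathbb E$ is obtained by gluing, over all open round disks $D\subset X$, the projective regions formed by the open hyperbolic half-space facing $D$, by $D$ itself, and by the points of de Sitter space whose dual closed disk is contained in $D$; the regions of two disks are glued along their intersection whenever the two disks meet. The group $\Gamma$ acts on it through $\rho$.) Let $\Sigma\subset\bar{\mathbb E}$ be an admissible triangulated polyhedral surface, that is: $\Sigma$ is a closed embedded surface, identified with $S$, which bounds a closed domain $K$ containing a neighbourhood of $\partial_0\mathbb E$ and convex for the real projective structure of $\bar{\mathbb E}$ (any projective segment of $\bar{\mathbb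 E}$ with endpoints in $K$ lies in $K$); the faces of $\Sigma$ are polygons; $\Sigma$ is triangulated by adding, if needed, diagonals to its faces, so that the vertices of the triangulation are the vertices of $\Sigma$ (extreme points of $K$), while adjacent triangles may be coplanar; every vertex is in $\mathbb E$ or in $\mathbb E^*$ (none is ideal); and no edge is contained in $\mathbb E^*$ and light-like. Represent each lifted vertex $v$ by the vector $x_v\in\mathbb R^{3,1}$ on its developed ray with $\langle x_v,x_v\rangle=-1$ if $v\in\mathbb E$ and $\langle x_v,x_v\rangle=1$ if $v\in\mathbb E^*$; the complex length $d$ of an edge $vw$ is given by $\cosh d=-\langle x_v,x_w\rangle$. A first-order deformation of $\Sigma$ within the fixed end is a choice, for each lifted vertex $v$, of a tangent vector $Z_v\in x_v^{\perp}$, with $Z_{\gamma v}=\rho(\gamma)Z_v$ for all $\gamma\in\Gamma$. If $Z$ preserves all edge lengths at first order, that is, if $$\langle Z_v,x_w\rangle+\langle x_v,Z_w\rangle=0\quad\text{for every edge } vw,$$ then $Z_v=0$ for every vertex $v$. -/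

import Mathlib

noncomputable section

namespace HypEnd

/-! ## Minkowski space -/

/-- Minkowski space `ℝ^{3,1}`, written as (space, time). -/
abbrev Minkowski : Type := EuclideanSpace ℝ (Fin 3) × ℝ

/-- The Minkowski product, of signature `(3,1)`. -/
def mink (x y : Minkowski) : ℝ := inner ℝ x.1 y.1 - x.2 * y.2

/-- `x` is timelike and future-directed, i.e. it spans a ray of the cone over hyperbolic 3-space. -/
def FutureTimelike (x : Minkowski) : Prop := mink x x < 0 ∧ 0 < x.2

/-- The complex projective line, as the sphere at infinity of hyperbolic 3-space. -/
abbrev CPOne : Type := Metric.sphere (0 : EuclideanSpace ℝ (Fin 3)) 1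

/-- The future null vector of time coordinate one spanning the light ray given by a point
of the sphere at infinity. -/
def lightVec (p : CPOne) : Minkowski := (p, 1)

lemma mink_add_left (x y z : Minkowski) : mink (x + y) z = mink x z + mink y z := by
  simp only [mink, Prod.fst_add, Prod.snd_add, inner_add_left]; ring

lemma mink_smul_left (c : ℝ) (x z : Minkowski) : mink (c • x) z = c * mink x z := by
  simp only [mink, Prod.smul_fst, Prod.smul_snd, real_inner_smul_left, smul_eq_mul]; ring

lemma mink_comm (x y : Minkowski) : mink x y = mink y x := by
  simp only [mink, real_inner_comm, mul_comm]

lemma mink_smul_right (c : ℝ) (x z : Minkowski) : mink x (c • z) = c * mink x z := by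
  rw [mink_comm, mink_smul_left, mink_comm]

lemma mink_lightVec_self (p : CPOne) : mink (lightVec p) (lightVec p) = 0 := by
  have h : ‖(p : EuclideanSpace ℝ (Fin 3))‖ = 1 := by simp
  simp [mink, lightVec, h]

/-- The restricted Lorentz group `SO₀(3,1) = PSL(2,ℂ)`: linear automorphisms preserving the
Minkowski product, the orientation, and the future. It is the group of orientation-preserving
isometries of hyperbolic 3-space, and acts on the sphere at infinity by Möbius transformations. -/
def lorentzGroup : Subgroup (Minkowski ≃ₗ[ℝ] Minkowski) where
  carrier := {A | (∀ x y, mink (A x) (A y) = mink x y) ∧ LinearEquiv.det A = 1 ∧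
    ∀ x, mink x x ≤ 0 → 0 < x.2 → 0 < (A x).2}
  one_mem' := ⟨fun _ _ => rfl, map_one _, fun _ _ h => h⟩
  mul_mem' := by
    rintro A B ⟨hA, hA', hA''⟩ ⟨hB, hB', hB''⟩
    refine ⟨fun x y => ?_, by rw [map_mul, hA', hB', one_mul], fun x hx hx' => ?_⟩
    · rw [LinearEquiv.mul_apply, LinearEquiv.mul_apply, hA, hB]
    · rw [LinearEquiv.mul_apply]
      exact hA'' _ (by rw [hB]; exact hx) (hB'' x hx hx')
  inv_mem' := by
    rintro A ⟨hA, hA', hA''⟩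
    have hinv : ∀ x, A (A⁻¹ x) = x := fun x => A.apply_symm_apply x
    have hm : ∀ x y, mink (A⁻¹ x) (A⁻¹ y) = mink x y := fun x y => by
      rw [← hA, hinv, hinv]
    refine ⟨hm, by rw [map_inv, hA', inv_one], fun x hx hx' => ?_⟩
    rcases lt_trichotomy (A⁻¹ x).2 0 with h | h | h
    · have h1 := hA'' (-(A⁻¹ x)) (by
        have h2 := hm x x
        simp only [mink, Prod.fst_neg, Prod.snd_neg, inner_neg_neg] at h2 hx ⊢
        linarith) (by simpa using h)
      rw [map_neg, hinv] at h1
      simp only [Prod.snd_neg] at h1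
      linarith
    · have h2 := hm x x
      have h3 : inner ℝ (A⁻¹ x).1 (A⁻¹ x).1 ≤ 0 := by
        simp only [mink, h] at h2 hx
        linarith
      have h4 : (A⁻¹ x).1 = 0 := by
        rw [real_inner_self_eq_norm_sq] at h3
        exact norm_eq_zero.1 (pow_eq_zero_iff two_ne_zero |>.1 (le_antisymm h3 (sq_nonneg _)))
      have h5 : A⁻¹ x = 0 := Prod.ext h4 h
      have h6 := hinv x
      rw [h5, map_zero] at h6
      rw [← h6] at hx'
      simp at hx'
    · exact h

/-! ## Complex projective structures on closed surfaces of genus at least two -/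

/-- A complex projective structure on the closed surface `S = X / Γ` of genus at least two,
given by its developing pair: `X` is the universal cover of `S`, `Γ` the deck group, `dev` the
developing map and `hol` the holonomy representation. -/
structure ProjectiveStructure (X Γ : Type*) [TopologicalSpace X] [Group Γ] [MulAction Γ X] where
  t2 : T2Space X
  simplyConnected : SimplyConnectedSpace X
  continuous_smul : ContinuousConstSMul Γ X
  properlyDiscontinuous : ProperlyDiscontinuousSMul Γ X
  free : ∀ (g : Γ) (x : X), g • x = x → g = 1
  cocompact : CompactSpace (Quotient (MulAction.orbitRel Γ X))
  /-- The first Betti number `2g` of `S`, i.e. the dimension of `H¹(S; ℝ) = Hom(π₁ S, ℝ)`,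
  is at least `4`. -/
  genus_ge_two : 4 ≤ Module.finrank ℝ (Additive Γ →+ ℝ)
  dev : X → CPOne
  isLocalHomeomorph_dev : IsLocalHomeomorph dev
  hol : Γ →* lorentzGroup
  equivariant : ∀ (g : Γ) (x : X),
    SameRay ℝ (lightVec (dev (g • x))) ((hol g : Minkowski ≃ₗ[ℝ] Minkowski) (lightVec (dev x)))

/-- The open convex cone of the vectors `y + t n`, where `t > 0` and `y` is future timelike and
orthogonal to the unit spacelike vector `n`. Let `D = {p | 0 < ⟨n, p⟩}` be the open round disk of
the sphere at infinity dual to `n`. The rays of this cone are: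
the points of the open hyperbolic half-space bounded by the plane `n^⊥` and facing `D`
(timelike rays); the points of `D` (null rays); and the points `x` of de Sitter space whose dual
closed disk `{p | 0 ≤ ⟨x, p⟩}` is contained in `D` (spacelike rays). -/
def diskRegion (n : Minkowski) : Set Minkowski :=
  {x | 0 < mink x n ∧ FutureTimelike (x - mink x n • n)}

namespace ProjectiveStructure

variable {X Γ : Type*} [TopologicalSpace X] [Group Γ] [MulAction Γ X]

/-- An open round disk in the universal cover `X`: an open set that `dev` maps injectively onto
an open round disk of the sphere at infinity, namely the one dual to the unit spacelike vector
`normal`. -/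
@[ext]
structure RoundDisk (σ : ProjectiveStructure X Γ) where
  carrier : Set X
  normal : Minkowski
  isOpen : IsOpen carrier
  injOn : Set.InjOn σ.dev carrier
  mink_normal : mink normal normal = 1
  image_dev : ∀ p : CPOne, p ∈ σ.dev '' carrier ↔ 0 < mink normal (lightVec p)

variable (σ : ProjectiveStructure X Γ)

/-- Two pairs (round disk, point of its region) give the same point when the disks intersect
and the points lie on the same ray. -/
def glue (a b : Σ D : σ.RoundDisk, diskRegion D.normal) : Prop :=
  (a.1.carrier ∩ b.1.carrier).Nonempty ∧ SameRay ℝ (a.2 : Minkowski) (b.2 : Minkowski)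

/-- The universal cover of the projective extension `Ē = E ∪ ∂_∞E ∪ E*` of the hyperbolic end `E`
with boundary at infinity the given complex projective surface. It is obtained by gluing, over all
round disks `D` of `X`, the projective regions associated with `D` (see `diskRegion`), along
regions whose disks intersect, and carries the quotient topology.
The timelike points form the universal cover of (the interior of) the hyperbolic end, a union of
hyperbolic half-spaces; the null points form `X`, the universal cover of `∂_∞E`; the spacelike
points correspond to the closed round disks of `X`, and form the universal cover of the de Sitter
spacetime `E*`. -/
def ExtendedEnd : Type _ := Quot σ.glue

instance : TopologicalSpace σ.ExtendedEnd := inferInstanceAs (TopologicalSpace (Quot σ.glue))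

variable {σ}

/-- The point of the extended end given by a vector in the region of a round disk. -/
def RoundDisk.point (D : σ.RoundDisk) (x : Minkowski) (hx : x ∈ diskRegion D.normal) :
    σ.ExtendedEnd := Quot.mk _ ⟨D, x, hx⟩

lemma hol_mink (σ : ProjectiveStructure X Γ) (g : Γ) (x y : Minkowski) :
    mink ((σ.hol g : Minkowski ≃ₗ[ℝ] Minkowski) x) ((σ.hol g : Minkowski ≃ₗ[ℝ] Minkowski) y) =
      mink x y := (σ.hol g).2.1 x y

lemma hol_future (σ : ProjectiveStructure X Γ) (g : Γ) (x : Minkowski) (h : mink x x ≤ 0)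
    (h' : 0 < x.2) : 0 < ((σ.hol g : Minkowski ≃ₗ[ℝ] Minkowski) x).2 := (σ.hol g).2.2.2 x h h'

lemma hol_diskRegion (σ : ProjectiveStructure X Γ) (g : Γ) {n x : Minkowski}
    (h : x ∈ diskRegion n) :
    (σ.hol g : Minkowski ≃ₗ[ℝ] Minkowski) x ∈
      diskRegion ((σ.hol g : Minkowski ≃ₗ[ℝ] Minkowski) n) := by
  obtain ⟨h1, h2, h3⟩ := h
  refine ⟨by rwa [hol_mink], ?_⟩
  rw [hol_mink, ← map_smul, ← map_sub]
  exact ⟨by rwa [hol_mink], σ.hol_future g _ h2.le h3⟩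

lemma lightVec_eq_of_sameRay {p q : CPOne} (h : SameRay ℝ (lightVec p) (lightVec q)) : p = q := by
  have hp : lightVec p ≠ 0 := fun h => by simpa [lightVec] using congrArg Prod.snd h
  have hq : lightVec q ≠ 0 := fun h => by simpa [lightVec] using congrArg Prod.snd h
  obtain ⟨r, _, hr⟩ := h.exists_pos_left hp hq
  have h1 : r = 1 := by simpa [lightVec] using congrArg Prod.snd hr
  subst h1
  have h2 := congrArg Prod.fst hr
  exact Subtype.ext (by simpa [lightVec] using h2)

lemma mem_image_smul_iff (σ : ProjectiveStructure X Γ) (g : Γ) (D : σ.RoundDisk) (p : CPOne) :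
    p ∈ σ.dev '' ((g • ·) '' D.carrier) ↔
      0 < mink ((σ.hol g : Minkowski ≃ₗ[ℝ] Minkowski) D.normal) (lightVec p) := by
  have hne : ∀ p, lightVec p ≠ 0 := fun p h => by simpa [lightVec] using congrArg Prod.snd h
  have hne' : ∀ p, (σ.hol g : Minkowski ≃ₗ[ℝ] Minkowski) (lightVec p) ≠ 0 := fun p h =>
    hne p ((LinearEquiv.map_eq_zero_iff _).1 h)
  constructor
  · rintro ⟨_, ⟨x, hx, rfl⟩, rfl⟩
    obtain ⟨r, hr, h⟩ := (σ.equivariant g x).exists_pos_right (hne _) (hne' _)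
    have h0 := (D.image_dev _).1 ⟨x, hx, rfl⟩
    change 0 < mink _ (lightVec (σ.dev (g • x)))
    rw [h, mink_smul_right, hol_mink]
    positivity
  · intro hp
    set A : Minkowski ≃ₗ[ℝ] Minkowski := (σ.hol g : Minkowski ≃ₗ[ℝ] Minkowski) with hA
    obtain ⟨w, hw⟩ : ∃ w, A w = lightVec p := A.surjective _
    have hw0 : mink w w = 0 := by
      rw [← hol_mink σ g, ← hA, hw, mink_lightVec_self]
    have hw2 : 0 < w.2 := by
      have h1 := hol_future σ g⁻¹ (lightVec p) (mink_lightVec_self p).le (by simp [lightVec])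
      have h2 : ((σ.hol g⁻¹ : lorentzGroup) : Minkowski ≃ₗ[ℝ] Minkowski) (lightVec p) = w := by
        rw [← hw, hA, map_inv]
        exact (σ.hol g : Minkowski ≃ₗ[ℝ] Minkowski).symm_apply_apply w
      rwa [h2] at h1
    have hnorm : ‖w.1‖ = w.2 := by
      have h1 : ‖w.1‖ ^ 2 = w.2 ^ 2 := by
        have h2 := hw0
        simp only [mink, real_inner_self_eq_norm_sq] at h2
        nlinarith
      exact (pow_left_inj₀ (norm_nonneg _) hw2.le two_ne_zero).1 h1
    let p' : CPOne := ⟨w.2⁻¹ • w.1, by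
      rw [mem_sphere_zero_iff_norm, norm_smul, hnorm, norm_inv, Real.norm_of_nonneg hw2.le]
      exact inv_mul_cancel₀ hw2.ne'⟩
    have hp' : lightVec p' = w.2⁻¹ • w := by
      refine Prod.ext rfl ?_
      simp [lightVec, hw2.ne']
    obtain ⟨x, hx, hxp⟩ := (D.image_dev p').2 (by
      rw [hp', mink_smul_right, ← hol_mink σ g, ← hA, hw]
      positivity)
    refine ⟨g • x, ⟨x, hx, rfl⟩, lightVec_eq_of_sameRay ?_⟩
    have h1 := σ.equivariant g x
    rw [hxp, hp', ← hA, map_smul, hw] at h1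
    exact h1.trans (SameRay.sameRay_pos_smul_left _ (inv_pos.2 hw2)) (fun h => by
      rcases smul_eq_zero.1 h with h | h
      · exact absurd h (inv_pos.2 hw2).ne'
      · exact absurd h (hne _))

/-- The image of a round disk by a deck transformation. -/
def RoundDisk.translate (g : Γ) (D : σ.RoundDisk) : σ.RoundDisk where
  carrier := (g • ·) '' D.carrier
  normal := (σ.hol g : Minkowski ≃ₗ[ℝ] Minkowski) D.normal
  isOpen := by
    have := σ.continuous_smul
    exact (Homeomorph.smul g).isOpenMap _ D.isOpen
  injOn := by
    rintro _ ⟨x, hx, rfl⟩ _ ⟨y, hy, rfl⟩ h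
    have hne : ∀ p, (σ.hol g : Minkowski ≃ₗ[ℝ] Minkowski) (lightVec p) ≠ 0 := fun p h => by
      have h1 := (LinearEquiv.map_eq_zero_iff _).1 h
      simpa [lightVec] using congrArg Prod.snd h1
    have hne' : ∀ p, lightVec p ≠ 0 := fun p h => by simpa [lightVec] using congrArg Prod.snd h
    have h1 := σ.equivariant g x
    have h2 := σ.equivariant g y
    change σ.dev (g • x) = σ.dev (g • y) at h
    rw [h] at h1
    have h3 := h1.symm.trans h2 (fun h => absurd h (hne' _))
    have h4 : SameRay ℝ (lightVec (σ.dev x)) (lightVec (σ.dev y)) :=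
      (SameRay.sameRay_map_iff _).1 h3
    change g • x = g • y
    rw [D.injOn hx hy (lightVec_eq_of_sameRay h4)]
  mink_normal := by rw [hol_mink, D.mink_normal]
  image_dev := σ.mem_image_smul_iff g D

/-- The action of the deck group on the universal cover of the extended end. -/
instance : MulAction Γ σ.ExtendedEnd where
  smul g := Quot.map
    (fun a => ⟨a.1.translate g, (σ.hol g : Minkowski ≃ₗ[ℝ] Minkowski) a.2,
      σ.hol_diskRegion g a.2.2⟩)
    (by
      rintro a b ⟨⟨x, hx, hx'⟩, h⟩
      exact ⟨⟨g • x, ⟨x, hx, rfl⟩, ⟨x, hx', rfl⟩⟩,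
        h.map (σ.hol g : Minkowski ≃ₗ[ℝ] Minkowski).toLinearMap⟩)
  one_smul := by
    rintro ⟨D, x, hx⟩
    refine Quot.sound ⟨?_, ?_⟩
    · have hne : D.carrier.Nonempty := by
        by_contra h
        rw [Set.not_nonempty_iff_eq_empty] at h
        have hn := D.mink_normal
        have h0 : ‖D.normal.1‖ ^ 2 = 1 + D.normal.2 ^ 2 := by
          simp only [mink, real_inner_self_eq_norm_sq] at hn
          nlinarith
        have hpos : 0 < ‖D.normal.1‖ := by
          rcases (norm_nonneg D.normal.1).lt_or_eq with h | h
          · exact h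
          · rw [← h] at h0; nlinarith
        have hlt : D.normal.2 < ‖D.normal.1‖ := by nlinarith
        let p : CPOne := ⟨‖D.normal.1‖⁻¹ • D.normal.1, by
          rw [mem_sphere_zero_iff_norm, norm_smul, norm_inv, norm_norm]
          exact inv_mul_cancel₀ hpos.ne'⟩
        have h1 := (D.image_dev p).2 (by
          simp only [mink, lightVec, p, real_inner_smul_right, real_inner_self_eq_norm_sq, mul_one]
          field_simp
          linarith)
        rw [h, Set.image_empty] at h1
        exact h1
      obtain ⟨z, hz⟩ := hne
      exact ⟨z, ⟨z, hz, one_smul _ _⟩, hz⟩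
    · change SameRay ℝ ((σ.hol 1 : Minkowski ≃ₗ[ℝ] Minkowski) x) x
      rw [map_one]
      exact SameRay.refl _
  mul_smul := by
    rintro g h ⟨D, x, hx⟩
    refine congrArg (Quot.mk _) ?_
    have hD : D.translate (g * h) = (D.translate h).translate g := by
      refine RoundDisk.ext ?_ ?_
      · change (fun x => (g * h) • x) '' D.carrier = (g • ·) '' ((h • ·) '' D.carrier)
        rw [Set.image_image]
        simp only [mul_smul]
      · change (σ.hol (g * h) : Minkowski ≃ₗ[ℝ] Minkowski) D.normal = _
        rw [map_mul]; rfl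
    refine Sigma.ext hD ?_
    have hx : (σ.hol (g * h) : Minkowski ≃ₗ[ℝ] Minkowski) x =
        (σ.hol g : Minkowski ≃ₗ[ℝ] Minkowski) ((σ.hol h : Minkowski ≃ₗ[ℝ] Minkowski) x) := by
      rw [map_mul]; rfl
    refine (Subtype.heq_iff_coe_eq ?_).2 hx
    intro y
    change y ∈ diskRegion (D.translate (g * h)).normal ↔
      y ∈ diskRegion ((D.translate h).translate g).normal
    rw [hD]

/-- The developed image (in the space of rays of Minkowski space) of the point `z` is the ray
spanned by `x`. -/
def Represents (z : σ.ExtendedEnd) (x : Minkowski) : Prop :=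
  ∃ (D : σ.RoundDisk) (hx : x ∈ diskRegion D.normal), D.point x hx = z

/-- `γ`, restricted to `[0,1]`, is a segment for the real projective structure of the extended
end, which develops onto the projective segment with (distinct and not antipodal) endpoints the
rays of `a` and `b`. -/
def IsSegment (γ : ℝ → σ.ExtendedEnd) (a b : Minkowski) : Prop :=
  LinearIndependent ℝ ![a, b] ∧ ContinuousOn γ (Set.Icc 0 1) ∧
    ∀ t ∈ Set.Icc (0 : ℝ) 1, Represents (γ t) ((1 - t) • a + t • b)

/-- Convexity in the sense of the real projective structure: any projective segment of the
extended end with endpoints in `K` is contained in `K`. -/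
def IsConvex (K : Set σ.ExtendedEnd) : Prop :=
  ∀ (γ : ℝ → σ.ExtendedEnd) (a b : Minkowski), IsSegment γ a b → γ 0 ∈ K → γ 1 ∈ K →
    ∀ t ∈ Set.Icc (0 : ℝ) 1, γ t ∈ K

/-- The points of the hyperbolic end whose distance `d` to the pleated boundary `∂₀E` satisfies
`sinh d < ε`. Indeed `d` is the supremum of the distances to the planes bounding the half-spaces
of the end that contain the point. -/
def collar (σ : ProjectiveStructure X Γ) (ε : ℝ) : Set σ.ExtendedEnd :=
  {z | ∃ x, Represents z x ∧ mink x x = -1 ∧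
    ∀ (D : σ.RoundDisk) (hx : x ∈ diskRegion D.normal), D.point x hx = z →
      mink x D.normal < ε}

/-! ## Triangulated polyhedral surfaces in the extended end -/

/-- The closed simplex with vertex set `t`, in barycentric coordinates. -/
def baryTriangle {V : Type*} (t : Finset V) : Set (V → ℝ) :=
  {s | (∀ v, 0 ≤ s v) ∧ (∀ v, v ∉ t → s v = 0) ∧ ∑ v ∈ t, s v = 1}

/-- A closed triangulated polyhedral surface in the extended end `Ē`, marked by `S = X / Γ`, none
of whose vertices is ideal, described through its lift to the universal cover of `Ē`, with vertex
set `V`. -/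
structure TriangulatedSurface (σ : ProjectiveStructure X Γ) (V : Type*) [MulAction Γ V] where
  /-- The vertex sets of the triangles. -/
  triangles : Set (Finset V)
  card_eq_three : ∀ t ∈ triangles, t.card = 3
  /-- The triangles at a vertex form a single cycle. -/
  link : ∀ v : V, ∃ n : ℕ, 3 ≤ n ∧ ∃ w : ZMod n → V, Function.Injective w ∧
    ∀ t : Finset V, (t ∈ triangles ∧ v ∈ t) ↔ ∃ i : ZMod n, (t : Set V) = {v, w i, w (i + 1)}
  smul_mem : ∀ (g : Γ), ∀ t ∈ triangles, t.map (MulAction.toPerm g).toEmbedding ∈ triangles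
  finite : Finite (Quotient (MulAction.orbitRel Γ V))
  /-- The piecewise projective realization of the simplicial complex, in barycentric
  coordinates. -/
  real : (V → ℝ) → σ.ExtendedEnd
  /-- The vector of squared norm `-1` (for a vertex in `E`) or `1` (for a vertex in `E*`)
  representing a vertex. -/
  vec : V → Minkowski
  mink_vec : ∀ v, mink (vec v) (vec v) = 1 ∨ mink (vec v) (vec v) = -1
  linearIndependent : ∀ t ∈ triangles, LinearIndependent ℝ (fun v : t => vec v)
  continuousOn_real : ∀ t ∈ triangles, ContinuousOn real (baryTriangle t)
  represents_real : ∀ t ∈ triangles, ∀ s ∈ baryTriangle t,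
    Represents (real s) (∑ v ∈ t, s v • vec v)
  injOn_real : Set.InjOn real (⋃ t ∈ triangles, baryTriangle t)
  equivariant : ∀ (g : Γ) (v : V),
    real (Set.indicator {g • v} 1) = g • real (Set.indicator {v} 1)
  /-- The surface is a copy of `S`: it is the image of an equivariant embedding of `X`. -/
  marking : ∃ u : X → σ.ExtendedEnd, Topology.IsEmbedding u ∧
    (∀ (g : Γ) (x : X), u (g • x) = g • u x) ∧
    Set.range u = real '' (⋃ t ∈ triangles, baryTriangle t)

namespace TriangulatedSurface

variable {V : Type*} [MulAction Γ V] (S : σ.TriangulatedSurface V)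

/-- The lift of the surface to the universal cover of the extended end. -/
def carrier : Set σ.ExtendedEnd := S.real '' (⋃ t ∈ S.triangles, baryTriangle t)

/-- The position of a vertex. -/
def pos (v : V) : σ.ExtendedEnd := S.real (Set.indicator {v} 1)

/-- `v` and `w` are the endpoints of an edge. -/
def IsEdge (v w : V) : Prop := v ≠ w ∧ ∃ t ∈ S.triangles, v ∈ t ∧ w ∈ t

/-- The edge `vw` is contained in the de Sitter part `E*`, and is light-like: its direction
at `v` is a null vector. -/
def IsLightlikeEdge (v w : V) : Prop :=
  S.IsEdge v w ∧
  (∀ t ∈ Set.Icc (0 : ℝ) 1, 0 < mink ((1 - t) • S.vec v + t • S.vec w)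
    ((1 - t) • S.vec v + t • S.vec w)) ∧
  mink (S.vec w - mink (S.vec w) (S.vec v) • S.vec v)
    (S.vec w - mink (S.vec w) (S.vec v) • S.vec v) = 0

/-- The triangles `t` and `t'` share an edge and lie in the same plane. -/
def CoplanarAdj (t t' : Finset V) : Prop :=
  t ∈ S.triangles ∧ t' ∈ S.triangles ∧ (∃ v w, v ≠ w ∧ v ∈ t ∧ w ∈ t ∧ v ∈ t' ∧ w ∈ t') ∧
    Submodule.span ℝ (S.vec '' t) = Submodule.span ℝ (S.vec '' t')

/-- The surface is a convex polyhedral surface, and the triangulation is obtained by adding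
diagonals to its faces: it bounds a closed convex domain `K` containing a neighbourhood
of `∂₀E`, the vertices of the triangulation are genuine vertices (extreme points of `K`), and the
faces (the maximal unions of coplanar triangles, connected through edges) are polygons, with
finitely many triangles. -/
def IsConvexPolyhedral : Prop :=
  (∃ K : Set σ.ExtendedEnd, IsClosed K ∧ (∀ (g : Γ), ∀ z ∈ K, g • z ∈ K) ∧
    IsConvex K ∧ (∃ ε > 0, σ.collar ε ⊆ K) ∧ frontier K = S.carrier ∧
    ∀ v : V, ¬ ∃ (γ : ℝ → σ.ExtendedEnd) (a b : Minkowski), IsSegment γ a b ∧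
      (∀ t ∈ Set.Icc (0 : ℝ) 1, γ t ∈ K) ∧ ∃ t ∈ Set.Ioo (0 : ℝ) 1, γ t = S.pos v) ∧
  ∀ t ∈ S.triangles, {t' | Relation.ReflTransGen S.CoplanarAdj t t'}.Finite

/-- Admissible surfaces: convex polyhedral, without light-like edge in `E*` (and without ideal
vertex, which is part of the definition of `TriangulatedSurface`). -/
def IsAdmissible : Prop :=
  S.IsConvexPolyhedral ∧ ∀ v w : V, ¬ S.IsLightlikeEdge v w

/-- A first-order deformation within the fixed end: a `Γ`-equivariant choice of a tangent vector
to `E` or `E*` at each vertex. The tangent space at a vertex is identified with that of the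
quadric `⟨x, x⟩ = ±1`, the orthogonal of the vector `vec v`. -/
def IsFirstOrderDeformation (Z : V → Minkowski) : Prop :=
  (∀ v, mink (S.vec v) (Z v) = 0) ∧
  ∀ (g : Γ) (v : V), Z (g • v) = (σ.hol g : Minkowski ≃ₗ[ℝ] Minkowski) (Z v)

/-- The deformation preserves all edge lengths at first order: for every edge `vw`, of complex
length `d`, the first-order variation of `cosh d = -⟨v, w⟩` vanishes. -/
def PreservesEdgeLengths (Z : V → Minkowski) : Prop :=
  ∀ v w : V, S.IsEdge v w →
    HasDerivAt (fun s : ℝ => -mink (S.vec v + s • Z v) (S.vec w + s • Z w)) 0 0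

end TriangulatedSurface

end ProjectiveStructure

end HypEnd

end

open Module

section Star

variable {E : Type*} [AddCommGroup E] [Module ℝ E]

/-- The star of a vertex `x` of a convex polyhedral surface: a cycle of neighbours `e i`, the
functionals `N i` supporting the star along its triangles, a functional `L` vanishing at the vertex
and positive on the neighbours, and the fact that triangles only meet along their faces. -/
structure IsStar (n : ℕ) (x : E) (e : ZMod n → E) (N : ZMod n → Dual ℝ E) (L : Dual ℝ E) :
    Prop where
  three_le : 3 ≤ n
  indep : ∀ i, LinearIndependent ℝ ![x, e i, e (i + 1)]
  N_x : ∀ i, N i x = 0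
  N_left : ∀ i, N i (e i) = 0
  N_right : ∀ i, N i (e (i + 1)) = 0
  N_ne : ∀ i, N i ≠ 0
  N_nonneg : ∀ i j, 0 ≤ N i (e j)
  L_x : L x = 0
  L_pos : ∀ i, 0 < L (e i)
  sep : ∀ i j (p q p' q' c : ℝ), 0 ≤ p → 0 ≤ q → 0 ≤ p' → 0 ≤ q' →
    p • e i + q • e (i + 1) = p' • e j + q' • e (j + 1) + c • x →
    (Pi.single i p + Pi.single (i + 1) q : ZMod n → ℝ) = Pi.single j p' + Pi.single (j + 1) q'

/-- A functional may be prescribed on a linearly independent family. -/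
lemma exists_dual_eq {ι : Type*} {v : ι → E} (hv : LinearIndependent ℝ v) (c : ι → ℝ) :
    ∃ G : Dual ℝ E, ∀ i, G (v i) = c i := by
  obtain ⟨G, hG⟩ := LinearMap.exists_extend ((Finsupp.linearCombination ℝ c).comp hv.repr)
  refine ⟨G, fun i => ?_⟩
  have h1 := LinearMap.congr_fun hG ⟨v i, Submodule.subset_span ⟨i, rfl⟩⟩
  rw [LinearMap.comp_apply, LinearMap.comp_apply, hv.repr_eq_single i _ rfl] at h1
  simpa using h1

lemma exists_relation_four [FiniteDimensional ℝ E] (hE : finrank ℝ E = 4) {Z : Dual ℝ E}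
    (hZ : Z ≠ 0) {a b c d : E} (ha : Z a = 0) (hb : Z b = 0) (hc : Z c = 0) (hd : Z d = 0) :
    ∃ α β γ δ : ℝ, α • a + β • b + γ • c + δ • d = 0 ∧
      ¬ (α = 0 ∧ β = 0 ∧ γ = 0 ∧ δ = 0) := by
  have h : ¬ LinearIndependent ℝ ![a, b, c, d] := by
    intro h
    have h1 := h.span_eq_top_of_card_eq_finrank' (by simp [hE])
    apply hZ
    apply LinearMap.ext_on_range (v := ![a, b, c, d]) h1
    intro i
    fin_cases i <;> simp [ha, hb, hc, hd]
  obtain ⟨g, hg, i, hi⟩ := Fintype.not_linearIndependent_iff.1 h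
  refine ⟨g 0, g 1, g 2, g 3, by simpa [Fin.sum_univ_four] using hg, ?_⟩
  rintro ⟨h0, h1, h2, h3⟩
  fin_cases i <;> simp_all

lemma exists_relation_three [FiniteDimensional ℝ E] (hE : finrank ℝ E = 4) {Z N : Dual ℝ E}
    (hZ : Z ≠ 0) {y a b c : E} (hy : Z y = 0) (hNy : N y ≠ 0) (ha : Z a = 0) (hb : Z b = 0)
    (hc : Z c = 0) (ha' : N a = 0) (hb' : N b = 0) (hc' : N c = 0) :
    ∃ α β γ : ℝ, α • a + β • b + γ • c = 0 ∧ ¬ (α = 0 ∧ β = 0 ∧ γ = 0) := by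
  obtain ⟨δ, α, β, γ, h, hne⟩ := exists_relation_four hE hZ hy ha hb hc
  have h1 := congrArg N h
  simp only [map_add, map_smul, smul_eq_mul, ha', hb', hc', map_zero, mul_zero, add_zero,
    mul_eq_zero, hNy, or_false] at h1
  subst h1
  exact ⟨α, β, γ, by simpa using h, by simpa using hne⟩

/-- Two nonzero functionals vanishing on three independent vectors are proportional. -/
lemma exists_eq_smul_of_three [FiniteDimensional ℝ E] (hE : finrank ℝ E = 4) {Z N : Dual ℝ E}
    (hN : N ≠ 0) {a b c : E} (hi : LinearIndependent ℝ ![a, b, c]) (ha : Z a = 0) (hb : Z b = 0)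
    (hc : Z c = 0) (ha' : N a = 0) (hb' : N b = 0) (hc' : N c = 0) :
    ∃ k : ℝ, Z = k • N := by
  by_contra hk
  push Not at hk
  obtain ⟨y, hy⟩ : ∃ y, N y ≠ 0 := by
    by_contra h
    push Not at h
    exact hN (LinearMap.ext h)
  have hM := sub_ne_zero.2 (hk (Z y / N y))
  obtain ⟨α, β, γ, h, hne⟩ := exists_relation_three hE (N := N) hM (y := y) (a := a) (b := b)
    (c := c) (by simp [hy]) hy (by simp [ha, ha']) (by simp [hb, hb']) (by simp [hc, hc']) ha' hb'
    hc'
  rw [Fintype.linearIndependent_iff] at hi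
  have h2 := hi ![α, β, γ] (by simpa [Fin.sum_univ_three] using h)
  exact hne ⟨h2 0, h2 1, h2 2⟩

namespace IsStar

variable {n : ℕ} {x : E} {e : ZMod n → E} {N : ZMod n → Dual ℝ E} {L : Dual ℝ E}

lemma one_ne (h : IsStar n x e N L) : (1 : ZMod n) ≠ 0 := by
  have := h.three_le
  intro h1
  have h2 : ((1 : ℕ) : ZMod n) = 0 := by exact_mod_cast h1
  rw [ZMod.natCast_eq_zero_iff] at h2
  have := Nat.le_of_dvd one_pos h2
  omega

lemma two_ne (h : IsStar n x e N L) : (1 + 1 : ZMod n) ≠ 0 := by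
  have := h.three_le
  intro h1
  have h2 : ((2 : ℕ) : ZMod n) = 0 := by push_cast; rw [← h1]; norm_num
  rw [ZMod.natCast_eq_zero_iff] at h2
  have := Nat.le_of_dvd two_pos h2
  omega

lemma x_ne (h : IsStar n x e N L) : x ≠ 0 := (h.indep 0).ne_zero (0 : Fin 3)

lemma proportional (h : IsStar n x e N L) {i j : ZMod n} {p q p' q' a b c : ℝ} (hp : 0 ≤ p)
    (hq : 0 ≤ q) (hp' : 0 ≤ p') (hq' : 0 ≤ q') (hpq : 0 < p + q) (hpq' : 0 < p' + q')
    (heq : a • (p • e i + q • e (i + 1)) + b • (p' • e j + q' • e (j + 1)) + c • x = 0)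
    (hne : ¬ (a = 0 ∧ b = 0 ∧ c = 0)) :
    ∃ k : ℝ, 0 < k ∧ (Pi.single i p + Pi.single (i + 1) q : ZMod n → ℝ) =
      k • (Pi.single j p' + Pi.single (j + 1) q' : ZMod n → ℝ) := by
  have hL := congrArg L heq
  simp only [map_add, map_smul, smul_eq_mul, map_zero, h.L_x, mul_zero, add_zero] at hL
  have h1 : 0 < p * L (e i) + q * L (e (i + 1)) := by
    rcases hp.lt_or_eq with hp | hp
    · have := mul_pos hp (h.L_pos i); have := mul_nonneg hq (h.L_pos (i + 1)).le; linarith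
    · have := mul_pos (show 0 < q by linarith) (h.L_pos (i + 1))
      have := mul_nonneg hp.le (h.L_pos i).le; linarith
  have h2 : 0 < p' * L (e j) + q' * L (e (j + 1)) := by
    rcases hp'.lt_or_eq with hp | hp
    · have := mul_pos hp (h.L_pos j); have := mul_nonneg hq' (h.L_pos (j + 1)).le; linarith
    · have := mul_pos (show 0 < q' by linarith) (h.L_pos (j + 1))
      have := mul_nonneg hp.le (h.L_pos j).le; linarith
  have ha : a ≠ 0 := by
    rintro rfl
    have hb : b = 0 := by
      rcases mul_eq_zero.1 (show b * _ = 0 by simpa using hL) with h | h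
      · exact h
      · exact absurd h h2.ne'
    subst hb
    refine hne ⟨rfl, rfl, ?_⟩
    have : c • x = 0 := by simpa using heq
    exact (smul_eq_zero.1 this).resolve_right h.x_ne
  set l1 := p * L (e i) + q * L (e (i + 1))
  set l2 := p' * L (e j) + q' * L (e (j + 1))
  have hk : -b / a = l1 / l2 := by field_simp; linarith
  have hk0 : 0 < -b / a := by rw [hk]; positivity
  refine ⟨-b / a, hk0, ?_⟩
  have h3 : p • e i + q • e (i + 1) =
      (-b / a * p') • e j + (-b / a * q') • e (j + 1) + (-c / a) • x := by
    have h4 : p • e i + q • e (i + 1) = a⁻¹ • (a • (p • e i + q • e (i + 1))) := by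
      rw [smul_smul, inv_mul_cancel₀ ha, one_smul]
    have h5 : a • (p • e i + q • e (i + 1)) =
      - (b • (p' • e j + q' • e (j + 1))) - c • x := by
      rw [← sub_eq_zero, ← heq]; abel
    rw [h4, h5]
    simp only [smul_sub, smul_neg, smul_add, smul_smul]
    module
  have h6 := h.sep i j p q _ _ _ hp hq (mul_nonneg hk0.le hp') (mul_nonneg hk0.le hq') h3
  rw [h6, smul_add, ← Pi.single_smul, ← Pi.single_smul]
  rfl

/-- The coefficients of a ray on which a functional changes sign along the star. -/
noncomputable def coeff (Z : Dual ℝ E) (e : ZMod n → E) : ZMod n ⊕ ZMod n → ℝ × ℝ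
  | .inl i => (|Z (e (i + 1))|, |Z (e i)|)
  | .inr _ => (1, 0)

/-- The first index of a ray on which a functional changes sign along the star. -/
def idx : ZMod n ⊕ ZMod n → ZMod n
  | .inl i => i
  | .inr i => i

/-- The places where a functional changes sign along the star. -/
def IsItem (Z : Dual ℝ E) (e : ZMod n → E) : ZMod n ⊕ ZMod n → Prop
  | .inl i => Z (e i) * Z (e (i + 1)) < 0
  | .inr i => Z (e i) = 0 ∧ (Z (e (i + 1)) ≠ 0 ∨ Z (e (i - 1)) ≠ 0)

/-- The vector on which a functional changes sign along the star. -/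
noncomputable def ray (Z : Dual ℝ E) (e : ZMod n → E) (a : ZMod n ⊕ ZMod n) : E :=
  (coeff Z e a).1 • e (idx a) + (coeff Z e a).2 • e (idx a + 1)

lemma coeff_nonneg (Z : Dual ℝ E) (e : ZMod n → E) (a : ZMod n ⊕ ZMod n) :
    0 ≤ (coeff Z e a).1 ∧ 0 ≤ (coeff Z e a).2 := by
  rcases a with i | i <;> simp [coeff]

lemma coeff_pos {Z : Dual ℝ E} {a : ZMod n ⊕ ZMod n} (ha : IsItem Z e a) :
    0 < (coeff Z e a).1 + (coeff Z e a).2 := by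
  rcases a with i | i
  · have : Z (e (i + 1)) ≠ 0 := by rintro h0; simp [IsItem, h0] at ha
    have := abs_pos.2 this
    have := abs_nonneg (Z (e i))
    simp only [coeff]; linarith
  · simp [coeff]

lemma map_ray {Z : Dual ℝ E} {a : ZMod n ⊕ ZMod n} (ha : IsItem Z e a) : Z (ray Z e a) = 0 := by
  rcases a with i | i
  · simp only [IsItem] at ha
    simp only [ray, coeff, idx, map_add, map_smul, smul_eq_mul]
    rcases mul_neg_iff.1 ha with ⟨h1, h2⟩ | ⟨h1, h2⟩
    · rw [abs_of_neg h2, abs_of_pos h1]; ring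
    · rw [abs_of_pos h2, abs_of_neg h1]; ring
  · simp [ray, coeff, idx, ha.1]

lemma ray_eq_of_relation (h : IsStar n x e N L) {Z : Dual ℝ E} {a b : ZMod n ⊕ ZMod n}
    (ha : IsItem Z e a) (hb : IsItem Z e b) {α β γ : ℝ}
    (heq : α • ray Z e a + β • ray Z e b + γ • x = 0) (hne : ¬ (α = 0 ∧ β = 0 ∧ γ = 0)) :
    a = b := by
  have h10 := h.one_ne
  have h20 := h.two_ne
  obtain ⟨k, hk, hab⟩ := h.proportional (coeff_nonneg Z e a).1 (coeff_nonneg Z e a).2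
    (coeff_nonneg Z e b).1 (coeff_nonneg Z e b).2 (coeff_pos ha) (coeff_pos hb) heq hne
  have hz : ∀ i, IsItem Z e (.inl i) → 0 < |Z (e i)| ∧ 0 < |Z (e (i + 1))| := by
    intro i hi
    simp only [IsItem] at hi
    constructor <;> rw [abs_pos] <;> intro h0 <;> simp [h0] at hi
  have hs : ∀ (i : ZMod n) (p q : ℝ),
      (Pi.single i p + Pi.single (i + 1) q : ZMod n → ℝ) i = p := by
    intro i p q
    simp [h10]
  have hs' : ∀ (i : ZMod n) (p q : ℝ),
      (Pi.single i p + Pi.single (i + 1) q : ZMod n → ℝ) (i + 1) = q := by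
    intro i p q
    simp [h10]
  have hv : ∀ (i j : ZMod n) (p q : ℝ),
      (Pi.single i p + Pi.single (i + 1) q : ZMod n → ℝ) j ≠ 0 → j = i ∨ (j = i + 1 ∧ q ≠ 0) := by
    intro i j p q hj
    by_contra hcon
    push Not at hcon
    apply hj
    by_cases h1 : j = i + 1
    · have := hcon.2 h1; subst this; simp [hcon.1]
    · simp [hcon.1, h1]
  rcases a with i | i <;> rcases b with j | j <;> simp only [idx, coeff] at hab
  · have h1 := congrFun hab i
    have h2 := congrFun hab (i + 1)
    rw [hs] at h1
    rw [hs'] at h2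
    have h3 := hv j i |Z (e (j + 1))| |Z (e j)| (fun h0 => (hz i ha).2.ne' (by
      rw [h1, Pi.smul_apply, h0, smul_zero]))
    have h4 := hv j (i + 1) |Z (e (j + 1))| |Z (e j)| (fun h0 => (hz i ha).1.ne' (by
      rw [h2, Pi.smul_apply, h0, smul_zero]))
    rcases h3 with h3 | ⟨h3, -⟩
    · rw [h3]
    · subst h3
      rcases h4 with h4 | ⟨h4, -⟩
      · rw [add_assoc, add_eq_left] at h4; exact absurd h4 h20
      · simp [h10] at h4
  · have h1 := congrFun hab i
    have h2 := congrFun hab (i + 1)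
    rw [hs] at h1
    rw [hs'] at h2
    have h3 := hv j i 1 0 (fun h0 => (hz i ha).2.ne' (by
      rw [h1, Pi.smul_apply, h0, smul_zero]))
    have h4 := hv j (i + 1) 1 0 (fun h0 => (hz i ha).1.ne' (by
      rw [h2, Pi.smul_apply, h0, smul_zero]))
    simp only [ne_eq, not_true_eq_false, and_false, or_false] at h3 h4
    rw [h3] at h4; simp [h10] at h4
  · have h1 := congrFun hab j
    have h2 := congrFun hab (j + 1)
    rw [Pi.smul_apply, hs, smul_eq_mul] at h1
    rw [Pi.smul_apply, hs', smul_eq_mul] at h2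
    have h3 := hv i j 1 0 (by rw [h1]; exact (mul_pos hk (hz j hb).2).ne')
    have h4 := hv i (j + 1) 1 0 (by rw [h2]; exact (mul_pos hk (hz j hb).1).ne')
    simp only [ne_eq, not_true_eq_false, and_false, or_false] at h3 h4
    rw [h3] at h4; simp [h10] at h4
  · have h1 := congrFun hab i
    rw [hs] at h1
    have h3 := hv j i 1 0 (fun h0 => one_ne_zero (α := ℝ) (by
      rw [h1, Pi.smul_apply, h0, smul_zero]))
    simp only [ne_eq, not_true_eq_false, and_false, or_false] at h3
    rw [h3]

lemma exists_support (h : IsStar n x e N L) {Z : Dual ℝ E} {a : ZMod n ⊕ ZMod n} (ha : IsItem Z e a) :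
    ∃ M : Dual ℝ E, M x = 0 ∧ (∀ j, 0 ≤ M (e j)) ∧ M (ray Z e a) = 0 ∧
      ∃ y, Z y = 0 ∧ M y ≠ 0 := by
  have key : ∀ i u, N i u = 0 → Z u ≠ 0 → ∃ y, Z y = 0 ∧ N i y ≠ 0 := by
    intro i u hu hZu
    obtain ⟨y, hy⟩ : ∃ y, N i y ≠ 0 := by
      by_contra hc
      push Not at hc
      exact h.N_ne i (LinearMap.ext hc)
    refine ⟨y - (Z y / Z u) • u, by simp [hZu], by simpa [hu] using hy⟩
  rcases a with i | i
  · refine ⟨N i, h.N_x i, h.N_nonneg i, by simp [ray, idx, h.N_left, h.N_right], ?_⟩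
    refine key i (e i) (h.N_left i) ?_
    rintro h0; simp [IsItem, h0] at ha
  · rcases ha.2 with h1 | h1
    · exact ⟨N i, h.N_x i, h.N_nonneg i, by simp [ray, idx, coeff, h.N_left],
        key i _ (h.N_right i) h1⟩
    · refine ⟨N (i - 1), h.N_x _, h.N_nonneg _, ?_, key (i - 1) _ (h.N_left _) h1⟩
      have := h.N_right (i - 1)
      rw [sub_add_cancel] at this
      simp [ray, idx, coeff, this]

lemma L_ray_pos (h : IsStar n x e N L) {Z : Dual ℝ E} {a : ZMod n ⊕ ZMod n}
    (ha : IsItem Z e a) : 0 < L (ray Z e a) := by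
  obtain ⟨h1, h2⟩ := coeff_nonneg Z e a
  have h3 := coeff_pos ha
  simp only [ray, map_add, map_smul, smul_eq_mul]
  have h4 := h.L_pos (idx a)
  have h5 := h.L_pos (idx a + 1)
  rcases h1.lt_or_eq with h1 | h1
  · have := mul_pos h1 h4; have := mul_nonneg h2 h5.le; linarith
  · have := mul_pos (show 0 < (coeff Z e a).2 by linarith) h5
    have := mul_nonneg h1.le h4.le; linarith

lemma support_ray_nonneg {Z M : Dual ℝ E} (hM : ∀ j, 0 ≤ M (e j)) (a : ZMod n ⊕ ZMod n) :
    0 ≤ M (ray Z e a) := by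
  obtain ⟨h1, h2⟩ := coeff_nonneg Z e a
  simp only [ray, map_add, map_smul, smul_eq_mul]
  have := mul_nonneg h1 (hM (idx a))
  have := mul_nonneg h2 (hM (idx a + 1))
  linarith

variable [FiniteDimensional ℝ E]

/-- If a ray on which `Z` changes sign is a positive combination of two others, it coincides
with one of them. -/
lemma eq_of_lone_sign (h : IsStar n x e N L) (hE : finrank ℝ E = 4) {Z : Dual ℝ E}
    (hZ : Z ≠ 0) (hZx : Z x = 0) {a b c : ZMod n ⊕ ZMod n} (ha : IsItem Z e a)
    (hb : IsItem Z e b) {α β γ δ : ℝ} (hβ : 0 < β) (hγ : 0 < γ)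
    (heq : α • ray Z e a + β • ray Z e b + γ • ray Z e c + δ • x = 0) : a = b := by
  obtain ⟨M, hMx, hM, hMa, y, hy, hMy⟩ := h.exists_support ha
  have h1 := congrArg M heq
  simp only [map_add, map_smul, smul_eq_mul, map_zero, hMx, hMa, mul_zero, add_zero,
    zero_add] at h1
  have hMb : M (ray Z e b) = 0 := by
    have h2 := support_ray_nonneg (Z := Z) hM b
    have h3 := support_ray_nonneg (Z := Z) hM c
    have h4 := mul_nonneg hγ.le h3
    have h5 := mul_nonneg hβ.le h2
    have h6 : β * M (ray Z e b) = 0 := by linarith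
    exact (mul_eq_zero.1 h6).resolve_left hβ.ne'
  obtain ⟨α', β', γ', h7, hne⟩ := exists_relation_three hE hZ hy hMy (map_ray ha) (map_ray hb)
    hZx hMa hMb hMx
  exact h.ray_eq_of_relation ha hb h7 hne

lemma not_three_items (h : IsStar n x e N L) (hE : finrank ℝ E = 4) {Z : Dual ℝ E}
    (hZ : Z ≠ 0) (hZx : Z x = 0) {a b c : ZMod n ⊕ ZMod n} (ha : IsItem Z e a)
    (hb : IsItem Z e b) (hc : IsItem Z e c) : a = b ∨ a = c ∨ b = c := by
  obtain ⟨α, β, γ, δ, heq, hne⟩ := exists_relation_four hE hZ (map_ray ha) (map_ray hb)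
    (map_ray hc) hZx
  wlog hα : 0 ≤ α generalizing α β γ δ
  · refine this (-α) (-β) (-γ) (-δ) ?_ (by simpa using hne) (by linarith)
    rw [← neg_eq_zero, ← heq]; module
  have hL := congrArg L heq
  simp only [map_add, map_smul, smul_eq_mul, map_zero, h.L_x, mul_zero, add_zero] at hL
  have la := h.L_ray_pos ha
  have lb := h.L_ray_pos hb
  have lc := h.L_ray_pos hc
  rcases hα.lt_or_eq with hα | rfl
  · rcases lt_trichotomy β 0 with hβ | rfl | hβ
    · rcases lt_trichotomy γ 0 with hγ | rfl | hγ
      · left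
        refine h.eq_of_lone_sign hE hZ hZx (c := c) ha hb (α := -α) (β := -β) (γ := -γ) (δ := -δ)
          (by linarith) (by linarith) ?_
        rw [← neg_eq_zero, ← heq]; module
      · left
        exact h.ray_eq_of_relation ha hb (by simpa using heq) (fun h => hα.ne' h.1)
      · left
        refine (h.eq_of_lone_sign hE hZ hZx (c := c) hb ha (α := β) (β := α) (γ := γ) (δ := δ)
          hα hγ ?_).symm
        rw [← heq]; module
    · right; left
      exact h.ray_eq_of_relation ha hc (by simpa using heq) (fun h => hα.ne' h.1)
    · rcases lt_trichotomy γ 0 with hγ | rfl | hγ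
      · right; left
        refine (h.eq_of_lone_sign hE hZ hZx (c := b) hc ha (α := γ) (β := α) (γ := β) (δ := δ)
          hα hβ ?_).symm
        rw [← heq]; module
      · left
        exact h.ray_eq_of_relation ha hb (by simpa using heq) (fun h => hα.ne' h.1)
      · have := mul_pos hα la; have := mul_pos hβ lb; have := mul_pos hγ lc; linarith
  · right; right
    exact h.ray_eq_of_relation hb hc (by simpa using heq) (by simpa using hne)

/-- The vectors of a star cannot all lie in a hyperplane: `Z` cannot vanish on the vertex and on
all its neighbours. -/
lemma exists_ne_zero (h : IsStar n x e N L) (hE : finrank ℝ E = 4) {Z : Dual ℝ E}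
    (hZ : Z ≠ 0) (hZx : Z x = 0) : ∃ i, Z (e i) ≠ 0 := by
  by_contra hcon
  push Not at hcon
  have h10 := h.one_ne
  have h20 := h.two_ne
  have : NeZero n := ⟨by have := h.three_le; omega⟩
  have hmid : ∀ i, ∃ p q c : ℝ, 0 < p ∧ 0 < q ∧ e (i + 1) = p • e i + q • e (i + 1 + 1) + c • x := by
    intro i
    obtain ⟨α, β, γ, δ, heq, hne⟩ := exists_relation_four hE hZ (hcon i) (hcon (i + 1))
      (hcon (i + 1 + 1)) hZx
    have hno : ∀ α β γ δ : ℝ, α • e i + β • e (i + 1) + γ • e (i + 1 + 1) + δ • x = 0 →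
        ¬ (α = 0 ∧ β = 0 ∧ γ = 0 ∧ δ = 0) → γ ≠ 0 := by
      rintro α β γ δ heq hne rfl
      have hi := Fintype.linearIndependent_iff.1 (h.indep i) ![δ, α, β]
        (by simp only [Fin.sum_univ_three]; rw [← heq]; simp; abel)
      exact hne ⟨hi 1, hi 2, rfl, hi 0⟩
    have hno' : ∀ α β γ δ : ℝ, α • e i + β • e (i + 1) + γ • e (i + 1 + 1) + δ • x = 0 →
        ¬ (α = 0 ∧ β = 0 ∧ γ = 0 ∧ δ = 0) → α ≠ 0 := by
      rintro α β γ δ heq hne rfl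
      have hi := Fintype.linearIndependent_iff.1 (h.indep (i + 1)) ![δ, β, γ]
        (by simp only [Fin.sum_univ_three]; rw [← heq]; simp; abel)
      exact hne ⟨rfl, hi 1, hi 2, hi 0⟩
    have hα := hno' _ _ _ _ heq hne
    have hγ := hno _ _ _ _ heq hne
    wlog hα0 : 0 < α generalizing α β γ δ
    · refine this (-α) (-β) (-γ) (-δ) ?_ (by simpa using hne) (by simpa) (by simpa) ?_
      · rw [← neg_eq_zero, ← heq]; module
      · have := lt_of_le_of_ne (not_lt.1 hα0) hα; linarith
    have hsep : ∀ (i' : ZMod n) (p q p' q' c : ℝ), 0 ≤ p → 0 ≤ q → 0 ≤ q' → 0 < p' →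
        p • e i' + q • e (i' + 1) ≠ p' • e (i' + 1 + 1) + c • x := by
      intro i' p q p' q' c hp hq hq' hp' h1
      have h2 := congrFun (h.sep i' (i' + 1 + 1) p q p' 0 c hp hq hp'.le le_rfl
        (by rw [h1]; simp)) (i' + 1 + 1)
      simp [h10, add_assoc, h20] at h2
      exact hp'.ne h2
    have hL := congrArg L heq
    simp only [map_add, map_smul, smul_eq_mul, map_zero, h.L_x, mul_zero, add_zero] at hL
    rcases lt_or_gt_of_ne hγ with hγ0 | hγ0
    · exfalso
      by_cases hβ0 : 0 ≤ β
      · refine hsep i α β (-γ) 0 (-δ) hα0.le hβ0 le_rfl (by linarith) ?_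
        rw [← sub_eq_zero, ← heq]; module
      · have h2 := congrFun (h.sep (i + 1) i (-β) (-γ) α 0 δ (by linarith) (by linarith) hα0.le
          le_rfl (by rw [← sub_eq_zero, ← neg_eq_zero, ← heq]; module)) i
        have h3 : i ≠ i + 1 + 1 := by
          intro h; rw [add_assoc, left_eq_add] at h; exact h20 h
        simp [h10, h3] at h2
        exact hα0.ne h2
    · have hβ0 : β < 0 := by
        by_contra hb
        have := mul_pos hα0 (h.L_pos i)
        have := mul_pos hγ0 (h.L_pos (i + 1 + 1))
        have := mul_nonneg (not_lt.1 hb) (h.L_pos (i + 1)).le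
        linarith
      refine ⟨α / -β, γ / -β, δ / -β, by apply div_pos <;> linarith, by apply div_pos <;> linarith,
        ?_⟩
      have h1 : (-β) • e (i + 1) = α • e i + γ • e (i + 1 + 1) + δ • x := by
        rw [← sub_eq_zero, ← neg_eq_zero, ← heq]; module
      have h2 : (-β)⁻¹ • ((-β) • e (i + 1)) = e (i + 1) := by
        rw [smul_smul, inv_mul_cancel₀ (by linarith), one_smul]
      rw [← h2, h1]
      simp only [div_eq_inv_mul, smul_add, smul_smul]
  have hconst : ∀ G : Dual ℝ E, G x = 0 → ∀ i, G (e i) / L (e i) = G (e 0) / L (e 0) := by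
    intro G hG
    obtain ⟨m, hm⟩ := Finite.exists_max (fun i => G (e i) / L (e i))
    have hstep : ∀ i, (∀ j, G (e j) / L (e j) ≤ G (e i) / L (e i)) →
        (∀ j, G (e j) / L (e j) ≤ G (e (i + 1)) / L (e (i + 1))) := by
      intro i hi
      obtain ⟨i', rfl⟩ : ∃ i', i = i' + 1 := ⟨i - 1, by simp⟩
      obtain ⟨p, q, c, hp, hq, heq⟩ := hmid i'
      have h1 := congrArg G heq
      have h2 := congrArg L heq
      simp only [map_add, map_smul, smul_eq_mul, hG, h.L_x, mul_zero, add_zero] at h1 h2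
      have l1 := h.L_pos i'
      have l2 := h.L_pos (i' + 1)
      have l3 := h.L_pos (i' + 1 + 1)
      have h3 := hi i'
      have h4 := hi (i' + 1 + 1)
      have h5 : G (e (i' + 1 + 1)) / L (e (i' + 1 + 1)) = G (e (i' + 1)) / L (e (i' + 1)) := by
        refine le_antisymm h4 ?_
        set M := G (e (i' + 1)) / L (e (i' + 1)) with hM
        rw [div_le_iff₀ l1] at h3
        rw [le_div_iff₀ l3]
        have h6 : G (e (i' + 1)) = M * L (e (i' + 1)) := by rw [hM]; field_simp
        rw [h6, h2] at h1
        have h7 := mul_le_mul_of_nonneg_left h3 hp.le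
        have h8 : q * (M * L (e (i' + 1 + 1))) ≤ q * G (e (i' + 1 + 1)) := by linarith
        exact le_of_mul_le_mul_left h8 hq
      intro j
      rw [h5]
      exact hi j
    have hall : ∀ k : ℕ, ∀ j, G (e j) / L (e j) ≤ G (e (m + k)) / L (e (m + k)) := by
      intro k
      induction k with
      | zero => simpa using hm
      | succ k ih => simpa [add_assoc] using hstep _ ih
    have hall' : ∀ i j, G (e j) / L (e j) ≤ G (e i) / L (e i) := by
      intro i
      have := hall (i - m).val
      simpa using this
    intro i
    exact le_antisymm (hall' 0 i) (hall' i 0)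
  have hi := h.indep 0
  obtain ⟨G, hG⟩ : ∃ G : Dual ℝ E, G x = 0 ∧ G (e 0) = 0 ∧ G (e (0 + 1)) = 1 := by
    obtain ⟨G, hG⟩ := exists_dual_eq hi ![0, 0, 1]
    exact ⟨G, by simpa using hG 0, by simpa using hG 1, by simpa using hG 2⟩
  have h1 := hconst G hG.1 (0 + 1)
  rw [hG.2.1, hG.2.2, zero_div] at h1
  have := h.L_pos (0 + 1)
  exact absurd h1 (by positivity)

/-- Twice the variation of the sign of a functional at a corner of the star. -/
noncomputable def corner (Z : Dual ℝ E) (e : ZMod n → E) (i : ZMod n) : ℤ :=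
  |(SignType.sign (Z (e i)) : ℤ) - SignType.sign (Z (e (i + 1)))|

open Classical in
lemma card_items_le (h : IsStar n x e N L) (hE : finrank ℝ E = 4) [NeZero n] {Z : Dual ℝ E}
    (hZ : Z ≠ 0) (hZx : Z x = 0) :
    ∑ i, (if Z (e i) * Z (e (i + 1)) < 0 then 1 else 0 : ℤ) +
      ∑ i, (if Z (e i) = 0 ∧ (Z (e (i + 1)) ≠ 0 ∨ Z (e (i - 1)) ≠ 0) then 1 else 0 : ℤ) ≤ 2 := by
  have h1 : ∑ a : ZMod n ⊕ ZMod n, (if IsItem Z e a then 1 else 0 : ℤ) ≤ 2 := by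
    rw [← Finset.sum_filter, Finset.sum_const, nsmul_eq_mul, mul_one]
    by_contra hc
    push Not at hc
    obtain ⟨a, ha, b, hb, c, hc, h1, h2, h3⟩ := Finset.two_lt_card.1 (by exact_mod_cast hc)
    rcases h.not_three_items hE hZ hZx (Finset.mem_filter.1 ha).2 (Finset.mem_filter.1 hb).2
      (Finset.mem_filter.1 hc).2 with h | h | h
    exacts [h1 h, h2 h, h3 h]
  rw [Fintype.sum_sum_type] at h1
  convert h1 <;> exact Iff.rfl

open Classical in
lemma corner_eq (Z : Dual ℝ E) (e : ZMod n → E) (i : ZMod n) :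
    corner Z e i = 2 * (if Z (e i) * Z (e (i + 1)) < 0 then 1 else 0) +
      (if Z (e i) = 0 ∧ Z (e (i + 1)) ≠ 0 then 1 else 0) +
      (if Z (e (i + 1)) = 0 ∧ Z (e (i + 1 - 1)) ≠ 0 then 1 else 0) := by
  rw [add_sub_cancel_right, corner]
  have hc : ∀ a b : ℝ, (|(SignType.sign a : ℤ) - SignType.sign b| : ℤ) =
      2 * (if a * b < 0 then 1 else 0) + (if a = 0 ∧ b ≠ 0 then 1 else 0) +
      (if b = 0 ∧ a ≠ 0 then 1 else 0) := by
    intro a b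
    rcases lt_trichotomy a 0 with h1 | rfl | h1 <;> rcases lt_trichotomy b 0 with h2 | rfl | h2
    · simp [h1, h2, h1.ne, h2.ne, (mul_pos_of_neg_of_neg h1 h2).le]
    · simp [h1, h1.ne]
    · simp [h1, h2, h1.ne, h2.ne', mul_neg_of_neg_of_pos h1 h2]
    · simp [h2, h2.ne]
    · simp
    · simp [h2, h2.ne']
    · simp [h1, h2, h1.ne', h2.ne, mul_neg_of_pos_of_neg h1 h2]
    · simp [h1, h1.ne']
    · simp [h1, h2, h1.ne', h2.ne', (mul_pos h1 h2).le]
  exact hc _ _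

open Classical in
lemma sum_corner_eq [NeZero n] (Z : Dual ℝ E) (e : ZMod n → E) :
    ∑ i, corner Z e i = 2 * ∑ i, (if Z (e i) * Z (e (i + 1)) < 0 then 1 else 0 : ℤ) +
      ∑ i, (if Z (e i) = 0 ∧ Z (e (i + 1)) ≠ 0 then 1 else 0 : ℤ) +
      ∑ i, (if Z (e i) = 0 ∧ Z (e (i - 1)) ≠ 0 then 1 else 0 : ℤ) := by
  simp only [corner_eq, Finset.sum_add_distrib, Finset.mul_sum]
  congr 1
  exact Equiv.sum_comp (Equiv.addRight (1 : ZMod n))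
    (fun i => if Z (e i) = 0 ∧ Z (e (i - 1)) ≠ 0 then (1 : ℤ) else 0)

/-- The sign of a functional has at most four half-variations along the star of a vertex. -/
lemma sum_corner_le_four (h : IsStar n x e N L) (hE : finrank ℝ E = 4) [NeZero n] {Z : Dual ℝ E}
    (hZ : Z ≠ 0) (hZx : Z x = 0) : ∑ i, corner Z e i ≤ 4 := by
  classical
  have h1 := h.card_items_le hE hZ hZx
  rw [sum_corner_eq]
  have h2 : ∑ i, (if Z (e i) = 0 ∧ Z (e (i + 1)) ≠ 0 then 1 else 0 : ℤ) ≤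
      ∑ i, (if Z (e i) = 0 ∧ (Z (e (i + 1)) ≠ 0 ∨ Z (e (i - 1)) ≠ 0) then 1 else 0 : ℤ) := by
    refine Finset.sum_le_sum fun i _ => ?_
    split_ifs <;> simp_all
  have h3 : ∑ i, (if Z (e i) = 0 ∧ Z (e (i - 1)) ≠ 0 then 1 else 0 : ℤ) ≤
      ∑ i, (if Z (e i) = 0 ∧ (Z (e (i + 1)) ≠ 0 ∨ Z (e (i - 1)) ≠ 0) then 1 else 0 : ℤ) := by
    refine Finset.sum_le_sum fun i _ => ?_
    split_ifs <;> simp_all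
  linarith

/-- A functional vanishing on a triangle of the star is proportional to the functional supporting
the star along this triangle. -/
lemma eq_smul_of_zero (h : IsStar n x e N L) (hE : finrank ℝ E = 4) {Z : Dual ℝ E}
    (hZ : Z ≠ 0) (hZx : Z x = 0) {j : ZMod n} (h0 : Z (e j) = 0) (h1 : Z (e (j + 1)) = 0) :
    ∃ k : ℝ, k ≠ 0 ∧ Z = k • N j := by
  obtain ⟨k, hk⟩ := exists_eq_smul_of_three hE (h.N_ne j) (h.indep j) hZx h0 h1 (h.N_x j)
    (h.N_left j) (h.N_right j)
  refine ⟨k, ?_, hk⟩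
  rintro rfl
  exact hZ (by simpa using hk)

/-- The neighbours on which a functional vanishes, if they contain a triangle of the star, form an
interval `[q', q]` of the star. -/
structure IsZeroRun (x : E) (e : ZMod n → E) (Z : Dual ℝ E) (q' q : ZMod n) : Prop where
  ne : q' ≠ q
  last : ∀ i, (Z (e i) = 0 ∧ Z (e (i + 1)) ≠ 0) ↔ i = q
  first : ∀ i, (Z (e i) = 0 ∧ Z (e (i - 1)) ≠ 0) ↔ i = q'
  last_prev : Z (e (q - 1)) = 0
  first_next : Z (e (q' + 1)) = 0
  mem_cone : ∀ k, Z (e k) = 0 → ∃ b c d : ℝ, 0 ≤ b ∧ 0 ≤ c ∧ e k = b • e q' + c • e q + d • x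

lemma exists_last (h : IsStar n x e N L) (hE : finrank ℝ E = 4) [NeZero n] {Z : Dual ℝ E}
    (hZ : Z ≠ 0) (hZx : Z x = 0) {j : ZMod n} (h0 : Z (e j) = 0) (h1 : Z (e (j + 1)) = 0) :
    ∃ q, Z (e q) = 0 ∧ Z (e (q + 1)) ≠ 0 ∧ Z (e (q - 1)) = 0 := by
  classical
  obtain ⟨i, hi⟩ := h.exists_ne_zero hE hZ hZx
  have hex : ∃ m : ℕ, Z (e (j + m)) ≠ 0 := ⟨(i - j).val, by simpa using hi⟩
  have hm := Nat.find_spec hex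
  obtain ⟨m, hm'⟩ : ∃ m, Nat.find hex = m + 2 := by
    refine ⟨Nat.find hex - 2, ?_⟩
    have h2 : Nat.find hex ≠ 0 := fun h2 => by rw [h2] at hm; simp [h0] at hm
    have h3 : Nat.find hex ≠ 1 := fun h2 => by rw [h2] at hm; simp [h1] at hm
    omega
  have h2 := Nat.find_min hex (m := m + 1) (by omega)
  have h3 := Nat.find_min hex (m := m) (by omega)
  rw [hm'] at hm
  rw [not_not] at h2 h3
  refine ⟨j + (m + 1 : ℕ), h2, ?_, ?_⟩
  · rwa [show j + ((m + 1 : ℕ) : ZMod n) + 1 = j + ((m + 2 : ℕ) : ZMod n) by push_cast; ring]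
  · rwa [show j + ((m + 1 : ℕ) : ZMod n) - 1 = j + (m : ZMod n) by push_cast; ring]

lemma exists_first (h : IsStar n x e N L) (hE : finrank ℝ E = 4) [NeZero n] {Z : Dual ℝ E}
    (hZ : Z ≠ 0) (hZx : Z x = 0) {j : ZMod n} (h0 : Z (e j) = 0) (h1 : Z (e (j + 1)) = 0) :
    ∃ q, Z (e q) = 0 ∧ Z (e (q - 1)) ≠ 0 ∧ Z (e (q + 1)) = 0 := by
  classical
  obtain ⟨i, hi⟩ := h.exists_ne_zero hE hZ hZx
  have hex : ∃ m : ℕ, Z (e (j + 1 - m)) ≠ 0 := ⟨(j + 1 - i).val, by simpa using hi⟩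
  have hm := Nat.find_spec hex
  obtain ⟨m, hm'⟩ : ∃ m, Nat.find hex = m + 2 := by
    refine ⟨Nat.find hex - 2, ?_⟩
    have h2 : Nat.find hex ≠ 0 := fun h2 => by rw [h2] at hm; simp [h1] at hm
    have h3 : Nat.find hex ≠ 1 := fun h2 => by rw [h2] at hm; simp [h0] at hm
    omega
  have h2 := Nat.find_min hex (m := m + 1) (by omega)
  have h3 := Nat.find_min hex (m := m) (by omega)
  rw [hm'] at hm
  rw [not_not] at h2 h3
  refine ⟨j + 1 - (m + 1 : ℕ), h2, ?_, ?_⟩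
  · rwa [show j + 1 - ((m + 1 : ℕ) : ZMod n) - 1 = j + 1 - ((m + 2 : ℕ) : ZMod n) by
      push_cast; ring]
  · rwa [show j + 1 - ((m + 1 : ℕ) : ZMod n) + 1 = j + 1 - (m : ZMod n) by push_cast; ring]

lemma exists_isZeroRun (h : IsStar n x e N L) (hE : finrank ℝ E = 4) [NeZero n] {Z : Dual ℝ E}
    (hZ : Z ≠ 0) (hZx : Z x = 0) {j : ZMod n} (h0 : Z (e j) = 0) (h1 : Z (e (j + 1)) = 0) :
    ∃ q' q, IsZeroRun x e Z q' q := by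
  obtain ⟨q, hq0, hq1, hq2⟩ := h.exists_last hE hZ hZx h0 h1
  obtain ⟨q', hq0', hq1', hq2'⟩ := h.exists_first hE hZ hZx h0 h1
  have hne : q' ≠ q := by rintro rfl; exact hq1 hq2'
  have item : ∀ i, Z (e i) = 0 → (Z (e (i + 1)) ≠ 0 ∨ Z (e (i - 1)) ≠ 0) → i = q' ∨ i = q := by
    intro i hi hi'
    rcases h.not_three_items hE hZ hZx (a := .inr q') (b := .inr q) (c := .inr i)
      ⟨hq0', .inr hq1'⟩ ⟨hq0, .inl hq1⟩ ⟨hi, hi'⟩ with h | h | h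
    · exact absurd (Sum.inr_injective h) hne
    · exact .inl (Sum.inr_injective h).symm
    · exact .inr (Sum.inr_injective h).symm
  have hpair : ∀ α β γ : ℝ, α • e q' + β • e q + γ • x = 0 → α = 0 ∧ β = 0 ∧ γ = 0 := by
    intro α β γ heq
    by_contra hcon
    have := h.ray_eq_of_relation (Z := Z) (a := .inr q') (b := .inr q)
      ⟨hq0', .inr hq1'⟩ ⟨hq0, .inl hq1⟩ (by simpa [ray, coeff, idx] using heq) hcon
    exact hne (Sum.inr_injective this)
  refine ⟨q', q, hne, fun i => ⟨?_, ?_⟩, fun i => ⟨?_, ?_⟩, hq2, hq2', ?_⟩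
  · rintro ⟨h2, h3⟩
    rcases item i h2 (.inl h3) with rfl | rfl
    · exact absurd hq2' h3
    · rfl
  · rintro rfl; exact ⟨hq0, hq1⟩
  · rintro ⟨h2, h3⟩
    rcases item i h2 (.inr h3) with rfl | rfl
    · rfl
    · exact absurd hq2 h3
  · rintro rfl; exact ⟨hq0', hq1'⟩
  · intro k hk
    obtain ⟨α, β, γ, δ, heq, hne'⟩ := exists_relation_four hE hZ hk hq0' hq0 hZx
    have hα : α ≠ 0 := by
      rintro rfl
      obtain ⟨h2, h3, h4⟩ := hpair β γ δ (by simpa using heq)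
      exact hne' ⟨rfl, h2, h3, h4⟩
    have heq' : e k = (-β / α) • e q' + (-γ / α) • e q + (-δ / α) • x := by
      have h2 : α⁻¹ • (α • e k) = e k := by rw [smul_smul, inv_mul_cancel₀ hα, one_smul]
      have h3 : α • e k = (-β) • e q' + (-γ) • e q + (-δ) • x := by
        rw [← sub_eq_zero, ← heq]; module
      rw [← h2, h3]
      simp only [div_eq_inv_mul, smul_add, smul_smul]
    have key : ∀ r s : ZMod n, IsItem Z e (.inr r) → Z (e s) = 0 →
        (∀ α β γ : ℝ, α • e r + β • e s + γ • x = 0 → α = 0 ∧ β = 0 ∧ γ = 0) →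
        ∀ b c d : ℝ, e k = b • e r + c • e s + d • x → 0 ≤ c := by
      intro r s hr hs hrs b c d hbc
      obtain ⟨M, hMx, hM, hMr, y, hy, hMy⟩ := h.exists_support hr
      simp only [ray, coeff, idx, one_smul, zero_smul, add_zero] at hMr
      have h2 := congrArg M hbc
      simp only [map_add, map_smul, smul_eq_mul, hMx, hMr, mul_zero, add_zero, zero_add] at h2
      rcases (hM s).lt_or_eq with h3 | h3
      · by_contra hc
        have := mul_neg_of_neg_of_pos (not_le.1 hc) h3
        have := hM k
        linarith
      · obtain ⟨a1, a2, a3, h4, h5⟩ := exists_relation_three hE hZ hy hMy hr.1 hs hZx hMr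
          h3.symm hMx
        exact absurd (hrs _ _ _ h4) h5
    refine ⟨_, _, _, ?_, ?_, heq'⟩
    · refine key q q' ⟨hq0, .inl hq1⟩ hq0' (fun a b c h2 => ?_) _ _ _ (heq'.trans (by abel))
      obtain ⟨h3, h4, h5⟩ := hpair b a c (by rw [← h2]; abel)
      exact ⟨h4, h3, h5⟩
    · exact key q' q ⟨hq0', .inr hq1'⟩ hq0 hpair _ _ _ heq'

/-- If a functional vanishes on a triangle of the star, its sign has at most two
half-variations. -/
lemma sum_corner_le_two (h : IsStar n x e N L) (hE : finrank ℝ E = 4) [NeZero n] {Z : Dual ℝ E}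
    (hZ : Z ≠ 0) (hZx : Z x = 0) {j : ZMod n} (h0 : Z (e j) = 0) (h1 : Z (e (j + 1)) = 0) :
    ∑ i, corner Z e i ≤ 2 := by
  classical
  obtain ⟨q', q, hr⟩ := h.exists_isZeroRun hE hZ hZx h0 h1
  obtain ⟨k, hk, hZk⟩ := h.eq_smul_of_zero hE hZ hZx h0 h1
  rw [sum_corner_eq]
  have h2 : ∀ i, ¬ Z (e i) * Z (e (i + 1)) < 0 := by
    intro i
    rw [hZk]
    simp only [LinearMap.smul_apply, smul_eq_mul]
    have h3 := mul_nonneg (h.N_nonneg j i) (h.N_nonneg j (i + 1))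
    have := mul_nonneg (mul_self_nonneg k) h3
    nlinarith
  simp only [h2, hr.last, hr.first]
  simp

end IsStar

end Star

/-- An oriented convex polyhedral surface around the origin of a vector space, given by the vectors
`x v` on the rays of its vertices. The triangle on the left of the oriented edge `vw` has third
vertex `nx v w`, and is supported by the functional `N v w`. -/
structure OSurf (E V : Type*) [AddCommGroup E] [Module ℝ E] where
  x : V → E
  adj : V → V → Prop
  nx : V → V → V
  N : V → V → Dual ℝ E
  L : V → Dual ℝ E
  adj_symm : ∀ {v w}, adj v w → adj w v
  link : ∀ v, ∃ (n : ℕ) (w : ZMod n → V), 3 ≤ n ∧ Function.Injective w ∧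
    (∀ u, adj v u ↔ ∃ i, w i = u) ∧ ∀ i, nx v (w i) = w (i + 1)
  adj_nx' : ∀ {v w}, adj v w → adj w (nx v w)
  nx_nx : ∀ {v w}, adj v w → nx w (nx v w) = v
  indep : ∀ {v w}, adj v w → LinearIndependent ℝ ![x v, x w, x (nx v w)]
  N_ne : ∀ {v w}, adj v w → N v w ≠ 0
  N_nonneg : ∀ {v w u}, adj v w → adj v u → 0 ≤ N v w (x u)
  N_left : ∀ {v w}, adj v w → N v w (x v) = 0
  N_cyc : ∀ {v w}, adj v w → N w (nx v w) = N v w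
  L_self : ∀ v, L v (x v) = 0
  L_pos : ∀ {v w}, adj v w → 0 < L v (x w)
  sep : ∀ {v a b} {p q p' q' c : ℝ}, adj v a → adj v b → 0 ≤ p → 0 ≤ q → 0 ≤ p' → 0 ≤ q' →
    p • x a + q • x (nx v a) = p' • x b + q' • x (nx v b) + c • x v →
    Finsupp.single a p + Finsupp.single (nx v a) q =
      Finsupp.single b p' + Finsupp.single (nx v b) q'
  connected : ∀ A : Set V, A.Nonempty → (∀ v ∈ A, ∀ w, adj v w → w ∈ A) → A = Set.univ

namespace OSurf

variable {E V : Type*} [AddCommGroup E] [Module ℝ E] (M : OSurf E V)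

lemma finite_adj (v : V) : {u | M.adj v u}.Finite := by
  obtain ⟨n, w, hn, -, hw, -⟩ := M.link v
  have : NeZero n := ⟨by omega⟩
  refine (Set.finite_range w).subset fun u hu => ?_
  exact (hw u).1 hu

/-- The neighbours of a vertex. -/
noncomputable def nbrs (v : V) : Finset V := (M.finite_adj v).toFinset

@[simp] lemma mem_nbrs {v u : V} : u ∈ M.nbrs v ↔ M.adj v u := by simp [nbrs]

variable {M} {v w : V}

lemma adj_nx (h : M.adj v w) : M.adj v (M.nx v w) := by
  have h1 := M.adj_nx' (M.adj_nx' h)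
  rw [M.nx_nx h] at h1
  exact M.adj_symm h1

lemma nx_nx_nx (h : M.adj v w) : M.nx (M.nx v w) v = w := by
  have h1 := M.nx_nx (M.adj_nx' h)
  rwa [M.nx_nx h] at h1

lemma N_right (h : M.adj v w) : M.N v w (M.x w) = 0 := by
  rw [← M.N_cyc h]; exact M.N_left (M.adj_nx' h)

lemma N_nx (h : M.adj v w) : M.N v w (M.x (M.nx v w)) = 0 := by
  rw [← M.N_cyc h]; exact N_right (M.adj_nx' h)

lemma ne_of_adj (h : M.adj v w) : v ≠ w := by
  rintro rfl
  have := (M.indep h).injective (a₁ := 0) (a₂ := 1) (by simp)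
  simp at this

/-- The vertex before `w` in the link of `v`. -/
lemma nx_prev (h : M.adj v w) : M.nx v (M.nx w v) = w := M.nx_nx (M.adj_symm h)

lemma adj_prev (h : M.adj v w) : M.adj v (M.nx w v) := M.adj_nx' (M.adj_symm h)

lemma nx_inj {a b : V} (ha : M.adj v a) (hb : M.adj v b) (h : M.nx v a = M.nx v b) : a = b := by
  rw [← nx_nx_nx ha, h, nx_nx_nx hb]

lemma prev_nx (h : M.adj v w) : M.nx (M.nx v w) v = w := nx_nx_nx h

variable (M) in
lemma exists_star (v : V) : ∃ (n : ℕ) (w : ZMod n → V), NeZero n ∧ Function.Injective w ∧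
    (∀ u, M.adj v u ↔ ∃ i, w i = u) ∧ (∀ i, M.nx v (w i) = w (i + 1)) ∧
    IsStar n (M.x v) (fun i => M.x (w i)) (fun i => M.N v (w i)) (M.L v) := by
  obtain ⟨n, w, hn, hinj, hw, hnx⟩ := M.link v
  have hadj : ∀ i, M.adj v (w i) := fun i => (hw _).2 ⟨i, rfl⟩
  refine ⟨n, w, ⟨by omega⟩, hinj, hw, hnx, hn, fun i => ?_, fun i => M.N_left (hadj i),
    fun i => N_right (hadj i), fun i => ?_, fun i => M.N_ne (hadj i),
    fun i j => M.N_nonneg (hadj i) (hadj j), M.L_self v, fun i => M.L_pos (hadj i), ?_⟩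
  · rw [← hnx]; exact M.indep (hadj i)
  · rw [← hnx]; exact N_nx (hadj i)
  · intro i j p q p' q' c hp hq hp' hq' heq
    rw [← hnx, ← hnx] at heq
    have h1 := M.sep (hadj i) (hadj j) hp hq hp' hq' heq
    ext k
    have h2 := DFunLike.congr_fun h1 (w k)
    classical
    simpa [Finsupp.single_apply, Pi.single_apply, hnx, hinj.eq_iff, eq_comm] using h2

lemma sum_nbrs {n : ℕ} [NeZero n] {w : ZMod n → V} (hinj : Function.Injective w)
    (hw : ∀ u, M.adj v u ↔ ∃ i, w i = u) {A : Type*} [AddCommMonoid A] (f : V → A) :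
    ∑ u ∈ M.nbrs v, f u = ∑ i, f (w i) := by
  classical
  rw [← Finset.sum_image (s := Finset.univ) (g := w) (f := f) (fun a _ b _ h => hinj h)]
  refine Finset.sum_congr ?_ fun _ _ => rfl
  ext u; simp [hw, eq_comm]

/-- The variation of the sign of `Z`, at the corner at `v` of the triangle left of `vu`. -/
noncomputable def corner (M : OSurf E V) (Z : Dual ℝ E) (v u : V) : ℤ :=
  |(SignType.sign (Z (M.x u)) : ℤ) - SignType.sign (Z (M.x (M.nx v u)))|

/-- The neighbours of `v` on which `Z` vanishes, if they contain a triangle, form an interval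
`[q', q]` of the link of `v`. -/
structure IsZeroRun (M : OSurf E V) (Z : Dual ℝ E) (v q' q : V) : Prop where
  adj_first : M.adj v q'
  adj_last : M.adj v q
  ne : q' ≠ q
  last : ∀ u, M.adj v u → ((Z (M.x u) = 0 ∧ Z (M.x (M.nx v u)) ≠ 0) ↔ u = q)
  first : ∀ u, M.adj v u → ((Z (M.x u) = 0 ∧ Z (M.x (M.nx u v)) ≠ 0) ↔ u = q')
  last_prev : Z (M.x (M.nx q v)) = 0
  first_next : Z (M.x (M.nx v q')) = 0
  mem_cone : ∀ u, M.adj v u → Z (M.x u) = 0 →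
    ∃ b c d : ℝ, 0 ≤ b ∧ 0 ≤ c ∧ M.x u = b • M.x q' + c • M.x q + d • M.x v

variable [FiniteDimensional ℝ E] (hE : finrank ℝ E = 4) {Z : Dual ℝ E} (hZ : Z ≠ 0)
include hE hZ

lemma exists_adj_ne_zero (hZv : Z (M.x v) = 0) : ∃ u, M.adj v u ∧ Z (M.x u) ≠ 0 := by
  obtain ⟨n, w, _, hinj, hw, hnx, hs⟩ := M.exists_star v
  obtain ⟨i, hi⟩ := hs.exists_ne_zero hE hZ hZv
  exact ⟨w i, (hw _).2 ⟨i, rfl⟩, hi⟩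

lemma sum_corner_le_four (hZv : Z (M.x v) = 0) : ∑ u ∈ M.nbrs v, M.corner Z v u ≤ 4 := by
  obtain ⟨n, w, _, hinj, hw, hnx, hs⟩ := M.exists_star v
  rw [sum_nbrs hinj hw]
  simpa [corner, IsStar.corner, hnx] using hs.sum_corner_le_four hE hZ hZv

lemma sum_corner_le_two (hZv : Z (M.x v) = 0) {u : V} (hu : M.adj v u) (h0 : Z (M.x u) = 0)
    (h1 : Z (M.x (M.nx v u)) = 0) : ∑ u ∈ M.nbrs v, M.corner Z v u ≤ 2 := by
  obtain ⟨n, w, _, hinj, hw, hnx, hs⟩ := M.exists_star v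
  obtain ⟨i, rfl⟩ := (hw u).1 hu
  rw [sum_nbrs hinj hw]
  rw [hnx] at h1
  simpa [corner, IsStar.corner, hnx] using hs.sum_corner_le_two hE hZ hZv h0 h1

lemma eq_smul_N_of_zero (hZv : Z (M.x v) = 0) {u : V} (hu : M.adj v u) (h0 : Z (M.x u) = 0)
    (h1 : Z (M.x (M.nx v u)) = 0) : ∃ k : ℝ, k ≠ 0 ∧ Z = k • M.N v u := by
  obtain ⟨k, hk⟩ := exists_eq_smul_of_three hE (M.N_ne hu) (M.indep hu) hZv h0 h1
    (M.N_left hu) (N_right hu) (N_nx hu)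
  refine ⟨k, ?_, hk⟩
  rintro rfl
  exact hZ (by simpa using hk)

lemma exists_isZeroRun (hZv : Z (M.x v) = 0) {u : V} (hu : M.adj v u) (h0 : Z (M.x u) = 0)
    (h1 : Z (M.x (M.nx v u)) = 0) : ∃ q' q, M.IsZeroRun Z v q' q := by
  obtain ⟨n, w, _, hinj, hw, hnx, hs⟩ := M.exists_star v
  obtain ⟨i, rfl⟩ := (hw u).1 hu
  rw [hnx] at h1
  obtain ⟨q', q, hr⟩ := hs.exists_isZeroRun hE hZ hZv h0 h1
  have hadj : ∀ i, M.adj v (w i) := fun i => (hw _).2 ⟨i, rfl⟩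
  have hpv : ∀ i, M.nx (w i) v = w (i - 1) := fun i => by
    refine nx_inj (adj_prev (hadj i)) (hadj _) ?_
    rw [nx_prev (hadj i), hnx, sub_add_cancel]
  refine ⟨w q', w q, hadj _, hadj _, fun h => hr.ne (hinj h), ?_, ?_,
    by rw [hpv]; exact hr.last_prev, by rw [hnx]; exact hr.first_next, ?_⟩
  · intro u hu
    obtain ⟨j, rfl⟩ := (hw u).1 hu
    rw [hnx, hinj.eq_iff]
    exact hr.last j
  · intro u hu
    obtain ⟨j, rfl⟩ := (hw u).1 hu
    rw [hpv, hinj.eq_iff]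
    exact hr.first j
  · intro u hu h0
    obtain ⟨j, rfl⟩ := (hw u).1 hu
    exact hr.mem_cone j h0

end OSurf

section DartSpaces

variable {D : Type*} [Fintype D]

/-- The functions supported in `T` that are antisymmetric under `τ`. -/
def antiSubmodule (τ : Equiv.Perm D) (T : Set D) : Submodule ℝ (D → ℝ) where
  carrier := {c | (∀ d, c (τ d) = -c d) ∧ ∀ d ∉ T, c d = 0}
  add_mem' := fun {a b} ha hb => ⟨fun d => by simp [ha.1 d, hb.1 d]; ring,
    fun d hd => by simp [ha.2 d hd, hb.2 d hd]⟩
  zero_mem' := by simp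
  smul_mem' := fun k a ha => ⟨fun d => by simp [ha.1 d], fun d hd => by simp [ha.2 d hd]⟩

/-- The functions supported in `F` that are invariant under `φ`. -/
def invSubmodule (φ : Equiv.Perm D) (F : Set D) : Submodule ℝ (D → ℝ) where
  carrier := {c | (∀ d, c (φ d) = c d) ∧ ∀ d ∉ F, c d = 0}
  add_mem' := fun {a b} ha hb => ⟨fun d => by simp [ha.1 d, hb.1 d],
    fun d hd => by simp [ha.2 d hd, hb.2 d hd]⟩
  zero_mem' := by simp
  smul_mem' := fun k a ha => ⟨fun d => by simp [ha.1 d], fun d hd => by simp [ha.2 d hd]⟩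

open Classical in
lemma finrank_eq_sum_of_isProj {p : Submodule ℝ (D → ℝ)} {f : (D → ℝ) →ₗ[ℝ] (D → ℝ)}
    (h : LinearMap.IsProj p f) : (finrank ℝ p : ℝ) = ∑ d, f (Pi.single d 1) d := by
  rw [← h.trace, LinearMap.trace_eq_matrix_trace ℝ (Pi.basisFun ℝ D), Matrix.trace]
  simp

lemma finrank_antiSubmodule {τ : Equiv.Perm D} (h2 : ∀ d, τ (τ d) = d) (hne : ∀ d, τ d ≠ d)
    {T : Set D} (hT : ∀ d ∈ T, τ d ∈ T) : 2 * finrank ℝ (antiSubmodule τ T) = T.ncard := by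
  classical
  have hT' : ∀ d, τ d ∈ T ↔ d ∈ T := fun d => ⟨fun h => by simpa [h2] using hT _ h, hT d⟩
  let f : (D → ℝ) →ₗ[ℝ] (D → ℝ) :=
    { toFun := fun c d => if d ∈ T then (c d - c (τ d)) / 2 else 0
      map_add' := fun a b => by ext d; dsimp; split_ifs <;> ring
      map_smul' := fun k a => by ext d; dsimp; split_ifs <;> ring }
  have hf : LinearMap.IsProj (antiSubmodule τ T) f := by
    refine ⟨fun c => ⟨fun d => ?_, fun d hd => if_neg hd⟩, fun c hc => ?_⟩
    · simp only [f, LinearMap.coe_mk, AddHom.coe_mk, hT', h2]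
      split_ifs <;> ring
    · ext d
      simp only [f, LinearMap.coe_mk, AddHom.coe_mk]
      split_ifs with h
      · rw [hc.1 d]; ring
      · rw [hc.2 d h]
  have h1 := finrank_eq_sum_of_isProj hf
  have h3 : ∀ d, f (Pi.single d 1) d = if d ∈ T then 1 / 2 else 0 := by
    intro d
    simp [f, hne d]
  simp only [h3] at h1
  rw [← Finset.sum_filter, Finset.sum_const, nsmul_eq_mul] at h1
  have h4 : T.ncard = (Finset.univ.filter (· ∈ T)).card := by
    rw [Set.ncard_eq_toFinset_card']; congr 1; ext; simp
  rw [h4]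
  have : (2 * finrank ℝ (antiSubmodule τ T) : ℝ) = (Finset.univ.filter (· ∈ T)).card := by
    rw [h1]; ring
  exact_mod_cast this

lemma finrank_invSubmodule {φ : Equiv.Perm D} (h3 : ∀ d, φ (φ (φ d)) = d) (hne : ∀ d, φ d ≠ d)
    {F : Set D} (hF : ∀ d ∈ F, φ d ∈ F) : 3 * finrank ℝ (invSubmodule φ F) = F.ncard := by
  classical
  have hF' : ∀ d, φ d ∈ F ↔ d ∈ F := fun d =>
    ⟨fun h => by simpa [h3] using hF _ (hF _ h), hF d⟩
  have hne2 : ∀ d, φ (φ d) ≠ d := fun d h => hne d (by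
    have := h3 d; rwa [h] at this)
  let f : (D → ℝ) →ₗ[ℝ] (D → ℝ) :=
    { toFun := fun c d => if d ∈ F then (c d + c (φ d) + c (φ (φ d))) / 3 else 0
      map_add' := fun a b => by ext d; dsimp; split_ifs <;> ring
      map_smul' := fun k a => by ext d; dsimp; split_ifs <;> ring }
  have hf : LinearMap.IsProj (invSubmodule φ F) f := by
    refine ⟨fun c => ⟨fun d => ?_, fun d hd => if_neg hd⟩, fun c hc => ?_⟩
    · simp only [f, LinearMap.coe_mk, AddHom.coe_mk, hF', h3]
      split_ifs <;> ring
    · ext d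
      simp only [f, LinearMap.coe_mk, AddHom.coe_mk]
      split_ifs with h
      · rw [hc.1 (φ d), hc.1 d]; ring
      · rw [hc.2 d h]
  have h1 := finrank_eq_sum_of_isProj hf
  have h5 : ∀ d, f (Pi.single d 1) d = if d ∈ F then 1 / 3 else 0 := by
    intro d
    simp [f, hne d, hne2 d]
  simp only [h5] at h1
  rw [← Finset.sum_filter, Finset.sum_const, nsmul_eq_mul] at h1
  have h4 : F.ncard = (Finset.univ.filter (· ∈ F)).card := by
    rw [Set.ncard_eq_toFinset_card']; congr 1; ext; simp
  rw [h4]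
  have : (3 * finrank ℝ (invSubmodule φ F) : ℝ) = (Finset.univ.filter (· ∈ F)).card := by
    rw [h1]; ring
  exact_mod_cast this

/-- A space of closed forms on a combinatorial surface (with faces the cycles of `φ` in `F`, and
edges the cycles of `τ` in `T`) is orthogonal to the coboundaries of functions on the faces; this
bounds its dimension. -/
theorem finrank_closed_forms_le {τ φ : Equiv.Perm D} (hτ : ∀ d, τ (τ d) = d)
    (hτ' : ∀ d, τ d ≠ d) (hφ : ∀ d, φ (φ (φ d)) = d) (hφ' : ∀ d, φ d ≠ d) {T F : Set D}
    (hT : ∀ d ∈ T, τ d ∈ T) (hF : ∀ d ∈ F, φ d ∈ F)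
    (hconn : ∀ b : D → ℝ, (∀ d, b (φ d) = b d) → (∀ d ∈ T, b (τ d) = b d) →
      ∀ d ∈ F, ∀ d' ∈ F, b d = b d')
    (W : Submodule ℝ (D → ℝ)) (hW : ∀ c ∈ W, (∀ d, c (τ d) = -c d) ∧ (∀ d ∉ T, c d = 0) ∧
      ∀ d ∈ F, c d + c (φ d) + c (φ (φ d)) = 0) :
    6 * finrank ℝ W + 2 * F.ncard ≤ 3 * T.ncard + 6 := by
  classical
  have hT' : ∀ d, τ d ∈ T ↔ d ∈ T := fun d => ⟨fun h => by simpa [hτ] using hT _ h, hT d⟩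
  have hF' : ∀ d, φ d ∈ F ↔ d ∈ F := fun d =>
    ⟨fun h => by simpa [hφ] using hF _ (hF _ h), hF d⟩
  let δ : (D → ℝ) →ₗ[ℝ] (D → ℝ) :=
    { toFun := fun b d => if d ∈ T then b d - b (τ d) else 0
      map_add' := fun a b => by ext d; dsimp; split_ifs <;> ring
      map_smul' := fun k a => by ext d; dsimp; split_ifs <;> ring }
  have hδ : ∀ b d, δ b d = if d ∈ T then b d - b (τ d) else 0 := fun _ _ => rfl
  let W2 := (invSubmodule φ F).map δ
  have hsub : W ⊔ W2 ≤ antiSubmodule τ T := by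
    refine sup_le (fun c hc => ⟨(hW c hc).1, (hW c hc).2.1⟩) ?_
    rintro _ ⟨b, -, rfl⟩
    refine ⟨fun d => ?_, fun d hd => if_neg hd⟩
    rw [hδ, hδ, hT', hτ]
    split_ifs <;> ring
  have hinf : W ⊓ W2 = ⊥ := by
    rw [eq_bot_iff]
    rintro c ⟨hc, b, hb, rfl⟩
    obtain ⟨h1, h2, h3⟩ := hW _ hc
    set c := δ b with hcdef
    have hsum : ∑ d, c d * c d = 0 := by
      have e1 : ∀ d, c d * c d = c d * b d - c d * b (τ d) := by
        intro d
        by_cases hd : d ∈ T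
        · rw [← mul_sub]; congr 1; rw [hcdef, hδ, if_pos hd]
        · simp [h2 d hd]
      have e2 : ∑ d, c d * b (τ d) = - ∑ d, c d * b d := by
        rw [← Equiv.sum_comp τ, ← Finset.sum_neg_distrib]
        refine Finset.sum_congr rfl fun d _ => ?_
        rw [h1, hτ]; ring
      have e3 : 3 * ∑ d, c d * b d = ∑ d, (c d + c (φ d) + c (φ (φ d))) * b d := by
        have e4 : ∑ d, c (φ d) * b d = ∑ d, c d * b d := by
          rw [← Equiv.sum_comp φ (fun d => c d * b d)]
          exact Finset.sum_congr rfl fun d _ => by rw [hb.1]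
        have e5 : ∑ d, c (φ (φ d)) * b d = ∑ d, c d * b d := by
          rw [← e4, ← Equiv.sum_comp φ (fun d => c (φ d) * b d)]
          exact Finset.sum_congr rfl fun d _ => by rw [hb.1]
        simp only [add_mul, Finset.sum_add_distrib, e4, e5]; ring
      have e6 : ∑ d, (c d + c (φ d) + c (φ (φ d))) * b d = 0 := by
        refine Finset.sum_eq_zero fun d _ => ?_
        by_cases hd : d ∈ F
        · rw [h3 d hd, zero_mul]
        · rw [hb.2 d hd, mul_zero]
      simp only [e1, Finset.sum_sub_distrib, e2]
      linarith
    rw [Submodule.mem_bot]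
    ext d
    have := (Finset.sum_eq_zero_iff_of_nonneg (fun d _ => mul_self_nonneg (c d))).1 hsum d
      (Finset.mem_univ d)
    simpa using this
  have hd1 := Submodule.finrank_sup_add_finrank_inf_eq W W2
  rw [hinf, finrank_bot, add_zero] at hd1
  have hd2 := Submodule.finrank_mono hsub
  have hd3 := finrank_antiSubmodule hτ hτ' hT
  have hd4 := finrank_invSubmodule hφ hφ' hF
  have hd5 := LinearMap.finrank_range_add_finrank_ker (δ.domRestrict (invSubmodule φ F))
  have hd6 : finrank ℝ (LinearMap.range (δ.domRestrict (invSubmodule φ F))) = finrank ℝ W2 := by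
    rw [LinearMap.range_domRestrict]
  have hd7 : finrank ℝ (LinearMap.ker (δ.domRestrict (invSubmodule φ F))) ≤ 1 := by
    have hc : ∀ b : LinearMap.ker (δ.domRestrict (invSubmodule φ F)),
        ∀ d ∈ F, ∀ d' ∈ F, (b : invSubmodule φ F).1 d = (b : invSubmodule φ F).1 d' := by
      intro b
      refine hconn _ b.1.2.1 fun d hd => ?_
      have h1 := congrFun (LinearMap.mem_ker.1 b.2) d
      rw [LinearMap.domRestrict_apply, hδ, if_pos hd] at h1
      simp only [Pi.zero_apply] at h1
      linarith
    rcases F.eq_empty_or_nonempty with hF0 | ⟨d0, hd0⟩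
    · refine finrank_le_one 0 fun b => ⟨0, ?_⟩
      refine Subtype.ext (Subtype.ext (funext fun d => ?_))
      simp [b.1.2.2 d (by simp [hF0])]
    · by_cases hall : ∀ b : LinearMap.ker (δ.domRestrict (invSubmodule φ F)),
        (b : invSubmodule φ F).1 d0 = 0
      · refine finrank_le_one 0 fun b => ⟨0, ?_⟩
        refine Subtype.ext (Subtype.ext (funext fun d => ?_))
        by_cases hd : d ∈ F
        · simp [hc b d hd d0 hd0, hall b]
        · simp [b.1.2.2 d hd]
      · push Not at hall
        obtain ⟨b0, hb0⟩ := hall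
        refine finrank_le_one b0 fun b => ⟨(b : invSubmodule φ F).1 d0 /
          (b0 : invSubmodule φ F).1 d0, ?_⟩
        refine Subtype.ext (Subtype.ext (funext fun d => ?_))
        by_cases hd : d ∈ F
        · simp [hc b d hd d0 hd0, hc b0 d hd d0 hd0, hb0]
        · simp [b.1.2.2 d hd, b0.1.2.2 d hd]
  omega

end DartSpaces

namespace OSurf

variable {E V : Type*} [AddCommGroup E] [Module ℝ E] (M : OSurf E V)

/-- A group acting freely by automorphisms of the oriented triangulated surface. -/
class Equivariant (G : Type*) [Group G] [MulAction G V] : Prop where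
  adj_smul : ∀ (g : G) {v w}, M.adj v w → M.adj (g • v) (g • w)
  nx_smul : ∀ (g : G) {v w}, M.adj v w → M.nx (g • v) (g • w) = g • M.nx v w
  free : ∀ (g : G) (v : V), g • v = v → g = 1
  free_edge : ∀ (g : G) {v w}, M.adj v w → g • v = w → g • w = v → False
  free_face : ∀ (g : G) {v w}, M.adj v w → g • v = w → g • w = M.nx v w → g • M.nx v w = v → False
  finite : Finite (MulAction.orbitRel.Quotient G V)

/-- Oriented edges. -/
abbrev Dart := {d : V × V // M.adj d.1 d.2}

namespace Dart

variable {M}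

@[ext] lemma ext {d d' : M.Dart} (h1 : d.1.1 = d'.1.1) (h2 : d.1.2 = d'.1.2) : d = d' :=
  Subtype.ext (Prod.ext h1 h2)

variable (M)

/-- Reversal of oriented edges. -/
def τ : Equiv.Perm M.Dart where
  toFun d := ⟨(d.1.2, d.1.1), M.adj_symm d.2⟩
  invFun d := ⟨(d.1.2, d.1.1), M.adj_symm d.2⟩
  left_inv _ := rfl
  right_inv _ := rfl

/-- Rotation around the face on the left. -/
def φ : Equiv.Perm M.Dart where
  toFun d := ⟨(d.1.2, M.nx d.1.1 d.1.2), M.adj_nx' d.2⟩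
  invFun d := ⟨(M.nx d.1.1 d.1.2, d.1.1), M.adj_symm (adj_nx d.2)⟩
  left_inv d := Dart.ext (M.nx_nx d.2) rfl
  right_inv d := Dart.ext rfl (nx_nx_nx d.2)

variable {M}

@[simp] lemma τ_fst (d : M.Dart) : (τ M d).1.1 = d.1.2 := rfl
@[simp] lemma τ_snd (d : M.Dart) : (τ M d).1.2 = d.1.1 := rfl
@[simp] lemma φ_fst (d : M.Dart) : (φ M d).1.1 = d.1.2 := rfl
@[simp] lemma φ_snd (d : M.Dart) : (φ M d).1.2 = M.nx d.1.1 d.1.2 := rfl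

@[simp] lemma τ_τ (d : M.Dart) : τ M (τ M d) = d := rfl

@[simp] lemma φ_φ_φ (d : M.Dart) : φ M (φ M (φ M d)) = d :=
  Dart.ext (M.nx_nx d.2) (by
    simp only [φ_snd, φ_fst]; rw [M.nx_nx d.2]; exact nx_nx_nx d.2)

/-- The next oriented edge with the same origin. -/
lemma τ_φ_φ (d : M.Dart) : τ M (φ M (φ M d)) = ⟨(d.1.1, M.nx d.1.1 d.1.2), adj_nx d.2⟩ :=
  Dart.ext (M.nx_nx d.2) rfl

variable {G : Type*} [Group G] [MulAction G V] [M.Equivariant G]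

instance : MulAction G M.Dart where
  smul g d := ⟨(g • d.1.1, g • d.1.2), Equivariant.adj_smul g d.2⟩
  one_smul _ := Dart.ext (one_smul _ _) (one_smul _ _)
  mul_smul _ _ _ := Dart.ext (mul_smul _ _ _) (mul_smul _ _ _)

@[simp] lemma smul_fst (g : G) (d : M.Dart) : (g • d).1.1 = g • d.1.1 := rfl
@[simp] lemma smul_snd (g : G) (d : M.Dart) : (g • d).1.2 = g • d.1.2 := rfl

lemma τ_smul (g : G) (d : M.Dart) : τ M (g • d) = g • τ M d := rfl

lemma φ_smul (g : G) (d : M.Dart) : φ M (g • d) = g • φ M d :=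
  Dart.ext rfl (Equivariant.nx_smul g d.2)

lemma smul_eq {g : G} {d : M.Dart} (h : g • d = d) : g = 1 :=
  Equivariant.free (M := M) g d.1.1 (congrArg (fun d : M.Dart => d.1.1) h)

lemma smul_ne_τ (g : G) (d : M.Dart) : g • d ≠ τ M d := fun h =>
  Equivariant.free_edge (M := M) g d.2 (congrArg (fun d : M.Dart => d.1.1) h)
    (congrArg (fun d : M.Dart => d.1.2) h)

lemma smul_ne_φ (g : G) (d : M.Dart) : g • d ≠ φ M d := fun h => by
  have h1 := congrArg (fun d : M.Dart => d.1.1) h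
  have h2 := congrArg (fun d : M.Dart => d.1.2) h
  have h3 : g • φ M d = φ M (φ M d) := by rw [← φ_smul, h]
  have h4 := congrArg (fun d : M.Dart => d.1.2) h3
  simp only [smul_fst, φ_fst, smul_snd, φ_snd] at h1 h2 h4
  rw [M.nx_nx d.2] at h4
  exact Equivariant.free_face (M := M) g d.2 h1 h2 h4

lemma smul_ne_φ_φ (g : G) (d : M.Dart) : g • d ≠ φ M (φ M d) := fun h => by
  refine smul_ne_φ g⁻¹ d ?_
  have h3 : φ M (g • d) = d := by rw [h, φ_φ_φ]
  rw [φ_smul] at h3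
  rw [inv_smul_eq_iff, h3]

/-- One step in the dual graph, across the edges in `T`. -/
def Step (T : Set M.Dart) (d d' : M.Dart) : Prop := d' = φ M d ∨ (d ∈ T ∧ d' = τ M d)

/-- The connected components of the dual graph, with the edges in `T`. -/
def Rel (T : Set M.Dart) : M.Dart → M.Dart → Prop := Relation.EqvGen (Step T)

variable {T T' : Set M.Dart} {d d' d'' : M.Dart}

namespace Rel

lemma refl : Rel T d d := Relation.EqvGen.refl _
lemma symm (h : Rel T d d') : Rel T d' d := Relation.EqvGen.symm _ _ h
lemma trans (h : Rel T d d') (h' : Rel T d' d'') : Rel T d d'' := Relation.EqvGen.trans _ _ _ h h'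
lemma φ : Rel T d (φ M d) := .rel _ _ (.inl rfl)
lemma φ_φ : Rel T d (Dart.φ M (Dart.φ M d)) := Rel.φ.trans Rel.φ
lemma τ (h : d ∈ T) : Rel T d (τ M d) := .rel _ _ (.inr ⟨h, rfl⟩)

lemma smul (hT : ∀ (g : G), ∀ d ∈ T, g • d ∈ T) (g : G) (h : Rel T d d') :
    Rel T (g • d) (g • d') := by
  induction h with
  | rel x y h =>
    rcases h with rfl | ⟨h, rfl⟩
    · rw [← φ_smul]; exact Rel.φ
    · rw [← τ_smul]; exact Rel.τ (hT g _ h)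
  | refl => exact Rel.refl
  | symm _ _ _ ih => exact ih.symm
  | trans _ _ _ _ _ ih1 ih2 => exact ih1.trans ih2

/-- An invariant set is a union of components. -/
lemma mem_iff {A : Set M.Dart} (h1 : ∀ d, Dart.φ M d ∈ A ↔ d ∈ A)
    (h2 : ∀ d ∈ T, (Dart.τ M d ∈ A ↔ d ∈ A)) (h : Rel T d d') : d ∈ A ↔ d' ∈ A := by
  induction h with
  | rel x y h =>
    rcases h with rfl | ⟨h, rfl⟩
    · exact (h1 _).symm
    · exact (h2 _ h).symm
  | refl => rfl
  | symm _ _ _ ih => exact ih.symm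
  | trans _ _ _ _ _ ih1 ih2 => exact ih1.trans ih2

/-- To be related is to be related for a coarser relation. -/
lemma of_step {R : M.Dart → M.Dart → Prop} (hR : Equivalence R)
    (h1 : ∀ d, R d (Dart.φ M d)) (h2 : ∀ d ∈ T, R d (Dart.τ M d)) (h : Rel T d d') : R d d' := by
  induction h with
  | rel x y h =>
    rcases h with rfl | ⟨h, rfl⟩
    · exact h1 _
    · exact h2 _ h
  | refl => exact hR.refl _
  | symm _ _ _ ih => exact hR.symm ih
  | trans _ _ _ _ _ ih1 ih2 => exact hR.trans ih1 ih2

end Rel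

lemma rel_equivalence (T : Set M.Dart) : Equivalence (Rel T) :=
  ⟨fun _ => Rel.refl, Rel.symm, Rel.trans⟩

/-- No nontrivial element of the group preserves a component. -/
def HolFree (G : Type*) [Group G] [MulAction G V] [M.Equivariant G] (T : Set M.Dart) : Prop :=
  ∀ (d : M.Dart) (g : G), Rel T d (g • d) → g = 1

lemma holFree_empty : HolFree G (∅ : Set M.Dart) := by
  intro d g h
  have h1 : g • d = d ∨ g • d = φ M d ∨ g • d = φ M (φ M d) := by
    refine Rel.of_step (T := ∅) (R := fun a b => b = a ∨ b = φ M a ∨ b = φ M (φ M a))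
      ⟨fun _ => .inl rfl, ?_, ?_⟩ (fun _ => .inr (.inl rfl)) (fun _ h => h.elim) h
    · rintro a b (rfl | rfl | rfl) <;> simp
    · rintro a b c (rfl | rfl | rfl) (rfl | rfl | rfl) <;> simp
  rcases h1 with h1 | h1 | h1
  · exact smul_eq h1
  · exact absurd h1 (smul_ne_φ g d)
  · exact absurd h1 (smul_ne_φ_φ g d)

/-- Adding edges within components does not change the components. -/
lemma HolFree.union_of_rel (hT : HolFree G T) (hG : ∀ (g : G), ∀ d ∈ T, g • d ∈ T)
    (h : Rel T d (τ M d)) :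
    HolFree G (T ∪ {e | ∃ g : G, e = g • d ∨ e = g • τ M d}) := by
  intro e g he
  refine hT e g (Rel.of_step (rel_equivalence T) (fun _ => Rel.φ) ?_ he)
  rintro e' (h' | ⟨k, rfl | rfl⟩)
  · exact Rel.τ h'
  · exact h.smul hG k
  · exact (h.smul hG k).symm

/-- Adding an edge between components in distinct orbits. -/
lemma HolFree.union_of_not_rel (hT : HolFree G T) (hG : ∀ (g : G), ∀ d ∈ T, g • d ∈ T)
    (h : ∀ g : G, ¬ Rel T d (g • τ M d)) :
    HolFree G (T ∪ {e | ∃ g : G, e = g • d ∨ e = g • τ M d}) := by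
  have huniq : ∀ (e e' : M.Dart) (g k : G), Rel T e (g • e') → Rel T e (k • e') → g = k := by
    intro e e' g k h1 h2
    have h3 := (h1.symm.trans h2).smul hG g⁻¹
    rw [inv_smul_smul, ← mul_smul] at h3
    have := hT _ _ h3
    rwa [inv_mul_eq_one] at this
  have hno : ∀ (e : M.Dart) (g k : G), Rel T e (g • d) → Rel T e (k • τ M d) → False := by
    intro e g k h1 h2
    have h3 := (h1.symm.trans h2).smul hG g⁻¹
    rw [inv_smul_smul, ← mul_smul] at h3
    exact h _ h3
  let R : M.Dart → M.Dart → Prop := fun x y => Rel T x y ∨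
    ∃ g : G, (Rel T x (g • d) ∧ Rel T y (g • τ M d)) ∨ (Rel T x (g • τ M d) ∧ Rel T y (g • d))
  have hR : Equivalence R := by
    refine ⟨fun _ => .inl Rel.refl, ?_, ?_⟩
    · rintro x y (h1 | ⟨g, h1 | h1⟩)
      · exact .inl h1.symm
      · exact .inr ⟨g, .inr h1.symm⟩
      · exact .inr ⟨g, .inl h1.symm⟩
    · rintro x y z (h1 | ⟨g, h1 | h1⟩) (h2 | ⟨k, h2 | h2⟩)
      · exact .inl (h1.trans h2)
      · exact .inr ⟨k, .inl ⟨h1.trans h2.1, h2.2⟩⟩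
      · exact .inr ⟨k, .inr ⟨h1.trans h2.1, h2.2⟩⟩
      · exact .inr ⟨g, .inl ⟨h1.1, h2.symm.trans h1.2⟩⟩
      · exact (hno _ _ _ h2.1 h1.2).elim
      · obtain rfl := huniq _ _ _ _ h1.2 h2.1
        exact .inl (h1.1.trans h2.2.symm)
      · exact .inr ⟨g, .inr ⟨h1.1, h2.symm.trans h1.2⟩⟩
      · obtain rfl := huniq _ _ _ _ h1.2 h2.1
        exact .inl (h1.1.trans h2.2.symm)
      · exact (hno _ _ _ h1.2 h2.1).elim
  intro e g he
  have h1 : R e (g • e) := by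
    refine Rel.of_step hR (fun _ => .inl Rel.φ) ?_ he
    rintro e' (h' | ⟨k, rfl | rfl⟩)
    · exact .inl (Rel.τ h')
    · exact .inr ⟨k, .inl ⟨Rel.refl, Rel.refl⟩⟩
    · exact .inr ⟨k, .inr ⟨Rel.refl, Rel.refl⟩⟩
  rcases h1 with h1 | ⟨k, ⟨h1, h2⟩ | ⟨h1, h2⟩⟩
  · exact hT _ _ h1
  · have h3 := h1.smul hG g
    rw [← mul_smul] at h3
    exact (hno _ _ _ h3 h2).elim
  · have h3 := h1.smul hG g
    rw [← mul_smul] at h3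
    exact (hno _ _ _ h2 h3).elim

end Dart

end OSurf

namespace OSurf

variable {E V : Type*} [AddCommGroup E] [Module ℝ E] {M : OSurf E V}

/-- Turning around a vertex, one meets all its neighbours. -/
lemma nx_induction {v w : V} (hw : M.adj v w) {P : V → Prop} (h0 : P w)
    (h1 : ∀ u, M.adj v u → P u → P (M.nx v u)) : ∀ u, M.adj v u → P u := by
  obtain ⟨n, e, hn, -, he, hnx⟩ := M.link v
  have : NeZero n := ⟨by omega⟩
  obtain ⟨i, rfl⟩ := (he w).1 hw
  have hall : ∀ k : ℕ, P (e (i + k)) := by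
    intro k
    induction k with
    | zero => simpa using h0
    | succ k ih =>
      have := h1 _ ((he _).2 ⟨_, rfl⟩) ih
      rw [hnx] at this
      rwa [Nat.cast_succ, ← add_assoc]
  intro u hu
  obtain ⟨j, rfl⟩ := (he u).1 hu
  have := hall (j - i).val
  simpa using this

variable (M) (G : Type*) [Group G] [MulAction G V]

/-- Orbits of vertices. -/
def VQ (_ : OSurf E V) (G : Type*) [Group G] [MulAction G V] := MulAction.orbitRel.Quotient G V

/-- The orbit of a vertex. -/
def vq (v : V) : M.VQ G := Quotient.mk (MulAction.orbitRel G V) v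

variable {M G} in
lemma exists_vq (q : M.VQ G) : ∃ v, M.vq G v = q := Quotient.exists_rep q

variable {M G} in
lemma vq_eq {v w : V} : M.vq G v = M.vq G w ↔ ∃ g : G, g • w = v := by
  exact Quotient.eq (r := MulAction.orbitRel G V)

variable [M.Equivariant G]

/-- Orbits of oriented edges. -/
def DQ := MulAction.orbitRel.Quotient G M.Dart


/-- The orbit of an oriented edge. -/
def dq (d : M.Dart) : M.DQ G := Quotient.mk (MulAction.orbitRel G M.Dart) d

variable {M G}

lemma dq_eq {d d' : M.Dart} : M.dq G d = M.dq G d' ↔ ∃ g : G, g • d' = d := by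
  exact Quotient.eq (r := MulAction.orbitRel G M.Dart)

@[simp] lemma vq_smul (g : G) (v : V) : M.vq G (g • v) = M.vq G v := vq_eq.2 ⟨g, rfl⟩

@[simp] lemma dq_smul (g : G) (d : M.Dart) : M.dq G (g • d) = M.dq G d := dq_eq.2 ⟨g, rfl⟩


lemma exists_dq (q : M.DQ G) : ∃ d, M.dq G d = q := Quotient.exists_rep q

instance : Finite (M.VQ G) := Equivariant.finite M

instance : Finite (M.DQ G) := by
  choose r hr using exists_vq (M := M) (G := G)
  refine Finite.of_surjective (α := Σ q : M.VQ G, {u // u ∈ M.nbrs (r q)})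
    (fun p => M.dq G ⟨(r p.1, p.2.1), mem_nbrs M |>.1 p.2.2⟩) ?_
  intro q
  obtain ⟨d, rfl⟩ := exists_dq q
  obtain ⟨g, hg⟩ := vq_eq.1 (hr (M.vq G d.1.1))
  refine ⟨⟨M.vq G d.1.1, ⟨g • d.1.2, ?_⟩⟩, ?_⟩
  · rw [mem_nbrs, ← hg]; exact Equivariant.adj_smul g d.2
  · refine dq_eq.2 ⟨g, Dart.ext ?_ rfl⟩
    exact hg

noncomputable instance : Fintype (M.VQ G) := Fintype.ofFinite _

noncomputable instance : Fintype (M.DQ G) := Fintype.ofFinite _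

variable (M G)

/-- The permutation of orbits induced by an equivariant permutation. -/
def permQ (ψ : Equiv.Perm M.Dart) (h : ∀ (g : G) d, ψ (g • d) = g • ψ d) :
    Equiv.Perm (M.DQ G) where
  toFun := Quotient.map ψ (by rintro _ d ⟨g, rfl⟩; exact ⟨g, (h g d).symm⟩)
  invFun := Quotient.map ψ.symm (by
    rintro _ d ⟨g, rfl⟩
    refine ⟨g, ?_⟩
    change g • ψ.symm d = ψ.symm (g • d)
    rw [Equiv.eq_symm_apply, h, Equiv.apply_symm_apply])
  left_inv := by rintro ⟨d⟩; exact congrArg (Quotient.mk _) (ψ.symm_apply_apply d)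
  right_inv := by rintro ⟨d⟩; exact congrArg (Quotient.mk _) (ψ.apply_symm_apply d)

/-- Reversal of orbits of oriented edges. -/
def τq : Equiv.Perm (M.DQ G) := permQ M G (Dart.τ M) fun g d => Dart.τ_smul g d

/-- Rotation around faces, on orbits of oriented edges. -/
def φq : Equiv.Perm (M.DQ G) := permQ M G (Dart.φ M) fun g d => Dart.φ_smul g d

/-- The origin of an orbit of oriented edges. -/
def tailq : M.DQ G → M.VQ G := Quotient.map (fun d => d.1.1) (by
  rintro _ d ⟨g, rfl⟩; exact ⟨g, rfl⟩)

variable {M G}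

@[simp] lemma τq_dq (d : M.Dart) : τq M G (M.dq G d) = M.dq G (Dart.τ M d) := rfl
@[simp] lemma φq_dq (d : M.Dart) : φq M G (M.dq G d) = M.dq G (Dart.φ M d) := rfl
@[simp] lemma tailq_dq (d : M.Dart) : tailq M G (M.dq G d) = M.vq G d.1.1 := rfl

lemma τq_τq (q : M.DQ G) : τq M G (τq M G q) = q := by
  obtain ⟨d, rfl⟩ := exists_dq q; rfl

lemma τq_ne (q : M.DQ G) : τq M G q ≠ q := by
  obtain ⟨d, rfl⟩ := exists_dq q
  rw [τq_dq, Ne, dq_eq]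
  rintro ⟨g, hg⟩
  exact Dart.smul_ne_τ g d hg

lemma φq_φq_φq (q : M.DQ G) : φq M G (φq M G (φq M G q)) = q := by
  obtain ⟨d, rfl⟩ := exists_dq q
  simp

lemma φq_ne (q : M.DQ G) : φq M G q ≠ q := by
  obtain ⟨d, rfl⟩ := exists_dq q
  rw [φq_dq, Ne, dq_eq]
  rintro ⟨g, hg⟩
  exact Dart.smul_ne_φ g d hg

lemma dq_mem_image {A : Set M.Dart} (hA : ∀ (g : G), ∀ d ∈ A, g • d ∈ A) {d : M.Dart} :
    M.dq G d ∈ M.dq G '' A ↔ d ∈ A := by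
  refine ⟨?_, fun h => ⟨d, h, rfl⟩⟩
  rintro ⟨d', h, h'⟩
  obtain ⟨g, rfl⟩ := dq_eq.1 h'.symm
  exact hA g _ h

lemma vq_mem_image {A : Set V} (hA : ∀ (g : G), ∀ d ∈ A, g • d ∈ A) {d : V} :
    M.vq G d ∈ M.vq G '' A ↔ d ∈ A := by
  refine ⟨?_, fun h => ⟨d, h, rfl⟩⟩
  rintro ⟨d', h, h'⟩
  obtain ⟨g, rfl⟩ := vq_eq.1 h'.symm
  exact hA g _ h

open Classical in
lemma sum_fiber (f : M.DQ G → ℤ) {F : V → V → ℤ} (hf : ∀ d, f (M.dq G d) = F d.1.1 d.1.2)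
    (v : V) : ∑ q with tailq M G q = M.vq G v, f q = ∑ u ∈ M.nbrs v, F v u := by
  rw [← Finset.sum_attach (M.nbrs v)]
  symm
  refine Finset.sum_bij (fun u _ => M.dq G ⟨(v, u.1), (mem_nbrs M).1 u.2⟩) ?_ ?_ ?_ ?_
  · intro u _
    simp
  · intro u _ u' _ h
    obtain ⟨g, hg⟩ := dq_eq.1 h
    have h1 := congrArg (fun d : M.Dart => d.1.1) hg
    have h2 := congrArg (fun d : M.Dart => d.1.2) hg
    obtain rfl := Equivariant.free (M := M) g v h1
    rw [Dart.smul_snd, one_smul] at h2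
    exact Subtype.ext h2.symm
  · intro q hq
    obtain ⟨d, rfl⟩ := exists_dq q
    rw [Finset.mem_filter, tailq_dq] at hq
    obtain ⟨g, hg⟩ := vq_eq.1 hq.2.symm
    refine ⟨⟨g • d.1.2, ?_⟩, Finset.mem_attach _ _, dq_eq.2 ⟨g, Dart.ext hg rfl⟩⟩
    rw [mem_nbrs, ← hg]; exact Equivariant.adj_smul g d.2
  · intro u _
    rw [hf]

/-- Sums over the oriented edges, organized by origin. -/
lemma sum_dq_eq (f : M.DQ G → ℤ) {F : V → V → ℤ} (hf : ∀ d, f (M.dq G d) = F d.1.1 d.1.2)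
    (B : M.VQ G → ℤ) (hB : ∀ v, ∑ u ∈ M.nbrs v, F v u = B (M.vq G v)) :
    ∑ q, f q = ∑ v, B v := by
  classical
  rw [← Finset.sum_fiberwise Finset.univ (tailq M G)]
  refine Finset.sum_congr rfl fun q _ => ?_
  obtain ⟨v, rfl⟩ := exists_vq q
  rw [sum_fiber f hf v, hB]

lemma sum_dq_le (f : M.DQ G → ℤ) {F : V → V → ℤ} (hf : ∀ d, f (M.dq G d) = F d.1.1 d.1.2)
    (B : M.VQ G → ℤ) (hB : ∀ v, ∑ u ∈ M.nbrs v, F v u ≤ B (M.vq G v)) :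
    ∑ q, f q ≤ ∑ v, B v := by
  classical
  rw [← Finset.sum_fiberwise Finset.univ (tailq M G)]
  refine Finset.sum_le_sum fun q _ => ?_
  obtain ⟨v, rfl⟩ := exists_vq q
  rw [sum_fiber f hf v]
  exact hB v

/-- The oriented edges with both sides in `F`. -/
def inner (F : Set M.Dart) : Set M.Dart := {d | d ∈ F ∧ Dart.τ M d ∈ F}

lemma inner_τ {F : Set M.Dart} {d : M.Dart} (h : d ∈ inner F) : Dart.τ M d ∈ inner F :=
  ⟨h.2, h.1⟩

lemma inner_smul {F : Set M.Dart} (hF : ∀ (g : G), ∀ d ∈ F, g • d ∈ F) (g : G) {d : M.Dart}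
    (h : d ∈ inner F) : g • d ∈ inner F := ⟨hF g _ h.1, by rw [Dart.τ_smul]; exact hF g _ h.2⟩

lemma mem_inner_of_tail {F : Set M.Dart} (hφ : ∀ d ∈ F, Dart.φ M d ∈ F) {v : V}
    (hv : ∀ d : M.Dart, d.1.1 = v → d ∈ F) {d : M.Dart} (hd : d.1.1 = v) : d ∈ inner F := by
  refine ⟨hv d hd, ?_⟩
  have h1 := hφ _ (hφ _ (hv ⟨(d.1.1, M.nx d.1.2 d.1.1), adj_prev d.2⟩ hd))
  convert h1 using 1
  exact Dart.ext (nx_prev d.2).symm (M.nx_nx (adj_prev d.2)).symm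

/-- Dimension count for functions `f` on the vertices (pulled back from `ι` by `k`) whose
differential is supported in `T`. -/
lemma card_le_of_pullback {F T : Set M.Dart}
    (hTG : ∀ (g : G), ∀ d ∈ T, g • d ∈ T)
    (hφ : ∀ d ∈ F, Dart.φ M d ∈ F) (hTτ : ∀ d ∈ T, Dart.τ M d ∈ T)
    (htrans : ∀ d ∈ F, ∀ d' ∈ F, ∃ g : G, Dart.Rel T d (g • d'))
    {A : Set V} (hA : ∀ d : M.Dart, d.1.1 ∈ A → d ∈ F) (hAne : A ≠ Set.univ)
    {ι : Type*} [Fintype ι] (k : M.VQ G → Option ι) (hk : ∀ v, k (M.vq G v) ≠ none → v ∈ A)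
    (hks : ∀ i, ∃ v, k (M.vq G v) = some i)
    (hkT : ∀ d ∈ F, d ∉ T → k (M.vq G d.1.1) = k (M.vq G d.1.2)) :
    6 * Fintype.card ι + 2 * (M.dq G '' F).ncard ≤ 3 * (M.dq G '' T).ncard + 6 := by
  classical
  let ev : (ι → ℝ) → M.VQ G → ℝ := fun f v => (k v).elim 0 f
  let δ : (ι → ℝ) →ₗ[ℝ] (M.DQ G → ℝ) :=
    { toFun := fun f q => if q ∈ M.dq G '' T then ev f (tailq M G (τq M G q)) -
        ev f (tailq M G q) else 0
      map_add' := fun a b => by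
        have hev : ∀ v, ev (a + b) v = ev a v + ev b v := fun v => by
          simp only [ev]; cases k v <;> simp
        ext q; simp only [hev, Pi.add_apply]; split_ifs <;> ring
      map_smul' := fun c a => by
        have hev : ∀ v, ev (c • a) v = c * ev a v := fun v => by
          simp only [ev]; cases k v <;> simp
        ext q; simp only [hev, Pi.smul_apply, smul_eq_mul, RingHom.id_apply]; split_ifs <;> ring }
  have hδ : ∀ f, ∀ d ∈ F, δ f (M.dq G d) = ev f (M.vq G d.1.2) - ev f (M.vq G d.1.1) := by
    intro f d hd
    change (if M.dq G d ∈ M.dq G '' T then _ else _) = _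
    rw [dq_mem_image hTG]
    split_ifs with h
    · rfl
    · simp [ev, hkT d hd h]
  have hinj : Function.Injective δ := by
    rw [← LinearMap.ker_eq_bot, LinearMap.ker_eq_bot']
    intro f hf
    ext i
    by_contra hi
    obtain ⟨v, hv⟩ := hks i
    have hall := M.connected {v | ev f (M.vq G v) ≠ 0} ⟨v, by simpa [ev, hv] using hi⟩ (by
      intro v hv w hvw
      have hvA : v ∈ A := hk v fun h => hv (by simp [ev, h])
      have h1 := hδ f ⟨(v, w), hvw⟩ (hA _ hvA)
      rw [hf] at h1
      simp only [Pi.zero_apply] at h1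
      change ev f (M.vq G w) ≠ 0
      have h2 : ev f (M.vq G w) = ev f (M.vq G v) := by linarith
      rwa [h2])
    apply hAne
    rw [Set.eq_univ_iff_forall] at hall ⊢
    exact fun v => hk v fun h => hall v (by simp [ev, h])
  have hmain := finrank_closed_forms_le (τ := τq M G) (φ := φq M G) (T := M.dq G '' T)
    (F := M.dq G '' F) τq_τq τq_ne φq_φq_φq φq_ne
    (by rintro _ ⟨d, hd, rfl⟩; exact ⟨_, hTτ d hd, rfl⟩)
    (by rintro _ ⟨d, hd, rfl⟩; exact ⟨_, hφ d hd, rfl⟩) (by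
      rintro b hb1 hb2 _ ⟨d, hd, rfl⟩ _ ⟨d', hd', rfl⟩
      obtain ⟨g, hg⟩ := htrans d hd d' hd'
      have h1 := Dart.Rel.of_step (R := fun x y => b (M.dq G x) = b (M.dq G y))
        ⟨fun _ => rfl, fun h => h.symm, fun h h' => h.trans h'⟩
        (fun d => by rw [← φq_dq, hb1]) (fun d hd => by rw [← τq_dq, hb2 _ ⟨d, hd, rfl⟩]) hg
      simpa using h1) (LinearMap.range δ) (by
      rintro _ ⟨f, rfl⟩
      refine ⟨fun q => ?_, fun q hq => if_neg hq, ?_⟩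
      · change (if τq M G q ∈ M.dq G '' T then _ else (0 : ℝ)) =
          -(if q ∈ M.dq G '' T then _ else (0 : ℝ))
        have h1 : τq M G q ∈ M.dq G '' T ↔ q ∈ M.dq G '' T := by
          obtain ⟨d, rfl⟩ := exists_dq q
          rw [τq_dq, dq_mem_image hTG, dq_mem_image hTG]
          exact ⟨fun h => by simpa using hTτ _ h, hTτ d⟩
        rw [h1, τq_τq]
        split_ifs <;> ring
      · rintro _ ⟨d, hd, rfl⟩
        rw [φq_dq, φq_dq, hδ f _ hd, hδ f _ (hφ _ hd), hδ f _ (hφ _ (hφ _ hd))]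
        simp only [Dart.φ_fst, Dart.φ_snd, M.nx_nx d.2]
        ring)
  rwa [LinearMap.finrank_range_of_inj hinj, Module.finrank_fintype_fun_eq_card] at hmain

end OSurf

namespace OSurf

variable {E V : Type*} [AddCommGroup E] [Module ℝ E] {M : OSurf E V}
variable {G : Type*} [Group G] [MulAction G V] [M.Equivariant G]

/-- Turning around `v` without crossing the edge `d`, one joins both sides of `d`. -/
lemma rel_τ_of_forall {T : Set M.Dart} {d : M.Dart}
    (h : ∀ d' : M.Dart, d'.1.1 = d.1.1 → d' ≠ d → d' ∈ T) : Dart.Rel T d (Dart.τ M d) := by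
  have key : ∀ u (hu : M.adj d.1.1 u), Dart.Rel T d ⟨(d.1.1, u), hu⟩ := by
    intro u hu
    refine nx_induction (P := fun u => ∀ hu : M.adj d.1.1 u, Dart.Rel T d ⟨(d.1.1, u), hu⟩) d.2
      (fun _ => Dart.Rel.refl) (fun u hu ih hu' => ?_) u hu hu
    by_cases hne : (⟨(d.1.1, M.nx d.1.1 u), hu'⟩ : M.Dart) = d
    · rw [hne]; exact Dart.Rel.refl
    · have h1 := Dart.Rel.τ (h ⟨(d.1.1, M.nx d.1.1 u), hu'⟩ rfl hne)
      have h2 : Dart.Rel T ⟨(d.1.1, u), hu⟩ (Dart.τ M ⟨(d.1.1, M.nx d.1.1 u), hu'⟩) := by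
        rw [← Dart.τ_φ_φ ⟨(d.1.1, u), hu⟩]
        exact Dart.Rel.φ_φ
      exact ((ih hu).trans h2).trans h1.symm
  have h1 := (key _ (adj_prev d.2)).trans Dart.Rel.φ_φ
  convert h1 using 1
  exact Dart.ext (nx_prev d.2).symm (M.nx_nx (adj_prev d.2)).symm

/-- A maximal invariant set of edges of the dual graph such that no component has holonomy. -/
lemma exists_maximal_holFree {F : Set M.Dart} (hFG : ∀ (g : G), ∀ d ∈ F, g • d ∈ F) :
    ∃ T : Set M.Dart, T ⊆ inner F ∧ (∀ (g : G), ∀ d ∈ T, g • d ∈ T) ∧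
      (∀ d ∈ T, Dart.τ M d ∈ T) ∧ Dart.HolFree G T ∧
      ∀ d ∈ inner F, Dart.HolFree G (T ∪ {e | ∃ g : G, e = g • d ∨ e = g • Dart.τ M d}) →
        d ∈ T := by
  let P : Set (Set (M.DQ G)) := {Tq | (∀ q ∈ Tq, τq M G q ∈ Tq) ∧ M.dq G ⁻¹' Tq ⊆ inner F ∧
    Dart.HolFree G (M.dq G ⁻¹' Tq)}
  obtain ⟨Tq, hmax⟩ := (Set.toFinite P).exists_maximal ⟨∅, by
    refine ⟨by simp, by simp, ?_⟩
    rw [Set.preimage_empty]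
    exact Dart.holFree_empty⟩
  refine ⟨M.dq G ⁻¹' Tq, hmax.prop.2.1, fun g d hd => by simpa using hd,
    fun d hd => hmax.prop.1 _ hd, hmax.prop.2.2, fun d hd hol => ?_⟩
  have heq : M.dq G ⁻¹' (Tq ∪ {M.dq G d, M.dq G (Dart.τ M d)}) =
      M.dq G ⁻¹' Tq ∪ {e | ∃ g : G, e = g • d ∨ e = g • Dart.τ M d} := by
    ext e
    simp only [Set.mem_preimage, Set.mem_union, Set.mem_insert_iff, Set.mem_singleton_iff,
      Set.mem_ofPred_eq, dq_eq, exists_or]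
    simp only [eq_comm (a := e)]
  have hmem : Tq ∪ {M.dq G d, M.dq G (Dart.τ M d)} ∈ P := by
    refine ⟨?_, ?_, ?_⟩
    · rintro q (hq | rfl | rfl)
      · exact .inl (hmax.prop.1 _ hq)
      · exact .inr (.inr rfl)
      · exact .inr (.inl rfl)
    · rw [heq]
      rintro e (he | ⟨g, rfl | rfl⟩)
      · exact hmax.prop.2.1 he
      · exact inner_smul hFG g hd
      · exact inner_smul hFG g (inner_τ hd)
    · rwa [heq]
  exact hmax.le_of_ge hmem Set.subset_union_left (.inr (.inl rfl))

/-- The Euler characteristic inequality for a surface formed by the triangles of `F` (which, up to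
the group, form a connected set), with vertices `A`: if a triangulated surface with boundary is
not the quotient of a disk, then its Euler characteristic is nonpositive. -/
theorem euler_le {F : Set M.Dart} (hFG : ∀ (g : G), ∀ d ∈ F, g • d ∈ F)
    (hφ : ∀ d ∈ F, Dart.φ M d ∈ F)
    (htrans : ∀ d ∈ F, ∀ d' ∈ F, ∃ g : G, Dart.Rel (inner F) d (g • d'))
    {A : Set V} (hAG : ∀ (g : G), ∀ v ∈ A, g • v ∈ A) (hA : ∀ d : M.Dart, d.1.1 ∈ A → d ∈ F)
    (hAne : A ≠ Set.univ) :
    6 * (M.vq G '' A).ncard + 2 * (M.dq G '' F).ncard ≤ 3 * (M.dq G '' inner F).ncard ∨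
    (6 * (M.vq G '' A).ncard + 2 * (M.dq G '' F).ncard ≤ 3 * (M.dq G '' inner F).ncard + 6 ∧
      Dart.HolFree G (inner F)) := by
  classical
  obtain ⟨T, hTF, hTG, hTτ, hol, hmax⟩ := exists_maximal_holFree (G := G) hFG
  have c1 : ∀ d ∈ inner F, ∃ g : G, Dart.Rel T d (g • Dart.τ M d) := by
    intro d hd
    by_contra hcon
    push Not at hcon
    have := hmax d hd (hol.union_of_not_rel hTG hcon)
    exact hcon 1 (by rw [one_smul]; exact Dart.Rel.τ this)
  have c2 : ∀ d ∈ F, ∀ d' ∈ F, ∃ g : G, Dart.Rel T d (g • d') := by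
    intro d hd d' hd'
    obtain ⟨g, hg⟩ := htrans d hd d' hd'
    obtain ⟨k, hk⟩ := Dart.Rel.of_step (R := fun x y => ∃ g : G, Dart.Rel T x (g • y))
      ⟨fun _ => ⟨1, by rw [one_smul]; exact Dart.Rel.refl⟩, fun ⟨k, hk⟩ => ⟨k⁻¹, by
        have := (hk.smul hTG k⁻¹).symm
        rwa [inv_smul_smul] at this⟩, fun ⟨k, hk⟩ ⟨l, hl⟩ => ⟨k * l, by
        rw [mul_smul]; exact hk.trans (hl.smul hTG k)⟩⟩
      (fun d => ⟨1, by rw [one_smul]; exact Dart.Rel.φ⟩) c1 hg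
    exact ⟨k * g, by rwa [mul_smul]⟩
  have hAin : ∀ d : M.Dart, d.1.1 ∈ A → d ∈ inner F := fun d hd =>
    mem_inner_of_tail (v := d.1.1) hφ (fun d' hd' => hA d' (hd' ▸ hd)) rfl
  have hAq : ∀ v, M.vq G v ∈ M.vq G '' A ↔ v ∈ A := fun v => vq_mem_image hAG
  by_cases hTe : T = inner F
  · right
    rw [hTe] at hTG hTτ c2 hol
    refine ⟨?_, hol⟩
    have := card_le_of_pullback hTG hφ hTτ c2 hA hAne (ι := (M.vq G '' A : Set (M.VQ G)))
      (fun q => if h : q ∈ M.vq G '' A then some ⟨q, h⟩ else none)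
      (fun v hv => by
        by_contra h
        rw [← hAq] at h
        simp [h] at hv)
      (by rintro ⟨_, v, hv, rfl⟩; exact ⟨v, dif_pos ⟨v, hv, rfl⟩⟩)
      (fun d hd hdT => by
        have h1 : d.1.1 ∉ A := fun h => hdT (hAin _ h)
        have h2 : d.1.2 ∉ A := fun h => hdT (by simpa using inner_τ (hAin (Dart.τ M d) h))
        rw [← hAq] at h1 h2
        rw [dif_neg h1, dif_neg h2])
    rwa [← Nat.card_eq_fintype_card, Nat.card_coe_set_eq] at this
  left
  let Aa : Set V := {v | v ∈ A ∧ ∀ d : M.Dart, d.1.1 = v → d ∈ T}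
  let Ab : Set V := {v | v ∈ A ∧ ¬ ∀ d : M.Dart, d.1.1 = v → d ∈ T}
  have hAaG : ∀ (g : G), ∀ v ∈ Aa, g • v ∈ Aa := by
    rintro g v ⟨h1, h2⟩
    refine ⟨hAG g v h1, fun d hd => ?_⟩
    have := hTG g _ (h2 (g⁻¹ • d) (by rw [Dart.smul_fst, hd, inv_smul_smul]))
    rwa [smul_inv_smul] at this
  have hAbG : ∀ (g : G), ∀ v ∈ Ab, g • v ∈ Ab := by
    rintro g v ⟨h1, h2⟩
    refine ⟨hAG g v h1, fun h3 => h2 fun d hd => ?_⟩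
    have := hTG g⁻¹ _ (h3 (g • d) (by rw [Dart.smul_fst, hd]))
    rwa [inv_smul_smul] at this
  have hAaq : ∀ v, M.vq G v ∈ M.vq G '' Aa ↔ v ∈ Aa := fun v => vq_mem_image hAaG
  have hAbq : ∀ v, M.vq G v ∈ M.vq G '' Ab ↔ v ∈ Ab := fun v => vq_mem_image hAbG
  have hsplit : (M.vq G '' A).ncard = (M.vq G '' Aa).ncard + (M.vq G '' Ab).ncard := by
    rw [← Set.ncard_union_eq]
    · congr 1
      ext q
      obtain ⟨v, rfl⟩ := exists_vq q
      rw [Set.mem_union, hAq, hAaq, hAbq]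
      simp only [Aa, Ab, Set.mem_ofPred_eq]; tauto
    · rw [Set.disjoint_left]
      intro q
      obtain ⟨v, rfl⟩ := exists_vq q
      rw [hAaq, hAbq]
      exact fun h h' => h'.2 h.2
  set H : Finset (M.DQ G) := Finset.univ.filter fun q =>
    q ∈ M.dq G '' inner F ∧ q ∉ M.dq G '' T with hH
  have hHmem : ∀ d, M.dq G d ∈ H ↔ d ∈ inner F ∧ d ∉ T := by
    intro d
    rw [hH, Finset.mem_filter, dq_mem_image hTG, dq_mem_image (fun g d => inner_smul hFG g)]
    simp
  have hHcard : (M.dq G '' inner F).ncard = H.card + (M.dq G '' T).ncard := by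
    rw [← Set.ncard_coe_finset, ← Set.ncard_union_eq]
    · congr 1
      ext q
      obtain ⟨d, rfl⟩ := exists_dq q
      rw [Set.mem_union, Finset.mem_coe, hHmem, dq_mem_image hTG,
        dq_mem_image (fun g d => inner_smul hFG g)]
      have := @hTF d
      tauto
    · rw [Set.disjoint_left]
      intro q
      obtain ⟨d, rfl⟩ := exists_dq q
      rw [Finset.mem_coe, hHmem, dq_mem_image hTG]
      tauto
  have hHeven : ∃ m, H.card = 2 * m := by
    have := finrank_antiSubmodule (τ := τq M G) τq_τq τq_ne (T := (H : Set (M.DQ G))) (by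
      intro q hq
      obtain ⟨d, rfl⟩ := exists_dq q
      rw [τq_dq]
      rw [Finset.mem_coe, hHmem] at hq ⊢
      exact ⟨inner_τ hq.1, fun h => hq.2 (by simpa using hTτ _ h)⟩)
    rw [Set.ncard_coe_finset] at this
    exact ⟨_, this.symm⟩
  have hfib : ∀ v ∈ Ab, 2 ≤ (H.filter fun q => tailq M G q = M.vq G v).card := by
    rintro v ⟨hvA, hv⟩
    push Not at hv
    obtain ⟨d, hdv, hdT⟩ := hv
    have hdin : d ∈ inner F := hAin d (hdv ▸ hvA)
    obtain ⟨d', hd'v, hdd', hd'T⟩ : ∃ d' : M.Dart, d'.1.1 = d.1.1 ∧ d' ≠ d ∧ d' ∉ T := by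
      by_contra hcon
      push Not at hcon
      exact hdT (hmax d hdin (hol.union_of_rel hTG (rel_τ_of_forall hcon)))
    have hd'in : d' ∈ inner F := hAin d' (by rw [hd'v, hdv]; exact hvA)
    refine Finset.one_lt_card.2 ⟨M.dq G d, ?_, M.dq G d', ?_, ?_⟩
    · rw [Finset.mem_filter, hHmem, tailq_dq, hdv]; exact ⟨⟨hdin, hdT⟩, rfl⟩
    · rw [Finset.mem_filter, hHmem, tailq_dq, hd'v, hdv]; exact ⟨⟨hd'in, hd'T⟩, rfl⟩
    · rw [Ne, dq_eq]
      rintro ⟨g, hg⟩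
      have h1 := congrArg (fun d : M.Dart => d.1.1) hg
      simp only [Dart.smul_fst, hd'v] at h1
      obtain rfl := Equivariant.free (M := M) g _ h1
      rw [one_smul] at hg
      exact hdd' hg
  have hle : 2 * (M.vq G '' Ab).ncard ≤
      (H.filter fun q => tailq M G q ∈ M.vq G '' Ab).card := by
    have h1 : (M.vq G '' Ab).ncard = (Finset.univ.filter (· ∈ M.vq G '' Ab)).card := by
      rw [← Set.ncard_coe_finset]; congr 1; ext; simp
    rw [h1, Finset.card_eq_sum_card_fiberwise (f := tailq M G)
      (t := Finset.univ.filter (· ∈ M.vq G '' Ab)) (fun q hq => by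
        simpa using (Finset.mem_filter.1 hq).2), mul_comm, ← smul_eq_mul]
    refine Finset.card_nsmul_le_sum _ _ _ fun q hq => ?_
    obtain ⟨v, rfl⟩ := exists_vq q
    have hv := (Finset.mem_filter.1 hq).2
    refine (hfib v ((hAbq v).1 hv)).trans (Finset.card_le_card fun q hq => ?_)
    rw [Finset.mem_filter] at hq
    rw [Finset.mem_filter, Finset.mem_filter]
    exact ⟨⟨hq.1, hq.2 ▸ hv⟩, hq.2⟩
  have hle' := Finset.card_filter_le H (fun q => tailq M G q ∈ M.vq G '' Ab)
  have hAaT : ∀ d : M.Dart, d ∉ T → d.1.1 ∉ Aa := fun d hd h => hd (h.2 d rfl)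
  have hτT : ∀ d : M.Dart, d ∉ T → Dart.τ M d ∉ T := fun d hd h => hd (by simpa using hTτ _ h)
  by_cases heq : (H.filter fun q => tailq M G q ∈ M.vq G '' Ab).card = H.card
  · have hall := Finset.card_filter_eq_iff.1 heq
    have hAbT : ∀ d : M.Dart, d ∈ inner F → d ∉ T → d.1.1 ∈ Ab := fun d h1 h2 =>
      (hAbq _).1 (hall _ ((hHmem d).2 ⟨h1, h2⟩))
    have := card_le_of_pullback hTG hφ hTτ c2 hA hAne
      (ι := Option (M.vq G '' Aa : Set (M.VQ G)))
      (fun q => if h : q ∈ M.vq G '' Aa then some (some ⟨q, h⟩) else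
        if q ∈ M.vq G '' Ab then some none else none)
      (fun v hv => by
        by_contra h
        have h1 : v ∉ Aa := fun h' => h h'.1
        have h2 : v ∉ Ab := fun h' => h h'.1
        rw [← hAaq] at h1
        rw [← hAbq] at h2
        simp [h1, h2] at hv)
      (by
        rintro (_ | ⟨_, v, hv, rfl⟩)
        · obtain ⟨d, hd1, hd2⟩ : ∃ d, d ∈ inner F ∧ d ∉ T := by
            by_contra hcon
            push Not at hcon
            exact hTe (Set.Subset.antisymm hTF hcon)
          have h1 := hAbT d hd1 hd2
          have h2 := hAaT d hd2
          rw [← hAaq] at h2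
          rw [← hAbq] at h1
          exact ⟨d.1.1, by rw [dif_neg h2, if_pos h1]⟩
        · exact ⟨v, dif_pos ⟨v, hv, rfl⟩⟩)
      (fun d hd hdT => by
        have h1 := hAaT d hdT
        have h2 := hAaT _ (hτT d hdT)
        rw [Dart.τ_fst] at h2
        rw [← hAaq] at h1 h2
        rw [dif_neg h1, dif_neg h2]
        by_cases hin : d ∈ inner F
        · have h3 := hAbT d hin hdT
          have h4 := hAbT _ (inner_τ hin) (hτT d hdT)
          rw [Dart.τ_fst] at h4
          rw [← hAbq] at h3 h4
          rw [if_pos h3, if_pos h4]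
        · have h3 : d.1.1 ∉ Ab := fun h => hin (hAin _ h.1)
          have h4 : d.1.2 ∉ Ab := fun h => hin (by simpa using inner_τ (hAin (Dart.τ M d) h.1))
          rw [← hAbq] at h3 h4
          rw [if_neg h3, if_neg h4])
    rw [Fintype.card_option, ← Nat.card_eq_fintype_card, Nat.card_coe_set_eq] at this
    omega
  · have := card_le_of_pullback hTG hφ hTτ c2 hA hAne
      (ι := (M.vq G '' Aa : Set (M.VQ G)))
      (fun q => if h : q ∈ M.vq G '' Aa then some ⟨q, h⟩ else none)
      (fun v hv => by
        by_contra h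
        have h1 : v ∉ Aa := fun h' => h h'.1
        rw [← hAaq] at h1
        simp [h1] at hv)
      (by rintro ⟨_, v, hv, rfl⟩; exact ⟨v, dif_pos ⟨v, hv, rfl⟩⟩)
      (fun d hd hdT => by
        have h1 := hAaT d hdT
        have h2 := hAaT _ (hτT d hdT)
        rw [Dart.τ_fst] at h2
        rw [← hAaq] at h1 h2
        rw [dif_neg h1, dif_neg h2])
    rw [← Nat.card_eq_fintype_card, Nat.card_coe_set_eq] at this
    omega

end OSurf

namespace OSurf

variable {E V : Type*} [AddCommGroup E] [Module ℝ E] (M : OSurf E V)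

/-- A first-order flex of the surface: the velocity of a vertex `v` is described by the functional
`Z v`. -/
structure IsFlex (Z : V → Dual ℝ E) : Prop where
  self : ∀ v, Z v (M.x v) = 0
  anti : ∀ {v w}, M.adj v w → Z v (M.x w) = -Z w (M.x v)

/-- Invariance of a flex under a group. -/
def IsInv (G : Type*) [Group G] [MulAction G V] (Z : V → Dual ℝ E) : Prop :=
  (∀ (g : G) {v w}, M.adj v w → Z (g • v) (M.x (g • w)) = Z v (M.x w)) ∧
    ∀ (g : G) v, Z (g • v) = 0 ↔ Z v = 0

/-- The flex is trivial along the sides of the triangle on the left of `vw`. -/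
def ZeroTri (Z : V → Dual ℝ E) (v w : V) : Prop :=
  Z v (M.x w) = 0 ∧ Z w (M.x (M.nx v w)) = 0 ∧ Z v (M.x (M.nx v w)) = 0

/-- The triangles on which the flex is not trivial. -/
def nz (Z : V → Dual ℝ E) : Set M.Dart := {d | ¬ M.ZeroTri Z d.1.1 d.1.2}

variable {M} {Z : V → Dual ℝ E}

namespace IsFlex

lemma zeroTri_cyc (hZ : M.IsFlex Z) {v w : V} (h : M.adj v w) :
    M.ZeroTri Z w (M.nx v w) ↔ M.ZeroTri Z v w := by
  unfold ZeroTri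
  rw [M.nx_nx h, hZ.anti (M.adj_symm h), hZ.anti (M.adj_symm (adj_nx h))]
  simp only [neg_eq_zero]
  tauto

lemma zeroTri_prev (hZ : M.IsFlex Z) {v w : V} (h : M.adj v w) :
    M.ZeroTri Z v (M.nx w v) ↔ M.ZeroTri Z w v := hZ.zeroTri_cyc (M.adj_symm h)

lemma nz_φ (hZ : M.IsFlex Z) {d : M.Dart} : Dart.φ M d ∈ M.nz Z ↔ d ∈ M.nz Z :=
  not_congr (hZ.zeroTri_cyc d.2)

lemma nz_of_φ (hZ : M.IsFlex Z) : ∀ d ∈ M.nz Z, Dart.φ M d ∈ M.nz Z := fun _ h => hZ.nz_φ.2 h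

/-- Each triangle on which the flex is not trivial carries at least two half-variations. -/
lemma two_le_sum_corner (hZ : M.IsFlex Z) {v w : V} (h : M.adj v w) (hz : ¬ M.ZeroTri Z v w) :
    2 ≤ M.corner (Z v) v w + M.corner (Z w) w (M.nx v w) + M.corner (Z (M.nx v w)) (M.nx v w) v := by
  have key : ∀ a b c : ℝ, ¬ (a = 0 ∧ b = 0 ∧ c = 0) →
      2 ≤ (|(SignType.sign a : ℤ) - SignType.sign c| : ℤ) +
        |(SignType.sign b : ℤ) - SignType.sign (-a)| +
        |(SignType.sign (-c) : ℤ) - SignType.sign (-b)| := by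
    intro a b c hne
    rcases lt_trichotomy a 0 with h1 | rfl | h1 <;> rcases lt_trichotomy b 0 with h2 | rfl | h2 <;>
    rcases lt_trichotomy c 0 with h3 | rfl | h3 <;> simp_all
  have h1 := key (Z v (M.x w)) (Z w (M.x (M.nx v w))) (Z v (M.x (M.nx v w))) hz
  unfold corner
  rw [M.nx_nx h, prev_nx h, hZ.anti (M.adj_symm h), hZ.anti (M.adj_symm (adj_nx h)),
    hZ.anti (M.adj_symm (M.adj_nx' h))]
  exact h1

variable [FiniteDimensional ℝ E] (hE : finrank ℝ E = 4)
include hE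

/-- At a vertex with nonzero velocity, triviality propagates to coplanar triangles. -/
lemma zeroTri_next (hZ : M.IsFlex Z) {v u : V} (hv : Z v ≠ 0) (hu : M.adj v u)
    (hz : M.ZeroTri Z v u) (h0 : Z v (M.x (M.nx v (M.nx v u))) = 0) :
    M.ZeroTri Z v (M.nx v u) := by
  obtain ⟨h1, h2, h3⟩ := hz
  have hu' := adj_nx hu
  refine ⟨h3, ?_, h0⟩
  obtain ⟨α, β, γ, δ, heq, hne⟩ := exists_relation_four hE hv h1 h3 h0 (hZ.self v)
  have hγ : γ ≠ 0 := by
    rintro rfl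
    have hi := Fintype.linearIndependent_iff.1 (M.indep hu) ![δ, α, β]
      (by simp only [Fin.sum_univ_three]; rw [← heq]; simp; abel)
    exact hne ⟨hi 1, hi 2, rfl, hi 0⟩
  have h4 := congrArg (Z (M.nx v u)) heq
  simp only [map_add, map_smul, smul_eq_mul, map_zero, hZ.self] at h4
  rw [hZ.anti (M.adj_symm (M.adj_nx' hu)), hZ.anti (M.adj_symm hu'), h2, h3] at h4
  simpa [hγ] using h4

lemma zeroTri_prev' (hZ : M.IsFlex Z) {v u : V} (hv : Z v ≠ 0) (hu : M.adj v u)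
    (hz : M.ZeroTri Z v (M.nx v u)) (h0 : Z v (M.x u) = 0) : M.ZeroTri Z v u := by
  have hu' := adj_nx hu
  obtain ⟨h1, h2, h3⟩ := hz
  refine ⟨h0, ?_, h1⟩
  obtain ⟨α, β, γ, δ, heq, hne⟩ := exists_relation_four hE hv h1 h3 h0 (hZ.self v)
  have hγ : γ ≠ 0 := by
    rintro rfl
    have hi := Fintype.linearIndependent_iff.1 (M.indep hu') ![δ, α, β]
      (by simp only [Fin.sum_univ_three]; rw [← heq]; simp; abel)
    exact hne ⟨hi 1, hi 2, rfl, hi 0⟩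
  have h4 := congrArg (Z (M.nx v u)) heq
  simp only [map_add, map_smul, smul_eq_mul, map_zero, hZ.self] at h4
  rw [hZ.anti (M.adj_symm hu'), h1, h2] at h4
  rw [hZ.anti (M.adj_nx' hu)]
  simpa [hγ] using h4

/-- At a vertex with nonzero velocity which belongs to a trivial triangle, all triangles in the
kernel of the velocity are trivial. -/
lemma zeroTri_of_zero (hZ : M.IsFlex Z) {v u : V} (hv : Z v ≠ 0) (hu : M.adj v u)
    (hz : M.ZeroTri Z v u) {u' : V} (hu' : M.adj v u') (h0 : Z v (M.x u') = 0)
    (h1 : Z v (M.x (M.nx v u')) = 0) : M.ZeroTri Z v u' := by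
  obtain ⟨q', q, hr⟩ := exists_isZeroRun hE hv (hZ.self v) hu hz.1 hz.2.2
  obtain ⟨t, ht, ht0⟩ := exists_adj_ne_zero hE hv (hZ.self v)
  have hgood : ∃ a, M.adj v a ∧ M.ZeroTri Z v a ∧ M.nx v a = q := by
    by_contra hcon
    push Not at hcon
    refine ht0 (nx_induction hu hz (fun a ha hza => ?_) t ht).1
    refine hZ.zeroTri_next hE hv ha hza ?_
    by_contra h
    exact hcon a ha hza ((hr.last _ (adj_nx ha)).1 ⟨hza.2.2, h⟩)
  by_contra hbad
  have hbad' : ∃ a, M.adj v a ∧ (Z v (M.x a) = 0 ∧ ¬ M.ZeroTri Z v a) ∧ M.nx v a = q := by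
    by_contra hcon
    push Not at hcon
    have h2 := nx_induction (P := fun a => Z v (M.x a) = 0 ∧ Z v (M.x (M.nx v a)) = 0 ∧
      ¬ M.ZeroTri Z v a) hu' ⟨h0, h1, hbad⟩ (fun a ha ⟨ha0, ha1, hza⟩ => ?_) t ht
    · exact ht0 h2.1
    · refine ⟨ha1, ?_, fun h => hza (hZ.zeroTri_prev' hE hv ha h ha0)⟩
      by_contra h
      exact hcon a ha ⟨ha0, hza⟩ ((hr.last _ (adj_nx ha)).1 ⟨ha1, h⟩)
  obtain ⟨a, ha, hza, haq⟩ := hgood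
  obtain ⟨b, hb, ⟨-, hzb⟩, hbq⟩ := hbad'
  rw [nx_inj ha hb (haq.trans hbq.symm)] at hza
  exact hzb hza

omit [FiniteDimensional ℝ E] hE in
lemma mem_nz_τ (hZ : M.IsFlex Z) {v u : V} (h : M.adj v u) :
    (Dart.τ M ⟨(v, u), h⟩ ∈ M.nz Z) ↔ ¬ M.ZeroTri Z v (M.nx u v) :=
  not_congr (hZ.zeroTri_prev h).symm

/-- At a vertex with nonzero velocity which belongs to a trivial triangle, there are exactly two
edges between a trivial and a nontrivial triangle. -/
lemma exists_boundary (hZ : M.IsFlex Z) {v u : V} (hv : Z v ≠ 0) (hu : M.adj v u)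
    (hz : M.ZeroTri Z v u) : ∃ q' q, M.IsZeroRun (Z v) v q' q ∧
      (∀ a, M.adj v a → ((M.ZeroTri Z v a ∧ ¬ M.ZeroTri Z v (M.nx a v)) ↔ a = q')) ∧
      ∀ a, M.adj v a → ((¬ M.ZeroTri Z v a ∧ M.ZeroTri Z v (M.nx a v)) ↔ a = q) := by
  obtain ⟨q', q, hr⟩ := exists_isZeroRun hE hv (hZ.self v) hu hz.1 hz.2.2
  have hiff : ∀ a, M.adj v a →
      (M.ZeroTri Z v a ↔ Z v (M.x a) = 0 ∧ Z v (M.x (M.nx v a)) = 0) := fun a ha =>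
    ⟨fun h => ⟨h.1, h.2.2⟩, fun h => hZ.zeroTri_of_zero hE hv hu hz ha h.1 h.2⟩
  refine ⟨q', q, hr, fun a ha => ?_, fun a ha => ?_⟩
  · rw [hiff a ha, hiff _ (adj_prev ha), nx_prev ha, ← hr.first a ha]
    constructor
    · rintro ⟨h1, h2⟩; exact ⟨h1.1, fun h => h2 ⟨h, h1.1⟩⟩
    · rintro ⟨h1, h2⟩
      have := (hr.first a ha).1 ⟨h1, h2⟩
      subst this
      exact ⟨⟨h1, hr.first_next⟩, fun h => h2 h.1⟩
  · rw [hiff a ha, hiff _ (adj_prev ha), nx_prev ha, ← hr.last a ha]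
    constructor
    · rintro ⟨h1, h2⟩; exact ⟨h2.2, fun h => h1 ⟨h2.2, h⟩⟩
    · rintro ⟨h1, h2⟩
      have := (hr.last a ha).1 ⟨h1, h2⟩
      subst this
      exact ⟨fun h => h2 h.2, hr.last_prev, h1⟩

end IsFlex

section Counting

variable {G : Type*} [Group G] [MulAction G V] [M.Equivariant G]

lemma IsInv.zeroTri (hG : M.IsInv G Z) (g : G) {v w : V} (h : M.adj v w) :
    M.ZeroTri Z (g • v) (g • w) ↔ M.ZeroTri Z v w := by
  unfold ZeroTri
  rw [Equivariant.nx_smul g h, hG.1 g h, hG.1 g (M.adj_nx' h), hG.1 g (adj_nx h)]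

lemma IsInv.nz_smul (hG : M.IsInv G Z) (g : G) : ∀ d ∈ M.nz Z, g • d ∈ M.nz Z :=
  fun d hd h => hd ((hG.zeroTri g d.2).1 h)

/-- An invariant function of oriented edges, on orbits. -/
def liftQ (F : V → V → ℤ)
    (hF : ∀ (g : G) (d : M.Dart), F (g • d.1.1) (g • d.1.2) = F d.1.1 d.1.2) : M.DQ G → ℤ :=
  Quotient.lift (fun d => F d.1.1 d.1.2) (by rintro _ d ⟨g, rfl⟩; exact hF g d)

open Classical in
lemma _root_.Set.ncard_eq_sum_ite {α : Type*} [Fintype α] (A : Set α) :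
    (A.ncard : ℤ) = ∑ v, if v ∈ A then 1 else 0 := by
  rw [← Finset.sum_filter, Finset.sum_const, nsmul_eq_mul, mul_one, ← Set.ncard_coe_finset]
  congr 2
  ext; simp

open Classical in
/-- Count of orbits of oriented edges, organized by origin. -/
lemma ncard_dq_eq {A : Set M.Dart} (hA : ∀ (g : G), ∀ d ∈ A, g • d ∈ A) (P : V → V → Prop)
    (hP : ∀ d, d ∈ A ↔ P d.1.1 d.1.2) (B : M.VQ G → ℤ)
    (hB : ∀ v, (∑ u ∈ M.nbrs v, if P v u then 1 else 0 : ℤ) = B (M.vq G v)) :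
    ((M.dq G '' A).ncard : ℤ) = ∑ v, B v := by
  rw [Set.ncard_eq_sum_ite]
  refine sum_dq_eq _ (F := fun v u => if P v u then 1 else 0) (fun d => ?_) B hB
  rw [dq_mem_image hA, hP]

/-- The vertices with nonzero velocity which only belong to nontrivial triangles. -/
def regular (M : OSurf E V) (Z : V → Dual ℝ E) : Set V :=
  {v | Z v ≠ 0 ∧ ∀ u, M.adj v u → ¬ M.ZeroTri Z v u}

/-- The vertices with nonzero velocity which belong to some trivial triangle. -/
def singular (M : OSurf E V) (Z : V → Dual ℝ E) : Set V :=
  {v | Z v ≠ 0 ∧ ∃ u, M.adj v u ∧ M.ZeroTri Z v u}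

lemma IsInv.regular_smul (hG : M.IsInv G Z) (g : G) : ∀ v ∈ M.regular Z, g • v ∈ M.regular Z := by
  rintro v ⟨h1, h2⟩
  refine ⟨fun h => h1 ((hG.2 g v).1 h), fun u hu h => ?_⟩
  have hu' : M.adj v (g⁻¹ • u) := by
    have := Equivariant.adj_smul (M := M) g⁻¹ hu
    rwa [inv_smul_smul] at this
  apply h2 _ hu'
  rw [← hG.zeroTri g hu', smul_inv_smul]
  exact h

lemma IsInv.singular_smul (hG : M.IsInv G Z) (g : G) :
    ∀ v ∈ M.singular Z, g • v ∈ M.singular Z := by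
  rintro v ⟨h1, u, hu, h2⟩
  exact ⟨fun h => h1 ((hG.2 g v).1 h), g • u, Equivariant.adj_smul g hu, (hG.zeroTri g hu).2 h2⟩

/-- The oriented edges between a trivial and a nontrivial triangle. -/
def bdry (M : OSurf E V) (Z : V → Dual ℝ E) : Set M.Dart :=
  {d | ¬ (d ∈ M.nz Z ↔ Dart.τ M d ∈ M.nz Z)}

lemma IsInv.bdry_smul (hG : M.IsInv G Z) (g : G) : ∀ d ∈ M.bdry Z, g • d ∈ M.bdry Z := by
  intro d hd h
  apply hd
  have : ∀ d, g • d ∈ M.nz Z ↔ d ∈ M.nz Z := fun d => not_congr (hG.zeroTri g d.2)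
  rwa [Dart.τ_smul, this, this] at h

/-- The oriented edges between a trivial and a nontrivial triangle, starting at a vertex with zero
velocity. -/
def bdry₀ (M : OSurf E V) (Z : V → Dual ℝ E) : Set M.Dart := {d | d ∈ M.bdry Z ∧ Z d.1.1 = 0}

lemma IsInv.bdry₀_smul (hG : M.IsInv G Z) (g : G) : ∀ d ∈ M.bdry₀ Z, g • d ∈ M.bdry₀ Z :=
  fun d hd => ⟨hG.bdry_smul g d hd.1, (hG.2 g _).2 hd.2⟩

end Counting

end OSurf

namespace OSurf

variable {E V : Type*} [AddCommGroup E] [Module ℝ E] {M : OSurf E V} {Z : V → Dual ℝ E}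
variable {G : Type*} [Group G] [MulAction G V] [M.Equivariant G]

open Classical in
/-- A bound on the number of triangles in `F`, from bounds for the weights of the corners. -/
lemma two_mul_ncard_le {F : Set M.Dart} (hF : ∀ (g : G), ∀ d ∈ F, g • d ∈ F) {c : V → V → ℤ}
    (hc : ∀ (g : G) (d : M.Dart), c (g • d.1.1) (g • d.1.2) = c d.1.1 d.1.2)
    (hc0 : ∀ v w, 0 ≤ c v w)
    (h2 : ∀ d ∈ F, 2 ≤ c d.1.1 d.1.2 + c d.1.2 (M.nx d.1.1 d.1.2) + c (M.nx d.1.1 d.1.2) d.1.1)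
    (B : M.VQ G → ℤ) (hB : ∀ v, ∑ u ∈ M.nbrs v, c v u ≤ B (M.vq G v)) :
    2 * ((M.dq G '' F).ncard : ℤ) ≤ 3 * ∑ v, B v := by
  let f := liftQ (G := G) c hc
  have hf : ∀ d, f (M.dq G d) = c d.1.1 d.1.2 := fun _ => rfl
  have h3 := sum_dq_le f hf B hB
  have h4 : ∑ q, f (φq M G q) = ∑ q, f q := Equiv.sum_comp (φq M G) f
  have h5 : ∑ q, f (φq M G (φq M G q)) = ∑ q, f q := by
    rw [← h4]; exact Equiv.sum_comp (φq M G) (fun q => f (φq M G q))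
  have h6 : 2 * ((M.dq G '' F).ncard : ℤ) = ∑ q, if q ∈ M.dq G '' F then 2 else 0 := by
    rw [Set.ncard_eq_sum_ite, Finset.mul_sum]
    exact Finset.sum_congr rfl fun q _ => by split_ifs <;> rfl
  have h7 : (∑ q, if q ∈ M.dq G '' F then 2 else 0) ≤
      ∑ q, (f q + f (φq M G q) + f (φq M G (φq M G q))) := by
    refine Finset.sum_le_sum fun q _ => ?_
    obtain ⟨d, rfl⟩ := exists_dq q
    rw [φq_dq, φq_dq, hf, hf, hf]
    simp only [Dart.φ_fst, Dart.φ_snd, M.nx_nx d.2]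
    split_ifs with h
    · rw [dq_mem_image hF] at h
      exact h2 d h
    · have := hc0 d.1.1 d.1.2
      have := hc0 d.1.2 (M.nx d.1.1 d.1.2)
      have := hc0 (M.nx d.1.1 d.1.2) d.1.1
      linarith
  rw [Finset.sum_add_distrib, Finset.sum_add_distrib, h4, h5] at h7
  linarith

lemma corner_nonneg (Z : Dual ℝ E) (v w : V) : 0 ≤ M.corner Z v w := abs_nonneg _

lemma IsInv.corner (hG : M.IsInv G Z) (g : G) (d : M.Dart) :
    M.corner (Z (g • d.1.1)) (g • d.1.1) (g • d.1.2) = M.corner (Z d.1.1) d.1.1 d.1.2 := by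
  unfold OSurf.corner
  rw [Equivariant.nx_smul g d.2, hG.1 g d.2, hG.1 g (adj_nx d.2)]

variable [FiniteDimensional ℝ E] (hE : finrank ℝ E = 4)
include hE

lemma IsFlex.sum_corner_regular (hZ : M.IsFlex Z) {v : V} (hv : Z v ≠ 0) :
    ∑ u ∈ M.nbrs v, M.corner (Z v) v u ≤ 4 := sum_corner_le_four hE hv (hZ.self v)

lemma IsFlex.sum_corner_singular (hZ : M.IsFlex Z) {v : V} (hv : v ∈ M.singular Z) :
    ∑ u ∈ M.nbrs v, M.corner (Z v) v u ≤ 2 := by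
  obtain ⟨h, u, hu, hz⟩ := hv
  exact sum_corner_le_two hE h (hZ.self v) hu hz.1 hz.2.2

/-- The nontrivial triangles are few. -/
lemma IsFlex.two_mul_ncard_nz_le (hZ : M.IsFlex Z) (hG : M.IsInv G Z) :
    2 * (M.dq G '' M.nz Z).ncard ≤
      12 * (M.vq G '' M.regular Z).ncard + 6 * (M.vq G '' M.singular Z).ncard := by
  classical
  have h1 := two_mul_ncard_le (F := M.nz Z) hG.nz_smul
    (c := fun v u => M.corner (Z v) v u) hG.corner (fun _ _ => corner_nonneg _ _ _)
    (fun d hd => hZ.two_le_sum_corner d.2 hd)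
    (fun q => 4 * (if q ∈ M.vq G '' M.regular Z then 1 else 0) +
      2 * (if q ∈ M.vq G '' M.singular Z then 1 else 0)) (fun v => by
        rw [vq_mem_image hG.regular_smul, vq_mem_image hG.singular_smul]
        by_cases h0 : Z v = 0
        · simp only [h0, OSurf.corner]
          simp only [LinearMap.zero_apply, sub_self, abs_zero, Finset.sum_const_zero]
          split_ifs <;> simp
        · by_cases hs : v ∈ M.singular Z
          · have := hZ.sum_corner_singular hE hs
            rw [if_pos hs]
            split_ifs <;> linarith
          · have hr : v ∈ M.regular Z := ⟨h0, fun u hu hz => hs ⟨h0, u, hu, hz⟩⟩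
            rw [if_pos hr, if_neg hs]
            have := hZ.sum_corner_regular hE h0
            linarith)
  rw [Finset.sum_add_distrib, ← Finset.mul_sum, ← Finset.mul_sum, ← Set.ncard_eq_sum_ite,
    ← Set.ncard_eq_sum_ite] at h1
  have : (2 * (M.dq G '' M.nz Z).ncard : ℤ) ≤
      12 * (M.vq G '' M.regular Z).ncard + 6 * (M.vq G '' M.singular Z).ncard := by linarith
  exact_mod_cast this

open Classical in
/-- The number of edges between a trivial and a nontrivial triangle. -/
lemma IsFlex.ncard_bdry_eq (hZ : M.IsFlex Z) (hG : M.IsInv G Z) :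
    (M.dq G '' M.bdry Z).ncard =
      2 * (M.vq G '' M.singular Z).ncard + (M.dq G '' M.bdry₀ Z).ncard := by
  obtain ⟨P, hPdef⟩ : ∃ P : V → V → Prop, ∀ v u,
      P v u ↔ ¬ (M.ZeroTri Z v u ↔ M.ZeroTri Z v (M.nx u v)) := ⟨_, fun _ _ => Iff.rfl⟩
  have hP : ∀ d, d ∈ M.bdry Z ↔ P d.1.1 d.1.2 := fun d => by
    rw [hPdef]
    change ¬ (_ ↔ _) ↔ ¬ (_ ↔ _)
    rw [hZ.mem_nz_τ d.2]
    exact not_congr not_iff_not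
  have hsum : ∀ v, v ∈ M.singular Z → (∑ u ∈ M.nbrs v, if P v u then 1 else 0 : ℤ) = 2 := by
    rintro v ⟨hv, u, hu, hz⟩
    obtain ⟨q', q, hr, h1, h2⟩ := hZ.exists_boundary hE hv hu hz
    have h3 : ∀ a ∈ M.nbrs v, (if P v a then 1 else 0 : ℤ) =
        (if a = q' then 1 else 0) + if a = q then 1 else 0 := by
      intro a ha
      rw [mem_nbrs] at ha
      have hne := hr.ne
      have h1 := h1 a ha
      have h2 := h2 a ha
      by_cases e1 : a = q'
      · have e2 : a ≠ q := e1 ▸ hne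
        have := h1.2 e1
        rw [if_pos e1, if_neg e2, if_pos (by rw [hPdef]; tauto)]; rfl
      · by_cases e2 : a = q
        · have := h2.2 e2
          rw [if_neg e1, if_pos e2, if_pos (by rw [hPdef]; tauto)]; rfl
        · rw [if_neg e1, if_neg e2, if_neg (by rw [hPdef]; tauto)]; rfl
    rw [Finset.sum_congr rfl h3, Finset.sum_add_distrib, Finset.sum_ite_eq', Finset.sum_ite_eq',
      if_pos ((mem_nbrs M).2 hr.adj_first), if_pos ((mem_nbrs M).2 hr.adj_last)]
    rfl
  have hB : ∀ v w, M.vq G v = M.vq G w → Z v = 0 → Z w = 0 := by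
    intro v w h h0
    obtain ⟨g, rfl⟩ := vq_eq.1 h
    exact (hG.2 g w).1 h0
  let cnt : V → ℤ := fun v => ∑ u ∈ M.nbrs v, if P v u then 1 else 0
  have hcnt : ∀ (g : G) v, cnt (g • v) = cnt v := by
    intro g v
    refine (Finset.sum_bij (fun u _ => g • u) ?_ ?_ ?_ ?_).symm
    · intro u hu; rw [mem_nbrs] at hu ⊢; exact Equivariant.adj_smul g hu
    · intro u _ u' _ h; exact MulAction.injective g h
    · intro u hu
      rw [mem_nbrs] at hu
      refine ⟨g⁻¹ • u, ?_, smul_inv_smul _ _⟩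
      rw [mem_nbrs]
      have := Equivariant.adj_smul (M := M) g⁻¹ hu
      rwa [inv_smul_smul] at this
    · intro u hu
      rw [mem_nbrs] at hu
      simp only [hPdef]
      rw [hG.zeroTri g hu, Equivariant.nx_smul g (M.adj_symm hu), hG.zeroTri g (adj_prev hu)]
  let B0 : M.VQ G → ℤ := Quotient.lift (fun v => if Z v = 0 then cnt v else 0) (by
    rintro _ v ⟨g, rfl⟩
    change (if Z (g • v) = 0 then cnt (g • v) else 0) = if Z v = 0 then cnt v else 0
    rw [hcnt]
    simp only [hG.2])
  have hB0 : ∀ v, B0 (M.vq G v) = if Z v = 0 then cnt v else 0 := fun _ => rfl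
  have e1 := ncard_dq_eq hG.bdry_smul P hP
    (fun q => 2 * (if q ∈ M.vq G '' M.singular Z then 1 else 0) + B0 q) (fun v => by
      rw [vq_mem_image hG.singular_smul, hB0]
      by_cases h0 : Z v = 0
      · have hs : v ∉ M.singular Z := fun h => h.1 h0
        rw [if_neg hs, if_pos h0]; simp [cnt]
      · by_cases hs : v ∈ M.singular Z
        · rw [if_pos hs, if_neg h0, hsum v hs]; rfl
        · rw [if_neg hs, if_neg h0]
          simp only [mul_zero, add_zero]
          refine Finset.sum_eq_zero fun u hu => ?_
          rw [mem_nbrs] at hu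
          have h1 : ∀ u, M.adj v u → ¬ M.ZeroTri Z v u := fun u hu hz => hs ⟨h0, u, hu, hz⟩
          have h2 := h1 _ (adj_prev hu)
          have h3 := h1 _ hu
          rw [if_neg (by rw [hPdef]; tauto)])
  have e2 := ncard_dq_eq hG.bdry₀_smul (fun v u => P v u ∧ Z v = 0)
    (fun d => and_congr_left fun _ => hP d) B0 (fun v => by
      rw [hB0]
      by_cases h0 : Z v = 0
      · simp only [h0, and_true, if_true]; rfl
      · simp [h0])
  rw [Finset.sum_add_distrib, ← Finset.mul_sum, ← Set.ncard_eq_sum_ite, ← e2] at e1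
  exact_mod_cast e1

/-- The number of edges from a vertex with zero velocity, between a trivial and a nontrivial
triangle, is controlled by the topology of the union of the nontrivial triangles. -/
theorem IsFlex.bdry₀_bound (hZ : M.IsFlex Z) (hG : M.IsInv G Z)
    (htrans : ∀ d ∈ M.nz Z, ∀ d' ∈ M.nz Z, ∃ g : G, Dart.Rel (inner (M.nz Z)) d (g • d'))
    (hne : M.regular Z ≠ Set.univ) :
    M.bdry₀ Z = ∅ ∨ ((M.dq G '' M.bdry₀ Z).ncard ≤ 4 ∧ Dart.HolFree G (inner (M.nz Z))) := by
  have h1 := euler_le hG.nz_smul hZ.nz_of_φ htrans hG.regular_smul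
    (fun d hd => hd.2 _ d.2) hne
  have h2 := hZ.two_mul_ncard_nz_le hE hG
  have h3 := hZ.ncard_bdry_eq hE hG
  have h4 : (M.dq G '' M.bdry Z).ncard + 2 * (M.dq G '' inner (M.nz Z)).ncard =
      2 * (M.dq G '' M.nz Z).ncard := by
    classical
    have e1 := Equiv.sum_comp (τq M G) fun q => if q ∈ M.dq G '' M.nz Z then (1 : ℤ) else 0
    have e2 : ∑ q, ((if q ∈ M.dq G '' M.bdry Z then (1 : ℤ) else 0) +
        2 * if q ∈ M.dq G '' inner (M.nz Z) then (1 : ℤ) else 0) =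
        ∑ q, ((if q ∈ M.dq G '' M.nz Z then (1 : ℤ) else 0) +
          if τq M G q ∈ M.dq G '' M.nz Z then (1 : ℤ) else 0) := by
      refine Finset.sum_congr rfl fun q _ => ?_
      obtain ⟨d, rfl⟩ := exists_dq q
      rw [τq_dq, dq_mem_image hG.bdry_smul, dq_mem_image hG.nz_smul, dq_mem_image hG.nz_smul,
        dq_mem_image (fun g d => inner_smul hG.nz_smul g)]
      simp only [bdry, inner, Set.mem_ofPred_eq]
      by_cases a : d ∈ M.nz Z <;> by_cases b : Dart.τ M d ∈ M.nz Z <;> simp [a, b]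
    rw [Finset.sum_add_distrib, Finset.sum_add_distrib, e1, ← Finset.mul_sum,
      ← Set.ncard_eq_sum_ite, ← Set.ncard_eq_sum_ite, ← Set.ncard_eq_sum_ite] at e2
    omega
  rcases h1 with h1 | ⟨h1, h5⟩
  · left
    have h6 : (M.dq G '' M.bdry₀ Z).ncard = 0 := by omega
    rw [Set.ncard_eq_zero] at h6
    exact Set.image_eq_empty.1 h6
  · exact .inr ⟨by omega, h5⟩

end OSurf

namespace OSurf

variable {E V : Type*} [AddCommGroup E] [Module ℝ E] {M : OSurf E V}

/-- Turning around a vertex inside `T`. -/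
lemma rel_of_tail_eq {T : Set M.Dart} {v : V} (hT : ∀ d : M.Dart, d.1.1 = v → d ∈ T) {d d' : M.Dart}
    (hd : d.1.1 = v) (hd' : d'.1.1 = v) : Dart.Rel T d d' := by
  obtain ⟨⟨v1, w⟩, hw⟩ := d
  obtain ⟨⟨v2, w'⟩, hw'⟩ := d'
  obtain rfl : v1 = v := hd
  obtain rfl : v2 = v1 := hd'
  refine nx_induction (P := fun u => ∀ hu : M.adj v2 u, Dart.Rel T ⟨(v2, w), hw⟩ ⟨(v2, u), hu⟩) hw
    (fun _ => Dart.Rel.refl) (fun u hu ih hu' => ?_) w' hw' hw'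
  have h1 := Dart.Rel.τ (hT ⟨(v2, M.nx v2 u), hu'⟩ rfl)
  have h2 : Dart.Rel T ⟨(v2, u), hu⟩ (Dart.τ M ⟨(v2, M.nx v2 u), hu'⟩) := by
    rw [← Dart.τ_φ_φ ⟨(v2, u), hu⟩]
    exact Dart.Rel.φ_φ
  exact ((ih hu).trans h2).trans h1.symm

/-- The dual graph is connected. -/
lemma rel_univ (d d' : M.Dart) : Dart.Rel Set.univ d d' := by
  have h := M.connected {v | ∀ e : M.Dart, e.1.1 = v → Dart.Rel Set.univ d e}
    ⟨d.1.1, fun e he => rel_of_tail_eq (v := d.1.1) (fun _ _ => trivial) rfl he⟩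
    (fun v hv w hvw e he => ?_)
  · have h1 : d'.1.1 ∈ {v | ∀ e : M.Dart, e.1.1 = v → Dart.Rel Set.univ d e} := by
      rw [h]; trivial
    exact h1 d' rfl
  · have h1 : Dart.Rel Set.univ d ⟨(v, w), hvw⟩ := hv _ rfl
    have h2 : Dart.Rel Set.univ (⟨(v, w), hvw⟩ : M.Dart) (Dart.τ M ⟨(v, w), hvw⟩) :=
      Dart.Rel.τ trivial
    exact (h1.trans h2).trans (rel_of_tail_eq (v := w) (fun _ _ => trivial) rfl he)

variable (M) (G : Type*) [Group G] [MulAction G V] [M.Equivariant G]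

/-- The Euler characteristic of the quotient surface, when its first Betti number is at least
four. -/
theorem six_mul_card_vq_add_le [Nonempty V] (hG : 4 ≤ finrank ℝ (Additive G →+ ℝ)) :
    6 * Fintype.card (M.VQ G) + 12 ≤ Fintype.card (M.DQ G) := by
  classical
  choose r hr using exists_vq (M := M) (G := G)
  have hγ : ∀ v, ∃ g : G, g • r (M.vq G v) = v := fun v => vq_eq.1 (hr (M.vq G v)).symm
  choose γ hγ using hγ
  have hγs : ∀ (g : G) v, γ (g • v) = g * γ v := by
    intro g v
    have h1 := hγ (g • v)
    rw [vq_smul] at h1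
    have h2 : (g * γ v) • r (M.vq G v) = g • v := by rw [mul_smul, hγ]
    have h3 : ((g * γ v)⁻¹ * γ (g • v)) • r (M.vq G v) = r (M.vq G v) := by
      rw [mul_smul, h1, inv_smul_eq_iff, h2]
    have h4 := Equivariant.free (M := M) _ _ h3
    rw [inv_mul_eq_one] at h4
    exact h4.symm
  let pot : (M.VQ G → ℝ) × (Additive G →+ ℝ) → V → ℝ :=
    fun p v => p.1 (M.vq G v) + p.2 (Additive.ofMul (γ v))
  have hpot : ∀ p (g : G) v, pot p (g • v) = p.2 (Additive.ofMul g) + pot p v := by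
    intro p g v
    simp only [pot, vq_smul, hγs, ofMul_mul, map_add]; ring
  let Ψ : ((M.VQ G → ℝ) × (Additive G →+ ℝ)) →ₗ[ℝ] (M.DQ G → ℝ) :=
    { toFun := fun p => Quotient.lift (fun d : M.Dart => pot p d.1.2 - pot p d.1.1) (by
        rintro _ d ⟨g, rfl⟩
        change pot p (g • d.1.2) - pot p (g • d.1.1) = pot p d.1.2 - pot p d.1.1
        rw [hpot, hpot]; ring)
      map_add' := fun p p' => by
        ext q
        obtain ⟨d, rfl⟩ := exists_dq q
        change pot (p + p') d.1.2 - pot (p + p') d.1.1 =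
          (pot p d.1.2 - pot p d.1.1) + (pot p' d.1.2 - pot p' d.1.1)
        simp only [pot, Prod.fst_add, Prod.snd_add, Pi.add_apply, AddMonoidHom.add_apply]; ring
      map_smul' := fun c p => by
        ext q
        obtain ⟨d, rfl⟩ := exists_dq q
        change pot (c • p) d.1.2 - pot (c • p) d.1.1 = c * (pot p d.1.2 - pot p d.1.1)
        simp only [pot, Prod.smul_fst, Prod.smul_snd, Pi.smul_apply, AddMonoidHom.smul_apply,
          smul_eq_mul]; ring }
  have hΨ : ∀ p d, Ψ p (M.dq G d) = pot p d.1.2 - pot p d.1.1 := fun _ _ => rfl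
  have hker : ∀ p ∈ LinearMap.ker Ψ, ∀ v w, pot p v = pot p w := by
    intro p hp v w
    have h1 := M.connected {u | pot p u = pot p w} ⟨w, rfl⟩ (fun a ha b hab => by
      have h2 := hΨ p ⟨(a, b), hab⟩
      rw [LinearMap.mem_ker.1 hp] at h2
      have ha : pot p a = pot p w := ha
      change pot p b = pot p w
      simp only [Pi.zero_apply] at h2
      linarith)
    have h2 : v ∈ {u | pot p u = pot p w} := by rw [h1]; trivial
    exact h2
  have hfinH : Module.Finite ℝ (Additive G →+ ℝ) := Module.finite_of_finrank_pos (by omega)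
  have hk1 : finrank ℝ (LinearMap.ker Ψ) ≤ 1 := by
    obtain ⟨v0⟩ := ‹Nonempty V›
    let one : LinearMap.ker Ψ := ⟨(fun _ => 1, 0), by
      rw [LinearMap.mem_ker]
      ext q
      obtain ⟨d, rfl⟩ := exists_dq q
      rw [hΨ]; simp [pot]⟩
    refine finrank_le_one one fun p => ⟨pot p.1 v0, ?_⟩
    have h1 := hker p.1 p.2
    have h2 : p.1.2 = 0 := by
      ext g
      have h3 := hpot p.1 g v0
      rw [h1 _ v0] at h3
      simpa using h3
    refine Subtype.ext (Prod.ext ?_ ?_)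
    · ext q
      obtain ⟨v, rfl⟩ := exists_vq q
      have h3 := h1 v0 v
      change pot p.1 v0 * 1 = p.1.1 (M.vq G v)
      rw [h3]
      simp [pot, h2]
    · rw [h2]; simp [one]
  have hrank := LinearMap.finrank_range_add_finrank_ker Ψ
  rw [Module.finrank_prod, Module.finrank_fintype_fun_eq_card] at hrank
  have hmain := finrank_closed_forms_le (τ := τq M G) (φ := φq M G) (T := Set.univ)
    (F := Set.univ) τq_τq τq_ne φq_φq_φq φq_ne (fun _ _ => trivial) (fun _ _ => trivial) (by
      rintro b hb1 hb2 q - q' -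
      obtain ⟨d, rfl⟩ := exists_dq q
      obtain ⟨d', rfl⟩ := exists_dq q'
      exact Dart.Rel.of_step (R := fun x y => b (M.dq G x) = b (M.dq G y))
        ⟨fun _ => rfl, fun h => h.symm, fun h h' => h.trans h'⟩
        (fun d => by rw [← φq_dq, hb1]) (fun d _ => by rw [← τq_dq, hb2 _ trivial])
        (rel_univ d d')) (LinearMap.range Ψ) (by
      rintro _ ⟨p, rfl⟩
      refine ⟨fun q => ?_, fun q hq => absurd trivial hq, fun q _ => ?_⟩
      · obtain ⟨d, rfl⟩ := exists_dq q
        rw [τq_dq, hΨ, hΨ]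
        simp
      · obtain ⟨d, rfl⟩ := exists_dq q
        rw [φq_dq, φq_dq, hΨ, hΨ, hΨ]
        simp only [Dart.φ_fst, Dart.φ_snd, M.nx_nx d.2]
        ring)
  rw [Set.ncard_univ, Nat.card_eq_fintype_card] at hmain
  omega

end OSurf

namespace OSurf

variable {E V : Type*} [AddCommGroup E] [Module ℝ E] {M : OSurf E V} {Z : V → Dual ℝ E}

lemma IsFlex.mem_nz_iff (hZ : M.IsFlex Z) {d : M.Dart} : d ∈ M.nz Z ↔ Z d.1.1 (M.x d.1.2) ≠ 0 ∨
    Z (Dart.φ M d).1.1 (M.x (Dart.φ M d).1.2) ≠ 0 ∨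
    Z (Dart.φ M (Dart.φ M d)).1.1 (M.x (Dart.φ M (Dart.φ M d)).1.2) ≠ 0 := by
  simp only [nz, ZeroTri, Set.mem_ofPred_eq, Dart.φ_fst, Dart.φ_snd, M.nx_nx d.2]
  rw [hZ.anti (M.adj_symm (adj_nx d.2)), neg_ne_zero]
  tauto

lemma mem_nz_of_ne {d : M.Dart} (h : Z d.1.1 (M.x d.1.2) ≠ 0) : d ∈ M.nz Z := fun hz => h hz.1

lemma IsFlex.mem_inner_of_ne (hZ : M.IsFlex Z) {d : M.Dart} (h : Z d.1.1 (M.x d.1.2) ≠ 0) :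
    d ∈ inner (M.nz Z) := by
  refine ⟨mem_nz_of_ne h, mem_nz_of_ne ?_⟩
  rw [hZ.anti d.2] at h
  simpa using h

/-- The union of some components of the set of nontrivial triangles. -/
structure IsNzUnion (M : OSurf E V) (Z : V → Dual ℝ E) (S : Set M.Dart) : Prop where
  subset : S ⊆ M.nz Z
  φ_mem : ∀ d, Dart.φ M d ∈ S ↔ d ∈ S
  τ_mem : ∀ d ∈ inner (M.nz Z), (Dart.τ M d ∈ S ↔ d ∈ S)

open Classical in
/-- The restriction of a flex to the vertices of some components of the set of nontrivial
triangles. -/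
noncomputable def trunc (M : OSurf E V) (Z : V → Dual ℝ E) (S : Set M.Dart) (v : V) : Dual ℝ E :=
  if ∃ d ∈ S, d.1.1 = v then Z v else 0

section

variable [FiniteDimensional ℝ E] (hE : finrank ℝ E = 4)
include hE

/-- The nontrivial triangles at a vertex with nonzero velocity are connected through edges between
nontrivial triangles. -/
lemma IsFlex.rel_of_tail_eq (hZ : M.IsFlex Z) {v : V} (hv : Z v ≠ 0) {d d' : M.Dart}
    (hd : d.1.1 = v) (hd' : d'.1.1 = v) (hnz : d ∈ M.nz Z) (hnz' : d' ∈ M.nz Z) :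
    Dart.Rel (inner (M.nz Z)) d d' := by
  obtain ⟨⟨v1, w⟩, hw⟩ := d
  obtain ⟨⟨v2, w'⟩, hw'⟩ := d'
  obtain rfl : v1 = v := hd
  obtain rfl : v2 = v1 := hd'
  obtain ⟨q, hq, hqz⟩ : ∃ q, M.adj v2 q ∧
      ∀ a, M.adj v2 a → M.ZeroTri Z v2 a → ¬ M.ZeroTri Z v2 (M.nx v2 a) → M.nx v2 a = q := by
    by_cases h : ∃ u, M.adj v2 u ∧ M.ZeroTri Z v2 u
    · obtain ⟨u, hu, hz⟩ := h
      obtain ⟨q', q, hr, -, h2⟩ := hZ.exists_boundary hE hv hu hz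
      refine ⟨q, hr.adj_last, fun a ha hza hz' => ?_⟩
      rw [← h2 _ (adj_nx ha), prev_nx ha]
      exact ⟨hz', hza⟩
    · exact ⟨w, hw, fun a ha hza => absurd ⟨a, ha, hza⟩ h⟩
  have key : ∀ a, M.adj v2 a → ∀ ha : M.adj v2 a, ¬ M.ZeroTri Z v2 a →
      Dart.Rel (inner (M.nz Z)) ⟨(v2, q), hq⟩ ⟨(v2, a), ha⟩ := by
    refine nx_induction hq (fun _ _ => Dart.Rel.refl) (fun a ha ih ha' hna => ?_)
    by_cases hza : M.ZeroTri Z v2 a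
    · have h1 := hqz a ha hza hna
      have h2 : (⟨(v2, M.nx v2 a), ha'⟩ : M.Dart) = ⟨(v2, q), hq⟩ := Dart.ext rfl h1
      rw [h2]; exact Dart.Rel.refl
    · have h1 : (⟨(v2, M.nx v2 a), ha'⟩ : M.Dart) ∈ inner (M.nz Z) := by
        refine ⟨hna, (hZ.mem_nz_τ ha').2 ?_⟩
        rwa [prev_nx ha]
      have h2 : Dart.Rel (inner (M.nz Z)) ⟨(v2, a), ha⟩
          (Dart.τ M ⟨(v2, M.nx v2 a), ha'⟩) := by
        rw [← Dart.τ_φ_φ ⟨(v2, a), ha⟩]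
        exact Dart.Rel.φ_φ
      exact ((ih ha hza).trans h2).trans (Dart.Rel.τ h1).symm
  exact (key w hw hw hnz).symm.trans (key w' hw' hw' hnz')

variable {S : Set M.Dart}

lemma IsNzUnion.mem_of_mem (hS : IsNzUnion M Z S) (hZ : M.IsFlex Z) {v : V} (hv : Z v ≠ 0)
    (h : ∃ d ∈ S, d.1.1 = v) {d : M.Dart} (hd : d.1.1 = v) (hnz : d ∈ M.nz Z) : d ∈ S := by
  obtain ⟨e, heS, he⟩ := h
  have h1 := hZ.rel_of_tail_eq hE hv he hd (hS.subset heS) hnz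
  exact (h1.mem_iff hS.φ_mem hS.τ_mem).1 heS

lemma IsNzUnion.trunc_ne (hS : IsNzUnion M Z S) (hZ : M.IsFlex Z) {d : M.Dart} :
    M.trunc Z S d.1.1 (M.x d.1.2) ≠ 0 ↔ Z d.1.1 (M.x d.1.2) ≠ 0 ∧ d ∈ S := by
  unfold trunc
  constructor
  · intro h
    split_ifs at h with hd
    · refine ⟨h, hS.mem_of_mem hE hZ (fun h0 => h (by simp [h0])) hd rfl (mem_nz_of_ne h)⟩
    · simp at h
  · rintro ⟨h, hd⟩
    rwa [if_pos ⟨d, hd, rfl⟩]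

lemma IsNzUnion.isFlex (hS : IsNzUnion M Z S) (hZ : M.IsFlex Z) : M.IsFlex (M.trunc Z S) := by
  refine ⟨fun v => ?_, fun {v w} h => ?_⟩
  · unfold trunc
    split_ifs
    · exact hZ.self v
    · rfl
  · have h1 := hS.trunc_ne hE hZ (d := ⟨(v, w), h⟩)
    have h2 := hS.trunc_ne hE hZ (d := ⟨(w, v), M.adj_symm h⟩)
    have hanti := hZ.anti h
    by_cases h0 : Z v (M.x w) = 0
    · have h0' : Z w (M.x v) = 0 := by rw [h0] at hanti; linarith
      have h1' : ¬ M.trunc Z S v (M.x w) ≠ 0 := fun h => (h1.1 h).1 h0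
      have h2' : ¬ M.trunc Z S w (M.x v) ≠ 0 := fun h => (h2.1 h).1 h0'
      rw [not_not] at h1' h2'
      rw [h1', h2', neg_zero]
    · have hin := hZ.mem_inner_of_ne (d := ⟨(v, w), h⟩) h0
      have h0' : Z w (M.x v) ≠ 0 := fun h => h0 (by rw [hanti, h, neg_zero])
      have h3 := hS.τ_mem _ hin
      by_cases hd : (⟨(v, w), h⟩ : M.Dart) ∈ S
      · have hd' := h3.2 hd
        unfold trunc
        rw [if_pos ⟨_, hd, rfl⟩, if_pos ⟨_, hd', rfl⟩, hanti]
      · have h1' : ¬ M.trunc Z S v (M.x w) ≠ 0 := fun h => hd (h1.1 h).2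
        have h2' : ¬ M.trunc Z S w (M.x v) ≠ 0 := fun h => hd (h3.1 (h2.1 h).2)
        rw [not_not] at h1' h2'
        rw [h1', h2', neg_zero]

lemma IsNzUnion.nz_trunc (hS : IsNzUnion M Z S) (hZ : M.IsFlex Z) : M.nz (M.trunc Z S) = S := by
  ext d
  rw [(hS.isFlex hE hZ).mem_nz_iff, hS.trunc_ne hE hZ, hS.trunc_ne hE hZ, hS.trunc_ne hE hZ,
    hS.φ_mem (Dart.φ M d), hS.φ_mem d, ← or_and_right, ← or_and_right, ← hZ.mem_nz_iff]
  exact ⟨fun h => h.2, fun h => ⟨hS.subset h, h⟩⟩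

end

lemma IsNzUnion.rel_inner {S : Set M.Dart} (hS : IsNzUnion M Z S) {d d' : M.Dart} (hd : d ∈ S)
    (h : Dart.Rel (inner (M.nz Z)) d d') : Dart.Rel (inner S) d d' := by
  have h1 := Dart.Rel.of_step (R := fun x y => (x ∈ S ↔ y ∈ S) ∧ (x ∈ S → Dart.Rel (inner S) x y))
    ⟨fun _ => ⟨Iff.rfl, fun _ => Dart.Rel.refl⟩,
      fun h => ⟨h.1.symm, fun hy => (h.2 (h.1.2 hy)).symm⟩,
      fun h h' => ⟨h.1.trans h'.1, fun hx => (h.2 hx).trans (h'.2 (h.1.1 hx))⟩⟩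
    (fun d => ⟨(hS.φ_mem d).symm, fun _ => Dart.Rel.φ⟩)
    (fun d hd => ⟨(hS.τ_mem d hd).symm, fun hdS => Dart.Rel.τ ⟨hdS, (hS.τ_mem d hd).2 hdS⟩⟩) h
  exact h1.2 hd

section

variable (G : Type*) [Group G] [MulAction G V] [M.Equivariant G]

lemma IsFlex.isNzUnion_component (hZ : M.IsFlex Z) (hG : M.IsInv G Z) {d0 : M.Dart}
    (h0 : d0 ∈ M.nz Z) : IsNzUnion M Z {d | ∃ g : G, Dart.Rel (inner (M.nz Z)) d0 (g • d)} := by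
  have hnz : ∀ d, Dart.Rel (inner (M.nz Z)) d0 d → d ∈ M.nz Z := fun d h =>
    (h.mem_iff (fun d => hZ.nz_φ) (fun d hd => ⟨fun _ => hd.1, fun _ => hd.2⟩)).1 h0
  refine ⟨?_, fun d => ⟨?_, ?_⟩, fun d hd => ⟨?_, ?_⟩⟩
  · rintro d ⟨g, hg⟩
    have h1 := hG.nz_smul g⁻¹ _ (hnz _ hg)
    rwa [inv_smul_smul] at h1
  · rintro ⟨g, hg⟩
    rw [← Dart.φ_smul] at hg
    exact ⟨g, hg.trans Dart.Rel.φ.symm⟩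
  · rintro ⟨g, hg⟩
    exact ⟨g, by rw [← Dart.φ_smul]; exact hg.trans Dart.Rel.φ⟩
  · rintro ⟨g, hg⟩
    rw [← Dart.τ_smul] at hg
    exact ⟨g, hg.trans (Dart.Rel.τ (inner_smul hG.nz_smul g hd)).symm⟩
  · rintro ⟨g, hg⟩
    exact ⟨g, by
      rw [← Dart.τ_smul]; exact hg.trans (Dart.Rel.τ (inner_smul hG.nz_smul g hd))⟩

lemma IsFlex.isNzUnion_component_one (hZ : M.IsFlex Z) {d0 : M.Dart}
    (h0 : d0 ∈ M.nz Z) : IsNzUnion M Z {d | Dart.Rel (inner (M.nz Z)) d0 d} :=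
  ⟨fun d h => (Dart.Rel.mem_iff (A := M.nz Z) (fun d => hZ.nz_φ)
      (fun d hd => ⟨fun _ => hd.1, fun _ => hd.2⟩) h).1 h0,
    fun _ => ⟨fun h => h.trans Dart.Rel.φ.symm, fun h => h.trans Dart.Rel.φ⟩,
    fun _ hd => ⟨fun h => h.trans (Dart.Rel.τ hd).symm, fun h => h.trans (Dart.Rel.τ hd)⟩⟩

variable {G}

lemma IsInv.trunc (hG : M.IsInv G Z) {S : Set M.Dart} (hS : ∀ (g : G), ∀ d ∈ S, g • d ∈ S) :
    M.IsInv G (M.trunc Z S) := by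
  have h1 : ∀ (g : G) v, (∃ d ∈ S, d.1.1 = g • v) ↔ ∃ d ∈ S, d.1.1 = v := by
    intro g v
    constructor
    · rintro ⟨d, hd, hdv⟩
      exact ⟨g⁻¹ • d, hS _ _ hd, by rw [Dart.smul_fst, hdv, inv_smul_smul]⟩
    · rintro ⟨d, hd, rfl⟩
      exact ⟨g • d, hS _ _ hd, rfl⟩
  refine ⟨fun g v w h => ?_, fun g v => ?_⟩
  · have h2 := h1 g v
    unfold OSurf.trunc
    by_cases hv : ∃ d ∈ S, d.1.1 = v
    · rw [if_pos hv, if_pos (h2.2 hv)]; exact hG.1 g h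
    · rw [if_neg hv, if_neg fun h => hv (h2.1 h)]; rfl
  · have h2 := h1 g v
    unfold OSurf.trunc
    by_cases hv : ∃ d ∈ S, d.1.1 = v
    · rw [if_pos hv, if_pos (h2.2 hv)]; exact hG.2 g v
    · rw [if_neg hv, if_neg fun h => hv (h2.1 h)]

end

variable [FiniteDimensional ℝ E] (hE : finrank ℝ E = 4)
variable {G : Type*} [Group G] [MulAction G V] [M.Equivariant G]
include hE

/-- A nontrivial flex may be restricted to one orbit of components of the set of nontrivial
triangles. -/
lemma IsFlex.exists_transitive (hZ : M.IsFlex Z) (hG : M.IsInv G Z) (hne : (M.nz Z).Nonempty) :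
    ∃ Z', M.IsFlex Z' ∧ M.IsInv G Z' ∧ (M.nz Z').Nonempty ∧
      ∀ d ∈ M.nz Z', ∀ d' ∈ M.nz Z', ∃ g : G, Dart.Rel (inner (M.nz Z')) d (g • d') := by
  obtain ⟨d0, h0⟩ := hne
  have hS := hZ.isNzUnion_component G hG h0
  set S := {d | ∃ g : G, Dart.Rel (inner (M.nz Z)) d0 (g • d)} with hSdef
  have hSG : ∀ (g : G), ∀ d ∈ S, g • d ∈ S := by
    rintro g d ⟨k, hk⟩
    exact ⟨k * g⁻¹, by rwa [mul_smul, inv_smul_smul]⟩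
  refine ⟨M.trunc Z S, hS.isFlex hE hZ, hG.trunc hSG, ?_, ?_⟩
  · rw [hS.nz_trunc hE hZ]
    exact ⟨d0, 1, by rw [one_smul]; exact Dart.Rel.refl⟩
  · rw [hS.nz_trunc hE hZ]
    rintro d hd d' hd'
    obtain ⟨g, hg⟩ := hd
    obtain ⟨g', hg'⟩ := hd'
    refine ⟨g⁻¹ * g', ?_⟩
    have h1 := hS.rel_inner (hSG g d ⟨g, hg⟩) (hg.symm.trans hg')
    have h2 := h1.smul (fun k d hd => inner_smul hSG k hd) g⁻¹
    rwa [inv_smul_smul, ← mul_smul] at h2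

/-- In the absence of holonomy, a flex may be restricted to a single component, which is finite. -/
lemma IsFlex.exists_finite (hZ : M.IsFlex Z) (hG : M.IsInv G Z) (hne : (M.nz Z).Nonempty)
    (hol : Dart.HolFree G (inner (M.nz Z))) (hb : (M.dq G '' M.bdry₀ Z).ncard ≤ 4) :
    ∃ Z', M.IsFlex Z' ∧ (M.nz Z').Nonempty ∧ (M.nz Z').Finite ∧ (M.bdry₀ Z').Finite ∧
      (M.bdry₀ Z').ncard ≤ 4 := by
  obtain ⟨d0, h0⟩ := hne
  have hS := hZ.isNzUnion_component_one h0
  set S := {d | Dart.Rel (inner (M.nz Z)) d0 d} with hSdef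
  have hSinj : ∀ (g : G) d, d ∈ S → g • d ∈ S → g = 1 := fun g d h1 h2 =>
    hol d g (Dart.Rel.trans (Dart.Rel.symm h1) h2)
  have hZ' := hS.isFlex hE hZ
  have hnz := hS.nz_trunc hE hZ
  refine ⟨M.trunc Z S, hZ', ?_, ?_, ?_⟩
  · rw [hnz]; exact ⟨d0, Dart.Rel.refl⟩
  · rw [hnz]
    refine Set.Finite.of_finite_image (f := M.dq G) (Set.toFinite _) ?_
    intro d hd d' hd' h
    obtain ⟨g, rfl⟩ := dq_eq.1 h
    rw [hSinj g d' hd' hd, one_smul]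
  · have hsides : ∀ d ∈ M.bdry₀ (M.trunc Z S), d ∈ M.bdry₀ Z ∧
        ((d ∈ S ∧ Dart.τ M d ∉ M.nz Z) ∨ (Dart.τ M d ∈ S ∧ d ∉ M.nz Z)) := by
      rintro d ⟨hd, hd0⟩
      unfold bdry at hd
      rw [Set.mem_ofPred_eq, hnz] at hd
      have h1 : (d ∈ S ∧ Dart.τ M d ∉ M.nz Z) ∨ (Dart.τ M d ∈ S ∧ d ∉ M.nz Z) := by
        by_cases a : d ∈ S
        · left
          have b : Dart.τ M d ∉ S := fun b => hd ⟨fun _ => b, fun _ => a⟩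
          exact ⟨a, fun h => b ((hS.τ_mem d ⟨hS.subset a, h⟩).2 a)⟩
        · right
          have b : Dart.τ M d ∈ S := by by_contra b; exact hd ⟨fun h => absurd h a,
            fun h => absurd h b⟩
          exact ⟨b, fun h => a ((hS.τ_mem d ⟨h, hS.subset b⟩).1 b)⟩
      refine ⟨⟨?_, ?_⟩, h1⟩
      · intro h
        rcases h1 with ⟨a, b⟩ | ⟨a, b⟩
        · exact b (h.1 (hS.subset a))
        · exact b (h.2 (hS.subset a))
      · have h2 : ∃ e ∈ S, e.1.1 = d.1.1 := by
          rcases h1 with ⟨a, b⟩ | ⟨a, b⟩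
          · exact ⟨d, a, rfl⟩
          · exact ⟨Dart.φ M (Dart.τ M d), (hS.φ_mem _).2 a, rfl⟩
        unfold trunc at hd0
        rwa [if_pos h2] at hd0
    have hinj : Set.InjOn (M.dq G) (M.bdry₀ (M.trunc Z S)) := by
      intro d hd d' hd' h
      obtain ⟨g, rfl⟩ := dq_eq.1 h
      have hg : ∀ d, g • d ∈ M.nz Z → d ∈ M.nz Z := fun d hd => by
        have := hG.nz_smul g⁻¹ _ hd
        rwa [inv_smul_smul] at this
      have h1 : g = 1 := by
        rcases (hsides _ hd).2 with ⟨a, b⟩ | ⟨a, b⟩ <;> rcases (hsides _ hd').2 with ⟨c, e⟩ | ⟨c, e⟩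
        · exact hSinj g d' c a
        · exact absurd (hg _ (hS.subset a)) e
        · rw [Dart.τ_smul] at a
          exact absurd (hg _ (hS.subset a)) e
        · rw [Dart.τ_smul] at a
          exact hSinj g _ c a
      rw [h1, one_smul]
    have hsub : M.dq G '' M.bdry₀ (M.trunc Z S) ⊆ M.dq G '' M.bdry₀ Z :=
      Set.image_mono fun d hd => (hsides d hd).1
    refine ⟨Set.Finite.of_finite_image (Set.toFinite _) hinj, ?_⟩
    rw [← hinj.ncard_image]
    exact (Set.ncard_le_ncard hsub).trans hb

end OSurf

namespace OSurf

variable {E V : Type*} [AddCommGroup E] [Module ℝ E] {M : OSurf E V}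

/-- The oriented edges whose sides are coplanar. -/
def cop (M : OSurf E V) : Set M.Dart :=
  {d | M.N d.1.1 d.1.2 (M.x (M.nx d.1.2 d.1.1)) = 0}

/-- Two triangles lie in the same face. -/
def SameFace (d d' : M.Dart) : Prop := Dart.Rel M.cop d d'

/-- The vertex `w` belongs to the face of the triangle `d`. -/
def InFace (d : M.Dart) (w : V) : Prop := ∃ e : M.Dart, SameFace d e ∧ e.1.1 = w

/-- The functional supporting the triangle on the left of `d`. -/
abbrev ND (d : M.Dart) : Dual ℝ E := M.N d.1.1 d.1.2

lemma ND_φ (d : M.Dart) : ND (Dart.φ M d) = ND d := M.N_cyc d.2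

/-- An edge from the viewpoint of a vertex: `u` lies in the sector of a triangle of the face. -/
def Visible (d : M.Dart) (u w : V) : Prop :=
  ∃ e : M.Dart, SameFace d e ∧ e.1.1 = w ∧ ∃ α β γ : ℝ, 0 ≤ α ∧ 0 ≤ β ∧ 0 < α + β ∧
    M.x u = α • M.x e.1.2 + β • M.x (M.nx w e.1.2) + γ • M.x w

lemma Visible.L_pos {d : M.Dart} {u w : V} (h : Visible d u w) : 0 < M.L w (M.x u) := by
  obtain ⟨e, -, rfl, α, β, γ, hα, hβ, hαβ, hx⟩ := h
  rw [hx]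
  simp only [map_add, map_smul, smul_eq_mul, M.L_self, mul_zero, add_zero]
  have h1 := M.L_pos e.2
  have h2 := M.L_pos (adj_nx e.2)
  rcases hα.lt_or_eq with h | h
  · have := mul_pos h h1; have := mul_nonneg hβ h2.le; linarith
  · have := mul_pos (show 0 < β by linarith) h2; have := mul_nonneg hα h1.le; linarith

/-- The predicate on a functional that separates the good and bad neighbours in a zero run. -/
lemma IsZeroRun.iff_of_step {Z : Dual ℝ E} {v q' q : V} (hr : M.IsZeroRun Z v q' q)
    {R : V → Prop} (hne : ∃ u, M.adj v u ∧ Z (M.x u) ≠ 0)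
    (hR : ∀ a, M.adj v a → Z (M.x a) = 0 → Z (M.x (M.nx v a)) = 0 →
      Z (M.x (M.nx v (M.nx v a))) = 0 → (R a ↔ R (M.nx v a))) {a b : V} (ha : M.adj v a)
    (ha0 : Z (M.x a) = 0) (ha1 : Z (M.x (M.nx v a)) = 0) (hb : M.adj v b)
    (hb0 : Z (M.x b) = 0) (hb1 : Z (M.x (M.nx v b)) = 0) : R a ↔ R b := by
  have key : ∀ a, M.adj v a → Z (M.x a) = 0 → Z (M.x (M.nx v a)) = 0 →
      (R a ↔ R (M.nx q v)) := by
    intro a ha h0 h1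
    by_contra hbad
    obtain ⟨t, ht, ht0⟩ := hne
    refine ht0 (nx_induction (P := fun b => Z (M.x b) = 0 ∧ Z (M.x (M.nx v b)) = 0 ∧
      ¬ (R b ↔ R (M.nx q v))) ha ⟨h0, h1, hbad⟩ (fun b hb ⟨hb0, hb1, hbR⟩ => ?_) t ht).1
    have hbq : M.nx v b ≠ q := by
      intro h
      rw [← h, prev_nx hb] at hbR
      exact hbR Iff.rfl
    have hb2 : Z (M.x (M.nx v (M.nx v b))) = 0 := by
      by_contra h
      exact hbq ((hr.last _ (adj_nx hb)).1 ⟨hb1, h⟩)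
    exact ⟨hb1, hb2, by rwa [← hR b hb hb0 hb1 hb2]⟩
  exact (key a ha ha0 ha1).trans (key b hb hb0 hb1).symm

variable [FiniteDimensional ℝ E] (hE : finrank ℝ E = 4)
include hE

/-- Two functionals supporting the surface at coplanar triangles are positively proportional. -/
lemma exists_pos_smul_ND {d e : M.Dart} (h0 : ND d (M.x e.1.1) = 0) (h1 : ND d (M.x e.1.2) = 0)
    (h2 : ND d (M.x (M.nx e.1.1 e.1.2)) = 0) (h : e.1.1 = d.1.1 ) :
    ∃ k : ℝ, 0 < k ∧ ND e = k • ND d := by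
  obtain ⟨k, hk⟩ := exists_eq_smul_of_three hE (M.N_ne d.2) (M.indep e.2) (M.N_left e.2)
    (N_right e.2) (N_nx e.2) h0 h1 h2
  obtain ⟨u, hu, hne⟩ := exists_adj_ne_zero hE (M.N_ne e.2) (M.N_left e.2)
  have h3 := M.N_nonneg e.2 hu
  have h4 := M.N_nonneg d.2 (h ▸ hu)
  refine ⟨k, ?_, hk⟩
  rw [hk] at h3 hne
  simp only [LinearMap.smul_apply, smul_eq_mul] at h3 hne
  rcases h4.lt_or_eq with h5 | h5
  · have h6 := lt_of_le_of_ne h3 (Ne.symm hne)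
    exact pos_of_mul_pos_left h6 h5.le
  · rw [← h5] at hne; simp at hne

lemma ND_τ_of_cop {d : M.Dart} (h : d ∈ M.cop) : ∃ k : ℝ, 0 < k ∧ ND (Dart.τ M d) = k • ND d := by
  have h1 := exists_pos_smul_ND hE (d := d) (e := Dart.φ M (Dart.τ M d)) (M.N_left d.2) h (by
    simp only [Dart.φ_fst, Dart.φ_snd, Dart.τ_snd, Dart.τ_fst]
    rw [nx_prev d.2]; exact N_right d.2) rfl
  rwa [ND_φ] at h1

lemma cop_τ {d : M.Dart} (h : d ∈ M.cop) : Dart.τ M d ∈ M.cop := by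
  obtain ⟨k, hk, hN⟩ := ND_τ_of_cop hE h
  change ND (Dart.τ M d) (M.x (M.nx d.1.1 d.1.2)) = 0
  rw [hN, LinearMap.smul_apply, N_nx d.2, smul_zero]

lemma SameFace.exists_pos_smul {d e : M.Dart} (h : SameFace d e) :
    ∃ k : ℝ, 0 < k ∧ ND e = k • ND d := by
  refine Dart.Rel.of_step (R := fun d e => ∃ k : ℝ, 0 < k ∧ ND e = k • ND d)
    ⟨fun _ => ⟨1, one_pos, by simp⟩, ?_, ?_⟩ (fun d => ⟨1, one_pos, by rw [ND_φ, one_smul]⟩)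
    (fun d hd => ND_τ_of_cop hE hd) h
  · rintro x y ⟨k, hk, h⟩
    exact ⟨k⁻¹, inv_pos.2 hk, by rw [h, smul_smul, inv_mul_cancel₀ hk.ne', one_smul]⟩
  · rintro x y z ⟨k, hk, h⟩ ⟨l, hl, h'⟩
    exact ⟨l * k, mul_pos hl hk, by rw [h', h, smul_smul]⟩

lemma InFace.ND_eq_zero {d : M.Dart} {w : V} (h : InFace d w) : ND d (M.x w) = 0 := by
  obtain ⟨e, he, rfl⟩ := h
  obtain ⟨k, hk, hN⟩ := he.exists_pos_smul hE
  have h1 := M.N_left e.2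
  change ND e _ = 0 at h1
  rw [hN] at h1
  simpa [hk.ne'] using h1

/-- The quadrilateral formed by two adjacent coplanar triangles is strictly convex. -/
lemma exists_relation_of_cop {d : M.Dart} (h : d ∈ M.cop) : ∃ p q r s : ℝ,
    0 < p ∧ 0 < q ∧ 0 < r ∧ 0 < s ∧ p • M.x (M.nx d.1.1 d.1.2) + q • M.x (M.nx d.1.2 d.1.1) =
      r • M.x d.1.1 + s • M.x d.1.2 := by
  obtain ⟨⟨a, b⟩, hab⟩ := d
  set c := M.nx a b with hc
  set e := M.nx b a with he
  change ∃ p q r s : ℝ, 0 < p ∧ 0 < q ∧ 0 < r ∧ 0 < s ∧ p • M.x c + q • M.x e =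
    r • M.x a + s • M.x b
  have hba := M.adj_symm hab
  have hac : M.adj a c := adj_nx hab
  have hae : M.adj a e := adj_prev hab
  have haeb : M.nx a e = b := nx_prev hab
  have hbc : M.adj b c := M.adj_nx' hab
  have hbe : M.adj b e := adj_nx hba
  obtain ⟨α, β, γ, δ, heq, hne⟩ := exists_relation_four hE (M.N_ne hab) (N_nx hab) h
    (M.N_left hab) (N_right hab)
  change α • M.x c + β • M.x e + γ • M.x a + δ • M.x b = 0 at heq
  have hce : c ≠ e := by
    intro hce
    have h1 : M.nx a c = b := by rw [hce, haeb]
    obtain ⟨n, w, hn, hinj, hw, hnx⟩ := M.link a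
    obtain ⟨i, hi⟩ := (hw b).1 hab
    have h2 : c = w (i + 1) := by rw [hc, ← hi, hnx]
    rw [h2, hnx, ← hi, hinj.eq_iff, add_assoc, add_eq_left] at h1
    have h3 : ((2 : ℕ) : ZMod n) = 0 := by push_cast; rw [← h1]; norm_num
    rw [ZMod.natCast_eq_zero_iff] at h3
    have := Nat.le_of_dvd two_pos h3
    omega
  have hcb : c ≠ b := fun h => (ne_of_adj hbc) h.symm
  have heb : e ≠ b := fun h => (ne_of_adj hbe) h.symm
  have hα : α ≠ 0 := by
    rintro rfl
    have hi := Fintype.linearIndependent_iff.1 (M.indep hae) ![γ, β, δ] (by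
      simp only [Fin.sum_univ_three]; rw [← heq]; simp [haeb]; abel)
    exact hne ⟨rfl, hi 1, hi 0, hi 2⟩
  have hβ : β ≠ 0 := by
    rintro rfl
    have hi := Fintype.linearIndependent_iff.1 (M.indep hab) ![γ, δ, α] (by
      simp only [Fin.sum_univ_three]; rw [← heq]; simp; abel)
    exact hne ⟨hi 2, rfl, hi 0, hi 1⟩
  wlog hα0 : 0 < α generalizing α β γ δ
  · refine this (-α) (-β) (-γ) (-δ) (by simpa using hne) ?_ (by simpa) (by simpa) ?_
    · rw [← neg_eq_zero, ← heq]; module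
    · have := lt_of_le_of_ne (not_lt.1 hα0) hα; linarith
  have hβ0 : 0 < β := by
    by_contra hβ0
    have hβ0 : β < 0 := lt_of_le_of_ne (not_lt.1 hβ0) hβ
    by_cases hδ : 0 ≤ δ
    · have h1 := M.sep hab hae (p := δ) (q := α) (p' := -β) (q' := 0) (c := -γ) hδ hα0.le
        (by linarith) le_rfl (by rw [← sub_eq_zero, ← heq, ← hc]; module)
      have h2 := DFunLike.congr_fun h1 c
      rw [← hc] at h2
      simp [hcb, hce] at h2
      exact hα0.ne' h2
    · have h1 := M.sep hae hab (p := -β) (q := -δ) (p' := 0) (q' := α) (c := γ) (by linarith)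
        (by linarith) le_rfl hα0.le (by
          rw [← sub_eq_zero, ← neg_eq_zero, ← heq, ← hc, haeb]; module)
      have h2 := DFunLike.congr_fun h1 c
      rw [← hc, haeb] at h2
      simp [hcb, hce] at h2
      exact hα0.ne h2
  have hLa := congrArg (M.L a) heq
  have hLb := congrArg (M.L b) heq
  simp only [map_add, map_smul, smul_eq_mul, map_zero, M.L_self, mul_zero, add_zero] at hLa hLb
  have hδ : δ < 0 := by
    by_contra hc
    have := mul_pos hα0 (M.L_pos hac)
    have := mul_pos hβ0 (M.L_pos hae)
    have := mul_nonneg (not_lt.1 hc) (M.L_pos hab).le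
    linarith
  have hγ : γ < 0 := by
    by_contra hc
    have := mul_pos hα0 (M.L_pos hbc)
    have := mul_pos hβ0 (M.L_pos hbe)
    have := mul_nonneg (not_lt.1 hc) (M.L_pos hba).le
    linarith
  refine ⟨α, β, -γ, -δ, hα0, hβ0, by linarith, by linarith, ?_⟩
  rw [← sub_eq_zero, ← heq]; module

/-- The triangles of a face, entered by crossing their side `d` when moving away from `u`. -/
inductive Reach (u : V) : M.Dart → Prop
  | base (d : M.Dart) : d ∈ M.cop → M.nx d.1.2 d.1.1 = u → Reach u d
  | left (d : M.Dart) : Reach u d → Dart.φ M d ∈ M.cop → Reach u (Dart.τ M (Dart.φ M d))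
  | right (d : M.Dart) : Reach u d → Dart.φ M (Dart.φ M d) ∈ M.cop →
      Reach u (Dart.τ M (Dart.φ M (Dart.φ M d)))

variable {u : V} {D d : M.Dart}

lemma visible_start (h : SameFace D d) : Visible D d.1.2 d.1.1 :=
  ⟨d, h, rfl, 1, 0, 0, zero_le_one, le_rfl, by norm_num, by module⟩

lemma visible_apex (h : SameFace D d) : Visible D (M.nx d.1.1 d.1.2) d.1.1 :=
  ⟨d, h, rfl, 0, 1, 0, le_rfl, zero_le_one, by norm_num, by module⟩

lemma visible_of_relation (h : SameFace D d) {p q r s : ℝ} (hp : 0 < p) (hr : 0 < r) (hs : 0 < s)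
    (heq : p • M.x u + q • M.x (M.nx d.1.1 d.1.2) = r • M.x d.1.1 + s • M.x d.1.2) :
    Visible D u (M.nx d.1.1 d.1.2) := by
  refine ⟨Dart.φ M (Dart.φ M d), (h.trans Dart.Rel.φ_φ), rfl, r / p, s / p, -(q / p),
    by positivity, by positivity, by positivity, ?_⟩
  have h1 : M.x u = p⁻¹ • (p • M.x u) := by rw [smul_smul, inv_mul_cancel₀ hp.ne', one_smul]
  simp only [Dart.φ_fst, Dart.φ_snd, M.nx_nx d.2, nx_nx_nx d.2]
  rw [h1, eq_sub_of_add_eq heq]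
  match_scalars <;> field_simp

/-- Moving away from a vertex `u` in a face, all vertices are in the sector under which the
triangles are seen. -/
lemma Reach.visible (hR : Reach u d) (h : SameFace D d) :
    Visible D u d.1.1 ∧ Visible D u d.1.2 ∧ Visible D u (M.nx d.1.1 d.1.2) ∧
      ∃ p q r s : ℝ, 0 < p ∧ 0 < q ∧ 0 < r ∧ 0 < s ∧
      p • M.x u + q • M.x (M.nx d.1.1 d.1.2) = r • M.x d.1.1 + s • M.x d.1.2 := by
  suffices H : Visible D u d.1.1 ∧ Visible D u d.1.2 ∧
      ∃ p q r s : ℝ, 0 < p ∧ 0 < q ∧ 0 < r ∧ 0 < s ∧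
      p • M.x u + q • M.x (M.nx d.1.1 d.1.2) = r • M.x d.1.1 + s • M.x d.1.2 by
    obtain ⟨h1, h2, p, q, r, s, hp, hq, hr, hs, heq⟩ := H
    exact ⟨h1, h2, visible_of_relation hE h hp hr hs heq, p, q, r, s, hp, hq, hr, hs, heq⟩
  induction hR with
  | base d hd hu =>
    have h1 : SameFace D (Dart.τ M d) := h.trans (Dart.Rel.τ hd)
    subst hu
    refine ⟨?_, ?_, ?_⟩
    · have := visible_start hE (h1.trans Dart.Rel.φ)
      simpa using this
    · exact visible_apex hE h1
    · obtain ⟨p, q, r, s, hp, hq, hr, hs, heq⟩ := exists_relation_of_cop hE hd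
      exact ⟨q, p, r, s, hq, hp, hr, hs, by rw [← heq]; abel⟩
  | left d hR hd ih =>
    have h1 : SameFace D (Dart.φ M d) := h.trans (Dart.Rel.τ hd).symm
    obtain ⟨h2, h3, p, q, r, s, hp, hq, hr, hs, heq⟩ := ih (h1.trans Dart.Rel.φ.symm)
    refine ⟨visible_of_relation hE (h1.trans Dart.Rel.φ.symm) hp hr hs heq, h3, ?_⟩
    obtain ⟨p1, q1, r1, s1, hp1, hq1, hr1, hs1, heq1⟩ := exists_relation_of_cop hE hd
    simp only [Dart.φ_fst, Dart.φ_snd, Dart.τ_fst, Dart.τ_snd, M.nx_nx d.2] at heq1 ⊢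
    have heq2 : (p1 * p / r) • M.x u + q1 • M.x (M.nx (M.nx d.1.1 d.1.2) d.1.2) =
        (s1 - p1 * q / r) • M.x (M.nx d.1.1 d.1.2) + (r1 + p1 * s / r) • M.x d.1.2 := by
      have h5 : M.x d.1.1 = r⁻¹ • (r • M.x d.1.1) := by
        rw [smul_smul, inv_mul_cancel₀ hr.ne', one_smul]
      rw [h5, ← sub_eq_of_eq_add heq] at heq1
      rw [← sub_eq_zero] at heq1 ⊢
      rw [← heq1]
      match_scalars <;> field_simp <;> ring
    refine ⟨_, _, _, _, by positivity, hq1, ?_, by positivity, heq2⟩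
    have h4 := congrArg (M.L d.1.2) heq2
    simp only [map_add, map_smul, smul_eq_mul, M.L_self, mul_zero, add_zero] at h4
    have h5 := M.L_pos (M.adj_nx' d.2)
    have h7 := M.L_pos (adj_prev (M.adj_nx' d.2))
    have h8 := h3.L_pos
    refine pos_of_mul_pos_left (b := M.L d.1.2 (M.x (M.nx d.1.1 d.1.2))) ?_ h5.le
    rw [← h4]
    positivity
  | right d hR hd ih =>
    have h1 : SameFace D (Dart.φ M (Dart.φ M d)) := h.trans (Dart.Rel.τ hd).symm
    have h0 : SameFace D d := h1.trans Dart.Rel.φ_φ.symm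
    obtain ⟨h2, h3, p, q, r, s, hp, hq, hr, hs, heq⟩ := ih h0
    have hv := visible_of_relation hE h0 hp hr hs heq
    obtain ⟨p1, q1, r1, s1, hp1, hq1, hr1, hs1, heq1⟩ := exists_relation_of_cop hE hd
    simp only [Dart.φ_fst, Dart.φ_snd, Dart.τ_fst, Dart.τ_snd, M.nx_nx d.2, nx_nx_nx d.2]
      at heq1 ⊢
    refine ⟨h2, hv, ?_⟩
    have heq2 : (p1 * p / s) • M.x u + q1 • M.x (M.nx d.1.1 (M.nx d.1.1 d.1.2)) =
        (s1 + p1 * r / s) • M.x d.1.1 + (r1 - p1 * q / s) • M.x (M.nx d.1.1 d.1.2) := by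
      have h5 : M.x d.1.2 = s⁻¹ • (s • M.x d.1.2) := by
        rw [smul_smul, inv_mul_cancel₀ hs.ne', one_smul]
      rw [h5, ← sub_eq_of_eq_add' heq] at heq1
      rw [← sub_eq_zero] at heq1 ⊢
      rw [← heq1]
      match_scalars <;> field_simp <;> ring
    refine ⟨_, _, _, _, by positivity, hq1, by positivity, ?_, heq2⟩
    have h4 := congrArg (M.L d.1.1) heq2
    simp only [map_add, map_smul, smul_eq_mul, M.L_self, mul_zero, zero_add] at h4
    have h5 := M.L_pos (adj_nx d.2)
    have h7 := M.L_pos (adj_nx (adj_nx d.2))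
    have h8 := h2.L_pos
    refine pos_of_mul_pos_left (b := M.L d.1.1 (M.x (M.nx d.1.1 d.1.2))) ?_ h5.le
    rw [← h4]
    positivity

/-- A triangle in the face of `u`. -/
def Near (u : V) (d : M.Dart) : Prop :=
  d.1.1 = u ∨ d.1.2 = u ∨ M.nx d.1.1 d.1.2 = u ∨ Reach u d ∨ Reach u (Dart.φ M d) ∨
    Reach u (Dart.φ M (Dart.φ M d))

omit [FiniteDimensional ℝ E] hE in
lemma Near.φ (h : Near u d) : Near u (Dart.φ M d) := by
  unfold Near at *
  simp only [Dart.φ_fst, Dart.φ_snd, M.nx_nx d.2, Dart.φ_φ_φ]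
  tauto

lemma Near.τ (h : Near u d) (hd : d ∈ M.cop) : Near u (Dart.τ M d) := by
  rcases h with h | h | h | h | h | h
  · exact .inr (.inl h)
  · exact .inl h
  · exact .inr (.inr (.inr (.inl (.base _ (cop_τ hE hd) h))))
  · cases h with
    | base _ hu => exact .inr (.inr (.inl (by assumption)))
    | left d' h1 h2 => exact .inr (.inr (.inr (.inr (.inr (by simpa using h1)))))
    | right d' h1 h2 => exact .inr (.inr (.inr (.inr (.inl (by simpa using h1)))))
  · have h1 : Dart.φ M (Dart.φ M (Dart.φ M d)) ∈ M.cop := by simpa using hd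
    have := Reach.right _ h h1
    exact .inr (.inr (.inr (.inl (by simpa using this))))
  · have h1 : Dart.φ M (Dart.φ M (Dart.φ M d)) ∈ M.cop := by simpa using hd
    have := Reach.left _ h h1
    exact .inr (.inr (.inr (.inl (by simpa using this))))

/-- The vertices of a face are seen from a vertex of this face in its angular sector. -/
lemma InFace.visible {w : V} (hu : InFace D u) (hw : InFace D w) (hne : u ≠ w) :
    Visible D u w := by
  obtain ⟨e, he, rfl⟩ := hu
  obtain ⟨d, hd, rfl⟩ := hw
  have hN : Near e.1.1 d := by
    have h1 : Near e.1.1 e := .inl rfl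
    refine (Dart.Rel.mem_iff (A := {d | Near e.1.1 d}) (fun d => ⟨fun h => ?_, Near.φ⟩)
      (fun d hd => ⟨fun h => ?_, fun h => h.τ hE hd⟩) (he.symm.trans hd)).1 h1
    · have := Near.φ (Near.φ h)
      rwa [Dart.φ_φ_φ] at this
    · have := Near.τ hE h (cop_τ hE hd)
      rwa [Dart.τ_τ] at this
  rcases hN with h | h | h | h | h | h
  · exact absurd h.symm hne
  · rw [← h]; exact visible_start hE hd
  · rw [← h]; exact visible_apex hE hd
  · exact (h.visible hE hd).1
  · have := (h.visible hE (hd.trans Dart.Rel.φ)).2.2.1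
    simpa [M.nx_nx d.2] using this
  · have := (h.visible hE (hd.trans Dart.Rel.φ_φ)).2.1
    simpa [M.nx_nx d.2] using this

lemma InFace.L_pos {w : V} (hu : InFace D u) (hw : InFace D w) (hne : u ≠ w) :
    0 < M.L w (M.x u) := (hu.visible hE hw hne).L_pos

/-- Three vertices of a face are not aligned. -/
lemma linearIndependent_of_inFace {a b c : V} (ha : InFace D a) (hb : InFace D b)
    (hc : InFace D c) (hab : a ≠ b) (hac : a ≠ c) (hbc : b ≠ c) {α β γ : ℝ}
    (h : α • M.x a + β • M.x b + γ • M.x c = 0) : α = 0 ∧ β = 0 ∧ γ = 0 := by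
  have h1 := congrArg (M.L a) h
  have h2 := congrArg (M.L b) h
  have h3 := congrArg (M.L c) h
  simp only [map_add, map_smul, smul_eq_mul, M.L_self, map_zero, mul_zero, zero_add,
    add_zero] at h1 h2 h3
  have a1 := hb.L_pos hE ha hab.symm
  have a2 := hc.L_pos hE ha hac.symm
  have b1 := ha.L_pos hE hb hab
  have b2 := hc.L_pos hE hb hbc.symm
  have c1 := ha.L_pos hE hc hac
  have c2 := hb.L_pos hE hc hbc
  have e1 : SignType.sign α = SignType.sign (-γ) := by
    have : α * M.L b (M.x a) = (-γ) * M.L b (M.x c) := by linarith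
    have := congrArg SignType.sign this
    rwa [sign_mul, sign_mul, sign_pos b1, sign_pos b2, mul_one, mul_one] at this
  have e2 : SignType.sign α = SignType.sign (-β) := by
    have : α * M.L c (M.x a) = (-β) * M.L c (M.x b) := by linarith
    have := congrArg SignType.sign this
    rwa [sign_mul, sign_mul, sign_pos c1, sign_pos c2, mul_one, mul_one] at this
  have e3 : SignType.sign β = SignType.sign (-γ) := by
    have : β * M.L a (M.x b) = (-γ) * M.L a (M.x c) := by linarith
    have := congrArg SignType.sign this
    rwa [sign_mul, sign_mul, sign_pos a1, sign_pos a2, mul_one, mul_one] at this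
  rcases lt_trichotomy α 0 with h | h | h <;> rcases lt_trichotomy β 0 with h' | h' | h' <;>
    rcases lt_trichotomy γ 0 with h'' | h'' | h'' <;> simp_all

end OSurf

namespace OSurf

variable {E V : Type*} [AddCommGroup E] [Module ℝ E] {M : OSurf E V} {Z : V → Dual ℝ E}
variable {D d : M.Dart} {p q u v w e : V}

/-- The edge `pe` is on the boundary of the face of `D`. -/
def IsEnd (D : M.Dart) (p e : V) : Prop := ∃ h : M.adj p e,
  (SameFace D ⟨(p, e), h⟩ ∧ ND D (M.x (M.nx e p)) ≠ 0) ∨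
    (SameFace D ⟨(e, p), M.adj_symm h⟩ ∧ ND D (M.x (M.nx p e)) ≠ 0)

lemma InFace.of_fst (h : SameFace D d) : InFace D d.1.1 := ⟨d, h, rfl⟩

lemma InFace.of_snd (h : SameFace D d) : InFace D d.1.2 := ⟨_, h.trans Dart.Rel.φ, rfl⟩

lemma InFace.of_nx (h : SameFace D d) : InFace D (M.nx d.1.1 d.1.2) :=
  ⟨_, h.trans Dart.Rel.φ_φ, rfl⟩

lemma IsEnd.adj (h : IsEnd D p e) : M.adj p e := h.1

lemma IsEnd.inFace (h : IsEnd D p e) : InFace D e := by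
  obtain ⟨h0, h | h⟩ := h
  · exact InFace.of_snd h.1
  · exact InFace.of_fst h.1

lemma IsEnd.inFace' (h : IsEnd D p e) : InFace D p := by
  obtain ⟨h0, h | h⟩ := h
  · exact InFace.of_fst h.1
  · exact InFace.of_snd h.1

variable [FiniteDimensional ℝ E] (hE : finrank ℝ E = 4)
include hE

/-- The triangles of a face at one of its vertices. -/
lemma InFace.exists_run (hp : InFace D p) : ∃ q' q, M.IsZeroRun (ND D) p q' q ∧
    ∀ a (h : M.adj p a), SameFace D ⟨(p, a), h⟩ ↔
      ND D (M.x a) = 0 ∧ ND D (M.x (M.nx p a)) = 0 := by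
  have hp0 := hp.ND_eq_zero hE
  obtain ⟨⟨⟨p', b⟩, hb⟩, hd, hpe⟩ := hp
  change p' = p at hpe
  subst hpe
  have hb0 := (InFace.of_snd hd).ND_eq_zero hE
  have hb1 := (InFace.of_nx hd).ND_eq_zero hE
  obtain ⟨q', q, hr⟩ := exists_isZeroRun hE (M.N_ne D.2) hp0 hb hb0 hb1
  refine ⟨q', q, hr, fun a ha => ⟨fun h => ⟨(InFace.of_snd h).ND_eq_zero hE,
    (InFace.of_nx h).ND_eq_zero hE⟩, fun h => ?_⟩⟩
  have key := hr.iff_of_step (R := fun a => ∃ h : M.adj p' a, SameFace D ⟨(_, a), h⟩)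
    (exists_adj_ne_zero hE (M.N_ne D.2) hp0) (fun a ha h0 h1 h2 => ?_) ha h.1 h.2 hb hb0 hb1
  · obtain ⟨_, h⟩ := key.2 ⟨hb, hd⟩
    exact h
  · obtain ⟨k, -, hk⟩ := eq_smul_N_of_zero hE (M.N_ne D.2) hp0 ha h0 h1
    have hk0 : k ≠ 0 := by
      rintro rfl
      exact M.N_ne D.2 (by simpa using hk)
    have hc : Dart.φ M (Dart.φ M ⟨(p', a), ha⟩) ∈ M.cop := by
      simp only [cop, Set.mem_ofPred_eq]
      have h3 : ND (Dart.φ M (Dart.φ M ⟨(p', a), ha⟩)) = M.N p' a := by rw [ND_φ, ND_φ]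
      rw [show M.N _ _ = M.N p' a from h3]
      simp only [Dart.φ_fst, Dart.φ_snd, M.nx_nx ha]
      change M.N D.1.1 D.1.2 = _ at hk
      change M.N D.1.1 D.1.2 _ = 0 at h2
      rw [hk] at h2
      simpa [hk0] using h2
    have h4 : SameFace (⟨(p', a), ha⟩ : M.Dart) ⟨(p', M.nx p' a), adj_nx ha⟩ := by
      have := Dart.Rel.φ_φ.trans (Dart.Rel.τ hc)
      rwa [Dart.τ_φ_φ] at this
    exact ⟨fun ⟨_, h⟩ => ⟨_, h.trans h4⟩, fun ⟨_, h⟩ => ⟨_, h.trans h4.symm⟩⟩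

/-- A vertex of a face is the origin of two edges of the boundary of the face, and the face is
contained in the sector that they span. -/
lemma InFace.exists_ends (hp : InFace D p) : ∃ d₁ d₂, d₁ ≠ d₂ ∧ IsEnd D p d₁ ∧ IsEnd D p d₂ ∧
    (∀ e, IsEnd D p e → e = d₁ ∨ e = d₂) ∧
    ∀ u, InFace D u → u ≠ p → ∃ b c k : ℝ, 0 ≤ b ∧ 0 ≤ c ∧
      M.x u = b • M.x d₁ + c • M.x d₂ + k • M.x p := by
  obtain ⟨d₁, d₂, hr, hiff⟩ := hp.exists_run hE
  have h1 := (hr.first d₁ hr.adj_first).2 rfl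
  have h2 := (hr.last d₂ hr.adj_last).2 rfl
  refine ⟨d₁, d₂, hr.ne, ⟨hr.adj_first, .inl ⟨(hiff _ _).2 ⟨h1.1, hr.first_next⟩, h1.2⟩⟩,
    ⟨hr.adj_last, .inr ⟨?_, h2.2⟩⟩, ?_, ?_⟩
  · have h3 := (hiff _ (adj_prev hr.adj_last)).2 ⟨hr.last_prev, by
      rw [nx_prev hr.adj_last]; exact h2.1⟩
    have h4 : Dart.φ M ⟨(d₂, p), M.adj_symm hr.adj_last⟩ = ⟨(p, M.nx d₂ p), adj_prev hr.adj_last⟩ :=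
      rfl
    rw [← h4] at h3
    exact h3.trans Dart.Rel.φ.symm
  · rintro e ⟨he, h | h⟩
    · exact .inl ((hr.first e he).1 ⟨((hiff _ _).1 h.1).1, h.2⟩)
    · exact .inr ((hr.last e he).1 ⟨(InFace.of_fst h.1).ND_eq_zero hE, h.2⟩)
  · intro u hu hup
    obtain ⟨⟨⟨_, a⟩, ha⟩, hd, rfl, α, β, γ, hα, hβ, -, hx⟩ := hu.visible hE hp hup
    have h3 := (hiff a ha).1 hd
    obtain ⟨b, c, k, hb, hc, h⟩ := hr.mem_cone a ha h3.1
    obtain ⟨b', c', k', hb', hc', h'⟩ := hr.mem_cone _ (adj_nx ha) h3.2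
    refine ⟨α * b + β * b', α * c + β * c', α * k + β * k' + γ, by positivity, by positivity, ?_⟩
    rw [hx]
    change α • M.x a + β • M.x (M.nx _ a) + _ = _
    rw [h, h']
    module

/-- A trivial triangle belongs to a trivial face. -/
lemma IsFlex.zeroTri_of_sameFace (hZ : M.IsFlex Z) (h : SameFace D d) (hD : D ∉ M.nz Z) :
    d ∉ M.nz Z := by
  have key : ∀ d ∈ M.cop, d ∉ M.nz Z → Dart.τ M d ∉ M.nz Z := by
    intro d hd h
    simp only [nz, Set.mem_ofPred_eq, not_not] at h
    have h0 := hd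
    obtain ⟨p, q, r, s, hp, hq, hr, hs, heq⟩ := exists_relation_of_cop hE h0
    rw [hZ.mem_nz_iff]
    obtain ⟨h1, h2, h3⟩ := h
    have e1 := congrArg (Z d.1.1) heq
    have e2 := congrArg (Z d.1.2) heq
    have h4 : Z d.1.2 (M.x d.1.1) = 0 := by rw [hZ.anti (M.adj_symm d.2), h1, neg_zero]
    simp only [map_add, map_smul, smul_eq_mul, hZ.self, h1, h2, h3, h4, mul_zero, add_zero,
      zero_add] at e1 e2
    have e3 := (mul_eq_zero.1 e1).resolve_left hq.ne'
    have e4 := (mul_eq_zero.1 e2).resolve_left hq.ne'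
    have e5 : Z (M.nx d.1.2 d.1.1) (M.x d.1.2) = 0 := by
      rw [hZ.anti (M.adj_symm (adj_nx (M.adj_symm d.2))), e4, neg_zero]
    simp [M.nx_nx (M.adj_symm d.2), h4, e3, e5]
  exact (Dart.Rel.mem_iff (A := (M.nz Z)ᶜ) (fun d => not_congr hZ.nz_φ)
    (fun d hd => ⟨fun h => by
      have := key _ (cop_τ hE hd) h
      rwa [Dart.τ_τ] at this, key d hd⟩) h).1 hD

/-- The velocities of the vertices of a trivial face are orthogonal to the face. -/
lemma IsFlex.eq_smul_ND (hZ : M.IsFlex Z) (hD : D ∉ M.nz Z) (hv : InFace D v) :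
    ∃ k : ℝ, Z v = k • ND D := by
  obtain ⟨d, hd, rfl⟩ := hv
  have h := hZ.zeroTri_of_sameFace hE hd hD
  simp only [nz, Set.mem_ofPred_eq, not_not] at h
  exact exists_eq_smul_of_three hE (M.N_ne D.2) (M.indep d.2) (hZ.self _) h.1 h.2.2
    ((InFace.of_fst hd).ND_eq_zero hE) ((InFace.of_snd hd).ND_eq_zero hE)
    ((InFace.of_nx hd).ND_eq_zero hE)

lemma IsFlex.apply_ne_zero (hZ : M.IsFlex Z) (hD : D ∉ M.nz Z) (hv : InFace D v) (h0 : Z v ≠ 0)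
    (hw : ND D (M.x w) ≠ 0) : Z v (M.x w) ≠ 0 := by
  obtain ⟨k, hk⟩ := hZ.eq_smul_ND hE hD hv
  have : k ≠ 0 := by rintro rfl; exact h0 (by simpa using hk)
  rw [hk, LinearMap.smul_apply, smul_eq_mul]
  exact mul_ne_zero this hw

/-- An edge of the boundary of a trivial face with exactly one trivial end. -/
lemma IsEnd.mem_bdry₀ (h : IsEnd D p e) (hZ : M.IsFlex Z) (hD : D ∉ M.nz Z) (hp : Z p = 0)
    (he : Z e ≠ 0) : (⟨(p, e), h.adj⟩ : M.Dart) ∈ M.bdry₀ Z := by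
  refine ⟨?_, hp⟩
  have hin := h.inFace
  obtain ⟨h0, ⟨h1, h2⟩ | ⟨h1, h2⟩⟩ := h
  · have h3 := hZ.zeroTri_of_sameFace hE h1 hD
    have h4 := hZ.apply_ne_zero hE hD hin he h2
    have h5 : Dart.τ M ⟨(p, e), h0⟩ ∈ M.nz Z := fun hz => h4 hz.2.2
    simp [bdry, h3, h5]
  · have h3 := hZ.zeroTri_of_sameFace hE h1 hD
    have h4 := hZ.apply_ne_zero hE hD hin he h2
    have h5 : (⟨(p, e), h0⟩ : M.Dart) ∈ M.nz Z := fun hz => h4 hz.2.1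
    have h6 : Dart.τ M ⟨(p, e), h0⟩ ∉ M.nz Z := h3
    simp [bdry, h5, h6]

/-- A functional which vanishes at three vertices of a face vanishes on the face. -/
lemma InFace.apply_eq_zero {a b c : V} (ha : InFace D a) (hb : InFace D b)
    (hc : InFace D c) (hab : a ≠ b) (hac : a ≠ c) (hbc : b ≠ c) {H : Dual ℝ E}
    (h1 : H (M.x a) = 0) (h2 : H (M.x b) = 0) (h3 : H (M.x c) = 0) (hw : InFace D w) :
    H (M.x w) = 0 := by
  obtain ⟨α, β, γ, δ, heq, hne⟩ := exists_relation_four hE (M.N_ne D.2) (hw.ND_eq_zero hE)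
    (ha.ND_eq_zero hE) (hb.ND_eq_zero hE) (hc.ND_eq_zero hE)
  have hα : α ≠ 0 := by
    rintro rfl
    rw [zero_smul, zero_add] at heq
    exact hne ⟨rfl, linearIndependent_of_inFace hE ha hb hc hab hac hbc heq⟩
  have := congrArg H heq
  simpa [h1, h2, h3, hα] using this

/-- Among the vertices with zero velocity of a trivial face, those which are extreme when seen from
a vertex with nonzero velocity. -/
lemma exists_extreme (hfin : {d | SameFace D d}.Finite) (hv : InFace D v) (hv0 : Z v ≠ 0) (hu : InFace D u)
    (hu0 : Z u = 0) {F : Dual ℝ E} (hF : F (M.x v) = 0)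
    (hF' : ∀ ρ : ℝ, ∃ w, InFace D w ∧ F (M.x w) ≠ ρ * M.L v (M.x w)) :
    ∃ p d, InFace D p ∧ Z p = 0 ∧ IsEnd D p d ∧ Z d ≠ 0 ∧ ∃ H : Dual ℝ E, H (M.x v) = 0 ∧
      H (M.x p) = 0 ∧ (∃ w, InFace D w ∧ H (M.x w) ≠ 0) ∧
      (∃ ρ : ℝ, H = F - ρ • M.L v) ∧
      ∀ w, InFace D w → Z w = 0 → H (M.x w) ≤ 0 := by
  have hfin' : {w | InFace D w ∧ Z w = 0}.Finite := by
    refine (hfin.image fun d => d.1.1).subset ?_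
    rintro w ⟨⟨e, he, rfl⟩, -⟩
    exact ⟨e, he, rfl⟩
  obtain ⟨p, ⟨hp, hp0⟩, hmax⟩ := Set.exists_max_image _ (fun u => F (M.x u) / M.L v (M.x u)) hfin'
    ⟨u, hu, hu0⟩
  have hpv : p ≠ v := by rintro rfl; exact hv0 hp0
  set ρ := F (M.x p) / M.L v (M.x p) with hρ
  set H : Dual ℝ E := F - ρ • M.L v with hH
  have hHx : ∀ w, H (M.x w) = F (M.x w) - ρ * M.L v (M.x w) := fun _ => rfl
  have hHv : H (M.x v) = 0 := by rw [hHx, hF, M.L_self]; ring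
  have hHp : H (M.x p) = 0 := by
    have := hp.L_pos hE hv hpv
    rw [hHx, hρ]; field_simp; ring
  have hHw : ∃ w, InFace D w ∧ H (M.x w) ≠ 0 := by
    obtain ⟨w, hw, hne⟩ := hF' ρ
    exact ⟨w, hw, by rw [hHx]; exact sub_ne_zero.2 hne⟩
  have hle : ∀ w, InFace D w → Z w = 0 → H (M.x w) ≤ 0 := by
    intro w hw hw0
    have hwv : w ≠ v := by rintro rfl; exact hv0 hw0
    have h1 := hw.L_pos hE hv hwv
    have h2 := hmax w ⟨hw, hw0⟩
    rw [div_le_iff₀ h1] at h2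
    rw [hHx]; linarith
  have hne0 : ∀ d, IsEnd D p d → d ≠ v → H (M.x d) ≠ 0 := by
    intro d hd hdv h0
    obtain ⟨w, hw, hne⟩ := hHw
    exact hne (hd.inFace.apply_eq_zero hE hv hp hdv (ne_of_adj hd.adj).symm hpv.symm h0 hHv hHp hw)
  obtain ⟨d₁, d₂, -, h₁, h₂, -, hcone⟩ := hp.exists_ends hE
  suffices ∃ d, IsEnd D p d ∧ Z d ≠ 0 by
    obtain ⟨d, hd, hd0⟩ := this
    exact ⟨p, d, hp, hp0, hd, hd0, H, hHv, hHp, hHw, ⟨ρ, rfl⟩, hle⟩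
  by_contra hcon
  push Not at hcon
  have e1 : d₁ ≠ v := by rintro rfl; exact hv0 (hcon _ h₁)
  have e2 : d₂ ≠ v := by rintro rfl; exact hv0 (hcon _ h₂)
  have f1 := lt_of_le_of_ne (hle _ h₁.inFace (hcon _ h₁)) (hne0 _ h₁ e1)
  have f2 := lt_of_le_of_ne (hle _ h₂.inFace (hcon _ h₂)) (hne0 _ h₂ e2)
  obtain ⟨b, c, k, hb, hc, hx⟩ := hcone v hv hpv.symm
  have h3 := congrArg H hx
  simp only [map_add, map_smul, smul_eq_mul, hHv, hHp, mul_zero, add_zero] at h3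
  have hb0 : b = 0 := by nlinarith
  have hc0 : c = 0 := by nlinarith
  have h4 := hv.L_pos hE hp hpv.symm
  rw [hx, hb0, hc0] at h4
  simp [M.L_self] at h4

omit [FiniteDimensional ℝ E] hE in
/-- A functional vanishing at `v`, not proportional to `L v` on the face. -/
lemma InFace.exists_functional (hv : InFace D v) : ∃ F : Dual ℝ E, F (M.x v) = 0 ∧
    ∀ ρ : ℝ, ∃ w, InFace D w ∧ F (M.x w) ≠ ρ * M.L v (M.x w) := by
  obtain ⟨d, hd, rfl⟩ := hv
  obtain ⟨F, hF⟩ := exists_dual_eq (M.indep d.2) ![0, 1, 0]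
  have h0 := hF 0
  have h1 := hF 1
  have h2 := hF 2
  simp at h0 h1 h2
  refine ⟨F, h0, fun ρ => ?_⟩
  by_contra hcon
  push Not at hcon
  have h3 := hcon _ (InFace.of_snd hd)
  have h4 := hcon _ (InFace.of_nx hd)
  rw [h1] at h3
  rw [h2] at h4
  have h5 := M.L_pos (adj_nx d.2)
  have : ρ = 0 := by simpa [h5.ne'] using h4.symm
  rw [this] at h3
  simp at h3

/-- The two extreme vertices with zero velocity of a trivial face, seen from a vertex with nonzero
velocity. -/
lemma exists_extreme_pair (hfin : {d | SameFace D d}.Finite) (hv : InFace D v) (hv0 : Z v ≠ 0) (hu : InFace D u)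
    (hu0 : Z u = 0) (hw : InFace D w) (hw0 : Z w = 0) (huw : u ≠ w) :
    ∃ p q, p ≠ q ∧ InFace D p ∧ InFace D q ∧ Z p = 0 ∧ Z q = 0 ∧
      (∃ d, IsEnd D p d ∧ Z d ≠ 0) ∧ (∃ d, IsEnd D q d ∧ Z d ≠ 0) ∧
      ∀ u, InFace D u → Z u = 0 → u ≠ p → u ≠ q →
        ∃ α β γ : ℝ, 0 < α ∧ 0 < β ∧ γ < 0 ∧ M.x u = α • M.x p + β • M.x q + γ • M.x v := by
  obtain ⟨F, hF, hF'⟩ := hv.exists_functional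
  obtain ⟨p, d, hp, hp0, hd, hd0, H, hHv, hHp, hHw, ⟨ρ, hρ⟩, hH⟩ :=
    exists_extreme hE hfin hv hv0 hu hu0 hF hF'
  obtain ⟨q, d', hq, hq0, hd', hd0', H', hHv', hHq, hHw', ⟨ρ', hρ'⟩, hH'⟩ :=
    exists_extreme hE hfin hv hv0 hu hu0 (F := -F) (by simp [hF]) (fun ρ => by
      obtain ⟨w, hw, hne⟩ := hF' (-ρ)
      exact ⟨w, hw, fun h => hne (by simp only [LinearMap.neg_apply] at h; linarith)⟩)
  have hne : ∀ u, Z u = 0 → u ≠ v := by rintro _ h rfl; exact hv0 h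
  have hpq : p ≠ q := by
    rintro rfl
    have hρρ : ρ' = -ρ := by
      have h1 := hHp
      have h2 := hHq
      rw [hρ] at h1
      rw [hρ'] at h2
      simp only [LinearMap.sub_apply, LinearMap.neg_apply, LinearMap.smul_apply, smul_eq_mul]
        at h1 h2
      have h3 : (ρ' + ρ) * M.L v (M.x p) = 0 := by linarith
      have := (mul_eq_zero.1 h3).resolve_right (hp.L_pos hE hv (hne _ hp0)).ne'
      linarith
    have hHH : ∀ u, InFace D u → Z u = 0 → H (M.x u) = 0 := by
      intro u hu hu0
      have h1 := hH u hu hu0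
      have h2 := hH' u hu hu0
      rw [hρ] at h1 ⊢
      rw [hρ', hρρ] at h2
      simp only [LinearMap.sub_apply, LinearMap.neg_apply, LinearMap.smul_apply, smul_eq_mul]
        at h1 h2 ⊢
      linarith
    obtain ⟨t, ht, htne⟩ := hHw
    exact htne (hv.apply_eq_zero hE hu hw (hne _ hu0).symm (hne _ hw0).symm huw hHv
      (hHH _ hu hu0) (hHH _ hw hw0) ht)
  have hneg : ∀ {K : Dual ℝ E} {a b : V}, a ≠ b → InFace D a → InFace D b → Z a = 0 → Z b = 0 →
      K (M.x v) = 0 → K (M.x a) = 0 → (∃ w, InFace D w ∧ K (M.x w) ≠ 0) →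
      (∀ w, InFace D w → Z w = 0 → K (M.x w) ≤ 0) → K (M.x b) < 0 := by
    rintro K a b hab ha hb ha0 hb0 h1 h2 ⟨t, ht, hne'⟩ h4
    refine lt_of_le_of_ne (h4 b hb hb0) fun h => hne' ?_
    exact hv.apply_eq_zero hE ha hb (hne _ ha0).symm (hne _ hb0).symm hab h1 h2 h ht
  refine ⟨p, q, hpq, hp, hq, hp0, hq0, ⟨d, hd, hd0⟩, ⟨d', hd', hd0'⟩, ?_⟩
  intro t ht ht0 htp htq
  obtain ⟨δ, α, β, γ, heq, hne4⟩ := exists_relation_four hE (M.N_ne D.2) (ht.ND_eq_zero hE)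
    (hp.ND_eq_zero hE) (hq.ND_eq_zero hE) (hv.ND_eq_zero hE)
  have hδ : δ ≠ 0 := by
    rintro rfl
    rw [zero_smul, zero_add] at heq
    exact hne4 ⟨rfl, linearIndependent_of_inFace hE hp hq hv hpq (hne _ hp0) (hne _ hq0) heq⟩
  have hx : M.x t = (-α / δ) • M.x p + (-β / δ) • M.x q + (-γ / δ) • M.x v := by
    have h1 : M.x t = δ⁻¹ • (δ • M.x t) := by rw [smul_smul, inv_mul_cancel₀ hδ, one_smul]
    have h2 : δ • M.x t = -(α • M.x p + β • M.x q + γ • M.x v) := by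
      rw [eq_neg_iff_add_eq_zero, ← heq]; abel
    rw [h1, h2]
    match_scalars <;> field_simp
  have e1 := congrArg H hx
  have e2 := congrArg H' hx
  have e3 := congrArg (M.L t) hx
  simp only [map_add, map_smul, smul_eq_mul, hHv, hHp, hHv', hHq, M.L_self, mul_zero, zero_add,
    add_zero] at e1 e2 e3
  have g1 := hneg hpq hp hq hp0 hq0 hHv hHp hHw hH
  have g2 := hneg hpq.symm hq hp hq0 hp0 hHv' hHq hHw' hH'
  have g3 := hneg htp.symm hp ht hp0 ht0 hHv hHp hHw hH
  have g4 := hneg htq.symm hq ht hq0 ht0 hHv' hHq hHw' hH'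
  have hβ : 0 < -β / δ := by by_contra h; nlinarith
  have hα : 0 < -α / δ := by by_contra h; nlinarith
  refine ⟨_, _, _, hα, hβ, ?_, hx⟩
  have k1 := mul_pos hα (hp.L_pos hE ht htp.symm)
  have k2 := mul_pos hβ (hq.L_pos hE ht htq.symm)
  have k3 := hv.L_pos hE ht (hne _ ht0).symm
  by_contra h
  nlinarith

end OSurf

namespace OSurf

variable {E V : Type*} [AddCommGroup E] [Module ℝ E] {M : OSurf E V} {Z : V → Dual ℝ E}
variable {D D' d : M.Dart} {p q u v w e : V}

lemma SameFace.symm (h : SameFace D d) : SameFace d D := Dart.Rel.symm h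

lemma SameFace.trans (h : SameFace D d) (h' : SameFace d D') : SameFace D D' := Dart.Rel.trans h h'

lemma SameFace.refl (D : M.Dart) : SameFace D D := Dart.Rel.refl

lemma IsFlex.mem_bdry_iff (hZ : M.IsFlex Z) {a : V} (ha : M.adj p a) :
    (⟨(p, a), ha⟩ : M.Dart) ∈ M.bdry Z ↔ ¬ (M.ZeroTri Z p a ↔ M.ZeroTri Z p (M.nx a p)) := by
  simp only [bdry, Set.mem_ofPred_eq, hZ.mem_nz_τ ha]
  rw [show (⟨(p, a), ha⟩ : M.Dart) ∈ M.nz Z ↔ ¬ M.ZeroTri Z p a from Iff.rfl]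
  tauto

/-- A vertex which is the origin of an edge between a trivial and a nontrivial triangle is the
origin of another one. -/
lemma IsFlex.exists_second_mem_bdry₀ (hZ : M.IsFlex Z) (hd : d ∈ M.bdry₀ Z) :
    ∃ d' ∈ M.bdry₀ Z, d' ≠ d ∧ d'.1.1 = d.1.1 := by
  obtain ⟨⟨p, a⟩, ha⟩ := d
  obtain ⟨hb, h0⟩ := hd
  by_contra hcon
  push Not at hcon
  have key := nx_induction (P := fun b => M.ZeroTri Z p b ↔ M.ZeroTri Z p a) ha Iff.rfl
    (fun b hb ih => by
      by_cases hba : M.nx p b = a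
      · rw [hba]
      · have h1 : (⟨(p, M.nx p b), adj_nx hb⟩ : M.Dart) ∉ M.bdry Z := fun h =>
          hcon _ ⟨h, h0⟩ (fun h => hba (congrArg (fun d : M.Dart => d.1.2) h)) rfl
        rw [hZ.mem_bdry_iff, not_not, prev_nx hb] at h1
        exact h1.trans ih)
  rw [hZ.mem_bdry_iff] at hb
  exact hb (key _ (adj_prev ha)).symm

lemma IsEnd.congr (h : SameFace D D') (hE : finrank ℝ E = 4) [FiniteDimensional ℝ E]
    (he : IsEnd D' p e) : IsEnd D p e := by
  obtain ⟨k, hk, hN⟩ := h.exists_pos_smul hE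
  have hx : ∀ x, ND D' x ≠ 0 → ND D x ≠ 0 := by
    intro x hx h0
    rw [hN, LinearMap.smul_apply, h0, smul_zero] at hx
    exact hx rfl
  obtain ⟨h0, h1 | h1⟩ := he
  · exact ⟨h0, .inl ⟨h.trans h1.1, hx _ h1.2⟩⟩
  · exact ⟨h0, .inr ⟨h.trans h1.1, hx _ h1.2⟩⟩

lemma IsEnd.exists_side (h : IsEnd D p e) :
    ∃ d : M.Dart, SameFace D d ∧ (d = ⟨(p, e), h.adj⟩ ∨ Dart.τ M d = ⟨(p, e), h.adj⟩) := by
  obtain ⟨h0, h1 | h1⟩ := h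
  · exact ⟨_, h1.1, .inl rfl⟩
  · exact ⟨_, h1.1, .inr rfl⟩

variable [FiniteDimensional ℝ E] (hE : finrank ℝ E = 4)
include hE

lemma isEnd_of_not_sameFace (h : SameFace D d) (h' : ¬ SameFace D (Dart.τ M d)) :
    IsEnd D d.1.1 d.1.2 ∧ IsEnd D d.1.2 d.1.1 := by
  have h1 : ND D (M.x (M.nx d.1.2 d.1.1)) ≠ 0 := by
    intro h0
    obtain ⟨k, hk, hN⟩ := h.exists_pos_smul hE
    refine h' (h.trans (Dart.Rel.τ ?_))
    change ND d _ = 0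
    rw [hN, LinearMap.smul_apply, h0, smul_zero]
  exact ⟨⟨d.2, .inl ⟨h, h1⟩⟩, ⟨M.adj_symm d.2, .inr ⟨h, h1⟩⟩⟩

/-- The sector of a face at a vertex, seen from one end. -/
lemma IsEnd.exists_other (h : IsEnd D p e) : ∃ z, z ≠ e ∧ IsEnd D p z ∧
    (∀ a, IsEnd D p a → a = e ∨ a = z) ∧
    ∀ u, InFace D u → u ≠ p → ∃ b c k : ℝ, 0 ≤ b ∧ 0 ≤ c ∧
      M.x u = b • M.x e + c • M.x z + k • M.x p := by
  obtain ⟨d₁, d₂, hne, h₁, h₂, huniq, hcone⟩ := h.inFace'.exists_ends hE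
  rcases huniq e h with rfl | rfl
  · exact ⟨d₂, hne.symm, h₂, huniq, hcone⟩
  · refine ⟨d₁, hne, h₁, fun a ha => (huniq a ha).symm, fun u hu hup => ?_⟩
    obtain ⟨b, c, k, hb, hc, hx⟩ := hcone u hu hup
    exact ⟨c, b, k, hc, hb, by rw [hx]; abel⟩

lemma InFace.exists_functional_eq {a b c : V} (ha : InFace D a) (hb : InFace D b)
    (hc : InFace D c) (hab : a ≠ b) (hac : a ≠ c) (hbc : b ≠ c) :
    ∃ H : Dual ℝ E, H (M.x a) = 0 ∧ H (M.x b) = 0 ∧ H (M.x c) = 1 := by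
  have hi : LinearIndependent ℝ ![M.x a, M.x b, M.x c] := by
    rw [Fintype.linearIndependent_iff]
    intro g hg
    simp only [Fin.sum_univ_three] at hg
    obtain ⟨h1, h2, h3⟩ := linearIndependent_of_inFace hE ha hb hc hab hac hbc hg
    intro i
    fin_cases i <;> assumption
  obtain ⟨H, hH⟩ := exists_dual_eq hi ![0, 0, 1]
  exact ⟨H, hH 0, hH 1, hH 2⟩

/-- Every vertex `u` of the face with zero velocity, other than `p` and `q`, is separated from `v`
by the line `pq`. -/
def Separated (Z : V → Dual ℝ E) (D : M.Dart) (p q v : V) : Prop :=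
  ∀ u, InFace D u → Z u = 0 → u ≠ p → u ≠ q →
    ∃ α β γ : ℝ, 0 < α ∧ 0 < β ∧ γ < 0 ∧ M.x u = α • M.x p + β • M.x q + γ • M.x v

omit [FiniteDimensional ℝ E] hE in
lemma Separated.swap (h : Separated Z D p q v) : Separated Z D q p v := by
  intro u hu hu0 h1 h2
  obtain ⟨α, β, γ, hα, hβ, hγ, hx⟩ := h u hu hu0 h2 h1
  exact ⟨β, α, γ, hβ, hα, hγ, by rw [hx]; abel⟩

lemma Separated.eq_of_isEnd (h : Separated Z D p q v) (hpq : IsEnd D p q) (hv : InFace D v)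
    (hvp : v ≠ p) (hvq : v ≠ q) (hu : InFace D u) (hu0 : Z u = 0) : u = p ∨ u = q := by
  by_contra hcon
  push Not at hcon
  obtain ⟨α, β, γ, hα, hβ, hγ, hx⟩ := h u hu hu0 hcon.1 hcon.2
  obtain ⟨z, hzq, hz, -, hcone⟩ := hpq.exists_other hE
  have hp := hpq.inFace'
  have hq := hpq.inFace
  have hpq' := ne_of_adj hpq.adj
  have hpz := ne_of_adj hz.adj
  obtain ⟨H, h1, h2, h3⟩ := hp.exists_functional_eq hE hq hz.inFace hpq' hpz hzq.symm
  have hnn : ∀ w, InFace D w → w ≠ p → 0 ≤ H (M.x w) := by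
    intro w hw hwp
    obtain ⟨b, c, k, hb, hc, hx⟩ := hcone w hw hwp
    rw [hx]
    simpa [h1, h2, h3] using hc
  have hvpos : 0 < H (M.x v) := lt_of_le_of_ne (hnn v hv hvp) fun h => by
    have := hp.apply_eq_zero hE hq hv hpq' hvp.symm hvq.symm h1 h2 h.symm hz.inFace
    rw [h3] at this
    exact one_ne_zero this
  have h4 := hnn u hu hcon.1
  rw [hx] at h4
  simp only [map_add, map_smul, smul_eq_mul, h1, h2, mul_zero, zero_add] at h4
  nlinarith

lemma Separated.eq_of_ends (h : Separated Z D p q e) (h' : Separated Z D p q w)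
    (he : IsEnd D p e)
    (hcone : ∃ b c k : ℝ, 0 ≤ b ∧ 0 ≤ c ∧ M.x q = b • M.x e + c • M.x w + k • M.x p)
    (hq : InFace D q) (hpq : p ≠ q) (hqe : q ≠ e) (hu : InFace D u) (hu0 : Z u = 0) :
    u = p ∨ u = q := by
  by_contra hcon
  push Not at hcon
  obtain ⟨α, β, γ, hα, hβ, hγ, hx⟩ := h u hu hu0 hcon.1 hcon.2
  obtain ⟨α', β', γ', hα', hβ', hγ', hx'⟩ := h' u hu hu0 hcon.1 hcon.2
  obtain ⟨H, h1, h2, h3⟩ := he.inFace'.exists_functional_eq hE hq he.inFace hpq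
    (ne_of_adj he.adj) hqe
  obtain ⟨b, c, k, hb, hc, hxq⟩ := hcone
  have e1 := congrArg H hx
  have e2 := congrArg H hx'
  have e3 := congrArg H hxq
  simp only [map_add, map_smul, smul_eq_mul, h1, h2, h3, mul_zero, zero_add, add_zero,
    mul_one] at e1 e2 e3
  have h4 : 0 < H (M.x w) := by nlinarith
  have hb0 : b = 0 := by nlinarith
  have hc0 : c = 0 := by
    subst hb0
    have : c * H (M.x w) = 0 := by linarith
    exact (mul_eq_zero.1 this).resolve_right h4.ne'
  have h5 := hq.L_pos hE he.inFace' hpq.symm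
  rw [hxq, hb0, hc0] at h5
  simp [M.L_self] at h5

/-- Two faces with two common vertices are adjacent along an edge. -/
lemma InFace.exists_edge (hpD : InFace D p) (hqD : InFace D q) (hpD' : InFace D' p)
    (hqD' : InFace D' q) (hpq : p ≠ q) (hne : ¬ SameFace D D') : ∃ d, SameFace D d ∧
      SameFace D' (Dart.τ M d) ∧ ((d.1.1 = p ∧ d.1.2 = q) ∨ (d.1.1 = q ∧ d.1.2 = p)) := by
  obtain ⟨⟨⟨p', a⟩, ha⟩, hd, hp', α, β, γ, hα, hβ, hαβ, hx⟩ := hqD.visible hE hpD hpq.symm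
  change p' = p at hp'
  subst hp'
  obtain ⟨⟨⟨p, b⟩, hb⟩, hd', hp', α', β', γ', hα', hβ', hαβ', hx'⟩ :=
    hqD'.visible hE hpD' hpq.symm
  change p = p' at hp'
  subst hp'
  change M.x q = α • M.x a + β • M.x (M.nx p a) + γ • M.x p at hx
  change M.x q = α' • M.x b + β' • M.x (M.nx p b) + γ' • M.x p at hx'
  have hsep := M.sep ha hb hα hβ hα' hβ' (c := γ' - γ) (by
    have := hx.symm.trans hx'
    rw [← sub_eq_zero] at this ⊢
    rw [← this]; module)
  have hab : a ≠ b := by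
    rintro rfl
    exact hne (SameFace.trans hd (SameFace.symm hd'))
  have hnab : M.nx p a ≠ M.nx p b := fun h => hab (nx_inj ha hb h)
  have hana : a ≠ M.nx p a := fun h => ne_of_adj (M.adj_nx' ha) h
  have hbnb : b ≠ M.nx p b := fun h => ne_of_adj (M.adj_nx' hb) h
  have hcyc : ¬ (a = M.nx p b ∧ b = M.nx p a) := by
    rintro ⟨h1, h2⟩
    obtain ⟨n, w, hn, hinj, hw, hnx⟩ := M.link p
    obtain ⟨i, hi⟩ := (hw a).1 ha
    rw [h2, ← hi, hnx, hnx, hinj.eq_iff, add_assoc, left_eq_add] at h1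
    have h3 : ((2 : ℕ) : ZMod n) = 0 := by push_cast; rw [← h1]; norm_num
    rw [ZMod.natCast_eq_zero_iff] at h3
    have := Nat.le_of_dvd two_pos h3
    omega
  have hq_of : ∀ {t : V} {c k : ℝ} {D₀ : M.Dart}, InFace D₀ p → InFace D₀ q → InFace D₀ t →
      t ≠ p → M.x q = c • M.x t + k • M.x p → q = t := by
    intro t c k D₀ h1 h2 h3 htp hx
    by_contra hqt
    have := linearIndependent_of_inFace hE (α := -1) (β := c) (γ := k) h2 h3 h1 hqt hpq.symm htp
      (by rw [hx]; module)
    linarith [this.1]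
  have ea := DFunLike.congr_fun hsep a
  have ena := DFunLike.congr_fun hsep (M.nx p a)
  have eb := DFunLike.congr_fun hsep b
  classical
  simp only [Finsupp.add_apply, Finsupp.single_apply, hab.symm, hana.symm, if_true, if_false,
    add_zero, zero_add, hana, hab, hnab.symm, hbnb.symm] at ea ena eb
  have ia := InFace.of_snd hd
  have ina := InFace.of_nx hd
  have ib := InFace.of_snd hd'
  have inb := InFace.of_nx hd'
  have hτ1 : ∀ h : b = M.nx p a, SameFace D ⟨(b, p), M.adj_symm hb⟩ := by
    intro h
    have h3 : (⟨(b, p), M.adj_symm hb⟩ : M.Dart) = Dart.φ M (Dart.φ M ⟨(p, a), ha⟩) :=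
      Dart.ext h (M.nx_nx ha).symm
    rw [h3]
    exact SameFace.trans hd Dart.Rel.φ_φ
  by_cases h1 : a = M.nx p b
  · have h2 : ¬ b = M.nx p a := fun h => hcyc ⟨h1, h⟩
    simp only [h2, if_false] at ena
    have hqa : q = a := hq_of hpD hqD ia (ne_of_adj ha).symm (by rw [hx, ena]; module)
    refine ⟨⟨(p, a), ha⟩, hd, ?_, .inl ⟨rfl, hqa.symm⟩⟩
    refine SameFace.trans hd' ?_
    have : (Dart.τ M ⟨(p, a), ha⟩) = Dart.φ M (Dart.φ M ⟨(p, b), hb⟩) :=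
      Dart.ext h1 (M.nx_nx hb).symm
    rw [this]
    exact Dart.Rel.φ_φ
  · have h1' : ¬ M.nx p b = a := fun h => h1 h.symm
    simp only [h1', if_false] at ea
    have hqa : q = M.nx p a := hq_of hpD hqD ina (ne_of_adj (adj_nx ha)).symm
      (by rw [hx, ea]; module)
    have hβ0 : β ≠ 0 := by intro h; linarith
    have h2 : b = M.nx p a := by
      by_contra h2
      simp only [h2, if_false] at ena
      exact hβ0 ena
    refine ⟨⟨(b, p), M.adj_symm hb⟩, hτ1 h2, hd', .inr ⟨h2.trans hqa.symm, rfl⟩⟩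

/-- The trivial side of an edge between a trivial and a nontrivial triangle. -/
lemma IsFlex.exists_side (hZ : M.IsFlex Z) (hd : d ∈ M.bdry₀ Z) : Z d.1.2 ≠ 0 ∧
    ∃ D, D ∉ M.nz Z ∧ IsEnd D d.1.1 d.1.2 := by
  obtain ⟨hb, h0⟩ := hd
  have key : ∀ s : M.Dart, s ∉ M.nz Z → Dart.τ M s ∈ M.nz Z →
      (Z s.1.1 = 0 → Z s.1.2 ≠ 0 ∧ ND s (M.x (M.nx s.1.2 s.1.1)) ≠ 0) ∧
      (Z s.1.2 = 0 → Z s.1.1 ≠ 0 ∧ ND s (M.x (M.nx s.1.2 s.1.1)) ≠ 0) := by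
    intro s hs hτ
    rw [hZ.mem_nz_iff] at hτ
    simp only [Dart.τ_fst, Dart.τ_snd, Dart.φ_fst, Dart.φ_snd, M.nx_nx (M.adj_symm s.2)] at hτ
    have h1 := hZ.anti (M.adj_symm s.2)
    have h2 := hZ.anti (M.adj_symm (adj_nx (M.adj_symm s.2)))
    have h3 := hZ.anti (M.adj_symm (adj_prev s.2))
    have h4 := hZ.anti s.2
    constructor
    · intro h
      have h5 : Z s.1.2 (M.x (M.nx s.1.2 s.1.1)) ≠ 0 := by
        rw [h1, h2, h] at hτ
        simpa using hτ
      refine ⟨fun h => h5 (by simp [h]), fun h6 => h5 ?_⟩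
      obtain ⟨k, hk⟩ := hZ.eq_smul_ND hE hs (InFace.of_snd (SameFace.refl s))
      rw [hk, LinearMap.smul_apply, h6, smul_zero]
    · intro h
      have h5 : Z s.1.1 (M.x (M.nx s.1.2 s.1.1)) ≠ 0 := by
        rw [h2, h] at hτ
        simpa using hτ
      refine ⟨fun h => h5 (by simp [h]), fun h6 => h5 ?_⟩
      obtain ⟨k, hk⟩ := hZ.eq_smul_ND hE hs (InFace.of_fst (SameFace.refl s))
      rw [hk, LinearMap.smul_apply, h6, smul_zero]
  by_cases h1 : d ∈ M.nz Z
  · have h2 : Dart.τ M d ∉ M.nz Z := fun h => hb ⟨fun _ => h, fun _ => h1⟩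
    obtain ⟨h3, h4⟩ := (key (Dart.τ M d) h2 (by simpa using h1)).2 h0
    exact ⟨h3, _, h2, d.2, .inr ⟨SameFace.refl _, h4⟩⟩
  · have h2 : Dart.τ M d ∈ M.nz Z := by
      by_contra h
      exact hb ⟨fun h' => absurd h' h1, fun h' => absurd h' h⟩
    obtain ⟨h3, h4⟩ := (key d h1 h2).1 h0
    exact ⟨h3, _, h1, d.2, .inl ⟨SameFace.refl _, h4⟩⟩

/-- An edge between a trivial and a nontrivial triangle is on the boundary of a single trivial
face. -/
lemma IsEnd.sameFace (h : IsEnd D p e) (h' : IsEnd D' p e) (hZ : M.IsFlex Z) (hD : D ∉ M.nz Z)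
    (hD' : D' ∉ M.nz Z) (hb : (⟨(p, e), h.adj⟩ : M.Dart) ∈ M.bdry Z) : SameFace D D' := by
  obtain ⟨d, hd, h1⟩ := h.exists_side
  obtain ⟨d', hd', h2⟩ := h'.exists_side
  have g1 := hZ.zeroTri_of_sameFace hE hd hD
  have g2 := hZ.zeroTri_of_sameFace hE hd' hD'
  have hne : d ≠ Dart.τ M d' := by
    rintro rfl
    apply hb
    rcases h1 with h1 | h1
    · rw [← h1]
      exact ⟨fun h => absurd h g1, fun h => absurd h g2⟩
    · rw [← h1]
      exact ⟨fun h => absurd h g2, fun h => absurd h g1⟩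
  have : d = d' := by
    rcases h1 with h1 | h1 <;> rcases h2 with h2 | h2
    · exact h1.trans h2.symm
    · exact absurd (h1.trans h2.symm) hne
    · exact absurd (congrArg (Dart.τ M) (h1.trans h2.symm)) hne
    · exact (Dart.τ M).injective (h1.trans h2.symm)
  subst this
  exact hd.trans hd'.symm

omit [FiniteDimensional ℝ E] hE in
/-- An edge between two vertices with zero velocity, whose two sides have exactly one further vertex
with zero velocity. -/
lemma exists_mixed_edge [Infinite V] (hV : {v | Z v ≠ 0}.Finite) (hne : ∃ v, Z v ≠ 0) :
    ∃ d : M.Dart, Z d.1.1 = 0 ∧ Z d.1.2 = 0 ∧ Z (M.nx d.1.1 d.1.2) ≠ 0 ∧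
      Z (M.nx d.1.2 d.1.1) = 0 := by
  classical
  have hfin : ({v | Z v ≠ 0} ∪ ⋃ v ∈ {v | Z v ≠ 0}, {u | M.adj v u}).Finite :=
    hV.union (hV.biUnion fun v _ => M.finite_adj v)
  obtain ⟨w, hw⟩ := hfin.exists_notMem
  simp only [Set.mem_union, Set.mem_iUnion, Set.mem_ofPred_eq, not_or, not_exists, not_not] at hw
  have hadj : ∀ u, M.adj w u → Z u = 0 := fun u hu => by
    by_contra h
    exact hw.2 u h (M.adj_symm hu)
  obtain ⟨n, f, -, -, hf, -⟩ := M.link w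
  have hwa := (hf (f 0)).2 ⟨0, rfl⟩
  obtain ⟨v, hv⟩ := hne
  obtain ⟨n', f', -, -, hf', -⟩ := M.link v
  have hva := (hf' (f' 0)).2 ⟨0, rfl⟩
  by_contra hcon
  push Not at hcon
  have key : ∀ d : M.Dart, (Z d.1.1 = 0 ∧ Z d.1.2 = 0 ∧ Z (M.nx d.1.1 d.1.2) = 0) →
      (Z (Dart.τ M d).1.1 = 0 ∧ Z (Dart.τ M d).1.2 = 0 ∧
        Z (M.nx (Dart.τ M d).1.1 (Dart.τ M d).1.2) = 0) := by
    rintro d ⟨h1, h2, h3⟩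
    refine ⟨h2, h1, ?_⟩
    by_contra h4
    exact hcon (Dart.τ M d) h2 h1 h4 h3
  have := (Dart.Rel.mem_iff (A := {d : M.Dart | Z d.1.1 = 0 ∧ Z d.1.2 = 0 ∧
    Z (M.nx d.1.1 d.1.2) = 0}) (fun d => by
      simp only [Set.mem_ofPred_eq, Dart.φ_fst, Dart.φ_snd, M.nx_nx d.2]; tauto)
    (fun d _ => ⟨fun h => by simpa using key _ h, key d⟩)
    (rel_univ (⟨(w, f 0), hwa⟩ : M.Dart) ⟨(v, f' 0), hva⟩)).1
    ⟨hw.1, hadj _ hwa, hadj _ (adj_nx hwa)⟩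
  exact hv this.1

end OSurf

namespace OSurf

variable {E V : Type*} [AddCommGroup E] [Module ℝ E] {M : OSurf E V} {Z : V → Dual ℝ E}
variable {D D' d : M.Dart} {p q u v w e : V}

/-- If there are at most four oriented edges from a vertex with zero velocity between a trivial and
a nontrivial triangle, two vertices share them. -/
lemma IsFlex.bdry₀_eq (hZ : M.IsFlex Z) (hb : (M.bdry₀ Z).Finite) (hb4 : (M.bdry₀ Z).ncard ≤ 4)
    {dp dq : M.Dart} (hp : dp ∈ M.bdry₀ Z) (hq : dq ∈ M.bdry₀ Z) (hpq : dp.1.1 ≠ dq.1.1) :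
    ∃ d' ∈ M.bdry₀ Z, d' ≠ dp ∧ d'.1.1 = dp.1.1 ∧
      ∀ e ∈ M.bdry₀ Z, e = dp ∨ e = d' ∨ e.1.1 = dq.1.1 := by
  obtain ⟨dp', hp', hne, htp⟩ := hZ.exists_second_mem_bdry₀ hp
  obtain ⟨dq', hq', hne', htq⟩ := hZ.exists_second_mem_bdry₀ hq
  refine ⟨dp', hp', hne, htp, fun e he => ?_⟩
  have h1 : dp ≠ dq := fun h => hpq (by rw [h])
  have h2 : dp ≠ dq' := fun h => hpq (by rw [h, htq])
  have h3 : dp' ≠ dq := fun h => hpq (by rw [← htp, h])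
  have h4 : dp' ≠ dq' := fun h => hpq (by rw [← htp, h, htq])
  classical
  have hc : ((({dp, dp', dq, dq'} : Finset M.Dart) : Set M.Dart)).ncard = 4 := by
    rw [Set.ncard_coe_finset]
    simp [hne.symm, hne'.symm, h1, h2, h3, h4]
  have hsub : (({dp, dp', dq, dq'} : Finset M.Dart) : Set M.Dart) ⊆ M.bdry₀ Z := by
    intro x hx
    simp only [Finset.coe_insert, Finset.coe_singleton, Set.mem_insert_iff,
      Set.mem_singleton_iff] at hx
    rcases hx with rfl | rfl | rfl | rfl <;> assumption
  have := Set.eq_of_subset_of_ncard_le hsub (by rw [hc]; exact hb4) hb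
  rw [← this] at he
  simp only [Finset.coe_insert, Finset.coe_singleton, Set.mem_insert_iff,
    Set.mem_singleton_iff] at he
  rcases he with rfl | rfl | rfl | rfl
  · exact .inl rfl
  · exact .inr (.inl rfl)
  · exact .inr (.inr rfl)
  · exact .inr (.inr htq)

variable [FiniteDimensional ℝ E] (hE : finrank ℝ E = 4)
include hE

/-- There is no nonzero flex with finite support and at most four oriented edges from a vertex with
zero velocity between a trivial and a nontrivial triangle. -/
theorem IsFlex.false_of_finite [Infinite V] (hZ : M.IsFlex Z)
    (hface : ∀ D : M.Dart, {d | SameFace D d}.Finite)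
    (hne : (M.nz Z).Nonempty) (hfin : (M.nz Z).Finite) (hb : (M.bdry₀ Z).Finite)
    (hb4 : (M.bdry₀ Z).ncard ≤ 4) : False := by
  have hV : {v | Z v ≠ 0}.Finite := by
    refine (hfin.image fun d => d.1.1).subset fun v hv => ?_
    obtain ⟨u, hu, h⟩ := exists_adj_ne_zero hE hv (hZ.self v)
    exact ⟨⟨(v, u), hu⟩, mem_nz_of_ne h, rfl⟩
  have hV0 : ∃ v, Z v ≠ 0 := by
    obtain ⟨d, hd⟩ := hne
    by_contra h
    push Not at h
    exact hd ⟨by simp [h], by simp [h], by simp [h]⟩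
  obtain ⟨D, h1, h2, h3, h4⟩ := exists_mixed_edge hV hV0
  have hD : D ∉ M.nz Z := by
    rw [hZ.mem_nz_iff]
    simp only [Dart.φ_fst, Dart.φ_snd, M.nx_nx D.2]
    rw [hZ.anti (M.adj_symm (adj_nx D.2))]
    simp [h1, h2]
  have hDself := SameFace.refl D
  have i1 := InFace.of_fst hDself
  have i2 := InFace.of_snd hDself
  have i3 := InFace.of_nx hDself
  have n12 := ne_of_adj D.2
  have n41 : M.nx D.1.2 D.1.1 ≠ D.1.1 := (ne_of_adj (adj_prev D.2)).symm
  have n42 : M.nx D.1.2 D.1.1 ≠ D.1.2 := (ne_of_adj (adj_nx (M.adj_symm D.2))).symm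
  obtain ⟨p, q, hpq, hp, hq, hp0, hq0, ⟨d, hd, hd0⟩, ⟨d', hd', hd0'⟩, -⟩ :=
    exists_extreme_pair hE (hface D) i3 h3 i1 h1 i2 h2 n12
  have hbp := hd.mem_bdry₀ hE hZ hD hp0 hd0
  have hbq := hd'.mem_bdry₀ hE hZ hD hq0 hd0'
  obtain ⟨⟨⟨p', y⟩, hpy⟩, hby, hyd, htp, hall⟩ := hZ.bdry₀_eq hb hb4 hbp hbq hpq
  change p' = p at htp
  subst htp
  have hyd : y ≠ d := fun h => hyd (Dart.ext rfl h)
  have hend : ∀ {D₁ : M.Dart} {e}, D₁ ∉ M.nz Z → IsEnd D₁ p' e → Z e ≠ 0 → e = d ∨ e = y := by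
    intro D₁ e hD₁ he he0
    have := hall _ (he.mem_bdry₀ hE hZ hD₁ hp0 he0)
    rcases this with h | h | h
    · exact .inl (congrArg (fun d : M.Dart => d.1.2) h)
    · exact .inr (congrArg (fun d : M.Dart => d.1.2) h)
    · exact absurd h hpq
  have htail : ∀ {D₁ : M.Dart} {a e}, D₁ ∉ M.nz Z → IsEnd D₁ a e → Z a = 0 → Z e ≠ 0 →
      a = p' ∨ a = q := by
    intro D₁ a e hD₁ he ha0 he0
    have := hall _ (he.mem_bdry₀ hE hZ hD₁ ha0 he0)
    rcases this with h | h | h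
    · exact .inl (congrArg (fun d : M.Dart => d.1.1) h)
    · exact .inl (congrArg (fun d : M.Dart => d.1.1) h)
    · exact .inr h
  have hsep : ∀ {D₁ : M.Dart} {v u w : V}, D₁ ∉ M.nz Z → InFace D₁ v → Z v ≠ 0 → InFace D₁ u →
      Z u = 0 → InFace D₁ w → Z w = 0 → u ≠ w →
      InFace D₁ q ∧ Separated Z D₁ p' q v := by
    intro D₁ v u w hD₁ hv hv0 hu hu0 hw hw0 huw
    obtain ⟨a, b, hab, ha, hb, ha0, hb0, ⟨e, he, he0⟩, ⟨e', he', he0'⟩, hs⟩ :=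
      exists_extreme_pair hE (hface D₁) hv hv0 hu hu0 hw hw0 huw
    have hs : Separated Z D₁ a b v := hs
    rcases htail hD₁ he ha0 he0 with rfl | rfl <;> rcases htail hD₁ he' hb0 he0' with rfl | rfl
    · exact absurd rfl hab
    · exact ⟨hb, hs⟩
    · exact ⟨ha, hs.swap⟩
    · exact absurd rfl hab
  have hpair : (D.1.1 = p' ∨ D.1.1 = q) → (D.1.2 = p' ∨ D.1.2 = q) →
      (D.1.1 = p' ∧ D.1.2 = q) ∨ (D.1.1 = q ∧ D.1.2 = p') := by
    rintro (h | h) (h' | h')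
    · exact absurd (h.trans h'.symm) n12
    · exact .inl ⟨h, h'⟩
    · exact .inr ⟨h, h'⟩
    · exact absurd (h.trans h'.symm) n12
  have hfour : ¬ ((D.1.1 = p' ∧ D.1.2 = q) ∨ (D.1.1 = q ∧ D.1.2 = p')) ∨
      ¬ (M.nx D.1.2 D.1.1 = p' ∨ M.nx D.1.2 D.1.1 = q) := by
    by_contra hcon
    push Not at hcon
    obtain ⟨⟨g1, g2⟩ | ⟨g1, g2⟩, g | g⟩ := hcon
    · exact n41 (g.trans g1.symm)
    · exact n42 (g.trans g2.symm)
    · exact n42 (g.trans g2.symm)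
    · exact n41 (g.trans g1.symm)
  obtain ⟨z, hzd, hz, huniq, hcone⟩ := hd.exists_other hE
  by_cases hz0 : Z z = 0
  · obtain ⟨hy0, Q, hQ, hyQ⟩ := hZ.exists_side hE hby
    change Z y ≠ 0 at hy0
    change IsEnd Q p' y at hyQ
    have hDQ : ¬ SameFace D Q := by
      intro h
      rcases huniq y (IsEnd.congr h hE hyQ) with h | h
      · exact hyd h
      · exact hy0 (h ▸ hz0)
    obtain ⟨z', hz'y, hz', -, -⟩ := hyQ.exists_other hE
    have hz'0 : Z z' = 0 := by
      by_contra hz'0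
      rcases hend hQ hz' hz'0 with rfl | rfl
      · exact hDQ (hd.sameFace hE hz' hZ hD hQ hbp.1)
      · exact hz'y rfl
    obtain ⟨hqQ, hsQ⟩ := hsep hQ hyQ.inFace hy0 hyQ.inFace' hp0 hz'.inFace hz'0 (ne_of_adj hz'.adj)
    obtain ⟨-, hsD⟩ := hsep hD hd.inFace hd0 i1 h1 i2 h2 n12
    obtain ⟨e, he, he', hepq⟩ := hp.exists_edge hE hq hyQ.inFace' hqQ hpq hDQ
    have hn1 : ¬ SameFace D (Dart.τ M e) := fun h => hDQ (h.trans he'.symm)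
    have hn2 : ¬ SameFace Q (Dart.τ M (Dart.τ M e)) := fun h => hDQ (he.trans h.symm)
    have hend1 : IsEnd D p' q ∧ IsEnd Q p' q := by
      have g1 := isEnd_of_not_sameFace hE he hn1
      have g2 := isEnd_of_not_sameFace hE he' hn2
      rcases hepq with ⟨rfl, rfl⟩ | ⟨rfl, rfl⟩
      · exact ⟨g1.1, g2.2⟩
      · exact ⟨g1.2, g2.1⟩
    have hne0 : ∀ {a b : V}, Z a = 0 → Z b ≠ 0 → b ≠ a := by rintro a b ha hb rfl; exact hb ha
    have hVD := fun {u} => hsD.eq_of_isEnd (u := u) hE hend1.1 hd.inFace (hne0 hp0 hd0)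
      (hne0 hq0 hd0)
    have hVQ := fun {u} => hsQ.eq_of_isEnd (u := u) hE hend1.2 hyQ.inFace (hne0 hp0 hy0)
      (hne0 hq0 hy0)
    have hD12 := hpair (hVD i1 h1) (hVD i2 h2)
    have hDe : D = e ∨ D = Dart.τ M e := by
      rcases hD12 with ⟨a1, a2⟩ | ⟨a1, a2⟩ <;> rcases hepq with ⟨b1, b2⟩ | ⟨b1, b2⟩
      · exact .inl (Dart.ext (a1.trans b1.symm) (a2.trans b2.symm))
      · exact .inr (Dart.ext (a1.trans b2.symm) (a2.trans b1.symm))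
      · exact .inr (Dart.ext (a1.trans b2.symm) (a2.trans b1.symm))
      · exact .inl (Dart.ext (a1.trans b1.symm) (a2.trans b2.symm))
    rcases hDe with rfl | hDe
    · exact hfour.elim (fun h => h hD12) fun h => h (hVQ (InFace.of_nx he') h4)
    · rw [← hDe] at he'
      exact hDQ he'.symm
  · have hzy : z = y := (hend hD hz hz0).resolve_left hzd
    obtain ⟨-, hs1⟩ := hsep hD hd.inFace hd0 i1 h1 i2 h2 n12
    obtain ⟨-, hs2⟩ := hsep hD hz.inFace hz0 i1 h1 i2 h2 n12
    have hqd : q ≠ d := by rintro rfl; exact hd0 hq0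
    have hqz : q ≠ z := by rintro rfl; exact hz0 hq0
    have hVD := fun {u} => hs1.eq_of_ends (u := u) hE hs2 hd (hcone q hq hpq.symm) hq hpq hqd
    have hD12 := hpair (hVD i1 h1) (hVD i2 h2)
    have hn : ¬ SameFace D (Dart.τ M D) := fun h =>
      hfour.elim (fun h => h hD12) fun h' => h' (hVD (InFace.of_nx h) h4)
    have hend1 := isEnd_of_not_sameFace hE hDself hn
    have : IsEnd D p' q := by
      rcases hD12 with ⟨g1, g2⟩ | ⟨g1, g2⟩
      · rw [← g1, ← g2]; exact hend1.1
      · rw [← g1, ← g2]; exact hend1.2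
    rcases huniq q this with h | h
    · exact hqd h
    · exact hqz h

/-- In the absence of edges from a vertex with zero velocity between a trivial and a nontrivial
triangle, no trivial triangle has a vertex with zero velocity. -/
lemma IsFlex.ne_zero_of_bdry₀_eq_empty (hZ : M.IsFlex Z)
    (hface : ∀ D : M.Dart, {d | SameFace D d}.Finite)
    (hne : (M.nz Z).Nonempty) (hb : M.bdry₀ Z = ∅) {D : M.Dart} (hD : D ∉ M.nz Z) {u : V}
    (hu : InFace D u) : Z u ≠ 0 := by
  intro hu0
  have hmix : ∀ (D : M.Dart), D ∉ M.nz Z → ∀ u, InFace D u → Z u = 0 → ∀ v, InFace D v →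
      Z v = 0 := by
    intro D hD u hu hu0 v hv
    by_contra hv0
    obtain ⟨F, hF, hF'⟩ := hv.exists_functional
    obtain ⟨p, d, hp, hp0, hd, hd0, -⟩ := exists_extreme hE (hface D) hv hv0 hu hu0 hF hF'
    have := hd.mem_bdry₀ hE hZ hD hp0 hd0
    rw [hb] at this
    exact this
  have hall : ∀ e : M.Dart, Z e.1.1 = 0 ∧ Z e.1.2 = 0 ∧ Z (M.nx e.1.1 e.1.2) = 0 := by
    have key : ∀ d : M.Dart, (Z d.1.1 = 0 ∧ Z d.1.2 = 0 ∧ Z (M.nx d.1.1 d.1.2) = 0) →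
        (Z (Dart.τ M d).1.1 = 0 ∧ Z (Dart.τ M d).1.2 = 0 ∧
          Z (M.nx (Dart.τ M d).1.1 (Dart.τ M d).1.2) = 0) := by
      rintro d ⟨h1, h2, -⟩
      refine ⟨h2, h1, ?_⟩
      have h0 : Dart.τ M d ∉ M.nz Z := by
        rw [hZ.mem_nz_iff]
        simp only [Dart.φ_fst, Dart.φ_snd, M.nx_nx (Dart.τ M d).2]
        rw [hZ.anti (M.adj_symm (adj_nx (Dart.τ M d).2))]
        simp [h1, h2]
      exact hmix _ h0 _ (InFace.of_fst (SameFace.refl _)) h2 _ (InFace.of_nx (SameFace.refl _))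
    intro e
    refine (Dart.Rel.mem_iff (A := {d : M.Dart | Z d.1.1 = 0 ∧ Z d.1.2 = 0 ∧
      Z (M.nx d.1.1 d.1.2) = 0}) (fun d => by
        simp only [Set.mem_ofPred_eq, Dart.φ_fst, Dart.φ_snd, M.nx_nx d.2]; tauto)
      (fun d _ => ⟨fun h => by simpa using key _ h, key d⟩) (rel_univ D e)).1 ?_
    exact ⟨hmix D hD u hu hu0 _ (InFace.of_fst (SameFace.refl D)),
      hmix D hD u hu hu0 _ (InFace.of_snd (SameFace.refl D)),
      hmix D hD u hu hu0 _ (InFace.of_nx (SameFace.refl D))⟩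
  obtain ⟨e, he⟩ := hne
  obtain ⟨h1, h2, h3⟩ := hall e
  exact he ⟨by simp [h1], by simp [h2], by simp [h1]⟩

end OSurf

namespace OSurf

variable {E V : Type*} [AddCommGroup E] [Module ℝ E] {M : OSurf E V} {Z : V → Dual ℝ E}
variable {D D' d : M.Dart} {p q u v w e : V}

/-- The sum of the vertices of a face. -/
noncomputable def center (D : M.Dart) : E := ∑ᶠ w ∈ {w | InFace D w}, M.x w

lemma InFace.congr (h : SameFace D D') : InFace D w ↔ InFace D' w :=
  ⟨fun ⟨e, he, hw⟩ => ⟨e, h.symm.trans he, hw⟩, fun ⟨e, he, hw⟩ => ⟨e, h.trans he, hw⟩⟩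

lemma center_congr (h : SameFace D D') : center D = center D' := by
  unfold center
  simp only [InFace.congr h]

lemma finite_inFace (hD : {d | SameFace D d}.Finite) : {w | InFace D w}.Finite := by
  refine (hD.image fun d => d.1.1).subset ?_
  rintro w ⟨e, he, rfl⟩
  exact ⟨e, he, rfl⟩

lemma map_center {F : Type*} [AddCommGroup F] [Module ℝ F] (A : E →ₗ[ℝ] F)
    (hD : {d | SameFace D d}.Finite) : A (center D) = ∑ᶠ w ∈ {w | InFace D w}, A (M.x w) :=
  AddMonoidHom.map_finsum_mem (f := fun w => M.x w) A.toAddMonoidHom (finite_inFace hD)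

open Classical in
/-- The coordinates of the center of the face of a triangle, in the basis formed by the vertices of
the triangle. -/
noncomputable def coef (d : M.Dart) : ℝ × ℝ × ℝ :=
  if h : ∃ c : ℝ × ℝ × ℝ, center d =
      c.1 • M.x d.1.1 + c.2.1 • M.x d.1.2 + c.2.2 • M.x (M.nx d.1.1 d.1.2)
  then h.choose else 0

lemma eq_of_indep (d : M.Dart) {c c' : ℝ × ℝ × ℝ}
    (h : c.1 • M.x d.1.1 + c.2.1 • M.x d.1.2 + c.2.2 • M.x (M.nx d.1.1 d.1.2) =
      c'.1 • M.x d.1.1 + c'.2.1 • M.x d.1.2 + c'.2.2 • M.x (M.nx d.1.1 d.1.2)) : c = c' := by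
  have hi := Fintype.linearIndependent_iff.1 (M.indep d.2) ![c.1 - c'.1, c.2.1 - c'.2.1,
    c.2.2 - c'.2.2] (by
      simp only [Fin.sum_univ_three]
      rw [← sub_eq_zero] at h
      rw [← h]
      simp
      module)
  have h0 := hi 0
  have h1 := hi 1
  have h2 := hi 2
  simp only [Matrix.cons_val_zero, Matrix.cons_val_one, Matrix.cons_val, sub_eq_zero] at h0 h1 h2
  exact Prod.ext h0 (Prod.ext h1 h2)

lemma abs_sign_add_sign {β γ s t : ℝ} (h : β * s + γ * t = 0) (h1 : ¬ (β = 0 ∧ γ = 0))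
    (h2 : ¬ (s = 0 ∧ t = 0)) :
    |(SignType.sign β : ℤ) + SignType.sign γ| = |(SignType.sign s : ℤ) - SignType.sign t| := by
  obtain ⟨l, hl, rfl, rfl⟩ : ∃ l : ℝ, l ≠ 0 ∧ s = l * γ ∧ t = -(l * β) := by
    by_cases hγ : γ = 0
    · have hβ : β ≠ 0 := fun h => h1 ⟨h, hγ⟩
      subst hγ
      have hs : s = 0 := by simpa [hβ] using h
      refine ⟨-t / β, ?_, by simp [hs], by field_simp⟩
      exact div_ne_zero (neg_ne_zero.2 fun h => h2 ⟨hs, h⟩) hβ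
    · refine ⟨s / γ, ?_, by field_simp, ?_⟩
      · refine div_ne_zero (fun h0 => h2 ⟨h0, ?_⟩) hγ
        simpa [h0, hγ] using h
      · field_simp; linarith
  have hl' : |(SignType.sign l : ℤ)| = 1 := by
    rcases lt_or_gt_of_ne hl with h | h <;> simp [h]
  rw [Left.sign_neg, sign_mul, sign_mul]
  push_cast
  rw [sub_neg_eq_add, ← mul_add, abs_mul, hl', one_mul, add_comm]

variable [FiniteDimensional ℝ E] (hE : finrank ℝ E = 4)
include hE

lemma center_eq (d : M.Dart) (hd : {d' | SameFace d d'}.Finite) : center d =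
    (coef d).1 • M.x d.1.1 + (coef d).2.1 • M.x d.1.2 +
      (coef d).2.2 • M.x (M.nx d.1.1 d.1.2) := by
  have h : ∃ c : ℝ × ℝ × ℝ, center d =
      c.1 • M.x d.1.1 + c.2.1 • M.x d.1.2 + c.2.2 • M.x (M.nx d.1.1 d.1.2) := by
    have h0 : ND d (center d) = 0 := by
      rw [map_center _ hd]
      exact finsum_mem_eq_zero_of_forall_eq_zero fun w hw => InFace.ND_eq_zero hE hw
    obtain ⟨δ, α, β, γ, heq, hne⟩ := exists_relation_four hE (M.N_ne d.2) h0 (M.N_left d.2)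
      (N_right d.2) (N_nx d.2)
    have hδ : δ ≠ 0 := by
      rintro rfl
      rw [zero_smul, zero_add] at heq
      have := eq_of_indep d (c := (α, β, γ)) (c' := 0) (by simpa using heq)
      simp only [Prod.mk_eq_zero] at this
      exact hne ⟨rfl, this⟩
    refine ⟨(-α / δ, -β / δ, -γ / δ), ?_⟩
    have h1 : center d = δ⁻¹ • (δ • center d) := by rw [smul_smul, inv_mul_cancel₀ hδ, one_smul]
    have h2 : δ • center d = -(α • M.x d.1.1 + β • M.x d.1.2 + γ • M.x (M.nx d.1.1 d.1.2)) := by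
      rw [eq_neg_iff_add_eq_zero, ← heq]; abel
    rw [h1, h2]
    match_scalars <;> field_simp
  rw [coef, dif_pos h]
  exact h.choose_spec

lemma coef_eq (d : M.Dart) (hd : {d' | SameFace d d'}.Finite) {c : ℝ × ℝ × ℝ} (h : center d =
    c.1 • M.x d.1.1 + c.2.1 • M.x d.1.2 + c.2.2 • M.x (M.nx d.1.1 d.1.2)) : coef d = c :=
  eq_of_indep d ((center_eq hE d hd).symm.trans h)

lemma coef_φ (d : M.Dart) (hd : {d' | SameFace d d'}.Finite)
    (hd' : {d' | SameFace (Dart.φ M d) d'}.Finite) :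
    coef (Dart.φ M d) = ((coef d).2.1, (coef d).2.2, (coef d).1) := by
  refine coef_eq hE _ hd' ?_
  rw [← center_congr (show SameFace d (Dart.φ M d) from Dart.Rel.φ), center_eq hE d hd]
  simp only [Dart.φ_fst, Dart.φ_snd, M.nx_nx d.2]
  abel

lemma center_pos (hD : {d | SameFace D d}.Finite) (hv : InFace D v) :
    0 < M.L v (center D) := by
  rw [map_center _ hD, finsum_mem_eq_finite_toFinset_sum _ (finite_inFace hD)]
  obtain ⟨d, hd, rfl⟩ := hv
  refine Finset.sum_pos' (fun w hw => ?_) ⟨d.1.2, ?_, M.L_pos d.2⟩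
  · rw [Set.Finite.mem_toFinset] at hw
    by_cases h : w = d.1.1
    · rw [h, M.L_self]
    · exact (InFace.L_pos hE hw (InFace.of_fst hd) h).le
  · rw [Set.Finite.mem_toFinset]
    exact InFace.of_snd hd

lemma coef_ne (d : M.Dart) (hd : {d' | SameFace d d'}.Finite) :
    ¬ ((coef d).2.1 = 0 ∧ (coef d).2.2 = 0) := by
  rintro ⟨h1, h2⟩
  have h := center_pos hE hd (InFace.of_fst (SameFace.refl d))
  rw [center_eq hE d hd, h1, h2] at h
  simp [M.L_self] at h

omit [FiniteDimensional ℝ E] hE in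
/-- The weight of the corner of the triangle `d` at its first vertex. -/
noncomputable def weight (d : M.Dart) : ℤ :=
  |(SignType.sign (coef d).2.1 : ℤ) + SignType.sign (coef d).2.2|

lemma two_le_sum_weight (hface : ∀ D : M.Dart, {d | SameFace D d}.Finite) (d : M.Dart) :
    2 ≤ weight d + weight (Dart.φ M d) + weight (Dart.φ M (Dart.φ M d)) := by
  have h1 := coef_ne hE d (hface _)
  have h2 := coef_ne hE (Dart.φ M d) (hface _)
  have h3 := coef_ne hE (Dart.φ M (Dart.φ M d)) (hface _)
  unfold weight
  rw [coef_φ hE (Dart.φ M d) (hface _) (hface _), coef_φ hE d (hface _) (hface _)] at *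
  generalize coef d = c at *
  obtain ⟨α, β, γ⟩ := c
  simp only at *
  rcases lt_trichotomy α 0 with h1 | rfl | h1 <;> rcases lt_trichotomy β 0 with h2 | rfl | h2 <;>
    rcases lt_trichotomy γ 0 with h3 | rfl | h3 <;> simp_all

/-- The weights of the corners of the triangles of a face at a vertex. -/
lemma InFace.exists_weight_eq_corner (hface : ∀ D : M.Dart, {d | SameFace D d}.Finite)
    (hv : InFace D v) : ∃ B : Dual ℝ E, B (M.x v) = 0 ∧ (∃ u, InFace D u ∧ B (M.x u) ≠ 0) ∧
      B (center D) = 0 ∧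
      ∀ u (h : M.adj v u), SameFace D ⟨(v, u), h⟩ → weight ⟨(v, u), h⟩ = M.corner B v u := by
  obtain ⟨d, hd, rfl⟩ := hv
  obtain ⟨B, hB⟩ := exists_dual_eq (M.indep d.2) ![0, (coef d).2.2, -(coef d).2.1]
  have h0 : B (M.x d.1.1) = 0 := hB 0
  have h1 : B (M.x d.1.2) = (coef d).2.2 := hB 1
  have h2 : B (M.x (M.nx d.1.1 d.1.2)) = -(coef d).2.1 := hB 2
  have hc : B (center D) = 0 := by
    rw [center_congr hd, center_eq hE d (hface _)]
    simp only [map_add, map_smul, smul_eq_mul, h0, h1, h2]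
    ring
  have hne : ∃ u, InFace D u ∧ B (M.x u) ≠ 0 := by
    by_contra hcon
    push Not at hcon
    have h3 := hcon _ (InFace.of_snd hd)
    have h4 := hcon _ (InFace.of_nx hd)
    rw [h1] at h3
    rw [h2, neg_eq_zero] at h4
    exact coef_ne hE d (hface _) ⟨h4, h3⟩
  refine ⟨B, h0, hne, hc, fun u hu h => abs_sign_add_sign ?_ (coef_ne hE _ (hface _)) ?_⟩
  · rw [center_congr h, center_eq hE _ (hface _)] at hc
    simp only [map_add, map_smul, smul_eq_mul] at hc
    rw [h0] at hc
    linarith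
  · rintro ⟨h3, h4⟩
    obtain ⟨w, hw, hw0⟩ := hne
    exact hw0 (InFace.apply_eq_zero hE (InFace.of_fst h) (InFace.of_snd h) (InFace.of_nx h)
      (ne_of_adj hu) (ne_of_adj (adj_nx hu)) (ne_of_adj (M.adj_nx' hu)) h0 h3 h4 hw)

/-- A bound for the weights of the corners of the triangles of a face at a vertex. -/
lemma InFace.sum_corner_le (hface : ∀ D : M.Dart, {d | SameFace D d}.Finite) {S : Finset V}
    {B : Dual ℝ E} (h0 : B (M.x v) = 0)
    (hne : ∃ u, InFace D u ∧ B (M.x u) ≠ 0) (hc : B (center D) = 0)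
    (hDv : D.1.1 = v) (hS : ∀ u, u ∈ S ↔ ∃ h : M.adj v u, SameFace D ⟨(v, u), h⟩) :
    ∑ u ∈ S, M.corner B v u ≤ 2 := by
  have hv : InFace D v := ⟨D, SameFace.refl D, hDv⟩
  obtain ⟨d₁, d₂, hr, hiff⟩ := hv.exists_run hE
  have hN : ∀ u, M.adj v u → 0 ≤ ND D (M.x u) := fun u hu => M.N_nonneg D.2 (hDv ▸ hu)
  obtain ⟨e₁, e₂, -, he₁, he₂, -, hcone⟩ := hv.exists_ends hE
  have hneg : B (M.x d₁) < 0 ∨ B (M.x d₂) < 0 := by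
    by_contra hcon
    push Not at hcon
    have hnn : ∀ u, InFace D u → 0 ≤ B (M.x u) := by
      intro u hu
      by_cases huv : u = v
      · rw [huv, h0]
      obtain ⟨⟨⟨v', a⟩, ha⟩, hd, hv', α, β, γ, hα, hβ, -, hx⟩ := hu.visible hE hv huv
      change v' = v at hv'
      subst hv'
      have h3 := (hiff a ha).1 hd
      obtain ⟨b, c, k, hb, hc, h⟩ := hr.mem_cone a ha h3.1
      obtain ⟨b', c', k', hb', hc', h'⟩ := hr.mem_cone _ (adj_nx ha) h3.2
      rw [hx]
      change 0 ≤ B (α • M.x a + β • M.x (M.nx v' a) + _)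
      rw [h, h']
      simp only [map_add, map_smul, smul_eq_mul, h0, mul_zero, add_zero]
      have := hcon.1
      have := hcon.2
      positivity
    obtain ⟨u, hu, hu0⟩ := hne
    rw [map_center _ (hface D), finsum_mem_eq_finite_toFinset_sum _ (finite_inFace (hface D)),
      Finset.sum_eq_zero_iff_of_nonneg (fun w hw => hnn w (by simpa using hw))] at hc
    exact hu0 (hc u (by simpa using hu))
  obtain ⟨t, ht⟩ : ∃ t : ℝ, ∀ u ∈ M.nbrs v, 0 < ND D (M.x u) → 0 < B (M.x u) + t * ND D (M.x u) := by
    obtain ⟨t, ht⟩ := (Finset.image (fun u => (1 - B (M.x u)) / ND D (M.x u)) (M.nbrs v)).bddAbove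
    refine ⟨t, fun u hu hpos => ?_⟩
    have h1 := ht (Finset.mem_coe.2 (Finset.mem_image_of_mem _ hu))
    rw [div_le_iff₀ hpos] at h1
    linarith
  set Y : Dual ℝ E := B + t • ND D with hY
  have hYx : ∀ x, Y x = B x + t * ND D x := fun _ => rfl
  have hYin : ∀ u, InFace D u → Y (M.x u) = B (M.x u) := fun u hu => by
    rw [hYx, hu.ND_eq_zero hE, mul_zero, add_zero]
  have hYout : ∀ u, M.adj v u → ND D (M.x u) ≠ 0 → 0 < Y (M.x u) := fun u hu hu0 =>
    ht u ((mem_nbrs M).2 hu) (lt_of_le_of_ne (hN u hu) (Ne.symm hu0))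
  have hY0 : Y ≠ 0 := by
    rintro h
    obtain ⟨u, hu, hu0⟩ := hne
    rw [← hYin u hu, h] at hu0
    exact hu0 rfl
  have h4 := sum_corner_le_four hE (v := v) hY0 (by rw [hYin v hv, h0])
  have hSsub : S ⊆ M.nbrs v := fun u hu => (mem_nbrs M).2 ((hS u).1 hu).1
  have hScorner : ∑ u ∈ S, M.corner B v u = ∑ u ∈ S, M.corner Y v u := by
    refine Finset.sum_congr rfl fun u hu => ?_
    obtain ⟨h, hs⟩ := (hS u).1 hu
    unfold corner
    rw [hYin u (InFace.of_snd hs), hYin _ (InFace.of_nx hs)]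
  have hz1 := (hr.first d₁ hr.adj_first).2 rfl
  have hz2 := (hr.last d₂ hr.adj_last).2 rfl
  have hextra : ∃ a, M.adj v a ∧ a ∉ S ∧ M.corner Y v a = 2 := by
    rcases hneg with h | h
    · refine ⟨M.nx d₁ v, adj_prev hr.adj_first, fun hmem => ?_, ?_⟩
      · obtain ⟨h, hs⟩ := (hS _).1 hmem
        exact hz1.2 ((hiff _ _).1 hs).1
      · have g1 := hYout _ (adj_prev hr.adj_first) hz1.2
        have g2 : Y (M.x d₁) < 0 := by rw [hYx, hz1.1]; linarith
        unfold corner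
        rw [nx_prev hr.adj_first, sign_pos g1, sign_neg g2]
        simp
    · refine ⟨d₂, hr.adj_last, fun hmem => ?_, ?_⟩
      · obtain ⟨h, hs⟩ := (hS _).1 hmem
        exact hz2.2 ((hiff _ _).1 hs).2
      · have g1 := hYout _ (adj_nx hr.adj_last) hz2.2
        have g2 : Y (M.x d₂) < 0 := by rw [hYx, hz2.1]; linarith
        unfold corner
        rw [sign_pos g1, sign_neg g2]
        simp
  obtain ⟨a, ha, haS, hac⟩ := hextra
  classical
  have h5 : ∑ u ∈ insert a S, M.corner Y v u ≤ ∑ u ∈ M.nbrs v, M.corner Y v u :=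
    Finset.sum_le_sum_of_subset_of_nonneg
      (Finset.insert_subset ((mem_nbrs M).2 ha) hSsub) fun _ _ _ => corner_nonneg _ _ _
  rw [Finset.sum_insert haS, hac] at h5
  rw [hScorner]
  linarith

section Equivariance

variable {G : Type*} [Group G] [MulAction G V] [M.Equivariant G] {g : G}

lemma cop_smul {A : E →ₗ[ℝ] E} (hA : ∀ v, M.x (g • v) = A (M.x v)) (hd : d ∈ M.cop) :
    g • d ∈ M.cop := by
  obtain ⟨p, q, r, s, hp, hq, hr, hs, heq⟩ := exists_relation_of_cop hE hd
  have h1 := congrArg A heq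
  simp only [map_add, map_smul, ← hA] at h1
  have h2 := congrArg (ND (g • d)) h1
  have e1 : ND (g • d) (M.x (g • d.1.1)) = 0 := M.N_left (g • d).2
  have e2 : ND (g • d) (M.x (g • d.1.2)) = 0 := N_right (g • d).2
  have e3 : ND (g • d) (M.x (g • M.nx d.1.1 d.1.2)) = 0 := by
    rw [← Equivariant.nx_smul g d.2]; exact N_nx (g • d).2
  simp only [map_add, map_smul, smul_eq_mul, e1, e2, e3, mul_zero, add_zero, zero_add,
    mul_eq_zero, hq.ne', false_or] at h2
  change ND (g • d) (M.x (M.nx (g • d.1.2) (g • d.1.1))) = 0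
  rwa [Equivariant.nx_smul g (M.adj_symm d.2)]

lemma SameFace.smul (hA : ∀ g : G, ∃ A : E →ₗ[ℝ] E, ∀ v, M.x (g • v) = A (M.x v))
    (h : SameFace D d) (g : G) : SameFace (g • D) (g • d) :=
  Dart.Rel.smul (fun g _ hd => cop_smul hE (hA g).choose_spec hd) g h

lemma inFace_smul (hA : ∀ g : G, ∃ A : E →ₗ[ℝ] E, ∀ v, M.x (g • v) = A (M.x v)) (g : G) :
    {w | InFace (g • D) w} = (g • ·) '' {w | InFace D w} := by
  ext w
  simp only [Set.mem_ofPred_eq, Set.mem_image]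
  constructor
  · rintro ⟨e, he, rfl⟩
    have := he.smul hE hA g⁻¹
    rw [inv_smul_smul] at this
    exact ⟨(g⁻¹ • e).1.1, ⟨_, this, rfl⟩, by rw [Dart.smul_fst, smul_inv_smul]⟩
  · rintro ⟨w, ⟨e, he, rfl⟩, rfl⟩
    exact ⟨g • e, he.smul hE hA g, rfl⟩

lemma weight_smul (hface : ∀ D : M.Dart, {d | SameFace D d}.Finite)
    (hA : ∀ g : G, ∃ A : E →ₗ[ℝ] E, ∀ v, M.x (g • v) = A (M.x v)) (g : G) (d : M.Dart) :
    weight (g • d) = weight d := by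
  suffices coef (g • d) = coef d by rw [weight, weight, this]
  obtain ⟨A, hAg⟩ := hA g
  have hc : center (g • d) = A (center d) := by
    rw [map_center _ (hface d), center, inFace_smul hE hA,
      finsum_mem_image (fun _ _ _ _ h => MulAction.injective g h)]
    simp only [hAg]
  refine coef_eq hE _ (hface _) ?_
  rw [hc, center_eq hE d (hface d)]
  simp only [map_add, map_smul, ← hAg, Dart.smul_fst, Dart.smul_snd, Equivariant.nx_smul g d.2]

/-- There is no invariant flex whose velocities do not vanish at the vertices of the trivial
triangles. -/
theorem IsFlex.false_of_ne_zero [Nonempty V] (hZ : M.IsFlex Z) (hG : M.IsInv G Z)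
    (hface : ∀ D : M.Dart, {d | SameFace D d}.Finite)
    (hA : ∀ g : G, ∃ A : E →ₗ[ℝ] E, ∀ v, M.x (g • v) = A (M.x v))
    (hgenus : 4 ≤ finrank ℝ (Additive G →+ ℝ))
    (hne : ∀ d : M.Dart, d ∉ M.nz Z → Z d.1.1 ≠ 0) : False := by
  classical
  let wt : V → V → ℤ := fun v u =>
    if h : M.adj v u then (if M.ZeroTri Z v u then weight ⟨(v, u), h⟩ else 0) else 0
  have hwt1 : ∀ d : M.Dart, M.ZeroTri Z d.1.1 d.1.2 → wt d.1.1 d.1.2 = weight d :=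
    fun d h => (dif_pos d.2).trans (if_pos h)
  have hwt2 : ∀ d : M.Dart, ¬ M.ZeroTri Z d.1.1 d.1.2 → wt d.1.1 d.1.2 = 0 :=
    fun d h => (dif_pos d.2).trans (if_neg h)
  have hwt0 : ∀ v u, 0 ≤ wt v u := by
    intro v u
    simp only [wt]
    split_ifs
    · exact abs_nonneg _
    · exact le_rfl
    · exact le_rfl
  have h1 := two_mul_ncard_le (M := M) (G := G) (F := Set.univ) (fun _ _ _ => trivial)
    (c := fun v u => M.corner (Z v) v u + wt v u)
    (fun g d => by
      have h2 : wt (g • d.1.1) (g • d.1.2) = wt d.1.1 d.1.2 := by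
        by_cases h : M.ZeroTri Z d.1.1 d.1.2
        · exact (hwt1 (g • d) ((hG.zeroTri g d.2).2 h)).trans
            ((weight_smul hE hface hA g d).trans (hwt1 d h).symm)
        · exact (hwt2 (g • d) (fun h' => h ((hG.zeroTri g d.2).1 h'))).trans (hwt2 d h).symm
      rw [hG.corner, h2])
    (fun v u => add_nonneg (corner_nonneg _ _ _) (hwt0 _ _))
    (fun d _ => by
      by_cases hd : M.ZeroTri Z d.1.1 d.1.2
      · have hd2 : M.ZeroTri Z d.1.2 (M.nx d.1.1 d.1.2) := (hZ.zeroTri_cyc d.2).2 hd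
        have hd3 : M.ZeroTri Z (M.nx d.1.1 d.1.2) d.1.1 := by
          have := (hZ.zeroTri_cyc (M.adj_nx' d.2)).2 hd2
          rwa [M.nx_nx d.2] at this
        have g1 := hwt1 d hd
        have g2 : wt d.1.2 (M.nx d.1.1 d.1.2) = weight (Dart.φ M d) := hwt1 (Dart.φ M d) hd2
        have g3 := hwt1 (Dart.φ M (Dart.φ M d)) (by
          simpa only [Dart.φ_fst, Dart.φ_snd, M.nx_nx d.2] using hd3)
        simp only [Dart.φ_fst, Dart.φ_snd, M.nx_nx d.2] at g3
        have h2 := two_le_sum_weight hE hface d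
        have c1 := corner_nonneg (M := M) (Z d.1.1) d.1.1 d.1.2
        have c2 := corner_nonneg (M := M) (Z d.1.2) d.1.2 (M.nx d.1.1 d.1.2)
        have c3 := corner_nonneg (M := M) (Z (M.nx d.1.1 d.1.2)) (M.nx d.1.1 d.1.2) d.1.1
        linarith
      · have h2 := hZ.two_le_sum_corner d.2 hd
        have := hwt0 d.1.1 d.1.2
        have := hwt0 d.1.2 (M.nx d.1.1 d.1.2)
        have := hwt0 (M.nx d.1.1 d.1.2) d.1.1
        linarith)
    (fun _ => 4) (fun v => by
      rw [Finset.sum_add_distrib]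
      by_cases hs : ∃ u, M.adj v u ∧ M.ZeroTri Z v u
      · obtain ⟨u, hu, hz⟩ := hs
        have hD : (⟨(v, u), hu⟩ : M.Dart) ∉ M.nz Z := fun h => h hz
        have hv := hne _ hD
        change Z v ≠ 0 at hv
        have h2 := hZ.sum_corner_singular hE ⟨hv, u, hu, hz⟩
        set D : M.Dart := ⟨(v, u), hu⟩ with hDdef
        have hvD : InFace D v := InFace.of_fst (SameFace.refl D)
        obtain ⟨B, b1, b2, b3, b4⟩ := hvD.exists_weight_eq_corner hE hface
        obtain ⟨q', q, hr, hiff⟩ := hvD.exists_run hE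
        have hzero : ∀ a (ha : M.adj v a), M.ZeroTri Z v a ↔ SameFace D ⟨(v, a), ha⟩ := by
          intro a ha
          constructor
          · intro h
            obtain ⟨k, hk⟩ := hZ.eq_smul_ND hE hD hvD
            have hk0 : k ≠ 0 := by rintro rfl; exact hv (by simpa using hk)
            rw [hiff]
            have e1 := h.1
            have e2 := h.2.2
            rw [hk, LinearMap.smul_apply, smul_eq_mul, mul_eq_zero] at e1 e2
            exact ⟨e1.resolve_left hk0, e2.resolve_left hk0⟩
          · intro h
            by_contra h'
            exact hZ.zeroTri_of_sameFace hE h hD h'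
        have h3 : ∑ a ∈ M.nbrs v, wt v a =
            ∑ a ∈ (M.nbrs v).filter (fun a => M.ZeroTri Z v a), M.corner B v a := by
          rw [Finset.sum_filter]
          refine Finset.sum_congr rfl fun a ha => ?_
          rw [mem_nbrs] at ha
          split_ifs with h
          · exact (hwt1 ⟨(v, a), ha⟩ h).trans (b4 a ha ((hzero a ha).1 h))
          · exact hwt2 ⟨(v, a), ha⟩ h
        have h4 := InFace.sum_corner_le hE hface (S := (M.nbrs v).filter (fun a => M.ZeroTri Z v a))
          b1 b2 b3 rfl (fun a => by
            rw [Finset.mem_filter, mem_nbrs]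
            exact ⟨fun h => ⟨h.1, (hzero a h.1).1 h.2⟩, fun ⟨h, h'⟩ => ⟨h, (hzero a h).2 h'⟩⟩)
        rw [h3]
        linarith
      · have h2 : ∑ a ∈ M.nbrs v, wt v a = 0 := Finset.sum_eq_zero fun a ha => by
          rw [mem_nbrs] at ha
          exact hwt2 ⟨(v, a), ha⟩ fun h => hs ⟨a, ha, h⟩
        rw [h2, add_zero]
        by_cases h0 : Z v = 0
        · simp [h0, OSurf.corner]
        · exact hZ.sum_corner_regular hE h0)
  have h2 := six_mul_card_vq_add_le M G hgenus
  have h3 : ((M.dq G '' (Set.univ : Set M.Dart)).ncard : ℤ) = Fintype.card (M.DQ G) := by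
    have : M.dq G '' Set.univ = Set.univ := by
      rw [Set.image_univ, Set.range_eq_univ]
      exact fun q => exists_dq q
    rw [this, Set.ncard_univ, Nat.card_eq_fintype_card]
  rw [h3, Finset.sum_const, Finset.card_univ, nsmul_eq_mul] at h1
  have h4 : (6 * Fintype.card (M.VQ G) + 12 : ℤ) ≤ Fintype.card (M.DQ G) := by exact_mod_cast h2
  linarith

end Equivariance

end OSurf

namespace OSurf

variable {E V : Type*} [AddCommGroup E] [Module ℝ E] {M : OSurf E V} {Z : V → Dual ℝ E}
variable {G : Type*} [Group G] [MulAction G V]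

lemma infinite_of_genus (M : OSurf E V) [M.Equivariant G] [Nonempty V]
    (hgenus : 4 ≤ finrank ℝ (Additive G →+ ℝ)) : Infinite V := by
  have h1 : ∃ f : Additive G →+ ℝ, f ≠ 0 := by
    by_contra h
    push Not at h
    have : Subsingleton (Additive G →+ ℝ) := ⟨fun a b => by rw [h a, h b]⟩
    rw [finrank_zero_of_subsingleton] at hgenus
    omega
  obtain ⟨f, hf⟩ := h1
  obtain ⟨g, hg⟩ := DFunLike.ne_iff.1 hf
  obtain ⟨v⟩ := ‹Nonempty V›
  refine Infinite.of_injective (fun n : ℕ => Additive.toMul (n • g) • v) fun m n h => ?_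
  have h2 : (Additive.toMul (n • g))⁻¹ * Additive.toMul (m • g) = 1 :=
    Equivariant.free (M := M) _ v (by
      rw [mul_smul, show Additive.toMul (m • g) • v = Additive.toMul (n • g) • v from h,
        inv_smul_smul])
  rw [inv_mul_eq_one] at h2
  have h3 := congrArg f (Additive.toMul.injective h2)
  rw [map_nsmul, map_nsmul] at h3
  simpa [show f g ≠ 0 from hg] using h3.symm

/-- Infinitesimal rigidity of equivariant convex polyhedral surfaces. -/
theorem IsFlex.eq_zero [M.Equivariant G] [FiniteDimensional ℝ E] (hE : finrank ℝ E = 4) (hZ : M.IsFlex Z)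
    (hG : M.IsInv G Z)
    (hface : ∀ D : M.Dart, {d | SameFace D d}.Finite)
    (hA : ∀ g : G, ∃ A : E →ₗ[ℝ] E, ∀ v, M.x (g • v) = A (M.x v))
    (hgenus : 4 ≤ finrank ℝ (Additive G →+ ℝ)) (v : V) : Z v = 0 := by
  by_contra hv
  have : Nonempty V := ⟨v⟩
  have := infinite_of_genus M hgenus
  obtain ⟨u, hu, h⟩ := exists_adj_ne_zero hE hv (hZ.self v)
  obtain ⟨Y, hY, hYG, hYne, hYtr⟩ := hZ.exists_transitive hE hG
    ⟨⟨(v, u), hu⟩, mem_nz_of_ne h⟩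
  by_cases hreg : M.regular Y = Set.univ
  · refine hY.false_of_ne_zero hE hYG hface hA hgenus fun d _ => ?_
    have : d.1.1 ∈ M.regular Y := hreg ▸ trivial
    exact this.1
  · rcases hY.bdry₀_bound hE hYG hYtr hreg with hb | ⟨hb, hol⟩
    · exact hY.false_of_ne_zero hE hYG hface hA hgenus fun d hd =>
        hY.ne_zero_of_bdry₀_eq_empty hE hface hYne hb hd (InFace.of_fst (SameFace.refl d))
    · obtain ⟨Y', h1, h2, h3, h4, h5⟩ := hY.exists_finite hE hYG hYne hol hb
      exact h1.false_of_finite hE hface h2 h3 h4 h5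

end OSurf

noncomputable section

namespace HypEnd

open Topology Filter

lemma futureTimelike_iff {x : Minkowski} : FutureTimelike x ↔ ‖x.1‖ < x.2 := by
  unfold FutureTimelike mink
  rw [real_inner_self_eq_norm_sq]
  have := norm_nonneg x.1
  constructor
  · rintro ⟨h1, h2⟩; nlinarith
  · intro h; exact ⟨by nlinarith, by linarith⟩

lemma continuous_mink {A : Type*} [TopologicalSpace A] {f g : A → Minkowski} (hf : Continuous f)
    (hg : Continuous g) : Continuous fun a => mink (f a) (g a) := by
  unfold mink
  fun_prop

section diskRegion

variable {n x y : Minkowski}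

lemma isOpen_diskRegion (n : Minkowski) : IsOpen (diskRegion n) := by
  have h : diskRegion n = {x | 0 < mink x n} ∩
      {x | ‖(x - mink x n • n).1‖ < (x - mink x n • n).2} := by
    ext x
    simp only [diskRegion, futureTimelike_iff, Set.mem_ofPred_eq, Set.mem_inter_iff]
  have hc : Continuous fun x => mink x n := continuous_mink continuous_id continuous_const
  rw [h]
  refine (isOpen_lt continuous_const hc).inter (isOpen_lt ?_ ?_) <;> fun_prop

lemma smul_mem_diskRegion (hx : x ∈ diskRegion n) {c : ℝ} (hc : 0 < c) :
    c • x ∈ diskRegion n := by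
  obtain ⟨h1, h2⟩ := hx
  rw [futureTimelike_iff] at h2
  have h3 : c • x - mink (c • x) n • n = c • (x - mink x n • n) := by
    rw [mink_smul_left, smul_sub, smul_smul]
  refine ⟨by rw [mink_smul_left]; positivity, ?_⟩
  rw [futureTimelike_iff, h3, Prod.smul_fst, Prod.smul_snd, norm_smul, Real.norm_of_nonneg hc.le,
    smul_eq_mul]
  exact mul_lt_mul_of_pos_left h2 hc

lemma add_mem_diskRegion (hx : x ∈ diskRegion n) (hy : y ∈ diskRegion n) :
    x + y ∈ diskRegion n := by
  obtain ⟨h1, h2⟩ := hx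
  obtain ⟨h3, h4⟩ := hy
  rw [futureTimelike_iff] at h2 h4
  have h5 : x + y - mink (x + y) n • n = (x - mink x n • n) + (y - mink y n • n) := by
    rw [mink_add_left]; module
  refine ⟨by rw [mink_add_left]; positivity, ?_⟩
  rw [futureTimelike_iff, h5, Prod.fst_add, Prod.snd_add]
  exact (norm_add_le _ _).trans_lt (add_lt_add h2 h4)

lemma convex_diskRegion (n : Minkowski) : Convex ℝ (diskRegion n) := by
  intro x hx y hy a b ha hb hab
  rcases ha.lt_or_eq with ha | rfl
  · rcases hb.lt_or_eq with hb | rfl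
    · exact add_mem_diskRegion (smul_mem_diskRegion hx ha) (smul_mem_diskRegion hy hb)
    · simpa using smul_mem_diskRegion hx ha
  · simpa using smul_mem_diskRegion hy (show 0 < b by linarith)

lemma ne_zero_of_mem_diskRegion (hx : x ∈ diskRegion n) : x ≠ 0 := by
  rintro rfl
  have := hx.1
  simp [mink] at this

lemma mem_diskRegion_of_sameRay (hx : x ∈ diskRegion n) (hy : y ≠ 0) (h : SameRay ℝ x y) :
    y ∈ diskRegion n := by
  obtain ⟨r, hr, rfl⟩ := h.exists_pos_left (ne_zero_of_mem_diskRegion hx) hy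
  exact smul_mem_diskRegion hx hr

end diskRegion

namespace ProjectiveStructure

variable {X Γ : Type*} [TopologicalSpace X] [Group Γ] [MulAction Γ X] {σ : ProjectiveStructure X Γ}

namespace RoundDisk

variable {D D' : σ.RoundDisk} {x y : Minkowski}

lemma carrier_nonempty (D : σ.RoundDisk) : D.carrier.Nonempty := by
  by_contra h
  rw [Set.not_nonempty_iff_eq_empty] at h
  have hn := D.mink_normal
  simp only [mink, real_inner_self_eq_norm_sq] at hn
  have hnn := norm_nonneg D.normal.1
  have hlt : D.normal.2 < ‖D.normal.1‖ := by nlinarith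
  have hpos : 0 < ‖D.normal.1‖ := by
    rcases hnn.lt_or_eq with h | h
    · exact h
    · rw [← h] at hn; nlinarith
  have h1 := (D.image_dev ⟨‖D.normal.1‖⁻¹ • D.normal.1, by
    rw [mem_sphere_zero_iff_norm, norm_smul, norm_inv, norm_norm]
    exact inv_mul_cancel₀ hpos.ne'⟩).2 (by
      simp only [mink, lightVec, real_inner_smul_right, real_inner_self_eq_norm_sq, mul_one]
      field_simp
      linarith)
  rw [h, Set.image_empty] at h1
  exact h1

lemma point_eq_of_sameRay (hx : x ∈ diskRegion D.normal) (hy : y ∈ diskRegion D.normal)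
    (h : SameRay ℝ x y) : D.point x hx = D.point y hy :=
  Quot.sound ⟨by rw [Set.inter_self]; exact D.carrier_nonempty, h⟩

lemma point_smul (hx : x ∈ diskRegion D.normal) {c : ℝ} (hc : 0 < c) :
    D.point (c • x) (smul_mem_diskRegion hx hc) = D.point x hx :=
  point_eq_of_sameRay _ _ (SameRay.sameRay_pos_smul_left x hc)

/-- The developing map of the extended end is well defined. -/
lemma sameRay_of_mk_eq {a b : Σ D : σ.RoundDisk, diskRegion D.normal}
    (h : Quot.mk σ.glue a = Quot.mk σ.glue b) : SameRay ℝ (a.2 : Minkowski) (b.2 : Minkowski) := by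
  have h1 := Quot.eqvGen_exact h
  clear h
  induction h1 with
  | rel a b h => exact h.2
  | refl a => exact SameRay.refl _
  | symm a b _ ih => exact ih.symm
  | trans a b c _ _ ih1 ih2 =>
    exact ih1.trans ih2 fun h => absurd h (ne_zero_of_mem_diskRegion b.2.2)

lemma sameRay_of_point_eq (hx : x ∈ diskRegion D.normal) (hy : y ∈ diskRegion D'.normal)
    (h : D.point x hx = D'.point y hy) : SameRay ℝ x y := sameRay_of_mk_eq h

lemma continuous_point (D : σ.RoundDisk) :
    Continuous fun x : diskRegion D.normal => D.point x x.2 :=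
  continuous_quot_mk.comp (continuous_sigmaMk (σ := fun D : σ.RoundDisk => diskRegion D.normal))

lemma nhds_mk_iff {hx : x ∈ diskRegion D.normal}
    {U : Set (Σ D : σ.RoundDisk, diskRegion D.normal)} :
    U ∈ 𝓝 (⟨D, x, hx⟩ : Σ D : σ.RoundDisk, diskRegion D.normal) ↔
      ∀ᶠ x' in 𝓝 x, ∀ h : x' ∈ diskRegion D.normal, (⟨D, x', h⟩ : Σ D : σ.RoundDisk, diskRegion D.normal) ∈ U := by
  rw [Sigma.nhds_mk, Filter.mem_map, mem_nhds_subtype]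
  constructor
  · rintro ⟨u, hu, h⟩
    filter_upwards [hu] with x' hx' h' using h (a := ⟨x', h'⟩) hx'
  · intro h
    exact ⟨_, h, fun x' hx' => hx' x'.2⟩

lemma nhds_of_glue {a b : Σ D : σ.RoundDisk, diskRegion D.normal} (h : σ.glue a b)
    {U : Set (Σ D : σ.RoundDisk, diskRegion D.normal)} (hU : U ∈ 𝓝 a) :
    {b' | ∃ a' ∈ U, σ.glue a' b'} ∈ 𝓝 b := by
  obtain ⟨D, x, hx⟩ := a
  obtain ⟨D', y, hy⟩ := b
  obtain ⟨hne, hr⟩ := h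
  obtain ⟨r, hr0, rfl⟩ := SameRay.exists_pos_right hr (ne_zero_of_mem_diskRegion hx)
    (ne_zero_of_mem_diskRegion hy)
  rw [nhds_mk_iff] at hU ⊢
  have ht : Tendsto (fun y' : Minkowski => r • y') (𝓝 y) (𝓝 (r • y)) :=
    (continuous_const_smul r).tendsto y
  filter_upwards [ht.eventually hU,
    ht.eventually ((isOpen_diskRegion D.normal).mem_nhds hx)] with y' h1 h2 h3
  exact ⟨⟨D, r • y', h2⟩, h1 h2, hne, SameRay.sameRay_pos_smul_left y' hr0⟩

lemma glue_symm {a b : Σ D : σ.RoundDisk, diskRegion D.normal} (h : σ.glue a b) : σ.glue b a :=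
  ⟨by rw [Set.inter_comm]; exact h.1, h.2.symm⟩

lemma nhds_of_mk_eq {a b : Σ D : σ.RoundDisk, diskRegion D.normal}
    (h : Quot.mk σ.glue a = Quot.mk σ.glue b)
    {U : Set (Σ D : σ.RoundDisk, diskRegion D.normal)} (hU : U ∈ 𝓝 a) :
    {b' | ∃ a' ∈ U, Quot.mk σ.glue a' = Quot.mk σ.glue b'} ∈ 𝓝 b := by
  have h1 := Quot.eqvGen_exact h
  clear h
  suffices H : (∀ U ∈ 𝓝 a, {b' | ∃ a' ∈ U, Quot.mk σ.glue a' = Quot.mk σ.glue b'} ∈ 𝓝 b) ∧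
      ∀ U ∈ 𝓝 b, {b' | ∃ a' ∈ U, Quot.mk σ.glue a' = Quot.mk σ.glue b'} ∈ 𝓝 a from H.1 U hU
  clear hU
  induction h1 with
  | rel a b h =>
    constructor
    · intro U hU
      filter_upwards [nhds_of_glue h hU]
      rintro b' ⟨a', ha', hg⟩
      exact ⟨a', ha', Quot.sound hg⟩
    · intro U hU
      filter_upwards [nhds_of_glue (glue_symm h) hU]
      rintro b' ⟨a', ha', hg⟩
      exact ⟨a', ha', Quot.sound hg⟩
  | refl a =>
    have : ∀ U ∈ 𝓝 a, {b' | ∃ a' ∈ U, Quot.mk σ.glue a' = Quot.mk σ.glue b'} ∈ 𝓝 a := by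
      intro U hU
      filter_upwards [hU] with a' ha' using ⟨a', ha', rfl⟩
    exact ⟨this, this⟩
  | symm a b _ ih => exact ih.symm
  | trans a b c _ _ ih1 ih2 =>
    constructor
    · intro U hU
      filter_upwards [ih2.1 _ (ih1.1 U hU)]
      rintro c' ⟨b', ⟨a', ha', h1⟩, h2⟩
      exact ⟨a', ha', h1.trans h2⟩
    · intro U hU
      filter_upwards [ih1.2 _ (ih2.2 U hU)]
      rintro c' ⟨b', ⟨a', ha', h1⟩, h2⟩
      exact ⟨a', ha', h1.trans h2⟩

/-- The charts of the extended end are open. -/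
lemma isOpen_image (D : σ.RoundDisk) {U : Set Minkowski} (hU : IsOpen U) :
    IsOpen {z | ∃ x ∈ U, ∃ h : x ∈ diskRegion D.normal, D.point x h = z} := by
  change IsOpen (Quot.mk σ.glue ⁻¹' _)
  rw [isOpen_iff_mem_nhds]
  rintro b ⟨x, hxU, hx, h⟩
  have hmem : {a : Σ D : σ.RoundDisk, diskRegion D.normal | a.1 = D ∧ (a.2 : Minkowski) ∈ U} ∈
      𝓝 (⟨D, x, hx⟩ : Σ D : σ.RoundDisk, diskRegion D.normal) := by
    rw [nhds_mk_iff]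
    filter_upwards [hU.mem_nhds hxU] with x' hx' h' using ⟨rfl, hx'⟩
  filter_upwards [nhds_of_mk_eq h hmem]
  rintro b' ⟨⟨D', x', hx'⟩, ⟨h1, h2⟩, h3⟩
  change D' = D at h1
  subst h1
  exact ⟨x', h2, hx', h3⟩

lemma image_mem_nhds (D : σ.RoundDisk) {U : Set Minkowski} (hx : x ∈ diskRegion D.normal)
    (hU : U ∈ 𝓝 x) :
    {z | ∃ x ∈ U, ∃ h : x ∈ diskRegion D.normal, D.point x h = z} ∈ 𝓝 (D.point x hx) := by
  obtain ⟨W, hWU, hW, hxW⟩ := mem_nhds_iff.1 hU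
  refine mem_of_superset ((isOpen_image D hW).mem_nhds ⟨x, hxW, hx, rfl⟩) ?_
  rintro z ⟨y, hy, h⟩
  exact ⟨y, hWU hy, h⟩

lemma eventually_point (hx : x ∈ diskRegion D.normal) {W : Set σ.ExtendedEnd}
    (hW : W ∈ 𝓝 (D.point x hx)) :
    ∀ᶠ y in 𝓝 x, ∃ h : y ∈ diskRegion D.normal, D.point y h ∈ W := by
  have h1 := (continuous_point D).continuousAt.preimage_mem_nhds (x := ⟨x, hx⟩) hW
  rw [mem_nhds_subtype] at h1
  obtain ⟨u, hu, h⟩ := h1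
  filter_upwards [hu, (isOpen_diskRegion D.normal).mem_nhds hx] with y hy hy'
  exact ⟨hy', h (a := ⟨y, hy'⟩) hy⟩

/-- A vector on the developed ray of a point belongs to every chart at this point. -/
lemma exists_point_eq {z : σ.ExtendedEnd} (hz : ∃ (y : Minkowski) (h : y ∈ diskRegion D.normal),
    D.point y h = z) (hx : Represents z x) : ∃ h : x ∈ diskRegion D.normal, D.point x h = z := by
  obtain ⟨y, hy, rfl⟩ := hz
  obtain ⟨D', hx', h⟩ := hx
  have h1 := sameRay_of_point_eq hy hx' h.symm
  have h2 := mem_diskRegion_of_sameRay hy (ne_zero_of_mem_diskRegion hx') h1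
  exact ⟨h2, point_eq_of_sameRay _ _ h1.symm⟩

/-- Two charts agree near a common point. -/
lemma eventually_point_eq (hx : x ∈ diskRegion D.normal) (hx' : x ∈ diskRegion D'.normal)
    (h : D.point x hx = D'.point x hx') : ∀ᶠ y in 𝓝 x, ∃ (hy : y ∈ diskRegion D.normal)
      (hy' : y ∈ diskRegion D'.normal), D.point y hy = D'.point y hy' := by
  have h1 := image_mem_nhds D hx (Filter.univ_mem : Set.univ ∈ 𝓝 x)
  rw [h] at h1
  filter_upwards [eventually_point hx' h1]
  rintro y ⟨hy', z, -, hz, h2⟩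
  obtain ⟨hy, h3⟩ := exists_point_eq ⟨z, hz, h2⟩ ⟨D', hy', rfl⟩
  exact ⟨hy, hy', h3⟩

end RoundDisk

lemma smul_point (g : Γ) (D : σ.RoundDisk) {x : Minkowski} (hx : x ∈ diskRegion D.normal) :
    g • D.point x hx = (D.translate g).point ((σ.hol g : Minkowski ≃ₗ[ℝ] Minkowski) x)
      (σ.hol_diskRegion g hx) := rfl

instance : ContinuousConstSMul Γ σ.ExtendedEnd := by
  refine ⟨fun g => ?_⟩
  refine continuous_coinduced_dom.2 ?_
  refine continuous_sigma fun D => ?_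
  have h1 : Continuous fun x : diskRegion D.normal =>
      (⟨(σ.hol g : Minkowski ≃ₗ[ℝ] Minkowski) x, σ.hol_diskRegion g x.2⟩ :
        diskRegion (D.translate g).normal) :=
    Continuous.subtype_mk ((LinearMap.continuous_of_finiteDimensional
      (σ.hol g : Minkowski ≃ₗ[ℝ] Minkowski).toLinearMap).comp continuous_subtype_val) _
  exact (RoundDisk.continuous_point (D.translate g)).comp h1

lemma Represents.smul {z : σ.ExtendedEnd} {x : Minkowski} (h : Represents z x) (g : Γ) :
    Represents (g • z) ((σ.hol g : Minkowski ≃ₗ[ℝ] Minkowski) x) := by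
  obtain ⟨D, hx, rfl⟩ := h
  exact ⟨D.translate g, σ.hol_diskRegion g hx, rfl⟩

lemma Represents.sameRay {z : σ.ExtendedEnd} {x y : Minkowski} (hx : Represents z x)
    (hy : Represents z y) : SameRay ℝ x y := by
  obtain ⟨D, hx, rfl⟩ := hx
  obtain ⟨D', hy, h⟩ := hy
  exact RoundDisk.sameRay_of_point_eq _ _ h.symm

lemma Represents.ne_zero {z : σ.ExtendedEnd} {x : Minkowski} (hx : Represents z x) : x ≠ 0 := by
  obtain ⟨D, hx, rfl⟩ := hx
  exact ne_zero_of_mem_diskRegion hx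

end ProjectiveStructure

end HypEnd

end

noncomputable section

namespace HypEnd

open Topology Filter

/-- A convex set in a finite-dimensional space has a supporting functional at any point which is not
interior. -/
lemma exists_support_of_notMem_interior {E : Type*} [NormedAddCommGroup E] [NormedSpace ℝ E]
    [FiniteDimensional ℝ E] {C : Set E} (hC : Convex ℝ C) {p : E} (hp : p ∈ C)
    (hpi : p ∉ interior C) : ∃ f : Dual ℝ E, f ≠ 0 ∧ ∀ y ∈ C, f p ≤ f y := by
  by_cases hne : (interior C).Nonempty
  · obtain ⟨f, hf⟩ := geometric_hahn_banach_open_point hC.interior isOpen_interior hpi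
    refine ⟨-f.toLinearMap, ?_, fun y hy => ?_⟩
    · intro h
      obtain ⟨y, hy⟩ := hne
      have h1 := hf y hy
      have h2 := LinearMap.congr_fun h y
      have h3 := LinearMap.congr_fun h p
      simp at h2 h3
      linarith
    · have h1 : y ∈ closure (interior C) := by
        rw [hC.closure_interior_eq_closure_of_nonempty_interior hne]
        exact subset_closure hy
      have h2 : closure (interior C) ⊆ {y | f y ≤ f p} :=
        closure_minimal (fun y hy => (hf y hy).le) (isClosed_le f.continuous continuous_const)
      have h3 : f y ≤ f p := h2 h1
      simpa using h3
  · have h1 : affineSpan ℝ C ≠ ⊤ := fun h => hne (hC.interior_nonempty_iff_affineSpan_eq_top.2 h)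
    have h2 : (affineSpan ℝ C).direction < ⊤ := by
      rw [lt_top_iff_ne_top]
      intro h
      exact h1 ((AffineSubspace.direction_eq_top_iff_of_nonempty
        ⟨p, subset_affineSpan ℝ C hp⟩).1 h)
    obtain ⟨f, hf, hle⟩ := Submodule.exists_le_ker_of_lt_top _ h2
    refine ⟨f, hf, fun y hy => ?_⟩
    have h3 := hle (AffineSubspace.vsub_mem_direction (subset_affineSpan ℝ C hy)
      (subset_affineSpan ℝ C hp))
    rw [LinearMap.mem_ker, vsub_eq_sub, map_sub, sub_eq_zero] at h3
    exact h3.ge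

namespace ProjectiveStructure

variable {X Γ : Type*} [TopologicalSpace X] [Group Γ] [MulAction Γ X] {σ : ProjectiveStructure X Γ}

/-- The cone over the part of a set contained in a chart. -/
def RoundDisk.cone (D : σ.RoundDisk) (K : Set σ.ExtendedEnd) : Set Minkowski :=
  {x | ∃ h : x ∈ diskRegion D.normal, D.point x h ∈ K}

/-- The chart contains the point. -/
def RoundDisk.At (D : σ.RoundDisk) (z : σ.ExtendedEnd) : Prop :=
  ∃ (y : Minkowski) (h : y ∈ diskRegion D.normal), D.point y h = z

namespace RoundDisk

variable {D D' : σ.RoundDisk} {K : Set σ.ExtendedEnd} {x y : Minkowski}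

lemma smul_mem_cone (hx : x ∈ D.cone K) {c : ℝ} (hc : 0 < c) : c • x ∈ D.cone K := by
  obtain ⟨h, hK⟩ := hx
  exact ⟨smul_mem_diskRegion h hc, by rwa [point_smul h hc]⟩

lemma isSegment (hx : x ∈ diskRegion D.normal) (hy : y ∈ diskRegion D.normal)
    (hi : LinearIndependent ℝ ![x, y]) : ∃ γ : ℝ → σ.ExtendedEnd, IsSegment γ x y ∧
      ∀ t ∈ Set.Icc (0 : ℝ) 1, ∃ h : (1 - t) • x + t • y ∈ diskRegion D.normal,
        γ t = D.point _ h := by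
  have hmem : ∀ t ∈ Set.Icc (0 : ℝ) 1, (1 - t) • x + t • y ∈ diskRegion D.normal := fun t ht =>
    convex_diskRegion _ hx hy (by linarith [ht.2]) ht.1 (by ring)
  classical
  refine ⟨fun t => if h : (1 - t) • x + t • y ∈ diskRegion D.normal then D.point _ h
    else D.point x hx, ⟨hi, ?_, fun t ht => ?_⟩, fun t ht => ⟨hmem t ht, dif_pos (hmem t ht)⟩⟩
  · rw [continuousOn_iff_continuous_domRestrict]
    have h1 : Continuous fun t : Set.Icc (0 : ℝ) 1 =>
        (⟨(1 - (t : ℝ)) • x + (t : ℝ) • y, hmem t t.2⟩ : diskRegion D.normal) :=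
      Continuous.subtype_mk (by fun_prop) _
    refine ((continuous_point D).comp h1).congr fun t => ?_
    simp only [Set.domRestrict_apply, Function.comp_apply, dif_pos (hmem t t.2)]
  · exact ⟨D, hmem t ht, (dif_pos (hmem t ht)).symm⟩

lemma add_mem_cone (hK : IsConvex K) (hx : x ∈ D.cone K) (hy : y ∈ D.cone K) :
    x + y ∈ D.cone K := by
  obtain ⟨hx, hxK⟩ := hx
  obtain ⟨hy, hyK⟩ := hy
  by_cases hi : LinearIndependent ℝ ![x, y]
  · obtain ⟨γ, hγ, hγD⟩ := isSegment hx hy hi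
    have h0 : γ 0 ∈ K := by
      obtain ⟨h, e⟩ := hγD 0 (by simp)
      rw [e]
      convert hxK using 2
      simp
    have h1 : γ 1 ∈ K := by
      obtain ⟨h, e⟩ := hγD 1 (by simp)
      rw [e]
      convert hyK using 2
      simp
    have h2 := hK γ x y hγ h0 h1 (1 / 2) (by norm_num)
    obtain ⟨h, e⟩ := hγD (1 / 2) (by norm_num)
    have h3 := smul_mem_cone (D := D) (K := K) ⟨h, e ▸ h2⟩ two_pos
    have h4 : (2 : ℝ) • ((1 - (1 / 2 : ℝ)) • x + (1 / 2 : ℝ) • y) = x + y := by module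
    rwa [h4] at h3
  · rw [LinearIndependent.pair_iff' (ne_zero_of_mem_diskRegion hx)] at hi
    push Not at hi
    obtain ⟨c, rfl⟩ := hi
    rcases lt_trichotomy c 0 with hc | rfl | hc
    · have h1 := add_mem_diskRegion (smul_mem_diskRegion hx (neg_pos.2 hc)) hy
      rw [neg_smul, neg_add_cancel] at h1
      exact absurd rfl (ne_zero_of_mem_diskRegion h1)
    · rw [zero_smul] at hy
      exact absurd rfl (ne_zero_of_mem_diskRegion hy)
    · have h1 : x + c • x = (1 + c) • x := by module
      rw [h1]
      exact smul_mem_cone ⟨hx, hxK⟩ (by linarith)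

lemma convex_cone (hK : IsConvex K) : Convex ℝ (D.cone K) := by
  intro x hx y hy a b ha hb hab
  rcases ha.lt_or_eq with ha | rfl
  · rcases hb.lt_or_eq with hb | rfl
    · exact add_mem_cone hK (smul_mem_cone hx ha) (smul_mem_cone hy hb)
    · simpa using smul_mem_cone hx ha
  · simpa using smul_mem_cone hy (show 0 < b by linarith)

lemma eventually_mem_cone_iff (hx : x ∈ diskRegion D.normal) (hx' : x ∈ diskRegion D'.normal)
    (h : D.point x hx = D'.point x hx') : ∀ᶠ y in 𝓝 x, (y ∈ D.cone K ↔ y ∈ D'.cone K) := by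
  filter_upwards [eventually_point_eq hx hx' h]
  rintro y ⟨hy, hy', h⟩
  exact ⟨fun ⟨_, h'⟩ => ⟨hy', h ▸ h'⟩, fun ⟨_, h'⟩ => ⟨hy, h ▸ h'⟩⟩

/-- A functional which is nonnegative on the cone over a convex set in a chart is so in any other
chart at a zero of the functional. -/
lemma nonneg_of_nonneg (hK : IsConvex K) (hx : x ∈ diskRegion D.normal)
    (hx' : x ∈ diskRegion D'.normal) (h : D.point x hx = D'.point x hx') (hxK : D.point x hx ∈ K)
    {N : Dual ℝ Minkowski} (hN : N x = 0) (hD : ∀ y ∈ D.cone K, 0 ≤ N y) :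
    ∀ y ∈ D'.cone K, 0 ≤ N y := by
  intro y hy
  have ht : Tendsto (fun τ : ℝ => x + τ • y) (𝓝[>] 0) (𝓝 x) := by
    have h1 : Continuous fun τ : ℝ => x + τ • y := by fun_prop
    have h2 := h1.tendsto 0
    rw [zero_smul, add_zero] at h2
    exact h2.mono_left nhdsWithin_le_nhds
  obtain ⟨τ, h1, hτ⟩ :=
    ((ht.eventually (eventually_mem_cone_iff (K := K) hx hx' h)).and self_mem_nhdsWithin).exists
  have hτ : 0 < τ := hτ
  have h2 : x + τ • y ∈ D'.cone K := add_mem_cone hK ⟨hx', h ▸ hxK⟩ (smul_mem_cone hy hτ)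
  have h3 := hD _ (h1.2 h2)
  rw [map_add, hN, map_smul, smul_eq_mul, zero_add] at h3
  exact nonneg_of_mul_nonneg_right h3 hτ

lemma notMem_interior_cone (hx : x ∈ diskRegion D.normal) (h : D.point x hx ∈ frontier K) :
    x ∉ interior (D.cone K) := by
  intro hi
  refine h.2 (mem_interior.2 ⟨_, ?_, isOpen_image D isOpen_interior, x, hi, hx, rfl⟩)
  rintro z ⟨y, hy, hy', rfl⟩
  exact (interior_subset hy).2

end RoundDisk

section Cone

variable {V : Type*}

/-- The vector with coordinate `1` at the vertex `v`. -/
def basisVec (v : V) : V → ℝ := Set.indicator {v} 1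

lemma basisVec_self (v : V) : basisVec v v = 1 := by simp [basisVec]

lemma basisVec_of_ne {v w : V} (h : w ≠ v) : basisVec v w = 0 := by simp [basisVec, h]

lemma basisVec_nonneg (v w : V) : 0 ≤ basisVec v w := by
  by_cases h : w = v
  · rw [h, basisVec_self]; exact zero_le_one
  · rw [basisVec_of_ne h]

/-- The nonnegative vectors supported in `t`. -/
def orthant (t : Finset V) : Set (V → ℝ) := {r | (∀ v, 0 ≤ r v) ∧ ∀ v, v ∉ t → r v = 0}

variable {t : Finset V} {r r' : V → ℝ} {v : V}

lemma basisVec_mem_orthant (hv : v ∈ t) : basisVec v ∈ orthant t :=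
  ⟨basisVec_nonneg v, fun w hw => basisVec_of_ne (by rintro rfl; exact hw hv)⟩

lemma add_mem_orthant (h : r ∈ orthant t) (h' : r' ∈ orthant t) : r + r' ∈ orthant t :=
  ⟨fun v => add_nonneg (h.1 v) (h'.1 v), fun v hv => by simp [h.2 v hv, h'.2 v hv]⟩

lemma smul_mem_orthant (h : r ∈ orthant t) {c : ℝ} (hc : 0 ≤ c) : c • r ∈ orthant t :=
  ⟨fun v => mul_nonneg hc (h.1 v), fun v hv => by simp [h.2 v hv]⟩

/-- The sum of the coordinates. -/
def mass (t : Finset V) : (V → ℝ) →ₗ[ℝ] ℝ := ∑ v ∈ t, LinearMap.proj v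

lemma mass_apply (t : Finset V) (r : V → ℝ) : mass t r = ∑ v ∈ t, r v := by
  simp [mass, LinearMap.sum_apply]

lemma continuous_mass (t : Finset V) : Continuous (mass t) := by
  have : (fun r => mass t r) = fun r : V → ℝ => ∑ v ∈ t, r v := funext (mass_apply t)
  change Continuous fun r => mass t r
  rw [this]
  fun_prop

lemma mass_basisVec (hv : v ∈ t) : mass t (basisVec v) = 1 := by
  rw [mass_apply, Finset.sum_eq_single_of_mem v hv fun w _ hw => basisVec_of_ne hw, basisVec_self]

/-- The open cone over the simplex `t`. -/
def coneTri (t : Finset V) : Set (V → ℝ) := {r | r ∈ orthant t ∧ 0 < mass t r}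

/-- The barycentric coordinates of the projection of a vector to the simplex. -/
def toBary (t : Finset V) (r : V → ℝ) : V → ℝ := (mass t r)⁻¹ • r

lemma toBary_mem (h : r ∈ coneTri t) : toBary t r ∈ baryTriangle t := by
  have h1 := smul_mem_orthant h.1 (inv_pos.2 h.2).le
  refine ⟨h1.1, h1.2, ?_⟩
  have : mass t (toBary t r) = 1 := by
    rw [toBary, map_smul, smul_eq_mul, inv_mul_cancel₀ h.2.ne']
  rwa [mass_apply] at this

lemma mem_coneTri_of_mem_bary (h : r ∈ baryTriangle t) : r ∈ coneTri t := by
  refine ⟨⟨h.1, h.2.1⟩, ?_⟩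
  rw [mass_apply, h.2.2]
  exact one_pos

lemma toBary_of_mem_bary (h : r ∈ baryTriangle t) : toBary t r = r := by
  rw [toBary, mass_apply, h.2.2, inv_one, one_smul]

lemma basisVec_mem_bary (hv : v ∈ t) : basisVec v ∈ baryTriangle t := by
  have h := basisVec_mem_orthant hv
  refine ⟨h.1, h.2, ?_⟩
  rw [← mass_apply, mass_basisVec hv]

lemma continuousOn_toBary (t : Finset V) : ContinuousOn (toBary t) (coneTri t) := by
  refine ContinuousOn.smul (ContinuousOn.inv₀ (continuous_mass t).continuousOn fun r hr =>
    hr.2.ne') continuousOn_id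

lemma convex_baryTriangle (t : Finset V) : Convex ℝ (baryTriangle t) := by
  intro r hr r' hr' a b ha hb hab
  have h := add_mem_orthant (smul_mem_orthant (mem_coneTri_of_mem_bary hr).1 ha)
    (smul_mem_orthant (mem_coneTri_of_mem_bary hr').1 hb)
  refine ⟨h.1, h.2, ?_⟩
  have h1 := hr.2.2
  have h2 := hr'.2.2
  rw [← mass_apply] at *
  rw [map_add, map_smul, map_smul, h1, h2]
  simpa using hab

/-- A property which is open and closed holds on the whole simplex. -/
lemma bary_induction {P : (V → ℝ) → Prop}
    (h1 : ∀ s ∈ baryTriangle t, P s → ∀ᶠ s' in 𝓝[baryTriangle t] s, P s')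
    (h2 : ∀ s ∈ baryTriangle t, ¬ P s → ∀ᶠ s' in 𝓝[baryTriangle t] s, ¬ P s')
    {s₀ : V → ℝ} (hs₀ : s₀ ∈ baryTriangle t) (h0 : P s₀) : ∀ s ∈ baryTriangle t, P s := by
  have := isPreconnected_iff_preconnectedSpace.1 (convex_baryTriangle t).isPreconnected
  have hclopen : IsClopen {s : baryTriangle t | P s} := by
    refine ⟨⟨?_⟩, ?_⟩
    · rw [isOpen_iff_eventually]
      intro s hs
      exact (eventually_nhds_subtype_iff _ s (fun s => ¬ P s)).2 (h2 s s.2 hs)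
    · rw [isOpen_iff_eventually]
      intro s hs
      exact (eventually_nhds_subtype_iff _ s P).2 (h1 s s.2 hs)
  have h3 := hclopen.eq_univ ⟨⟨s₀, hs₀⟩, h0⟩
  intro s hs
  have : (⟨s, hs⟩ : baryTriangle t) ∈ {s : baryTriangle t | P s} := h3 ▸ trivial
  exact this

end Cone

namespace TriangulatedSurface

variable {V : Type*} [MulAction Γ V] (S : σ.TriangulatedSurface V)

/-- The vector with given coordinates in the basis formed by the vertices of a triangle. -/
def vsum (t : Finset V) : (V → ℝ) →ₗ[ℝ] Minkowski :=
  ∑ v ∈ t, (LinearMap.proj v : (V → ℝ) →ₗ[ℝ] ℝ).smulRight (S.vec v)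

lemma vsum_apply (t : Finset V) (r : V → ℝ) : S.vsum t r = ∑ v ∈ t, r v • S.vec v := by
  simp [vsum, LinearMap.sum_apply]

variable {S} {t : Finset V} {r r' : V → ℝ} {v w : V} {D D' : σ.RoundDisk} {K : Set σ.ExtendedEnd}

lemma vsum_basisVec (hv : v ∈ t) : S.vsum t (basisVec v) = S.vec v := by
  rw [vsum_apply, Finset.sum_eq_single_of_mem v hv fun w _ hw => by
    rw [basisVec_of_ne hw, zero_smul], basisVec_self, one_smul]

lemma represents_toBary (ht : t ∈ S.triangles) (hr : r ∈ coneTri t) :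
    Represents (S.real (toBary t r)) (S.vsum t r) := by
  have h := S.represents_real t ht _ (toBary_mem hr)
  rw [← vsum_apply, toBary, map_smul] at h
  obtain ⟨D, hx, h⟩ := h
  have h1 := smul_mem_diskRegion hx hr.2
  have h2 := RoundDisk.point_smul hx hr.2
  simp only [smul_smul, mul_inv_cancel₀ hr.2.ne', one_smul] at h1 h2
  exact ⟨D, h1, h2.trans h⟩

lemma exists_at (ht : t ∈ S.triangles) (hr : r ∈ coneTri t) :
    ∃ D : σ.RoundDisk, D.At (S.real (toBary t r)) := by
  obtain ⟨D, hx, h⟩ := represents_toBary ht hr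
  exact ⟨D, _, hx, h⟩

lemma point_vsum (ht : t ∈ S.triangles) (hr : r ∈ coneTri t)
    (hD : D.At (S.real (toBary t r))) : ∃ h : S.vsum t r ∈ diskRegion D.normal,
      D.point _ h = S.real (toBary t r) :=
  RoundDisk.exists_point_eq hD (represents_toBary ht hr)

lemma eventually_at (ht : t ∈ S.triangles) (hr : r ∈ coneTri t)
    (hD : D.At (S.real (toBary t r))) :
    ∀ᶠ r' in 𝓝[coneTri t] r, D.At (S.real (toBary t r')) := by
  have hc : ContinuousOn (fun r => S.real (toBary t r)) (coneTri t) :=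
    (S.continuousOn_real t ht).comp (continuousOn_toBary t) fun r hr => toBary_mem hr
  obtain ⟨y, hy, h⟩ := hD
  have h1 := RoundDisk.image_mem_nhds D hy (Filter.univ_mem : Set.univ ∈ 𝓝 y)
  rw [h] at h1
  filter_upwards [(hc r hr).eventually h1]
  rintro r' ⟨x, -, hx, h⟩
  exact ⟨x, hx, h⟩

lemma eventually_at_bary (ht : t ∈ S.triangles) {s : V → ℝ} (hs : s ∈ baryTriangle t)
    (hD : D.At (S.real s)) : ∀ᶠ s' in 𝓝[baryTriangle t] s, D.At (S.real s') := by
  have hs' := mem_coneTri_of_mem_bary hs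
  rw [← toBary_of_mem_bary hs] at hD
  have h1 := (eventually_at ht hs' hD).filter_mono
    (nhdsWithin_mono s fun r hr => mem_coneTri_of_mem_bary hr)
  filter_upwards [h1, self_mem_nhdsWithin] with s' h2 h3
  rwa [toBary_of_mem_bary h3] at h2

lemma tendsto_line (hr : r ∈ coneTri t)
    (hq : ∀ᶠ τ : ℝ in 𝓝[>] 0, r + τ • r' ∈ orthant t) :
    Tendsto (fun τ : ℝ => r + τ • r') (𝓝[>] 0) (𝓝[coneTri t] r) := by
  have h1 : Continuous fun τ : ℝ => r + τ • r' := by fun_prop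
  have h2 := h1.tendsto 0
  rw [zero_smul, add_zero] at h2
  have h3 := h2.mono_left (nhdsWithin_le_nhds (s := Set.Ioi (0 : ℝ)))
  refine tendsto_nhdsWithin_iff.2 ⟨h3, ?_⟩
  have h4 := ((continuous_mass t).tendsto r).comp h3
  filter_upwards [hq, h4.eventually (lt_mem_nhds hr.2)] with τ h5 h6 using ⟨h5, h6⟩

/-- In the chart at a point of a triangle, the triangle is linear. -/
lemma eventually_line (ht : t ∈ S.triangles) (hr : r ∈ coneTri t)
    (hD : D.At (S.real (toBary t r)))
    (hq : ∀ᶠ τ : ℝ in 𝓝[>] 0, r + τ • r' ∈ orthant t) :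
    ∀ᶠ τ : ℝ in 𝓝[>] 0, r + τ • r' ∈ coneTri t ∧
      ∃ h : S.vsum t r + τ • S.vsum t r' ∈ diskRegion D.normal,
        D.point _ h = S.real (toBary t (r + τ • r')) := by
  have h1 := tendsto_line hr hq
  filter_upwards [h1.eventually (eventually_at ht hr hD), h1.eventually self_mem_nhdsWithin]
    with τ h2 h3
  refine ⟨h3, ?_⟩
  have h4 := point_vsum ht h3 h2
  rwa [map_add, map_smul] at h4

lemma real_mem_carrier (ht : t ∈ S.triangles) {s : V → ℝ} (hs : s ∈ baryTriangle t) :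
    S.real s ∈ S.carrier := ⟨s, Set.mem_biUnion ht hs, rfl⟩

/-- The cone over the convex domain has a supporting hyperplane along each triangle. -/
lemma exists_support (hK : IsConvex K) (hKc : IsClosed K) (hfr : frontier K = S.carrier)
    (ht : t ∈ S.triangles) {s : V → ℝ} (hs : s ∈ baryTriangle t)
    (hD : D.At (S.real s)) :
    ∃ N : Dual ℝ Minkowski, N ≠ 0 ∧ (∀ w ∈ t, N (S.vec w) = 0) ∧ ∀ y ∈ D.cone K, 0 ≤ N y := by
  have hcK : ∀ {s}, s ∈ baryTriangle t → S.real s ∈ K := fun {s} hs =>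
    hKc.frontier_subset (hfr ▸ real_mem_carrier ht hs)
  have hs' := mem_coneTri_of_mem_bary hs
  rw [← toBary_of_mem_bary hs] at hD
  have hone : (Set.indicator (t : Set V) 1 : V → ℝ) ∈ orthant t :=
    ⟨fun v => Set.indicator_nonneg (fun _ _ => zero_le_one) v, fun v hv => by simp [hv]⟩
  obtain ⟨τ, ⟨hτr, hτ, hpt⟩, hτ0⟩ := ((eventually_line ht hs' hD (r' := Set.indicator t 1) (by
    filter_upwards [self_mem_nhdsWithin] with τ hτ
    exact add_mem_orthant hs'.1 (smul_mem_orthant hone (le_of_lt hτ)))).and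
      self_mem_nhdsWithin).exists
  have hτ0 : 0 < τ := hτ0
  set r := s + τ • Set.indicator (t : Set V) (1 : V → ℝ) with hr
  have hrpos : ∀ v ∈ t, 0 < r v := fun v hv => by
    have := hs.1 v
    simp only [hr, Pi.add_apply, Pi.smul_apply, Finset.mem_coe, hv, Set.indicator_of_mem,
      Pi.one_apply, smul_eq_mul, mul_one]
    linarith
  have hvr : S.vsum t s + τ • S.vsum t (Set.indicator t 1) = S.vsum t r := by
    rw [hr, map_add, map_smul]
  have hDr : D.At (S.real (toBary t r)) := ⟨_, hτ, hpt⟩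
  obtain ⟨hreg, hpr⟩ := point_vsum ht hτr hDr
  have hmem : S.vsum t r ∈ D.cone K := ⟨hreg, by rw [hpr]; exact hcK (toBary_mem hτr)⟩
  have hni : S.vsum t r ∉ interior (D.cone K) := by
    refine RoundDisk.notMem_interior_cone hreg ?_
    rw [hpr, hfr]
    exact real_mem_carrier ht (toBary_mem hτr)
  obtain ⟨N, hN0, hN⟩ := exists_support_of_notMem_interior (RoundDisk.convex_cone hK) hmem hni
  have h0 : N (S.vsum t r) = 0 := by
    have h1 := hN _ (RoundDisk.smul_mem_cone hmem two_pos)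
    have h2 := hN _ (RoundDisk.smul_mem_cone hmem one_half_pos)
    rw [map_smul, smul_eq_mul] at h1 h2
    linarith
  rw [h0] at hN
  refine ⟨N, hN0, fun w hw => ?_, hN⟩
  have hside : ∀ c : ℝ, 0 ≤ c * N (S.vec w) := by
    intro c
    have hq : ∀ᶠ τ : ℝ in 𝓝[>] 0, r + τ • (c • basisVec w) ∈ orthant t := by
      have h1 : Tendsto (fun τ : ℝ => r w + τ * c) (𝓝[>] 0) (𝓝 (r w)) := by
        have h1 : Continuous fun τ : ℝ => r w + τ * c := by fun_prop
        have h2 := h1.tendsto 0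
        rw [zero_mul, add_zero] at h2
        exact h2.mono_left nhdsWithin_le_nhds
      filter_upwards [h1.eventually (lt_mem_nhds (hrpos w hw))] with τ hτ
      refine ⟨fun v => ?_, fun v hv => ?_⟩
      · by_cases hvw : v = w
        · subst hvw
          simpa [basisVec_self] using hτ.le
        · simpa [basisVec_of_ne hvw] using hτr.1.1 v
      · have hvw : v ≠ w := by rintro rfl; exact hv hw
        simpa [basisVec_of_ne hvw] using hτr.1.2 v hv
    obtain ⟨τ, ⟨h1, h2, h3⟩, h4⟩ :=
      ((eventually_line ht hτr hDr hq).and self_mem_nhdsWithin).exists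
    have h4 : 0 < τ := h4
    have h5 := hN _ ⟨h2, by rw [h3]; exact hcK (toBary_mem h1)⟩
    rw [map_smul, vsum_basisVec hw, map_add, h0, map_smul, map_smul, zero_add, smul_eq_mul,
      smul_eq_mul] at h5
    exact nonneg_of_mul_nonneg_right h5 h4
  have h1 := hside 1
  have h2 := hside (-1)
  linarith

end TriangulatedSurface

end ProjectiveStructure

end HypEnd

end

noncomputable section

namespace HypEnd

open Topology Filter

lemma finrank_minkowski : finrank ℝ Minkowski = 4 := by
  simp [Minkowski, Module.finrank_prod]

namespace ProjectiveStructure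

variable {X Γ : Type*} [TopologicalSpace X] [Group Γ] [MulAction Γ X] {σ : ProjectiveStructure X Γ}

namespace TriangulatedSurface

variable {V : Type*} [MulAction Γ V] {S : σ.TriangulatedSurface V}
variable {t t' : Finset V} {r r' : V → ℝ} {a b c d v w : V} {D D' : σ.RoundDisk}
  {K : Set σ.ExtendedEnd}

/-- The surface bounds the convex domain `K`, of which its vertices are extreme points. -/
structure Bounds (S : σ.TriangulatedSurface V) (K : Set σ.ExtendedEnd) : Prop where
  isClosed : IsClosed K
  smul_mem : ∀ (g : Γ), ∀ z ∈ K, g • z ∈ K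
  isConvex : IsConvex K
  frontier_eq : frontier K = S.carrier
  extreme : ∀ v : V, ¬ ∃ (γ : ℝ → σ.ExtendedEnd) (a b : Minkowski), IsSegment γ a b ∧
      (∀ t ∈ Set.Icc (0 : ℝ) 1, γ t ∈ K) ∧ ∃ t ∈ Set.Ioo (0 : ℝ) 1, γ t = S.pos v

/-- The triangle with (distinct) vertices `a`, `b`, `c` is a triangle of the surface. -/
def Tri (S : σ.TriangulatedSurface V) (a b c : V) : Prop :=
  ∃ t ∈ S.triangles, (t : Set V) = {a, b, c}

lemma Tri.rot (h : S.Tri a b c) : S.Tri b c a := by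
  obtain ⟨t, ht, h⟩ := h
  refine ⟨t, ht, ?_⟩
  rw [h]
  ext x
  simp only [Set.mem_insert_iff, Set.mem_singleton_iff]
  tauto

lemma Tri.swap (h : S.Tri a b c) : S.Tri a c b := by
  obtain ⟨t, ht, h⟩ := h
  refine ⟨t, ht, ?_⟩
  rw [h, Set.pair_comm]


lemma Tri.ne (h : S.Tri a b c) : a ≠ b ∧ b ≠ c ∧ a ≠ c := by
  obtain ⟨t, ht, h⟩ := h
  have h1 : ∀ x y : V, (t : Set V) ≠ {x, y} := fun x y hxy => by
    have h1 := S.card_eq_three t ht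
    have h2 := Set.ncard_insert_le x {y}
    rw [← hxy, Set.ncard_coe_finset, Set.ncard_singleton] at h2
    omega
  refine ⟨?_, ?_, ?_⟩ <;> rintro rfl
  · exact h1 a c (by rw [h]; simp)
  · exact h1 a b (by rw [h]; simp)
  · exact h1 a b (by rw [h]; ext; simp only [Set.mem_insert_iff, Set.mem_singleton_iff]; tauto)

lemma Tri.indep (h : S.Tri a b c) : LinearIndependent ℝ ![S.vec a, S.vec b, S.vec c] := by
  obtain ⟨hab, hbc, hac⟩ := h.ne
  obtain ⟨t, ht, h⟩ := h
  have ha : a ∈ t := by rw [← Finset.mem_coe, h]; simp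
  have hb : b ∈ t := by rw [← Finset.mem_coe, h]; simp
  have hc : c ∈ t := by rw [← Finset.mem_coe, h]; simp
  have h1 := (S.linearIndependent t ht).comp ![⟨a, ha⟩, ⟨b, hb⟩, ⟨c, hc⟩] (by
    intro i j hij
    fin_cases i <;> fin_cases j <;> simp_all)
  convert h1 using 1
  funext i
  fin_cases i <;> rfl

/-- The triangles at a vertex form a single cycle. -/
lemma exists_link (S : σ.TriangulatedSurface V) (v : V) : ∃ (n : ℕ) (w : ZMod n → V), 3 ≤ n ∧
    Function.Injective w ∧ (∀ i, S.Tri v (w i) (w (i + 1))) ∧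
    ∀ a b, S.Tri v a b → ∃ i, a = w i ∧ b = w (i + 1) ∨ b = w i ∧ a = w (i + 1) := by
  obtain ⟨n, hn, w, hw, h⟩ := S.link v
  have htri : ∀ i, S.Tri v (w i) (w (i + 1)) := fun i => by
    classical
    exact ⟨{v, w i, w (i + 1)}, ((h _).2 ⟨i, by simp⟩).1, by simp⟩
  refine ⟨n, w, hn, hw, htri, fun a b ht => ?_⟩
  have hne := ht.ne
  obtain ⟨t, ht, hab⟩ := ht
  obtain ⟨i, hi⟩ := (h t).1 ⟨ht, by rw [← Finset.mem_coe, hab]; simp⟩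
  have hne' := (htri i).ne
  rw [hab] at hi
  have h1 : a ∈ ({v, w i, w (i + 1)} : Set V) := by rw [← hi]; simp
  have h2 : b ∈ ({v, w i, w (i + 1)} : Set V) := by rw [← hi]; simp
  refine ⟨i, ?_⟩
  simp only [Set.mem_insert_iff, Set.mem_singleton_iff] at h1 h2
  grind

lemma exists_tri (S : σ.TriangulatedSurface V) (v : V) : ∃ t ∈ S.triangles, v ∈ t := by
  obtain ⟨n, w, -, -, h, -⟩ := S.exists_link v
  obtain ⟨t, ht, hv⟩ := h 0
  exact ⟨t, ht, by rw [← Finset.mem_coe, hv]; simp⟩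

lemma exists_at_pos (S : σ.TriangulatedSurface V) (v : V) : ∃ D : σ.RoundDisk, D.At (S.pos v) := by
  obtain ⟨t, ht, hv⟩ := S.exists_tri v
  have h := exists_at ht (mem_coneTri_of_mem_bary (basisVec_mem_bary hv))
  rwa [toBary_of_mem_bary (basisVec_mem_bary hv)] at h

lemma point_vec (hD : D.At (S.pos v)) :
    ∃ h : S.vec v ∈ diskRegion D.normal, D.point _ h = S.pos v := by
  obtain ⟨t, ht, hv⟩ := S.exists_tri v
  have h := point_vsum ht (mem_coneTri_of_mem_bary (basisVec_mem_bary hv)) (D := D)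
  rw [toBary_of_mem_bary (basisVec_mem_bary hv), vsum_basisVec hv] at h
  exact h hD

lemma Bounds.mem (hK : S.Bounds K) (ht : t ∈ S.triangles) {s : V → ℝ} (hs : s ∈ baryTriangle t) :
    S.real s ∈ K := hK.isClosed.frontier_subset (hK.frontier_eq ▸ real_mem_carrier ht hs)

lemma Bounds.pos_mem (hK : S.Bounds K) (v : V) : S.pos v ∈ K := by
  obtain ⟨t, ht, hv⟩ := S.exists_tri v
  exact hK.mem ht (basisVec_mem_bary hv)

lemma Bounds.vec_mem_cone (hK : S.Bounds K) (hD : D.At (S.pos v)) : S.vec v ∈ D.cone K := by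
  obtain ⟨h, h'⟩ := point_vec hD
  exact ⟨h, h' ▸ hK.pos_mem v⟩

lemma eventually_mem_orthant (hv : v ∈ t) (hr : ∀ u, u ≠ v → 0 ≤ r u)
    (hr' : ∀ u, u ∉ t → r u = 0) : ∀ᶠ τ : ℝ in 𝓝[>] 0, basisVec v + τ • r ∈ orthant t := by
  have h1 : Tendsto (fun τ : ℝ => 1 + τ * r v) (𝓝[>] 0) (𝓝 1) := by
    have h1 : Continuous fun τ : ℝ => 1 + τ * r v := by fun_prop
    have h2 := h1.tendsto 0
    rw [zero_mul, add_zero] at h2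
    exact h2.mono_left nhdsWithin_le_nhds
  filter_upwards [h1.eventually (lt_mem_nhds one_pos), self_mem_nhdsWithin] with τ h2 h3
  have h3 : 0 < τ := h3
  refine ⟨fun u => ?_, fun u hu => ?_⟩
  · by_cases h : u = v
    · subst h
      simpa [basisVec_self] using h2.le
    · simpa [basisVec_of_ne h] using mul_nonneg h3.le (hr u h)
  · have h : u ≠ v := by rintro rfl; exact hu hv
    simp [basisVec_of_ne h, hr' u hu]

/-- In a chart at a vertex, the triangles at this vertex are linear. -/
lemma eventually_line_vertex (ht : t ∈ S.triangles) (hv : v ∈ t) (hD : D.At (S.pos v))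
    (hr : ∀ u, u ≠ v → 0 ≤ r u) (hr' : ∀ u, u ∉ t → r u = 0) :
    ∀ᶠ τ : ℝ in 𝓝[>] 0, basisVec v + τ • r ∈ coneTri t ∧
      ∃ h : S.vec v + τ • S.vsum t r ∈ diskRegion D.normal,
        D.point _ h = S.real (toBary t (basisVec v + τ • r)) := by
  have h := eventually_line ht (mem_coneTri_of_mem_bary (basisVec_mem_bary hv)) (D := D)
    (by rwa [toBary_of_mem_bary (basisVec_mem_bary hv)]) (eventually_mem_orthant hv hr hr')
  rwa [vsum_basisVec hv] at h

lemma Bounds.eventually_mem_cone (hK : S.Bounds K) (ht : t ∈ S.triangles) (hv : v ∈ t)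
    (hw : w ∈ t) (hD : D.At (S.pos v)) :
    ∀ᶠ τ : ℝ in 𝓝[>] 0, S.vec v + τ • S.vec w ∈ D.cone K := by
  have h := basisVec_mem_orthant hw
  have h0 := eventually_line_vertex ht hv hD (fun u _ => h.1 u) h.2
  simp only [vsum_basisVec hw] at h0
  filter_upwards [h0]
  rintro τ ⟨h1, h2, h3⟩
  exact ⟨h2, h3 ▸ hK.mem ht (toBary_mem h1)⟩

/-- A functional which is nonnegative on the convex domain and vanishes at a vertex is nonnegative
at the neighbours of this vertex. -/
lemma Bounds.nonneg_vec (hK : S.Bounds K) (ht : t ∈ S.triangles) (hv : v ∈ t)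
    (hw : w ∈ t) (hD : D.At (S.pos v)) {N : Dual ℝ Minkowski} (hN : N (S.vec v) = 0)
    (hND : ∀ y ∈ D.cone K, 0 ≤ N y) : 0 ≤ N (S.vec w) := by
  obtain ⟨τ, h1, h2⟩ := ((hK.eventually_mem_cone ht hv hw hD).and self_mem_nhdsWithin).exists
  have h3 := hND _ h1
  rw [map_add, hN, map_smul, smul_eq_mul, zero_add] at h3
  exact nonneg_of_mul_nonneg_right h3 h2

/-- The directions at a vertex in which the convex domain extends. -/
def dirs (S : σ.TriangulatedSurface V) (K : Set σ.ExtendedEnd) (D : σ.RoundDisk) (v : V) :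
    Set Minkowski := {y | ∃ m : ℝ, 0 < m ∧ m • S.vec v + y ∈ D.cone K}

lemma Bounds.add_mem_dirs (hK : S.Bounds K) {y z : Minkowski} (hy : y ∈ S.dirs K D v)
    (hz : z ∈ S.dirs K D v) : y + z ∈ S.dirs K D v := by
  obtain ⟨m, hm, hy⟩ := hy
  obtain ⟨m', hm', hz⟩ := hz
  refine ⟨m + m', add_pos hm hm', ?_⟩
  have h := RoundDisk.add_mem_cone hK.isConvex hy hz
  have h1 : (m + m') • S.vec v + (y + z) = m • S.vec v + y + (m' • S.vec v + z) := by module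
  rwa [h1]

lemma smul_mem_dirs {y : Minkowski} (hy : y ∈ S.dirs K D v) {c : ℝ} (hc : 0 < c) :
    c • y ∈ S.dirs K D v := by
  obtain ⟨m, hm, hy⟩ := hy
  refine ⟨c * m, mul_pos hc hm, ?_⟩
  have h1 : (c * m) • S.vec v + c • y = c • (m • S.vec v + y) := by module
  rw [h1]
  exact RoundDisk.smul_mem_cone hy hc

lemma Bounds.vec_smul_mem_dirs (hK : S.Bounds K) (hD : D.At (S.pos v)) (c : ℝ) :
    c • S.vec v ∈ S.dirs K D v := by
  refine ⟨|c| + 1, by positivity, ?_⟩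
  rw [← add_smul]
  exact RoundDisk.smul_mem_cone (hK.vec_mem_cone hD) (by linarith [neg_abs_le c])

/-- Vertices are extreme points. -/
lemma Bounds.eq_smul_of_neg_mem (hK : S.Bounds K) (hD : D.At (S.pos v)) {y : Minkowski}
    (hy : y ∈ S.dirs K D v) (hy' : -y ∈ S.dirs K D v) : ∃ k : ℝ, y = k • S.vec v := by
  by_contra hcon
  push Not at hcon
  obtain ⟨hv, hpv⟩ := point_vec hD
  have hx := hK.vec_mem_cone hD
  obtain ⟨m, hm, hy⟩ := hy
  obtain ⟨m', hm', hy'⟩ := hy'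
  have ha := RoundDisk.add_mem_cone hK.isConvex hy (RoundDisk.smul_mem_cone hx hm')
  have hb := RoundDisk.add_mem_cone hK.isConvex hy' (RoundDisk.smul_mem_cone hx hm)
  set a := m • S.vec v + y + m' • S.vec v with hadef
  set b := m' • S.vec v + -y + m • S.vec v with hbdef
  have hab : a + b = (2 * (m + m')) • S.vec v := by rw [hadef, hbdef]; module
  have hi : LinearIndependent ℝ ![a, b] := by
    rw [LinearIndependent.pair_iff' (ne_zero_of_mem_diskRegion ha.1)]
    intro k hk
    by_cases h1 : 1 + k = 0
    · have h2 : a + k • a = (1 + k) • a := by module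
      rw [← hk, h2, h1, zero_smul] at hab
      have := smul_eq_zero.1 hab.symm
      rcases this with h | h
      · linarith
      · exact ne_zero_of_mem_diskRegion hv h
    · refine hcon ((1 + k)⁻¹ * (2 * (m + m')) - (m + m')) ?_
      have h2 : a + k • a = (1 + k) • a := by module
      rw [← hk, h2] at hab
      have h3 : a = (1 + k)⁻¹ • ((2 * (m + m')) • S.vec v) := by
        rw [← hab, smul_smul, inv_mul_cancel₀ h1, one_smul]
      have h4 : y = a - (m + m') • S.vec v := by rw [hadef]; module
      rw [h4, h3]
      module
  obtain ⟨γ, hγ, hγD⟩ := RoundDisk.isSegment ha.1 hb.1 hi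
  refine hK.extreme v ⟨γ, a, b, hγ, fun t ht => ?_, 1 / 2, by norm_num, ?_⟩
  · obtain ⟨h, h'⟩ := hγD t ht
    rw [h']
    have h2 := RoundDisk.convex_cone (D := D) hK.isConvex ha hb (sub_nonneg.2 ht.2) ht.1 (by ring)
    exact h2.2
  · obtain ⟨h, h'⟩ := hγD (1 / 2) (by norm_num)
    rw [h', ← hpv]
    have h2 : (1 - (1 / 2 : ℝ)) • a + (1 / 2 : ℝ) • b = (m + m') • S.vec v := by
      have h3 : (1 - (1 / 2 : ℝ)) • a + (1 / 2 : ℝ) • b = (1 / 2 : ℝ) • (a + b) := by module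
      rw [h3, hab]
      module
    refine RoundDisk.point_eq_of_sameRay _ _ ?_
    rw [h2]
    exact SameRay.sameRay_pos_smul_left _ (by positivity)

/-- The tangent cone at a vertex is pointed. -/
lemma Bounds.exists_pos (hK : S.Bounds K) (v : V) : ∃ L : Dual ℝ Minkowski, L (S.vec v) = 0 ∧
    ∀ a b, S.Tri v a b → 0 < L (S.vec a) := by
  obtain ⟨D, hD⟩ := S.exists_at_pos v
  obtain ⟨n, w, hn, -, hw, hw'⟩ := S.exists_link v
  have : NeZero n := ⟨by omega⟩
  set P : Set Minkowski := {y | y ∈ S.dirs K D v ∧ ∀ k : ℝ, y ≠ k • S.vec v} with hP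
  have hPc : Convex ℝ P := by
    rintro y ⟨hy, hy'⟩ z ⟨hz, hz'⟩ a b ha hb hab
    rcases ha.lt_or_eq with ha | rfl
    swap
    · rw [zero_add] at hab
      simpa only [hab, zero_smul, zero_add, one_smul] using (show z ∈ P from ⟨hz, hz'⟩)
    rcases hb.lt_or_eq with hb | rfl
    swap
    · rw [add_zero] at hab
      simpa only [hab, zero_smul, add_zero, one_smul] using (show y ∈ P from ⟨hy, hy'⟩)
    refine ⟨hK.add_mem_dirs (smul_mem_dirs hy ha) (smul_mem_dirs hz hb), fun k hk => ?_⟩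
    have h1 : -z = b⁻¹ • (a • y + (-k) • S.vec v) := by
      have h2 : b • z = k • S.vec v - a • y := by rw [← hk]; module
      have h3 : z = b⁻¹ • (b • z) := by rw [smul_smul, inv_mul_cancel₀ hb.ne', one_smul]
      rw [h3, h2]
      module
    have h2 : -z ∈ S.dirs K D v := by
      rw [h1]
      exact smul_mem_dirs (hK.add_mem_dirs (smul_mem_dirs hy ha) (hK.vec_smul_mem_dirs hD _))
        (inv_pos.2 hb)
    obtain ⟨k, hk⟩ := hK.eq_smul_of_neg_mem hD hz h2
    exact hz' k hk
  have hsub : convexHull ℝ (Set.range fun i => S.vec (w i)) ⊆ P := by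
    refine convexHull_min ?_ hPc
    rintro _ ⟨i, rfl⟩
    have hi := (hw i).indep
    obtain ⟨t, ht, htv⟩ := hw i
    have hvt : v ∈ t := by rw [← Finset.mem_coe, htv]; simp
    have hwt : w i ∈ t := by rw [← Finset.mem_coe, htv]; simp
    refine ⟨?_, fun k hk => ?_⟩
    · obtain ⟨τ, h1, h2⟩ :=
        ((hK.eventually_mem_cone ht hvt hwt hD).and self_mem_nhdsWithin).exists
      have h2 : 0 < τ := h2
      refine ⟨τ⁻¹, inv_pos.2 h2, ?_⟩
      have h3 := RoundDisk.smul_mem_cone h1 (inv_pos.2 h2)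
      rwa [smul_add, smul_smul, inv_mul_cancel₀ h2.ne', one_smul] at h3
    · have h1 := Fintype.linearIndependent_iff.1 hi ![k, -1, 0] (by
        simp only [Fin.sum_univ_three, Matrix.cons_val_zero, Matrix.cons_val_one,
          Matrix.cons_val_two]
        change k • S.vec v + (-1 : ℝ) • S.vec (w i) + (0 : ℝ) • S.vec (w (i + 1)) = 0
        change S.vec (w i) = _ at hk
        rw [hk]
        module) 1
      simp at h1
  have hdisj : Disjoint (convexHull ℝ (Set.range fun i => S.vec (w i)))
      (Submodule.span ℝ {S.vec v} : Set Minkowski) := by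
    rw [Set.disjoint_left]
    intro y hy hy'
    obtain ⟨k, hk⟩ := Submodule.mem_span_singleton.1 hy'
    exact (hsub hy).2 k hk.symm
  obtain ⟨f, u, u', h1, h2, h3⟩ := geometric_hahn_banach_compact_closed (convex_convexHull ℝ _)
    ((Set.finite_range _).isCompact_convexHull ℝ) (Submodule.span ℝ {S.vec v}).convex
    (Submodule.closed_of_finiteDimensional _) hdisj
  have h4 : ∀ k : ℝ, u' < k * f (S.vec v) := fun k => by
    have := h3 (k • S.vec v) (Submodule.smul_mem _ _ (Submodule.mem_span_singleton_self _))
    rwa [map_smul, smul_eq_mul] at this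
  have h5 : f (S.vec v) = 0 := by
    by_contra h
    have := h4 (u' / f (S.vec v))
    rw [div_mul_cancel₀ _ h] at this
    exact lt_irrefl _ this
  have h6 : u' < 0 := by simpa using h4 0
  refine ⟨-f.toLinearMap, by simpa using h5, fun a b hab => ?_⟩
  obtain ⟨i, hi⟩ : ∃ i, w i = a := by
    obtain ⟨i, ⟨h, -⟩ | ⟨-, h⟩⟩ := hw' a b hab
    · exact ⟨i, h.symm⟩
    · exact ⟨i + 1, h.symm⟩
  have h7 := h1 (S.vec (w i)) (subset_convexHull ℝ _ ⟨i, rfl⟩)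
  rw [hi] at h7
  have h8 : f (S.vec a) < 0 := by linarith
  simpa using h8

lemma vsum_congr (h : ∀ u, u ∉ t → r u = 0) (h' : ∀ u, u ∉ t' → r u = 0) :
    S.vsum t r = S.vsum t' r := by
  classical
  have h1 : ∀ t, (∀ u, u ∉ t → r u = 0) →
      S.vsum t r = ∑ u ∈ t.filter fun u => r u ≠ 0, r u • S.vec u := fun t ht => by
    rw [vsum_apply, Finset.sum_filter_of_ne]
    intro u _ hu hr
    rw [hr, zero_smul] at hu
    exact hu rfl
  rw [h1 t h, h1 t' h']
  refine Finset.sum_congr ?_ fun _ _ => rfl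
  ext u
  simp only [Finset.mem_filter]
  have := h u
  have := h' u
  tauto

/-- The triangles at a vertex develop to cones with disjoint interiors, modulo the vector of this
vertex. -/
lemma eq_of_vsum_eq (ht : t ∈ S.triangles) (ht' : t' ∈ S.triangles) (hv : v ∈ t) (hv' : v ∈ t')
    (hr : r ∈ orthant t) (hr' : r' ∈ orthant t') {k : ℝ}
    (h : S.vsum t r = S.vsum t' r' + k • S.vec v) {u : V} (hu : u ≠ v) : r u = r' u := by
  obtain ⟨D, hD⟩ := S.exists_at_pos v
  obtain ⟨τ, ⟨⟨h1, h2, h3⟩, h4, h5, h6⟩, hτ⟩ :=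
    (((eventually_line_vertex ht hv hD (fun u _ => hr.1 u) hr.2).and
      (eventually_line_vertex (r := r' + k • basisVec v) ht' hv' hD
        (fun u hu => by simpa [basisVec_of_ne hu] using hr'.1 u)
        (fun u hu => by
          have : u ≠ v := fun e => hu (e ▸ hv')
          simpa [basisVec_of_ne this] using hr'.2 u hu))).and self_mem_nhdsWithin).exists
  have hτ : 0 < τ := hτ
  have hvec : S.vsum t' (r' + k • basisVec v) = S.vsum t r := by
    rw [map_add, map_smul, vsum_basisVec hv', h]
  simp only [hvec] at h5 h6
  have h7 := S.injOn_real (Set.mem_biUnion ht (toBary_mem h1))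
    (Set.mem_biUnion ht' (toBary_mem h4)) (h3.symm.trans h6)
  have h8 : S.vsum t (toBary t (basisVec v + τ • r)) =
      S.vsum t' (toBary t' (basisVec v + τ • (r' + k • basisVec v))) := by
    rw [← h7]
    refine vsum_congr (toBary_mem h1).2.1 ?_
    rw [h7]
    exact (toBary_mem h4).2.1
  rw [toBary, toBary, map_smul (S.vsum t), map_smul (S.vsum t'), map_add (S.vsum t),
    map_add (S.vsum t'), map_smul (S.vsum t), map_smul (S.vsum t'), hvec,
    vsum_basisVec hv, vsum_basisVec hv'] at h8
  have h9 : (mass t (basisVec v + τ • r))⁻¹ =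
      (mass t' (basisVec v + τ • (r' + k • basisVec v)))⁻¹ :=
    smul_left_injective ℝ (ne_zero_of_mem_diskRegion h2) h8
  rw [toBary, toBary, h9] at h7
  have h10 := congrFun (smul_right_injective (V → ℝ) (inv_ne_zero h4.2.ne') h7) u
  simpa [basisVec_of_ne hu, hτ.ne'] using h10

end TriangulatedSurface

end ProjectiveStructure

end HypEnd

end

noncomputable section

namespace HypEnd

open Topology Filter

lemma exists_linearIndependent_four {a b c : Minkowski} (h : LinearIndependent ℝ ![a, b, c]) :
    ∃ d, LinearIndependent ℝ ![d, a, b, c] := by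
  obtain ⟨d, hd⟩ : ∃ d, d ∉ Submodule.span ℝ (Set.range ![a, b, c]) := by
    by_contra hcon
    push Not at hcon
    have h1 := finrank_range_le_card (R := ℝ) ![a, b, c]
    have h2 : Submodule.span ℝ (Set.range ![a, b, c]) = ⊤ := eq_top_iff.2 fun x _ => hcon x
    rw [Set.finrank, h2, finrank_top, finrank_minkowski] at h1
    simp at h1
  exact ⟨d, linearIndependent_finCons.2 ⟨h, hd⟩⟩

/-- The functional `d ↦ det (a, b, c, d)`. -/
def volForm (a b c : Minkowski) : Dual ℝ Minkowski :=
  (finBasisOfFinrankEq ℝ Minkowski finrank_minkowski).det.toMultilinearMap.toLinearMap ![a, b, c, 0] 3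

section volForm

variable (a b c d : Minkowski)

lemma volForm_apply :
    volForm a b c d = (finBasisOfFinrankEq ℝ Minkowski finrank_minkowski).det ![a, b, c, d] := by
  rw [volForm, MultilinearMap.toLinearMap_apply]
  have h : Function.update ![a, b, c, 0] 3 d = ![a, b, c, d] := by
    funext i
    fin_cases i <;> rfl
  rw [h]
  rfl

lemma volForm_swap_left : volForm b a c d = -volForm a b c d := by
  rw [volForm_apply, volForm_apply, ← AlternatingMap.map_swap _ _ (show (0 : Fin 4) ≠ 1 by decide)]
  congr 1
  funext i
  fin_cases i <;> rfl

lemma volForm_swap_mid : volForm a c b d = -volForm a b c d := by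
  rw [volForm_apply, volForm_apply, ← AlternatingMap.map_swap _ _ (show (1 : Fin 4) ≠ 2 by decide)]
  congr 1
  funext i
  fin_cases i <;> rfl

lemma volForm_swap_right : volForm a b d c = -volForm a b c d := by
  rw [volForm_apply, volForm_apply, ← AlternatingMap.map_swap _ _ (show (2 : Fin 4) ≠ 3 by decide)]
  congr 1
  funext i
  fin_cases i <;> rfl

lemma volForm_swap : volForm a c b = -volForm a b c :=
  LinearMap.ext fun d => by rw [volForm_swap_mid]; rfl

lemma volForm_rot : volForm b c a = volForm a b c :=
  LinearMap.ext fun d => by rw [volForm_swap_mid, volForm_swap_left, neg_neg]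

lemma volForm_right : volForm a b c c = 0 := by
  have h := volForm_swap_right a b c c
  linarith

lemma volForm_mid : volForm a b c b = 0 := by
  rw [← volForm_rot, ← volForm_rot, volForm_right]

lemma volForm_left : volForm a b c a = 0 := by
  rw [← volForm_rot, volForm_right]

variable {a b c}

lemma volForm_ne_zero (h : LinearIndependent ℝ ![a, b, c]) : volForm a b c ≠ 0 := by
  obtain ⟨d, hd⟩ := exists_linearIndependent_four h
  intro h0
  have h1 := (Basis.is_basis_iff_det (finBasisOfFinrankEq ℝ Minkowski finrank_minkowski)).1
    ⟨hd, hd.span_eq_top_of_card_eq_finrank' (by simp)⟩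
  rw [← volForm_apply, volForm_swap_left, volForm_swap_mid, volForm_swap_right, h0] at h1
  simp at h1

lemma volForm_map {A : Minkowski →ₗ[ℝ] Minkowski} (hA : LinearMap.det A = 1) :
    volForm (A a) (A b) (A c) (A d) = volForm a b c d := by
  rw [volForm_apply, volForm_apply]
  have h : ![A a, A b, A c, A d] = A ∘ ![a, b, c, d] := by
    funext i
    fin_cases i <;> rfl
  rw [h, Basis.det_comp, hA, one_mul]

end volForm

namespace ProjectiveStructure

variable {X Γ : Type*} [TopologicalSpace X] [Group Γ] [MulAction Γ X] {σ : ProjectiveStructure X Γ}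

namespace TriangulatedSurface

variable {V : Type*} [MulAction Γ V] {S : σ.TriangulatedSurface V}
variable {t : Finset V} {a b c d v w : V} {D : σ.RoundDisk} {K : Set σ.ExtendedEnd}
  {N : Dual ℝ Minkowski}

lemma Tri.sep {a' b' : V} (h : S.Tri v a b) (h' : S.Tri v a' b') {p q p' q' k : ℝ} (hp : 0 ≤ p)
    (hq : 0 ≤ q) (hp' : 0 ≤ p') (hq' : 0 ≤ q')
    (e : p • S.vec a + q • S.vec b = p' • S.vec a' + q' • S.vec b' + k • S.vec v) :
    p • basisVec a + q • basisVec b = p' • basisVec a' + q' • basisVec b' := by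
  obtain ⟨hva, -, hvb⟩ := h.ne
  obtain ⟨hva', -, hvb'⟩ := h'.ne
  obtain ⟨t, ht, h⟩ := h
  obtain ⟨t', ht', h'⟩ := h'
  have hv : v ∈ t := by rw [← Finset.mem_coe, h]; simp
  have ha : a ∈ t := by rw [← Finset.mem_coe, h]; simp
  have hb : b ∈ t := by rw [← Finset.mem_coe, h]; simp
  have hv' : v ∈ t' := by rw [← Finset.mem_coe, h']; simp
  have ha' : a' ∈ t' := by rw [← Finset.mem_coe, h']; simp
  have hb' : b' ∈ t' := by rw [← Finset.mem_coe, h']; simp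
  funext u
  by_cases hu : u = v
  · subst hu
    simp [basisVec_of_ne hva, basisVec_of_ne hvb, basisVec_of_ne hva', basisVec_of_ne hvb']
  · refine eq_of_vsum_eq ht ht' hv hv'
      (add_mem_orthant (smul_mem_orthant (basisVec_mem_orthant ha) hp)
        (smul_mem_orthant (basisVec_mem_orthant hb) hq))
      (add_mem_orthant (smul_mem_orthant (basisVec_mem_orthant ha') hp')
        (smul_mem_orthant (basisVec_mem_orthant hb') hq')) (k := k) ?_ hu
    simp only [map_add, map_smul, vsum_basisVec ha, vsum_basisVec hb, vsum_basisVec ha',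
      vsum_basisVec hb']
    exact e

/-- The functional `N` is nonnegative on the convex domain, in the charts at the vertex `v`. -/
def Supp (S : σ.TriangulatedSurface V) (K : Set σ.ExtendedEnd) (v : V) (N : Dual ℝ Minkowski) :
    Prop := ∀ D : σ.RoundDisk, D.At (S.pos v) → ∀ y ∈ D.cone K, 0 ≤ N y

lemma Bounds.nonneg_iff (hK : S.Bounds K) (ht : t ∈ S.triangles) {s : V → ℝ}
    (hs : s ∈ baryTriangle t) (hN : ∀ w ∈ t, N (S.vec w) = 0) (hD : D.At (S.real s)) :
    (∀ D' : σ.RoundDisk, D'.At (S.real s) → ∀ y ∈ D'.cone K, 0 ≤ N y) ↔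
      ∀ y ∈ D.cone K, 0 ≤ N y := by
  refine ⟨fun h => h D hD, fun h D' hD' => ?_⟩
  have hs' := mem_coneTri_of_mem_bary hs
  have hb := toBary_of_mem_bary hs
  obtain ⟨hx, h1⟩ := point_vsum (D := D) ht hs' (by rwa [hb])
  obtain ⟨hx', h1'⟩ := point_vsum (D := D') ht hs' (by rwa [hb])
  refine RoundDisk.nonneg_of_nonneg hK.isConvex hx hx' (h1.trans h1'.symm) ?_ ?_ h
  · rw [h1, hb]
    exact hK.mem ht hs
  · rw [vsum_apply, map_sum]
    exact Finset.sum_eq_zero fun w hw => by rw [map_smul, hN w hw, smul_zero]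

/-- The supporting half-space of a triangle is the same at all its vertices. -/
lemma Bounds.supp_congr (hK : S.Bounds K) (ht : t ∈ S.triangles) (hv : v ∈ t) (hw : w ∈ t)
    (hN : ∀ w ∈ t, N (S.vec w) = 0) (h : S.Supp K v N) : S.Supp K w N := by
  refine bary_induction (t := t) (P := fun s => ∀ D : σ.RoundDisk, D.At (S.real s) →
    ∀ y ∈ D.cone K, 0 ≤ N y) (fun s hs h => ?_) (fun s hs h => ?_) (basisVec_mem_bary hv) h _
    (basisVec_mem_bary hw)
  all_goals
    obtain ⟨D, hD⟩ := exists_at ht (mem_coneTri_of_mem_bary hs)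
    rw [toBary_of_mem_bary hs] at hD
    filter_upwards [eventually_at_bary ht hs hD, self_mem_nhdsWithin] with s' h1 h2
    rw [hK.nonneg_iff ht hs hN hD] at h
    rwa [hK.nonneg_iff ht h2 hN h1]

lemma Bounds.supp_or (hK : S.Bounds K) (h : S.Tri a b c) (ha : N (S.vec a) = 0)
    (hb : N (S.vec b) = 0) (hc : N (S.vec c) = 0) : S.Supp K a N ∨ S.Supp K a (-N) := by
  have hi := h.indep
  obtain ⟨t, ht, h⟩ := h
  have hat : a ∈ t := by rw [← Finset.mem_coe, h]; simp
  have hbt : b ∈ t := by rw [← Finset.mem_coe, h]; simp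
  have hct : c ∈ t := by rw [← Finset.mem_coe, h]; simp
  have hN : ∀ w ∈ t, N (S.vec w) = 0 := by
    intro w hw
    rw [← Finset.mem_coe, h] at hw
    rcases hw with rfl | rfl | rfl <;> assumption
  have hN' : ∀ w ∈ t, (-N) (S.vec w) = 0 := fun w hw => by simp [hN w hw]
  obtain ⟨D, hD⟩ := S.exists_at_pos a
  obtain ⟨M, hM0, hM, hMD⟩ := exists_support hK.isConvex hK.isClosed hK.frontier_eq ht
    (basisVec_mem_bary hat) hD
  obtain ⟨k, hk⟩ := exists_eq_smul_of_three finrank_minkowski hM0 hi ha hb hc (hM a hat) (hM b hbt)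
    (hM c hct)
  rcases le_total 0 k with h0 | h0
  · refine Or.inl ((hK.nonneg_iff ht (basisVec_mem_bary hat) hN hD).2 fun y hy => ?_)
    rw [hk]
    exact mul_nonneg h0 (hMD y hy)
  · refine Or.inr ((hK.nonneg_iff ht (basisVec_mem_bary hat) hN' hD).2 fun y hy => ?_)
    rw [hk, LinearMap.neg_apply, LinearMap.smul_apply, smul_eq_mul, ← neg_mul]
    exact mul_nonneg (neg_nonneg.2 h0) (hMD y hy)

/-- The convex domain is not contained in a plane near a vertex. -/
lemma Bounds.not_supp_neg (hK : S.Bounds K) (hN0 : N ≠ 0) (hN : N (S.vec v) = 0)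
    (h : S.Supp K v N) (h' : S.Supp K v (-N)) : False := by
  obtain ⟨D, hD⟩ := S.exists_at_pos v
  obtain ⟨n, w, hn, hinj, hw, -⟩ := S.exists_link v
  obtain ⟨L, hL, hLpos⟩ := hK.exists_pos v
  have hz : ∀ i, N (S.vec (w i)) = 0 := fun i => by
    obtain ⟨t, ht, hti⟩ := hw i
    have hvt : v ∈ t := by rw [← Finset.mem_coe, hti]; simp
    have hwt : w i ∈ t := by rw [← Finset.mem_coe, hti]; simp
    have h1 := hK.nonneg_vec ht hvt hwt hD hN (h D hD)
    have h2 := hK.nonneg_vec ht hvt hwt hD (by simpa using hN) (h' D hD)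
    rw [LinearMap.neg_apply] at h2
    linarith
  have hstar : IsStar n (S.vec v) (fun i => S.vec (w i)) (fun _ => N) L :=
    { three_le := hn
      indep := fun i => (hw i).indep
      N_x := fun _ => hN
      N_left := fun i => hz i
      N_right := fun i => hz (i + 1)
      N_ne := fun _ => hN0
      N_nonneg := fun _ j => (hz j).ge
      L_x := hL
      L_pos := fun i => hLpos _ _ (hw i)
      sep := by
        intro i j p q p' q' k hp hq hp' hq' e
        have h1 := (hw i).sep (hw j) hp hq hp' hq' e
        have h2 : ∀ i m (p : ℝ), (Pi.single i p : ZMod n → ℝ) m = p * basisVec (w i) (w m) := by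
          intro i m p
          by_cases h : m = i
          · subst h; simp [basisVec_self]
          · rw [Pi.single_eq_of_ne h, basisVec_of_ne (fun e => h (hinj e)), mul_zero]
        funext m
        have h3 := congrFun h1 (w m)
        simpa only [Pi.add_apply, h2, Pi.smul_apply, smul_eq_mul] using h3 }
  obtain ⟨i, hi⟩ := hstar.exists_ne_zero finrank_minkowski hN0 hN
  exact hi (hz i)

/-- The triangle with vertices `a`, `b`, `c` is positively oriented, as seen from outside of the
convex domain. -/
def Pos (S : σ.TriangulatedSurface V) (K : Set σ.ExtendedEnd) (a b c : V) : Prop :=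
  S.Tri a b c ∧ S.Supp K a (volForm (S.vec a) (S.vec b) (S.vec c))

lemma Tri.volForm_eq_zero (h : (t : Set V) = {a, b, c}) :
    ∀ w ∈ t, volForm (S.vec a) (S.vec b) (S.vec c) (S.vec w) = 0 := by
  intro w hw
  rw [← Finset.mem_coe, h] at hw
  rcases hw with rfl | rfl | rfl
  exacts [volForm_left _ _ _, volForm_mid _ _ _, volForm_right _ _ _]

lemma Bounds.pos_rot (hK : S.Bounds K) (h : S.Pos K a b c) : S.Pos K b c a := by
  refine ⟨h.1.rot, ?_⟩
  rw [volForm_rot]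
  obtain ⟨⟨t, ht, htabc⟩, h⟩ := h
  exact hK.supp_congr ht (by rw [← Finset.mem_coe, htabc]; simp)
    (by rw [← Finset.mem_coe, htabc]; simp) (Tri.volForm_eq_zero htabc) h

lemma Bounds.pos_or (hK : S.Bounds K) (h : S.Tri a b c) : S.Pos K a b c ∨ S.Pos K a c b := by
  refine (hK.supp_or h (volForm_left _ _ _) (volForm_mid _ _ _)
    (volForm_right _ _ _)).imp (fun h' => ⟨h, h'⟩) fun h' => ⟨h.swap, ?_⟩
  rwa [volForm_swap]

lemma Bounds.not_pos_swap (hK : S.Bounds K) (h : S.Pos K a b c) : ¬ S.Pos K a c b := by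
  intro h'
  have h2 := h'.2
  rw [volForm_swap] at h2
  exact hK.not_supp_neg (volForm_ne_zero h.1.indep) (volForm_left _ _ _) h.2 h2

lemma Bounds.volForm_nonneg (hK : S.Bounds K) (h : S.Pos K a b c) (hv : S.Tri a v w) :
    0 ≤ volForm (S.vec a) (S.vec b) (S.vec c) (S.vec v) := by
  obtain ⟨t, ht, hav⟩ := hv
  obtain ⟨D, hD⟩ := S.exists_at_pos a
  exact hK.nonneg_vec ht (by rw [← Finset.mem_coe, hav]; simp)
    (by rw [← Finset.mem_coe, hav]; simp) hD (volForm_left _ _ _) (h.2 D hD)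

/-- There is a single positively oriented triangle on each side of an edge. -/
lemma Bounds.pos_unique (hK : S.Bounds K) (h : S.Pos K v w c) (h' : S.Pos K v w d) : c = d := by
  by_contra hcd
  have h1 := hK.volForm_nonneg h h'.1.swap
  have h2 := hK.volForm_nonneg h' h.1.swap
  rw [volForm_swap_right] at h2
  have h0 : volForm (S.vec v) (S.vec w) (S.vec c) (S.vec d) = 0 := by linarith
  obtain ⟨α, β, γ, δ, he, hne⟩ := exists_relation_four finrank_minkowski
    (volForm_ne_zero h.1.indep) (volForm_left _ _ _) (volForm_mid _ _ _) (volForm_right _ _ _) h0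
  have hδ : δ ≠ 0 := by
    rintro rfl
    have h3 := Fintype.linearIndependent_iff.1 h.1.indep ![α, β, γ] (by
      simpa [Fin.sum_univ_three] using he)
    exact hne ⟨h3 0, h3 1, h3 2, rfl⟩
  obtain ⟨α, β, γ, he⟩ : ∃ α β γ : ℝ, S.vec d = α • S.vec v + β • S.vec w + γ • S.vec c := by
    refine ⟨-δ⁻¹ * α, -δ⁻¹ * β, -δ⁻¹ * γ, ?_⟩
    have h3 : S.vec d = δ⁻¹ • (δ • S.vec d) := by rw [smul_smul, inv_mul_cancel₀ hδ, one_smul]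
    have h4 : δ • S.vec d = -(α • S.vec v + β • S.vec w + γ • S.vec c) :=
      (neg_eq_of_add_eq_zero_right he).symm
    rw [h3, h4]
    module
  have hform : volForm (S.vec v) (S.vec w) (S.vec d) = γ • volForm (S.vec v) (S.vec w) (S.vec c) := by
    refine LinearMap.ext fun y => ?_
    rw [volForm_swap_right, he, map_add, map_add, map_smul, map_smul, map_smul, volForm_left,
      volForm_mid, volForm_swap_right]
    simp
  have hγ : 0 ≤ γ := by
    by_contra hγ
    push Not at hγ
    refine hK.not_supp_neg (volForm_ne_zero h.1.indep) (volForm_left _ _ _) h.2 ?_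
    intro D hD y hy
    have h3 := h'.2 D hD y hy
    rw [hform, LinearMap.smul_apply, smul_eq_mul] at h3
    rw [LinearMap.neg_apply]
    nlinarith
  have hwd := h'.1.ne.2.1
  rcases le_total 0 β with hβ | hβ
  · have h3 := congrFun (h'.1.sep h.1 (p := 0) (q := 1) (p' := β) (q' := γ) (k := α) le_rfl
      zero_le_one hβ hγ (by rw [he]; module)) d
    simp [basisVec_self, basisVec_of_ne hwd.symm, basisVec_of_ne (Ne.symm hcd)] at h3
  · have h3 := congrFun (h'.1.sep h.1 (p := -β) (q := 1) (p' := 0) (q' := γ) (k := α)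
      (neg_nonneg.2 hβ) zero_le_one le_rfl hγ (by rw [he]; module)) d
    simp [basisVec_self, basisVec_of_ne hwd.symm, basisVec_of_ne (Ne.symm hcd)] at h3

/-- The positively oriented triangles at a vertex form a cycle. -/
lemma Bounds.exists_link (hK : S.Bounds K) (v : V) : ∃ (n : ℕ) (w : ZMod n → V), 3 ≤ n ∧
    Function.Injective w ∧ (∀ i, S.Pos K v (w i) (w (i + 1))) ∧
    ∀ a b, S.Pos K v a b → ∃ i, a = w i ∧ b = w (i + 1) := by
  obtain ⟨n, w, hn, hinj, hw, hw'⟩ := S.exists_link v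
  have : NeZero n := ⟨by omega⟩
  have h2 : ∀ i : ZMod n, i ≠ i + 1 + 1 := by
    intro i h
    have h3 : ((2 : ℕ) : ZMod n) = 0 := by
      push_cast
      linear_combination -h
    rw [ZMod.natCast_eq_zero_iff] at h3
    have := Nat.le_of_dvd two_pos h3
    omega
  have hstep : ∀ i, S.Pos K v (w i) (w (i + 1)) → S.Pos K v (w (i + 1)) (w (i + 1 + 1)) := by
    intro i hi
    refine (hK.pos_or (hw (i + 1))).resolve_right fun h => ?_
    have h3 := hK.pos_unique (hK.pos_rot (hK.pos_rot hi)) (hK.pos_rot (hK.pos_rot h))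
    exact h2 i (hinj h3)
  by_cases hex : ∃ i, S.Pos K v (w i) (w (i + 1))
  · obtain ⟨i, hi⟩ := hex
    have hall : ∀ j, S.Pos K v (w j) (w (j + 1)) := by
      intro j
      have h3 : ∀ m : ℕ, S.Pos K v (w (i + m)) (w (i + m + 1)) := by
        intro m
        induction m with
        | zero => simpa using hi
        | succ m ih => simpa [add_assoc] using hstep _ ih
      simpa using h3 (j - i).val
    refine ⟨n, w, hn, hinj, hall, fun a b hab => ?_⟩
    obtain ⟨i, h | ⟨rfl, rfl⟩⟩ := hw' a b hab.1
    · exact ⟨i, h⟩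
    · exact absurd hab (hK.not_pos_swap (hall i))
  · push Not at hex
    have hall : ∀ j, S.Pos K v (w (j + 1)) (w j) := fun j =>
      (hK.pos_or (hw j)).resolve_left (hex j)
    refine ⟨n, fun i => w (-i), hn, hinj.comp neg_injective, fun i => ?_, fun a b hab => ?_⟩
    · have h3 := hall (-(i + 1))
      rwa [show -(i + 1) + 1 = -i by ring] at h3
    · obtain ⟨i, ⟨rfl, rfl⟩ | ⟨rfl, rfl⟩⟩ := hw' a b hab.1
      · exact absurd hab (hK.not_pos_swap (hall i))
      · exact ⟨-(i + 1), by simp, by simp⟩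

end TriangulatedSurface

end ProjectiveStructure

end HypEnd

end

noncomputable section

namespace HypEnd

open Topology Filter

namespace ProjectiveStructure

variable {X Γ : Type*} [TopologicalSpace X] [Group Γ] [MulAction Γ X] {σ : ProjectiveStructure X Γ}

lemma det_hol (σ : ProjectiveStructure X Γ) (g : Γ) :
    LinearMap.det ((σ.hol g : Minkowski ≃ₗ[ℝ] Minkowski) : Minkowski →ₗ[ℝ] Minkowski) = 1 := by
  rw [← LinearEquiv.coe_det, (σ.hol g).2.2.1, Units.val_one]

lemma hol_hol_inv (σ : ProjectiveStructure X Γ) (g : Γ) (x : Minkowski) :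
    (σ.hol g : Minkowski ≃ₗ[ℝ] Minkowski) ((σ.hol g⁻¹ : Minkowski ≃ₗ[ℝ] Minkowski) x) = x := by
  rw [map_inv]
  exact (σ.hol g : Minkowski ≃ₗ[ℝ] Minkowski).apply_symm_apply x

lemma RoundDisk.At.translate {D : σ.RoundDisk} {z : σ.ExtendedEnd} (h : D.At z) (g : Γ) :
    (D.translate g).At (g • z) := by
  obtain ⟨y, hy, rfl⟩ := h
  exact ⟨_, _, rfl⟩

namespace TriangulatedSurface

variable {V : Type*} [MulAction Γ V] {S : σ.TriangulatedSurface V}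
variable {t : Finset V} {s : V → ℝ} {a b c d v w : V} {D : σ.RoundDisk} {K : Set σ.ExtendedEnd}

lemma pos_smul (S : σ.TriangulatedSurface V) (g : Γ) (v : V) : S.pos (g • v) = g • S.pos v :=
  S.equivariant g v

lemma vec_smul (S : σ.TriangulatedSurface V) (g : Γ) (v : V) :
    S.vec (g • v) = (σ.hol g : Minkowski ≃ₗ[ℝ] Minkowski) (S.vec v) := by
  have hrep : ∀ v, Represents (S.pos v) (S.vec v) := fun v => by
    obtain ⟨D, hD⟩ := S.exists_at_pos v
    obtain ⟨h, h'⟩ := point_vec hD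
    exact ⟨D, h, h'⟩
  have h1 := hrep (g • v)
  rw [pos_smul] at h1
  have h2 := (hrep v).smul g
  obtain ⟨r, hr, h⟩ := (h2.sameRay h1).exists_pos_left h2.ne_zero h1.ne_zero
  have h3 := S.mink_vec (g • v)
  rw [← h, mink_smul_left, mink_smul_right, hol_mink] at h3
  have h4 : r * r = 1 := by
    have := mul_pos hr hr
    rcases S.mink_vec v with h5 | h5 <;> rw [h5] at h3 <;> rcases h3 with h3 | h3 <;> nlinarith
  have h5 : r = 1 := by nlinarith
  rw [← h, h5, one_smul]

/-- The image of a triangle under a deck transformation. -/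
def translate (g : Γ) (t : Finset V) : Finset V := t.map (MulAction.toPerm g).toEmbedding

lemma coe_translate (g : Γ) (t : Finset V) : (translate g t : Set V) = (g • ·) '' (t : Set V) := by
  rw [translate, Finset.coe_map]
  rfl

lemma smul_mem_translate (g : Γ) : g • v ∈ translate g t ↔ v ∈ t := by
  rw [← Finset.mem_coe, coe_translate]
  exact (MulAction.injective g).mem_set_image

lemma translate_mul (g h : Γ) (t : Finset V) :
    translate (g * h) t = translate g (translate h t) := by
  rw [← Finset.coe_inj, coe_translate, coe_translate, coe_translate, Set.image_image]
  simp only [mul_smul]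

lemma translate_one (t : Finset V) : translate (1 : Γ) t = t := by
  rw [← Finset.coe_inj, coe_translate]
  simp

lemma Tri.smul (h : S.Tri a b c) (g : Γ) : S.Tri (g • a) (g • b) (g • c) := by
  obtain ⟨t, ht, h⟩ := h
  refine ⟨translate g t, S.smul_mem g t ht, ?_⟩
  rw [coe_translate, h, Set.image_insert_eq, Set.image_pair]

lemma Bounds.pos_smul (hK : S.Bounds K) (h : S.Pos K a b c) (g : Γ) :
    S.Pos K (g • a) (g • b) (g • c) := by
  refine ⟨h.1.smul g, fun D hD y hy => ?_⟩
  have h1 := hD.translate g⁻¹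
  rw [TriangulatedSurface.pos_smul, inv_smul_smul] at h1
  obtain ⟨hy, hyK⟩ := hy
  have h2 := h.2 _ h1 _ ⟨σ.hol_diskRegion g⁻¹ hy, hK.smul_mem g⁻¹ _ hyK⟩
  rw [← volForm_map _ (σ.det_hol g)] at h2
  simp only [LinearEquiv.coe_coe, hol_hol_inv, ← vec_smul] at h2
  exact h2

/-- The action of the deck group on barycentric coordinates. -/
def push (g : Γ) (s : V → ℝ) : V → ℝ := fun v => s (g⁻¹ • v)

lemma push_smul (g : Γ) (s : V → ℝ) (v : V) : push g s (g • v) = s v := by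
  rw [push, inv_smul_smul]

lemma push_mem (hs : s ∈ baryTriangle t) (g : Γ) : push g s ∈ baryTriangle (translate g t) := by
  refine ⟨fun v => hs.1 _, fun v hv => hs.2.1 _ fun h => hv ?_, ?_⟩
  · rwa [← smul_mem_translate g, smul_inv_smul] at h
  · rw [translate, Finset.sum_map]
    exact (Finset.sum_congr rfl fun v _ => push_smul g s v).trans hs.2.2

lemma push_basisVec (g : Γ) (v : V) : push g (basisVec v) = basisVec (g • v) := by
  funext u
  rw [push]
  by_cases h : u = g • v
  · rw [h, inv_smul_smul, basisVec_self, basisVec_self]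
  · rw [basisVec_of_ne h, basisVec_of_ne]
    rintro rfl
    exact h (smul_inv_smul g u).symm

lemma vsum_push (S : σ.TriangulatedSurface V) (g : Γ) (t : Finset V) (s : V → ℝ) :
    S.vsum (translate g t) (push g s) =
      (σ.hol g : Minkowski ≃ₗ[ℝ] Minkowski) (S.vsum t s) := by
  rw [vsum_apply, vsum_apply, map_sum, translate, Finset.sum_map]
  refine Finset.sum_congr rfl fun v _ => ?_
  change push g s (g • v) • S.vec (g • v) = _
  rw [push_smul, vec_smul, map_smul]

lemma smul_mem_carrier (S : σ.TriangulatedSurface V) (g : Γ) {z : σ.ExtendedEnd}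
    (hz : z ∈ S.carrier) : g • z ∈ S.carrier := by
  obtain ⟨u, -, hu, hr⟩ := S.marking
  change z ∈ S.real '' _ at hz
  change g • z ∈ S.real '' _
  rw [← hr] at hz ⊢
  obtain ⟨x, rfl⟩ := hz
  exact ⟨g • x, hu g x⟩

lemma exists_separated_nhds (S : σ.TriangulatedSurface V) {z z' : σ.ExtendedEnd}
    (hz : z ∈ S.carrier) (hz' : z' ∈ S.carrier) (hne : z ≠ z') :
    ∃ W ∈ 𝓝 z, ∃ W' ∈ 𝓝 z', ∀ y ∈ S.carrier, y ∈ W → y ∉ W' := by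
  obtain ⟨u, hemb, hu, hr⟩ := S.marking
  change z ∈ S.real '' _ at hz
  change z' ∈ S.real '' _ at hz'
  rw [← hr] at hz hz'
  obtain ⟨x, rfl⟩ := hz
  obtain ⟨x', rfl⟩ := hz'
  have := σ.t2
  obtain ⟨U, U', hU, hU', hx, hx', hd⟩ := t2_separation (fun h => hne (congrArg u h) : x ≠ x')
  obtain ⟨W, hW, rfl⟩ := hemb.isInducing.isOpen_iff.1 hU
  obtain ⟨W', hW', rfl⟩ := hemb.isInducing.isOpen_iff.1 hU'
  refine ⟨W, hW.mem_nhds hx, W', hW'.mem_nhds hx', ?_⟩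
  intro y hy
  change y ∈ S.real '' _ at hy
  rw [← hr] at hy
  obtain ⟨y, rfl⟩ := hy
  exact fun h h' => Set.disjoint_left.1 hd h h'

lemma real_push (ht : t ∈ S.triangles) (hs : s ∈ baryTriangle t) (g : Γ) :
    S.real (push g s) = g • S.real s := by
  obtain ⟨v, hv⟩ : ∃ v, v ∈ t := Finset.card_pos.1 (by rw [S.card_eq_three t ht]; norm_num)
  have htg : translate g t ∈ S.triangles := S.smul_mem g t ht
  have hcont : Continuous fun s : V → ℝ => push g s := by
    unfold push
    fun_prop
  have htend : ∀ s, Tendsto (push g) (𝓝[baryTriangle t] s)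
      (𝓝[baryTriangle (translate g t)] (push g s)) := fun s =>
    tendsto_nhdsWithin_iff.2 ⟨(hcont.tendsto s).mono_left nhdsWithin_le_nhds, by
      filter_upwards [self_mem_nhdsWithin] with s' hs' using push_mem hs' g⟩
  refine bary_induction (t := t) (P := fun s => S.real (push g s) = g • S.real s)
    (fun s hs h => ?_) (fun s hs h => ?_) (basisVec_mem_bary hv) ?_ s hs
  · obtain ⟨D, hD⟩ := exists_at ht (mem_coneTri_of_mem_bary hs)
    rw [toBary_of_mem_bary hs] at hD
    have hD' := hD.translate g
    rw [← h] at hD'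
    filter_upwards [eventually_at_bary ht hs hD, self_mem_nhdsWithin,
      (htend s).eventually (eventually_at_bary htg (push_mem hs g) hD')] with s' h1 h2 h3
    obtain ⟨hr1, e1⟩ := point_vsum ht (mem_coneTri_of_mem_bary h2) (D := D)
      (by rwa [toBary_of_mem_bary h2])
    obtain ⟨hr2, e2⟩ := point_vsum htg (mem_coneTri_of_mem_bary (push_mem h2 g))
      (D := D.translate g) (by rwa [toBary_of_mem_bary (push_mem h2 g)])
    rw [toBary_of_mem_bary h2] at e1
    rw [toBary_of_mem_bary (push_mem h2 g)] at e2
    rw [← e1, ← e2, smul_point]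
    simp only [vsum_push]
  · obtain ⟨W, hW, W', hW', hd⟩ := S.exists_separated_nhds
      (real_mem_carrier htg (push_mem hs g)) (S.smul_mem_carrier g (real_mem_carrier ht hs)) h
    have h1 := ((S.continuousOn_real _ htg _ (push_mem hs g)).tendsto.comp (htend s)).eventually hW
    have h2 := ((continuous_const_smul g).continuousAt.tendsto.comp
      (S.continuousOn_real _ ht _ hs).tendsto).eventually hW'
    filter_upwards [h1, h2, self_mem_nhdsWithin] with s' h1 h2 h3 h4
    refine hd _ (real_mem_carrier htg (push_mem h3 g)) h1 ?_
    rw [h4]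
    exact h2
  · rw [push_basisVec]
    exact S.equivariant g v

lemma eq_one_of_smul_eq (S : σ.TriangulatedSurface V) {g : Γ} {z : σ.ExtendedEnd}
    (hz : z ∈ S.carrier) (h : g • z = z) : g = 1 := by
  obtain ⟨u, hemb, hu, hr⟩ := S.marking
  change z ∈ S.real '' _ at hz
  rw [← hr] at hz
  obtain ⟨x, rfl⟩ := hz
  rw [← hu] at h
  exact σ.free g x (hemb.injective h)

/-- No nontrivial deck transformation fixes a point of the surface. -/
lemma eq_one_of_push_eq (ht : t ∈ S.triangles) (hs : s ∈ coneTri t) {g : Γ}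
    (h : push g s = s) : g = 1 := by
  refine S.eq_one_of_smul_eq (real_mem_carrier ht (toBary_mem hs)) (z := S.real (toBary t s)) ?_
  rw [← real_push ht (toBary_mem hs)]
  congr 1
  change (mass t s)⁻¹ • push g s = _
  rw [h]
  rfl

lemma add_mem_coneTri {r r' : V → ℝ} (h : r ∈ coneTri t) (h' : r' ∈ coneTri t) :
    r + r' ∈ coneTri t := ⟨add_mem_orthant h.1 h'.1, by rw [map_add]; exact add_pos h.2 h'.2⟩

lemma push_add (g : Γ) (r r' : V → ℝ) : push g (r + r') = push g r + push g r' := rfl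

lemma eq_one_of_smul_vertex (S : σ.TriangulatedSurface V) {g : Γ} (h : g • v = v) : g = 1 := by
  obtain ⟨t, ht, hv⟩ := S.exists_tri v
  exact eq_one_of_push_eq ht (mem_coneTri_of_mem_bary (basisVec_mem_bary hv))
    (by rw [push_basisVec, h])

lemma Tri.not_swap (h : S.Tri a b c) {g : Γ} (h1 : g • a = b) (h2 : g • b = a) : False := by
  have hne := h.ne.1
  obtain ⟨t, ht, h⟩ := h
  have ha : a ∈ t := by rw [← Finset.mem_coe, h]; simp
  have hb : b ∈ t := by rw [← Finset.mem_coe, h]; simp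
  have hg := eq_one_of_push_eq ht (add_mem_coneTri
    (mem_coneTri_of_mem_bary (basisVec_mem_bary ha))
    (mem_coneTri_of_mem_bary (basisVec_mem_bary hb))) (g := g)
    (by rw [push_add, push_basisVec, push_basisVec, h1, h2, add_comm])
  rw [hg, one_smul] at h1
  exact hne h1

lemma Tri.not_rot (h : S.Tri a b c) {g : Γ} (h1 : g • a = b) (h2 : g • b = c) (h3 : g • c = a) :
    False := by
  have hne := h.ne.1
  obtain ⟨t, ht, h⟩ := h
  have ha : a ∈ t := by rw [← Finset.mem_coe, h]; simp
  have hb : b ∈ t := by rw [← Finset.mem_coe, h]; simp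
  have hc : c ∈ t := by rw [← Finset.mem_coe, h]; simp
  have hg := eq_one_of_push_eq ht (add_mem_coneTri (add_mem_coneTri
    (mem_coneTri_of_mem_bary (basisVec_mem_bary ha))
    (mem_coneTri_of_mem_bary (basisVec_mem_bary hb)))
    (mem_coneTri_of_mem_bary (basisVec_mem_bary hc))) (g := g)
    (by rw [push_add, push_add, push_basisVec, push_basisVec, push_basisVec, h1, h2, h3]; abel)
  rw [hg, one_smul] at h1
  exact hne h1

/-! ### Connectedness -/

lemma isCompact_baryTriangle (t : Finset V) : IsCompact (baryTriangle t) := by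
  have h1 : IsCompact (Set.pi Set.univ fun _ : V => Set.Icc (0 : ℝ) 1) :=
    isCompact_univ_pi fun _ => isCompact_Icc
  refine h1.of_isClosed_subset ?_ fun s hs v _ => ⟨hs.1 v, ?_⟩
  · have h2 : baryTriangle t = (⋂ v, {s : V → ℝ | 0 ≤ s v}) ∩
        ((⋂ v, ⋂ (_ : v ∉ t), {s : V → ℝ | s v = 0}) ∩ {s : V → ℝ | ∑ v ∈ t, s v = 1}) := by
      ext s
      simp [baryTriangle]
    rw [h2]
    refine (isClosed_iInter fun v => isClosed_le continuous_const (continuous_apply v)).inter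
      ((isClosed_iInter fun v => isClosed_iInter fun _ =>
        isClosed_eq (continuous_apply v) continuous_const).inter
        (isClosed_eq (by fun_prop) continuous_const))
  · by_cases hv : v ∈ t
    · rw [← hs.2.2]
      exact Finset.single_le_sum (fun w _ => hs.1 w) hv
    · rw [hs.2.1 v hv]
      exact zero_le_one

lemma finite_triangles_at (S : σ.TriangulatedSurface V) (v : V) :
    {t | t ∈ S.triangles ∧ v ∈ t}.Finite := by
  obtain ⟨n, hn, w, -, h⟩ := S.link v
  have : NeZero n := ⟨by omega⟩
  refine Set.Finite.of_finite_image (f := fun t : Finset V => (t : Set V)) ?_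
    Finset.coe_injective.injOn
  refine (Set.finite_range fun i => ({v, w i, w (i + 1)} : Set V)).subset ?_
  rintro _ ⟨t, ht, rfl⟩
  obtain ⟨i, hi⟩ := (h t).1 ht
  exact ⟨i, hi.symm⟩

lemma exists_finite_triangles (S : σ.TriangulatedSurface V) : ∃ F : Set (Finset V), F.Finite ∧
    F ⊆ S.triangles ∧ ∀ t ∈ S.triangles, ∃ g : Γ, ∃ t₀ ∈ F, t = translate g t₀ := by
  have := S.finite
  refine ⟨⋃ q : Quotient (MulAction.orbitRel Γ V), {t | t ∈ S.triangles ∧ q.out ∈ t},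
    Set.finite_iUnion fun q => S.finite_triangles_at _, ?_, fun t ht => ?_⟩
  · intro t ht
    obtain ⟨q, hq⟩ := Set.mem_iUnion.1 ht
    exact hq.1
  · obtain ⟨v, hv⟩ : ∃ v, v ∈ t := Finset.card_pos.1 (by rw [S.card_eq_three t ht]; norm_num)
    obtain ⟨g, hg⟩ : ∃ g : Γ, g • v = (Quotient.mk (MulAction.orbitRel Γ V) v).out :=
      (MulAction.orbitRel_apply).1 (Quotient.mk_out (s := MulAction.orbitRel Γ V) v)
    refine ⟨g⁻¹, translate g t, Set.mem_iUnion.2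
      ⟨Quotient.mk (MulAction.orbitRel Γ V) v, S.smul_mem g t ht, ?_⟩, ?_⟩
    · rw [← hg]
      exact (smul_mem_translate g).2 hv
    · rw [← translate_mul, inv_mul_cancel, translate_one]

lemma exists_compact_nhds (σ : ProjectiveStructure X Γ) (x : X) : ∃ L ∈ 𝓝 x, IsCompact L := by
  obtain ⟨e, hx, -⟩ := σ.isLocalHomeomorph_dev x
  obtain ⟨C, hC, hCe, hCc⟩ := local_compact_nhds (e.open_target.mem_nhds (e.map_source hx))
  refine ⟨e.symm '' C, ?_, hCc.image_of_continuousOn (e.continuousOn_symm.mono hCe)⟩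
  have h1 := e.symm.image_mem_nhds (e.map_source hx) hC
  rwa [e.left_inv hx] at h1

/-- The triangles connected by edges to a given vertex form the whole surface. -/
lemma eq_univ_of_closed (S : σ.TriangulatedSurface V) {A : Set V} (hA : A.Nonempty)
    (hadj : ∀ a b c, S.Tri a b c → a ∈ A → b ∈ A) : A = Set.univ := by
  obtain ⟨u, hemb, hu, hr⟩ := S.marking
  have := σ.t2
  have := σ.properlyDiscontinuous
  have := σ.simplyConnected
  have hclosed : ∀ t ∈ S.triangles, ∀ v ∈ t, v ∈ A → ∀ w ∈ t, w ∈ A := by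
    intro t ht v hv hvA w hw
    by_cases hvw : w = v
    · rwa [hvw]
    obtain ⟨n, hn, e, -, h⟩ := S.link v
    obtain ⟨i, hi⟩ := (h t).1 ⟨ht, hv⟩
    have h1 : S.Tri v (e i) (e (i + 1)) := ⟨t, ht, hi⟩
    have hw : w ∈ (t : Set V) := hw
    rw [hi] at hw
    rcases hw with rfl | rfl | rfl
    exacts [hvA, hadj _ _ _ h1 hvA, hadj _ _ _ h1.swap hvA]
  set T : S.triangles → Set X := fun t => u ⁻¹' (S.real '' baryTriangle t) with hT
  have hTc : ∀ t, IsCompact (T t) := fun t => by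
    refine (hemb.isInducing.isCompact_preimage_iff ?_).2
      ((isCompact_baryTriangle _).image_of_continuousOn (S.continuousOn_real t t.2))
    rw [hr]
    exact Set.image_mono (Set.subset_biUnion_of_mem t.2)
  have hTg : ∀ (g : Γ) (t t' : S.triangles), (t : Finset V) = translate g (t' : Finset V) →
      ∀ x ∈ T t, ∃ y ∈ T t', g • y = x := by
    rintro g t t' h x ⟨s, hs, hsx⟩
    have h1 := push_mem hs g⁻¹
    rw [h, ← translate_mul, inv_mul_cancel, translate_one] at h1
    refine ⟨g⁻¹ • x, ⟨push g⁻¹ s, h1, ?_⟩, smul_inv_smul g x⟩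
    rw [hu, ← hsx]
    exact real_push t.2 hs g⁻¹
  obtain ⟨F, hF, hFt, hFg⟩ := S.exists_finite_triangles
  have hlf : LocallyFinite T := by
    intro x
    obtain ⟨L, hL, hLc⟩ := exists_compact_nhds σ x
    refine ⟨L, hL, ?_⟩
    have := hF.to_subtype
    have hQ : IsCompact (⋃ t : F, T ⟨t, hFt t.2⟩) := isCompact_iUnion fun t => hTc _
    have h1 := ProperlyDiscontinuousSMul.finite_disjoint_inter_image (Γ := Γ) hQ hLc
    refine Set.Finite.of_finite_image (f := Subtype.val) ?_ Subtype.val_injective.injOn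
    refine ((h1.prod hF).image fun p => translate p.1 p.2).subset ?_
    rintro _ ⟨t, ⟨x, hxt, hxL⟩, rfl⟩
    obtain ⟨g, t₀, ht₀, ht⟩ := hFg t t.2
    obtain ⟨y, hy, hyx⟩ := hTg g t ⟨t₀, hFt ht₀⟩ ht x hxt
    refine ⟨(g, t₀), ⟨?_, ht₀⟩, ht.symm⟩
    have h2 : x ∈ (g • ·) '' (⋃ t : F, T ⟨t, hFt t.2⟩) ∩ L :=
      ⟨⟨y, Set.mem_iUnion.2 ⟨⟨t₀, ht₀⟩, hy⟩, hyx⟩, hxL⟩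
    exact ⟨x, h2⟩
  have hunion : ∀ I : Set S.triangles, IsClosed (⋃ t : I, T t) := fun I =>
    (hlf.comp_injective Subtype.val_injective).isClosed_iUnion fun t => (hTc t).isClosed
  set I : Set S.triangles := {t | ∃ v ∈ (t : Finset V), v ∈ A} with hI
  have hcover : (⋃ t : I, T t) ∪ (⋃ t : (Iᶜ : Set S.triangles), T t) = Set.univ := by
    refine Set.eq_univ_of_forall fun x => ?_
    obtain ⟨s, hs, hsx⟩ : u x ∈ S.real '' (⋃ t ∈ S.triangles, baryTriangle t) := hr ▸ ⟨x, rfl⟩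
    obtain ⟨t, ht, hs⟩ := Set.mem_iUnion₂.1 hs
    by_cases h : (⟨t, ht⟩ : S.triangles) ∈ I
    · exact Or.inl (Set.mem_iUnion.2 ⟨⟨_, h⟩, s, hs, hsx⟩)
    · exact Or.inr (Set.mem_iUnion.2 ⟨⟨_, h⟩, s, hs, hsx⟩)
  have hdisj : Disjoint (⋃ t : I, T t) (⋃ t : (Iᶜ : Set S.triangles), T t) := by
    rw [Set.disjoint_left]
    intro x hx hx'
    obtain ⟨⟨t, v, hv, hvA⟩, s, hs, hsx⟩ := Set.mem_iUnion.1 hx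
    obtain ⟨⟨t', ht'⟩, s', hs', hsx'⟩ := Set.mem_iUnion.1 hx'
    have h1 := S.injOn_real (Set.mem_biUnion t.2 hs) (Set.mem_biUnion t'.2 hs')
      (hsx.trans hsx'.symm)
    subst h1
    obtain ⟨w, hw, hws⟩ : ∃ w ∈ (t : Finset V), s w ≠ 0 := by
      refine Finset.exists_ne_zero_of_sum_ne_zero (f := s) ?_
      rw [hs.2.2]
      exact one_ne_zero
    refine ht' ⟨w, ?_, hclosed t t.2 v hv hvA w hw⟩
    by_contra hwt
    exact hws (hs'.2.1 w hwt)
  have hcl : IsClopen (⋃ t : I, T t) := by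
    refine ⟨hunion _, ?_⟩
    rw [← isClosed_compl_iff, IsCompl.compl_eq (isCompl_iff.2
      ⟨hdisj, codisjoint_iff.2 hcover⟩)]
    exact hunion _
  have hne : (⋃ t : I, T t).Nonempty := by
    obtain ⟨v, hv⟩ := hA
    obtain ⟨t, ht, hvt⟩ := S.exists_tri v
    obtain ⟨x, hx⟩ : S.pos v ∈ Set.range u := hr ▸ real_mem_carrier ht (basisVec_mem_bary hvt)
    exact ⟨x, Set.mem_iUnion.2 ⟨⟨⟨t, ht⟩, v, hvt, hv⟩, basisVec v, basisVec_mem_bary hvt, hx.symm⟩⟩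
  have huniv := hcl.eq_univ hne
  refine Set.eq_univ_of_forall fun v => ?_
  obtain ⟨t, ht, hvt⟩ := S.exists_tri v
  obtain ⟨x, hx⟩ : S.pos v ∈ Set.range u := hr ▸ real_mem_carrier ht (basisVec_mem_bary hvt)
  have hx' : x ∈ ⋃ t : I, T t := huniv ▸ trivial
  obtain ⟨⟨t', w, hw, hwA⟩, s, hs, hsx⟩ := Set.mem_iUnion.1 hx'
  have h1 := S.injOn_real (Set.mem_biUnion t'.2 hs) (Set.mem_biUnion ht (basisVec_mem_bary hvt))
    (hsx.trans hx)
  subst h1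
  refine hclosed t' t'.2 w hw hwA v ?_
  by_contra hvt'
  have h2 := hs.2.1 v hvt'
  rw [basisVec_self] at h2
  exact one_ne_zero h2

end TriangulatedSurface

end ProjectiveStructure

end HypEnd

end

noncomputable section

namespace HypEnd

open Topology Filter

/-- The functional dual to a vector for the Minkowski product. -/
def minkDual (z : Minkowski) : Dual ℝ Minkowski where
  toFun y := mink z y
  map_add' x y := by rw [mink_comm, mink_add_left, mink_comm x, mink_comm y]
  map_smul' c x := by rw [mink_smul_right]; rfl

lemma minkDual_apply (z y : Minkowski) : minkDual z y = mink z y := rfl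

lemma minkDual_eq_zero {z : Minkowski} : minkDual z = 0 ↔ z = 0 := by
  constructor
  · intro h
    have h1 : minkDual z (z.1, -z.2) = 0 := by rw [h]; rfl
    simp only [minkDual_apply, mink, real_inner_self_eq_norm_sq] at h1
    have h2 : ‖z.1‖ = 0 := by nlinarith [sq_nonneg ‖z.1‖, sq_nonneg z.2]
    have h3 : z.2 = 0 := by nlinarith [sq_nonneg ‖z.1‖, sq_nonneg z.2]
    exact Prod.ext (norm_eq_zero.1 h2) h3
  · rintro rfl
    ext <;> simp [minkDual_apply, mink]

namespace ProjectiveStructure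

variable {X Γ : Type*} [TopologicalSpace X] [Group Γ] [MulAction Γ X] {σ : ProjectiveStructure X Γ}

namespace TriangulatedSurface

variable {V : Type*} [MulAction Γ V] {S : σ.TriangulatedSurface V}
variable {t : Finset V} {a b c d v w : V} {K : Set σ.ExtendedEnd}

/-- The third vertex of the positively oriented triangle containing an edge. -/
def third (S : σ.TriangulatedSurface V) (K : Set σ.ExtendedEnd) (v w : V) : V := by
  classical exact if h : ∃ c, S.Pos K v w c then h.choose else v

lemma pos_third (h : ∃ c, S.Pos K v w c) : S.Pos K v w (S.third K v w) := by
  rw [third, dif_pos h]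
  exact h.choose_spec

lemma Bounds.third_eq (hK : S.Bounds K) (h : S.Pos K v w c) : S.third K v w = c :=
  hK.pos_unique (pos_third ⟨c, h⟩) h

lemma Bounds.exists_pos_symm (hK : S.Bounds K) (h : ∃ c, S.Pos K v w c) :
    ∃ c, S.Pos K w v c := by
  obtain ⟨c, h⟩ := h
  obtain ⟨n, u, -, -, hu, hu'⟩ := hK.exists_link v
  obtain ⟨i, rfl, rfl⟩ := hu' w c h
  have h1 := hK.pos_rot (hu (i - 1))
  rw [sub_add_cancel] at h1
  exact ⟨_, hK.pos_rot (hK.pos_rot (hK.pos_rot (hK.pos_rot h1)))⟩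

/-- The oriented convex polyhedral surface given by the vectors of the vertices. -/
def Bounds.toOSurf (hK : S.Bounds K) : OSurf Minkowski V where
  x := S.vec
  adj v w := ∃ c, S.Pos K v w c
  nx := S.third K
  N v w := volForm (S.vec v) (S.vec w) (S.vec (S.third K v w))
  L v := (hK.exists_pos v).choose
  adj_symm := hK.exists_pos_symm
  link v := by
    obtain ⟨n, w, hn, hinj, hw, hw'⟩ := hK.exists_link v
    refine ⟨n, w, hn, hinj, fun u => ⟨?_, ?_⟩, fun i => hK.third_eq (hw i)⟩
    · rintro ⟨c, hc⟩
      obtain ⟨i, h, -⟩ := hw' u c hc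
      exact ⟨i, h.symm⟩
    · rintro ⟨i, rfl⟩
      exact ⟨_, hw i⟩
  adj_nx' h := ⟨_, hK.pos_rot (pos_third h)⟩
  nx_nx h := hK.third_eq (hK.pos_rot (pos_third h))
  indep h := (pos_third h).1.indep
  N_ne h := volForm_ne_zero (pos_third h).1.indep
  N_nonneg h h' := hK.volForm_nonneg (pos_third h) (pos_third h').1
  N_left _ := volForm_left _ _ _
  N_cyc h := by rw [hK.third_eq (hK.pos_rot (pos_third h)), volForm_rot]
  L_self v := (hK.exists_pos v).choose_spec.1
  L_pos := fun {v w} h => (hK.exists_pos v).choose_spec.2 w _ (pos_third h).1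
  sep := by
    intro v a b p q p' q' k ha hb hp hq hp' hq' e
    have h1 := (pos_third ha).1.sep (pos_third hb).1 hp hq hp' hq' e
    have h2 : ∀ (v u : V) (p : ℝ), Finsupp.single v p u = p * basisVec v u := by
      intro v u p
      by_cases h : u = v
      · subst h; simp [basisVec_self]
      · rw [Finsupp.single_eq_of_ne h, basisVec_of_ne h, mul_zero]
    ext u
    have h3 := congrFun h1 u
    simpa only [Finsupp.add_apply, h2, Pi.add_apply, Pi.smul_apply, smul_eq_mul] using h3
  connected A hA h := by
    refine S.eq_univ_of_closed hA fun a b c habc ha => h a ha b ?_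
    rcases hK.pos_or habc with h1 | h1
    · exact ⟨c, h1⟩
    · exact hK.exists_pos_symm ⟨c, hK.pos_rot (hK.pos_rot h1)⟩

lemma Bounds.equivariant (hK : S.Bounds K) : hK.toOSurf.Equivariant Γ where
  adj_smul g := fun ⟨c, h⟩ => ⟨g • c, hK.pos_smul h g⟩
  nx_smul g := fun h => hK.third_eq (hK.pos_smul (pos_third h) g)
  free _ _ h := S.eq_one_of_smul_vertex h
  free_edge _ := fun h h1 h2 => (pos_third h).1.not_swap h1 h2
  free_face _ := fun h h1 h2 h3 => (pos_third h).1.not_rot h1 h2 h3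
  finite := S.finite

lemma Tri.span_eq_ker (h : S.Tri a b c) (ht : (t : Set V) = {a, b, c}) {N : Dual ℝ Minkowski}
    (hN : N ≠ 0) (ha : N (S.vec a) = 0) (hb : N (S.vec b) = 0) (hc : N (S.vec c) = 0) :
    Submodule.span ℝ (S.vec '' (t : Set V)) = LinearMap.ker N := by
  have h1 : S.vec '' (t : Set V) = Set.range ![S.vec a, S.vec b, S.vec c] := by
    rw [ht, Set.image_insert_eq, Set.image_pair]
    simp only [Matrix.range_cons, Matrix.range_empty, Set.union_empty, Set.singleton_union]
  rw [h1]
  refine Submodule.eq_of_le_of_finrank_eq (Submodule.span_le.2 ?_) ?_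
  · rintro _ ⟨i, rfl⟩
    fin_cases i <;> assumption
  · have h2 := Module.Dual.finrank_ker_add_one_of_ne_zero hN
    rw [finrank_minkowski] at h2
    rw [finrank_span_eq_card h.indep, Fintype.card_fin]
    omega

/-- The vertices of the triangle on the left of an oriented edge. -/
lemma Bounds.exists_triangle (hK : S.Bounds K) (e : hK.toOSurf.Dart) : ∃ t ∈ S.triangles,
    (t : Set V) = {e.1.1, e.1.2, S.third K e.1.1 e.1.2} := (pos_third e.2).1

lemma CoplanarAdj.symm {t t' : Finset V} (h : S.CoplanarAdj t t') : S.CoplanarAdj t' t := by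
  obtain ⟨h1, h2, ⟨v, w, hvw, h3, h4, h5, h6⟩, h7⟩ := h
  exact ⟨h2, h1, ⟨v, w, hvw, h5, h6, h3, h4⟩, h7.symm⟩

lemma Bounds.finite_face (hK : S.Bounds K)
    (hf : ∀ t ∈ S.triangles, {t' | Relation.ReflTransGen S.CoplanarAdj t t'}.Finite)
    (D : hK.toOSurf.Dart) : {d | OSurf.SameFace D d}.Finite := by
  choose T hT hTe using hK.exists_triangle
  have hrel : ∀ d, OSurf.SameFace D d → Relation.ReflTransGen S.CoplanarAdj (T D) (T d) := by
    intro d h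
    refine OSurf.Dart.Rel.of_step
      (R := fun d d' => Relation.ReflTransGen S.CoplanarAdj (T d) (T d'))
      ⟨fun _ => .refl, fun h => Relation.ReflTransGen.mono (fun _ _ => CoplanarAdj.symm) _ _ h.swap, fun h h' => h.trans h'⟩
      (fun d => ?_) (fun d hd => ?_) h
    · have h1 : T (OSurf.Dart.φ hK.toOSurf d) = T d := by
        rw [← Finset.coe_inj, hTe, hTe]
        change ({d.1.2, S.third K d.1.1 d.1.2, S.third K d.1.2 (S.third K d.1.1 d.1.2)} : Set V) = _
        rw [hK.third_eq (hK.pos_rot (pos_third d.2))]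
        ext u
        simp only [Set.mem_insert_iff, Set.mem_singleton_iff]
        tauto
      rw [h1]
    · refine .single ⟨hT _, hT _, ⟨d.1.1, d.1.2, OSurf.ne_of_adj d.2, ?_, ?_, ?_, ?_⟩, ?_⟩
      · rw [← Finset.mem_coe, hTe]; simp
      · rw [← Finset.mem_coe, hTe]; simp
      · rw [← Finset.mem_coe, hTe]
        change _ ∈ ({d.1.2, d.1.1, _} : Set V)
        simp
      · rw [← Finset.mem_coe, hTe]
        change _ ∈ ({d.1.2, d.1.1, _} : Set V)
        simp
      · have h1 := pos_third d.2
        have h2 := pos_third (OSurf.Dart.τ hK.toOSurf d).2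
        rw [h1.1.span_eq_ker (hTe d) (volForm_ne_zero h1.1.indep) (volForm_left _ _ _)
          (volForm_mid _ _ _) (volForm_right _ _ _)]
        exact (h2.1.span_eq_ker (hTe _) (volForm_ne_zero h1.1.indep) (volForm_mid _ _ _)
          (volForm_left _ _ _) hd).symm
  refine Set.Finite.of_finite_image (f := Subtype.val) ?_ Subtype.val_injective.injOn
  refine ((hf _ (hT D)).biUnion fun t _ => (t.finite_toSet.prod t.finite_toSet)).subset ?_
  rintro _ ⟨d, hd, rfl⟩
  refine Set.mem_biUnion (hrel d hd) ⟨?_, ?_⟩ <;> rw [hTe] <;> simp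

lemma mink_add_mink_eq_zero {Z : V → Minkowski} (hlen : S.PreservesEdgeLengths Z)
    (h : S.IsEdge v w) : mink (Z v) (S.vec w) + mink (S.vec v) (Z w) = 0 := by
  have h1 := hlen v w h
  have h2 : (fun s : ℝ => -mink (S.vec v + s • Z v) (S.vec w + s • Z w)) = fun s =>
      -(mink (S.vec v) (S.vec w) + s * (mink (Z v) (S.vec w) + mink (S.vec v) (Z w)) +
        s ^ 2 * mink (Z v) (Z w)) := by
    funext s
    rw [mink_add_left, mink_smul_left, mink_comm _ (S.vec w + s • Z w), mink_comm (Z v) (_ + _),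
      mink_add_left, mink_add_left, mink_smul_left, mink_smul_left, mink_comm (S.vec w),
      mink_comm (S.vec w), mink_comm (Z w), mink_comm (Z w)]
    ring
  rw [h2] at h1
  have h3 : HasDerivAt (fun s : ℝ =>
      -(mink (S.vec v) (S.vec w) + s * (mink (Z v) (S.vec w) + mink (S.vec v) (Z w)) +
        s ^ 2 * mink (Z v) (Z w)))
      (-(0 + 1 * (mink (Z v) (S.vec w) + mink (S.vec v) (Z w)) +
        (2 : ℕ) * (0 : ℝ) ^ (2 - 1) * mink (Z v) (Z w))) 0 :=
    ((((hasDerivAt_const _ _).add ((hasDerivAt_id _).mul_const _))).add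
      ((hasDerivAt_pow 2 _).mul_const _)).neg
  have h4 := h1.unique h3
  simp at h4
  linarith

/-- Admissible polyhedral surfaces are infinitesimally rigid. -/
theorem IsAdmissible.eq_zero (hS : S.IsAdmissible) {Z : V → Minkowski}
    (hZ : S.IsFirstOrderDeformation Z) (hlen : S.PreservesEdgeLengths Z) : Z = 0 := by
  obtain ⟨⟨⟨K, hc, hsmul, hconv, -, hfr, hext⟩, hf⟩, -⟩ := hS
  have hK : S.Bounds K := ⟨hc, hsmul, hconv, hfr, hext⟩
  have := hK.equivariant
  have hflex : hK.toOSurf.IsFlex fun v => minkDual (Z v) := by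
    refine ⟨fun v => ?_, fun {v w} h => ?_⟩
    · rw [minkDual_apply, mink_comm]
      exact hZ.1 v
    · obtain ⟨c, ⟨t, ht, hvw⟩, -⟩ := id h
      have h1 := mink_add_mink_eq_zero hlen (v := v) (w := w) ⟨OSurf.ne_of_adj h, t, ht,
        by rw [← Finset.mem_coe, hvw]; simp, by rw [← Finset.mem_coe, hvw]; simp⟩
      rw [mink_comm (S.vec v)] at h1
      exact eq_neg_of_add_eq_zero_left h1
  have hinv : hK.toOSurf.IsInv Γ fun v => minkDual (Z v) := by
    refine ⟨fun g v w _ => ?_, fun g v => ?_⟩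
    · change mink (Z (g • v)) (S.vec (g • w)) = mink (Z v) (S.vec w)
      rw [hZ.2, S.vec_smul, hol_mink]
    · rw [minkDual_eq_zero, minkDual_eq_zero, hZ.2]
      exact LinearEquiv.map_eq_zero_iff _
  funext v
  exact minkDual_eq_zero.1 (hflex.eq_zero finrank_minkowski hinv (hK.finite_face hf)
    (fun g => ⟨_, S.vec_smul g⟩) σ.genus_ge_two v)

end TriangulatedSurface

end ProjectiveStructure

end HypEnd

end

theorem mainTheorem9 {X Γ V : Type*} [TopologicalSpace X] [Group Γ] [MulAction Γ X]
    [MulAction Γ V] (σ : HypEnd.ProjectiveStructure X Γ)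
    (S : HypEnd.ProjectiveStructure.TriangulatedSurface σ V) (hS : S.IsAdmissible)
    (Z : V → HypEnd.Minkowski) (hZ : S.IsFirstOrderDeformation Z)
    (hlen : S.PreservesEdgeLengths Z) : Z = 0 :=
  hS.eq_zero hZ hlen
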